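/- **Setting.** For $k\in\mathbb N$ let $\mathcal P_{\sf D}=\mathcal P_{\sf D}(k)$ be the set of all probability distributions on $[k]$, and ${\sf TV}(p,q)=\frac12\sum_i|p_i-q_i|$. For $S\subseteq[k]$ put ${\sf sep}(S)=p(S)-q(S)$ and $\tau(S)=\min\{p(S)p(S^c),\,q(S)q(S^c)\}$. Let $n_{\sf GoF}(\epsilon,\delta,\mathcal P_{\sf D})$ be the least $N$ such that for all $n\ge N$ and every known $P_0\in\mathcal P_{\sf D}$ there is a test of $P=P_0$ against $\{P\in\mathcal P_{\sf D}:{\sf TV}(P,P_0)\ge\epsilon\}$, based on $n$ i.i.d. samples of $P$, with both error probabilities at most $\delta$. Given $c_0>0$, put $t=k\wedge\frac{c_0m}{\log(1/\delta)}$ and $\ell=\lceil\log_2(t/n)\rceil$. For $r:[k]\to\mathbb R$ the level sets of $r$ at scale $t$ are $D_0=\{i:r_i\le\frac1t\}$, $D_j=\{i:r_i\in(\frac{2^{j-1}}t,\frac{2^j}t]\}$ for $1\le j\le\ell$, and $D_{\ell+1}=\{i:r_i>\frac{2^\ell}t\}$. Given samples $X,Y$ of size $n$ let, for $D\subseteq[k]$,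 $\hat S_>(D)$ (resp. $\hat S_<(D)$) be the set of $i\in D$ that occur strictly more (resp. less) often among the first $\lfloor n/2\rfloor$ points of $X$ than among the first $\lfloor n/2\rfloor$ points of $Y$; the remaining points are held out and may be used for selecting one of these sets. Throughout, $n\ge1$, $0<\epsilon\le1$ and $0<\delta<\frac12$. **1. Separating sets.** There is an absolute $\bar c>0$ such that for each $c_0\in(0,\bar c]$ there are $c,C>0$ (depending only on $c_0$) with the following property. Let $k,n,m,\epsilon,\delta$ satisfy $n<t$, $\epsilon/\ell\le\frac12$ and $$n\sqrt{1\wedge\tfrac{m}{k\log(1/\delta)}}\ \ge\ \tfrac1c\,n_{\sf GoF}(\epsilon/\ell,\delta,\mathcal P_{\sf D}).$$ Let $X\sim p^{\otimes n}$, $Y\sim q^{\otimes n}$ and $\lfloor m/2\rfloor$ further samples from $q$ with empirical mass function $\hat q$ be independent, and let $D_j$ be the level sets of $\hat q$ at scale $t$. There is a rule, not depending on $p,q$, that selects from these data some $j\in\{0,\dots,\ell+1\}$ and one set $\hat S\in\{\hat S_>(D_j),\hat S_<(D_j)\}$ such that for all $p,q\in\mathcal P_{\sf D}$ with ${\sf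 TV}(p,q)\ge\epsilon$, with probability at least $1-Ck\delta$, $$|{\sf sep}(\hat S)|\ge c\Big(\frac\epsilon\ell\Big)^2\cdot\begin{cases}n/k&j=0\\ n/\sqrt{kt/2^j}&1\le j\le\ell+1\end{cases}\qquad\text{and}\qquad\tau(\hat S)\le\frac{n2^j}{ct}.$$ **2. Known $q$** (the case $m=\infty$). With absolute constants $c,C>0$ the same holds for each known $q\in\mathcal P_{\sf D}$ with $t=k$, $\hat q=q$ and a rule that uses only $X,Y$ and may depend on $q$ (not on $p$), provided $n<k$, $\epsilon/\ell\le\frac12$ and $n\ge\frac1c\,n_{\sf GoF}(\epsilon/\ell,\delta,\mathcal P_{\sf D})$. **3. Goodness of fit.** Let $T_S(A,B)$ be the fraction of points of $A$ in $S$ minus the fraction of points of $B$ in $S$. There are absolute constants $K,C>0$ and $a\in\mathbb N$ such that the following holds for $n<k$, with $t=k$ and $\ell=\lceil\log_2(k/n)\rceil$. Assume either (i) $\epsilon/\ell\le\frac12$ and $n\ge C\,n_{\sf GoF}(\epsilon/\ell,\delta/k,\mathcal P_{\sf D})$, or (ii) $\epsilon\le\frac12$, $\delta\le\frac14$ and $n\ge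 C(\log k)^a\,n_{\sf GoF}(\epsilon,\delta,\mathcal P_{\sf D})$. Then for each known $P_0\in\mathcal P_{\sf D}$ the following type of classifier-accuracy test of $P=P_0$ against ${\sf TV}(P,P_0)\ge\epsilon$ has both errors at most $\delta$, for a suitable selection rule: from $n$ training samples of $P$ and $n$ of $P_0$ select $j$ and $\hat S\in\{\hat S_>(D_j),\hat S_<(D_j)\}$, with $D_j$ the level sets of $P_0$ at scale $t$, and, with $n$ fresh test samples $A$ of $P$ and $B$ of $P_0$, reject if and only if $|T_{\hat S}(A,B)|>\sqrt{K\bar\tau\log(1/\delta)/n}+K\log(1/\delta)/n$, where $\bar\tau=n2^j/t$. **4. Likelihood-free testing.** There is an absolute $\bar c>0$ such that for each $c_0\in(0,\bar c]$ there are $K,C>0$ and $a\in\mathbb N$ (depending only on $c_0$) such that the following holds with $t=k\wedge\frac{c_0m}{\log(k/\delta)}$ and $\ell=\lceil\log_2(t/n)\rceil$, whenever $n<t$. Assume either (i) $\epsilon/\ell\le\frac12$ and $n\sqrt{1\wedge\frac m{k\log(k/\delta)}}\ge C\,n_{\sf GoF}(\epsilon/\ell,\delta/k,\mathcal P_{\sf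 D})$, or (ii) $\epsilon\le\frac12$, $\delta\le\frac14$ and $n\ge C(\log k)^a\log(k/\delta)\,n'$ for some $n'$ such that the hypotheses $P_Z=P_X$ and $P_Z=P_Y$ can be tested with both errors at most $\delta$, uniformly over $P_X,P_Y\in\mathcal P_{\sf D}$ with ${\sf TV}(P_X,P_Y)\ge\epsilon$, from $n'$ samples of each of $P_X,P_Y$ and $m$ samples of $P_Z$. Then, for a suitable selection rule not depending on $P_X,P_Y$, the following classifier-accuracy test solves the same testing problem with both errors at most $\delta$: from training data consisting of $n$ samples of $P_X$, $n$ of $P_Y$ and $\lfloor m/2\rfloor$ of $P_Z$ select $j$ and $\hat S\in\{\hat S_>(D_j),\hat S_<(D_j)\}$, with $D_j$ the level sets at scale $t$ of the empirical mass function of the $P_Z$-samples, and, with $n$ fresh samples $A$ of $P_X$ and the other $m-\lfloor m/2\rfloor$ samples $B$ of $P_Z$, declare $P_Z=P_Y$ if and only if $|T_{\hat S}(A,B)|>\sqrt{K\bar\tau\log(1/\delta)/n}+K\log(1/\delta)/n$, where $\bar\tau=n2^j/t$. -/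

import Mathlib

open MeasureTheory

/-- The class of all probability distributions on the alphabet `[k]`. -/
def PD (k : ℕ) : Set (Measure (Fin k)) := {p | IsProbabilityMeasure p}

/-- Total variation distance between two distributions on `[k]`. -/
noncomputable def tv {k : ℕ} (p q : Measure (Fin k)) : ℝ :=
  (1 / 2) * ∑ i, |p.real {i} - q.real {i}|

/-- The law of `n` independent samples from `p`. -/
noncomputable def iid {k : ℕ} (p : Measure (Fin k)) (n : ℕ) : Measure (Fin n → Fin k) :=
  Measure.pi fun _ => p

/-- The number of samples equal to the symbol `i` among the first `⌊n/2⌋` samples. -/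
def firstHalfCount {k n : ℕ} (x : Fin n → Fin k) (i : Fin k) : ℕ :=
  (Finset.univ.filter fun a : Fin n => (a : ℕ) < n / 2 ∧ x a = i).card

/-- The empirical probability mass function of a sample. -/
noncomputable def empPMF {k m : ℕ} (w : Fin m → Fin k) (i : Fin k) : ℝ :=
  ((Finset.univ.filter fun a : Fin m => w a = i).card : ℝ) / m

/-! ### Minimax sample complexities -/

/-- `ψ` (with `true` meaning "reject") tests `P = P₀` against `TV(P, P₀) ≥ ε`, `P ∈ cls`, from `n`
samples of `P`, with both errors at most `δ`. -/
def IsGoFTest {k : ℕ} (cls : Set (Measure (Fin k))) (P₀ : Measure (Fin k)) (ε δ : ℝ) (n : ℕ)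
    (ψ : (Fin n → Fin k) → Bool) : Prop :=
  (iid P₀ n).real {x | ψ x = true} ≤ δ ∧
    ∀ P ∈ cls, ε ≤ tv P P₀ → (iid P n).real {x | ψ x = false} ≤ δ

/-- The minimax sample complexity of goodness-of-fit testing: the least `N` such that for every
`n ≥ N` and every known null distribution there is a test from `n` samples with error at most `δ`.
(For `ε, δ > 0` such an `N` exists, by learning the distribution.) -/
noncomputable def nGoF {k : ℕ} (cls : Set (Measure (Fin k))) (ε δ : ℝ) : ℕ :=
  sInf {N : ℕ | ∀ n ≥ N, ∀ P₀ ∈ cls, ∃ ψ : (Fin n → Fin k) → Bool, IsGoFTest cls P₀ ε δ n ψ}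

/-- Likelihood-free hypothesis testing (`P_Z = P_X` against `P_Z = P_Y`, where
`TV(P_X, P_Y) ≥ ε`) is possible with `n` samples from each of `P_X`, `P_Y` and `m` samples from
`P_Z`, with both errors at most `δ`. -/
def LFHTSolvable {k : ℕ} (cls : Set (Measure (Fin k))) (ε δ : ℝ) (n m : ℕ) : Prop :=
  ∃ ψ : (Fin n → Fin k) × (Fin n → Fin k) × (Fin m → Fin k) → Bool,
    ∀ PX ∈ cls, ∀ PY ∈ cls, ε ≤ tv PX PY →
      ((iid PX n).prod ((iid PY n).prod (iid PX m))).real {ω | ψ ω = true} ≤ δ ∧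
      ((iid PX n).prod ((iid PY n).prod (iid PY m))).real {ω | ψ ω = false} ≤ δ

/-! ### Separating sets -/

/-- Separation of a set. -/
noncomputable def sep {k : ℕ} (p q : Measure (Fin k)) (S : Finset (Fin k)) : ℝ :=
  p.real (S : Set (Fin k)) - q.real (S : Set (Fin k))

/-- Size of a set. -/
noncomputable def tau {k : ℕ} (p q : Measure (Fin k)) (S : Finset (Fin k)) : ℝ :=
  min (p.real (S : Set (Fin k)) * p.real (S : Set (Fin k))ᶜ)
    (q.real (S : Set (Fin k)) * q.real (S : Set (Fin k))ᶜ)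

/-- The scale `t = k ∧ (c₀ m / log (1/δ))`. -/
noncomputable def scale (c₀ : ℝ) (k m : ℕ) (δ : ℝ) : ℝ :=
  min (k : ℝ) (c₀ * m / Real.log (1 / δ))

/-- The number `ℓ = ⌈log₂ (t/n)⌉`. -/
noncomputable def numLevels (t : ℝ) (n : ℕ) : ℕ := ⌈Real.logb 2 (t / n)⌉₊

/-- The dyadic level sets `D_0, …, D_{ℓ+1}` of a function `r` on `[k]`. -/
noncomputable def levelSet {k : ℕ} (t : ℝ) (ℓ : ℕ) (r : Fin k → ℝ) (j : ℕ) : Finset (Fin k) :=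
  Finset.univ.filter fun i =>
    if j = 0 then r i ≤ 1 / t
    else if j ≤ ℓ then 2 ^ (j - 1) / t < r i ∧ r i ≤ 2 ^ j / t
    else 2 ^ ℓ / t < r i

/-- The sets `Ŝ_>(D)` (for `s = true`) and `Ŝ_<(D)` (for `s = false`), computed from the first
halves of the two samples. -/
def candSet {k n : ℕ} (x y : Fin n → Fin k) (D : Finset (Fin k)) (s : Bool) : Finset (Fin k) :=
  D.filter fun i =>
    if s then firstHalfCount y i < firstHalfCount x i
    else firstHalfCount x i < firstHalfCount y i

/-- The separating set with index `js = (j, s)`: `Ŝ_>(D_j)` or `Ŝ_<(D_j)`, for the level sets `D_j`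
of `r` at scale `t`. -/
noncomputable def sepSet {k n : ℕ} (t : ℝ) (r : Fin k → ℝ) (x y : Fin n → Fin k)
    (js : Fin (numLevels t n + 2) × Bool) : Finset (Fin k) :=
  candSet x y (levelSet t (numLevels t n) r js.1) js.2

/-- The guarantees on `|sep(S)|` and `τ(S)` for a set found at level `j`. -/
def GoodAtLevel {k : ℕ} (c ε t : ℝ) (n : ℕ) (p q : Measure (Fin k)) (j : ℕ)
    (S : Finset (Fin k)) : Prop :=
  c * (ε / numLevels t n) ^ 2 *
      (if j = 0 then (n : ℝ) / k else (n : ℝ) / Real.sqrt (k * t / 2 ^ j)) ≤ |sep p q S| ∧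
    tau p q S ≤ n * 2 ^ j / (c * t)

/-! ### Classifier-accuracy tests -/

/-- The classifier-accuracy statistic `T_S(A, B)`. -/
noncomputable def accStat {k a b : ℕ} (S : Finset (Fin k)) (A : Fin a → Fin k)
    (B : Fin b → Fin k) : ℝ :=
  ((Finset.univ.filter fun i => A i ∈ S).card : ℝ) / a -
    ((Finset.univ.filter fun j => B j ∈ S).card : ℝ) / b

/-- The threshold `√(K τ log(1/δ) / n) + K log(1/δ) / n`. -/
noncomputable def accThreshold (K δ : ℝ) (n : ℕ) (τ : ℝ) : ℝ :=
  Real.sqrt (K * τ * Real.log (1 / δ) / n) + K * Real.log (1 / δ) / n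

/-- For every known null `P₀`, goodness-of-fit testing of `P = P₀` against `TV(P, P₀) ≥ ε` is solved
with both errors at most `δ` by a classifier-accuracy test: from training samples `x` of `P` and `y`
of `P₀`, of size `n` each, an index `(j, s)` is selected, and the null is rejected if and only if
`|T_S|` on independent test samples of size `n` each exceeds the threshold with `τ = n 2^j / k`;
here `S` is the set with index `(j, s)`, for the level sets of `P₀` at scale `k`. -/
def GoFClassifierTest (K : ℝ) (k n : ℕ) (ε δ : ℝ) : Prop :=
  ∀ P₀ ∈ PD k, ∃ sel : (Fin n → Fin k) × (Fin n → Fin k) → Fin (numLevels k n + 2) × Bool,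
    let rejects : ((Fin n → Fin k) × (Fin n → Fin k)) × ((Fin n → Fin k) × (Fin n → Fin k)) → Prop :=
      fun ω =>
        accThreshold K δ n (n * 2 ^ ((sel ω.1).1 : ℕ) / k) <
          |accStat (sepSet k (fun i => P₀.real {i}) ω.1.1 ω.1.2 (sel ω.1)) ω.2.1 ω.2.2|
    let law : Measure (Fin k) →
        Measure (((Fin n → Fin k) × (Fin n → Fin k)) × ((Fin n → Fin k) × (Fin n → Fin k))) :=
      fun P => ((iid P n).prod (iid P₀ n)).prod ((iid P n).prod (iid P₀ n))
    (law P₀).real {ω | rejects ω} ≤ δ ∧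
      ∀ P ∈ PD k, ε ≤ tv P P₀ → (law P).real {ω | ¬ rejects ω} ≤ δ

/-- Likelihood-free hypothesis testing at separation `ε` is solved with both errors at most `δ` by a
classifier-accuracy test. The training data are `n` samples `x` of `P_X`, `n` samples `y` of `P_Y`
and `⌊m/2⌋` samples `z` of `P_Z`; the test data are `n` samples of `P_X` and the other
`m - ⌊m/2⌋` samples of `P_Z`. An index `(j, s)` is selected from the training data, and `P_Z = P_Y`
is declared if and only if `|T_S|` on the test data exceeds the threshold with `τ = n 2^j / t`; here
`S` is the set with index `(j, s)`, for the level sets of the empirical mass function of `z` at scale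
`t = k ∧ (c₀ m / log (k/δ))`. -/
def LFHTClassifierTest (K c₀ : ℝ) (k n m : ℕ) (ε δ : ℝ) : Prop :=
  let t : ℝ := scale c₀ k m (δ / k)
  ∃ sel : (Fin n → Fin k) × (Fin n → Fin k) × (Fin (m / 2) → Fin k) →
      Fin (numLevels t n + 2) × Bool,
    let declares : ((Fin n → Fin k) × (Fin n → Fin k) × (Fin (m / 2) → Fin k)) ×
        ((Fin n → Fin k) × (Fin (m - m / 2) → Fin k)) → Prop :=
      fun ω =>
        accThreshold K δ n (n * 2 ^ ((sel ω.1).1 : ℕ) / t) <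
          |accStat (sepSet t (empPMF ω.1.2.2) ω.1.1 ω.1.2.1 (sel ω.1)) ω.2.1 ω.2.2|
    let law : Measure (Fin k) → Measure (Fin k) → Measure (Fin k) →
        Measure (((Fin n → Fin k) × (Fin n → Fin k) × (Fin (m / 2) → Fin k)) ×
          ((Fin n → Fin k) × (Fin (m - m / 2) → Fin k))) :=
      fun PX PY PZ => ((iid PX n).prod ((iid PY n).prod (iid PZ (m / 2)))).prod
        ((iid PX n).prod (iid PZ (m - m / 2)))
    ∀ PX ∈ PD k, ∀ PY ∈ PD k, ε ≤ tv PX PY →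
      (law PX PY PX).real {ω | declares ω} ≤ δ ∧ (law PX PY PY).real {ω | ¬ declares ω} ≤ δ

/-!
The theorem has an achievability half, the selection of a separating set from samples, and a
converse half, which turns "`n` exceeds the optimal sample complexity" into the explicit inequality
`n² (ε/ℓ)⁴ t / k ≥ b² k log (1/δ)` on which the achievability half runs.

*Achievability.* Write `X_i`, `Y_i` for the counts of the symbol `i` among the first halves of the
samples, which are binomial. The difference `sep (Ŝ_>(D)) - sep (Ŝ_<(D))` equals `∑ i ∈ D, (p_i -
q_i) sign (X_i - Y_i)` (`sum_candSet_sub`), so one of the two candidate sets of a level is good as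
soon as this sum is large. Each summand has expectation at least a constant times `|p_i - q_i| min
(1, n |p_i - q_i| / √(1 + n q_i))` (`signConst_mul_le_bernE_sg`): exchanging `X_i` and `Y_i` tilts
their joint law by a power of the odds ratio, which expresses both `E (X_i - Y_i)` and `E sign (X_i
- Y_i)` through the positive part of the difference, and the two are compared by means of the fourth
moment. Exponential moments of the summands (`bernE_exp_sg_le_of_light`, `bernE_exp_sg_le_of_heavy`)
multiply over the symbols, although the counts are dependent, because the counts of a multinomial
sample are negatively associated (`piE_piE_prod_le`). Some level carries a `1/ℓ` share of the total
variation (`exists_level`), and by the Cauchy–Schwarz inequality in Titu's form the sum over this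
level is of the order of the claimed separation (`le_sum_gain`, `exists_separating`). The held-out
halves estimate the separation of all candidate sets with Bernstein accuracy, so that selecting any
set whose estimate is large succeeds (`exists_selection`). Candidate sets consist of at most `n`
observed symbols, which bounds their mass (`sum_sepSet_le`); when the levels come from an empirical
mass function, it approximates `q` up to a constant factor above the resolution `1 / t`
(`piE_not_approximates_empPMF_le`). One more application of Bernstein's inequality to the fresh test
samples turns a separating set into a classifier-accuracy test (`gofClassifierTest_of_le`,
`lfhtClassifierTest_of_le`).

*Converse.* For goodness of fit this is the bound `k log (1/δ) ≤ C n² ε⁴` for testing uniformity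
against paired perturbations with random signs (`mul_log_le_nGoF`); the mixture likelihood ratio has
second moment `exp (O(ε⁴ n² / k))`. The same mixture gives `k ≤ C n² ε⁴` for likelihood-free testing
(`LFHTSolvable.le_mul_sq`). When `m` is much smaller than `k`, one needs `k² ≤ C (log k)⁴ n² m ε⁴`
(`LFHTSolvable.sq_le`). Here the alphabet is divided into `m` units of `k / (4 m)` cells of four
letters. In every unit about `log k` hidden heavy cells carry a third of the mass, and a random
perturbation of relative size `ε` affects the light mass only. To detect the perturbation, two draws
of the perturbed sample must collide in a cell; but as long as a unit receives fewer draws than it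
has heavy cells, some heavy cell is still unseen, and a collision is far more likely to be in a
heavy cell, where it carries no information. Hence the chi-square divergence contributed by a unit
is `O(ε⁴ (log k)⁴ / cells²)` on the event that at least two perturbed draws fall into it, and the
sum over the units is small unless `n² m ε⁴` is of the order `k²` up to logarithms.

All distributions are on finite sets, so probabilities are written as finite sums: `piE w F` is the
expectation of `F` over independent draws from the probability vector `w`.
-/

/-! ### Expectations over independent samples -/

/-- A probability vector on a finite type. -/
structure IsProbVec {α : Type*} [Fintype α] (w : α → ℝ) : Prop where
  nonneg : ∀ i, 0 ≤ w i
  sum_eq_one : ∑ i, w i = 1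

/-- The expectation of `F` over a family of independent draws, indexed by `ι`, from the
probability vector `w`. -/
noncomputable def piE {ι α : Type*} [Fintype ι] [DecidableEq ι] [Fintype α] (w : α → ℝ)
    (F : (ι → α) → ℝ) : ℝ :=
  ∑ ω, (∏ a, w (ω a)) * F ω

section piE

variable {ι α : Type*} [Fintype ι] [DecidableEq ι] [Fintype α] {w : α → ℝ}

theorem IsProbVec.le_one (hw : IsProbVec w) (i : α) : w i ≤ 1 := by
  rw [← hw.sum_eq_one]
  exact Finset.single_le_sum (fun j _ => hw.nonneg j) (Finset.mem_univ i)

theorem IsProbVec.sum_le_one (hw : IsProbVec w) (s : Finset α) : ∑ i ∈ s, w i ≤ 1 := by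
  rw [← hw.sum_eq_one]
  exact Finset.sum_le_sum_of_subset_of_nonneg (Finset.subset_univ s) fun i _ _ => hw.nonneg i

theorem piE_prod (f : ι → α → ℝ) :
    piE w (fun ω => ∏ a, f a (ω a)) = ∏ a, ∑ i, w i * f a i := by
  rw [Finset.prod_univ_sum, Fintype.piFinset_univ]
  simp [piE, Finset.prod_mul_distrib]

theorem piE_const (hw : IsProbVec w) (c : ℝ) : piE (ι := ι) w (fun _ => c) = c := by
  have := piE_prod (ι := ι) (w := w) (fun _ _ => 1)
  simp only [mul_one, hw.sum_eq_one, Finset.prod_const_one, piE] at this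
  rw [piE, ← Finset.sum_mul, this, one_mul]

theorem piE_mono (hw : IsProbVec w) {F G : (ι → α) → ℝ} (h : ∀ ω, F ω ≤ G ω) :
    piE w F ≤ piE w G :=
  Finset.sum_le_sum fun ω _ =>
    mul_le_mul_of_nonneg_left (h ω) (Finset.prod_nonneg fun _ _ => hw.nonneg _)

theorem piE_nonneg (hw : IsProbVec w) {F : (ι → α) → ℝ} (h : ∀ ω, 0 ≤ F ω) : 0 ≤ piE w F :=
  Finset.sum_nonneg fun ω _ => mul_nonneg (Finset.prod_nonneg fun _ _ => hw.nonneg _) (h ω)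

theorem piE_add (F G : (ι → α) → ℝ) : piE w (fun ω => F ω + G ω) = piE w F + piE w G := by
  simp [piE, mul_add, Finset.sum_add_distrib]

theorem piE_sub (F G : (ι → α) → ℝ) : piE w (fun ω => F ω - G ω) = piE w F - piE w G := by
  simp [piE, mul_sub, Finset.sum_sub_distrib]

theorem piE_const_mul (c : ℝ) (F : (ι → α) → ℝ) : piE w (fun ω => c * F ω) = c * piE w F := by
  simp only [piE, Finset.mul_sum]
  exact Finset.sum_congr rfl fun ω _ => by ring

theorem piE_sum {β : Type*} (s : Finset β) (F : β → (ι → α) → ℝ) :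
    piE w (fun ω => ∑ b ∈ s, F b ω) = ∑ b ∈ s, piE w (F b) := by
  simp only [piE, Finset.mul_sum]
  exact Finset.sum_comm

theorem piE_comm {ι' α' : Type*} [Fintype ι'] [DecidableEq ι'] [Fintype α'] {w' : α' → ℝ}
    (F : (ι → α) → (ι' → α') → ℝ) :
    piE w (fun x => piE w' (fun y => F x y)) = piE w' (fun y => piE w (fun x => F x y)) := by
  simp only [piE, Finset.mul_sum]
  rw [Finset.sum_comm]
  exact Finset.sum_congr rfl fun _ _ => Finset.sum_congr rfl fun _ _ => by ring

/-- Samples split into two independent groups. -/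
theorem piE_split (P : ι → Prop) [DecidablePred P] (F : ({a // P a} → α) → ({a // ¬ P a} → α) → ℝ) :
    piE w (fun ω : ι → α => F (fun a : {a // P a} => ω a) (fun a : {a // ¬ P a} => ω a)) =
      piE w (fun x => piE w (fun y => F x y)) := by
  simp only [piE, Finset.mul_sum]
  rw [← Fintype.sum_prod_type']
  refine Fintype.sum_equiv (Equiv.piEquivPiSubtypeProd P fun _ => α) _ _ fun ω => ?_
  rw [← Fintype.prod_subtype_mul_prod_subtype P fun a => w (ω a)]
  simp [Equiv.piEquivPiSubtypeProd, mul_assoc]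

end piE

/-- The probability vector of a distribution on `[k]`. -/
noncomputable def pv {k : ℕ} (p : Measure (Fin k)) (i : Fin k) : ℝ := p.real {i}

theorem isProbVec_pv {k : ℕ} {p : Measure (Fin k)} (hp : p ∈ PD k) : IsProbVec (pv p) := by
  have : IsProbabilityMeasure p := hp
  refine ⟨fun i => measureReal_nonneg, ?_⟩
  simp [pv]

theorem real_coe_eq_sum {k : ℕ} {p : Measure (Fin k)} (hp : p ∈ PD k) (S : Finset (Fin k)) :
    p.real (S : Set (Fin k)) = ∑ i ∈ S, pv p i := by
  have : IsProbabilityMeasure p := hp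
  exact (sum_measureReal_singleton S).symm

theorem isProbabilityMeasure_iid {k : ℕ} {p : Measure (Fin k)} (hp : p ∈ PD k) (n : ℕ) :
    IsProbabilityMeasure (iid p n) := by
  have : IsProbabilityMeasure p := hp
  unfold iid
  infer_instance

theorem integral_iid {k n : ℕ} {p : Measure (Fin k)} (hp : p ∈ PD k) (F : (Fin n → Fin k) → ℝ) :
    ∫ x, F x ∂(iid p n) = piE (pv p) F := by
  have : IsProbabilityMeasure p := hp
  have := isProbabilityMeasure_iid hp n
  rw [integral_fintype (Integrable.of_finite)]
  refine Finset.sum_congr rfl fun ω _ => ?_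
  simp only [iid, measureReal_def, Measure.pi_singleton, ENNReal.toReal_prod, smul_eq_mul, pv]

/-- Indicator of a proposition, as a real number. -/
noncomputable def ind (P : Prop) : ℝ := by
  classical exact if P then 1 else 0

theorem ind_true {P : Prop} (h : P) : ind P = 1 := by simp [ind, h]
theorem ind_false {P : Prop} (h : ¬ P) : ind P = 0 := by simp [ind, h]
theorem ind_nonneg (P : Prop) : 0 ≤ ind P := by unfold ind; split_ifs <;> norm_num
theorem ind_le_one (P : Prop) : ind P ≤ 1 := by unfold ind; split_ifs <;> norm_num

theorem ind_mono {P Q : Prop} (h : P → Q) : ind P ≤ ind Q := by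
  by_cases hP : P
  · rw [ind_true hP, ind_true (h hP)]
  · rw [ind_false hP]; exact ind_nonneg _

theorem ind_or_le (P Q : Prop) : ind (P ∨ Q) ≤ ind P + ind Q := by
  by_cases hP : P
  · rw [ind_true (Or.inl hP), ind_true hP]; linarith [ind_nonneg Q]
  · exact (ind_mono fun h => h.resolve_left hP).trans (by linarith [ind_nonneg P])

theorem ind_not (P : Prop) : ind (¬ P) = 1 - ind P := by
  unfold ind; split_ifs <;> norm_num

theorem ind_exists_le {β : Type*} [Fintype β] (P : β → Prop) : ind (∃ b, P b) ≤ ∑ b, ind (P b) := by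
  by_cases h : ∃ b, P b
  · obtain ⟨b, hb⟩ := h
    rw [ind_true ⟨b, hb⟩, ← ind_true hb]
    exact Finset.single_le_sum (f := fun b => ind (P b)) (fun _ _ => ind_nonneg _)
      (Finset.mem_univ b)
  · rw [ind_false h]; exact Finset.sum_nonneg fun _ _ => ind_nonneg _

/-- Markov's inequality for the exponential, in pointwise form. -/
theorem ind_le_exp (a b : ℝ) : ind (a ≤ b) ≤ Real.exp (b - a) := by
  by_cases h : a ≤ b
  · rw [ind_true h]; exact Real.one_le_exp (by linarith)
  · rw [ind_false h]; exact (Real.exp_pos _).le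

theorem real_eq_integral_ind {Ω : Type*} [MeasurableSpace Ω] [Finite Ω] [MeasurableSingletonClass Ω]
    (μ : Measure Ω) [IsFiniteMeasure μ] (P : Ω → Prop) : μ.real {ω | P ω} = ∫ ω, ind (P ω) ∂μ := by
  have : (fun ω => ind (P ω)) = Set.indicator {ω | P ω} 1 := by
    ext ω
    by_cases h : P ω
    · rw [ind_true h, Set.indicator_of_mem (by simpa using h)]; rfl
    · rw [ind_false h, Set.indicator_of_notMem (by simpa using h)]
  rw [this, integral_indicator_one (Set.toFinite _).measurableSet]

theorem integral_prod_of_finite {Ω Ω' : Type*} [MeasurableSpace Ω] [Finite Ω]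
    [MeasurableSingletonClass Ω] [MeasurableSpace Ω'] [Finite Ω'] [MeasurableSingletonClass Ω']
    (μ : Measure Ω) (ν : Measure Ω') [IsFiniteMeasure μ] [IsFiniteMeasure ν] (F : Ω × Ω' → ℝ) :
    ∫ ω, F ω ∂(μ.prod ν) = ∫ x, ∫ y, F (x, y) ∂ν ∂μ :=
  integral_prod _ Integrable.of_finite

section conv

variable {k : ℕ} {p q r : Measure (Fin k)}

theorem real_iid {n : ℕ} (hp : p ∈ PD k) (P : (Fin n → Fin k) → Prop) :
    (iid p n).real {x | P x} = piE (pv p) (fun x => ind (P x)) := by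
  have := isProbabilityMeasure_iid hp n
  rw [real_eq_integral_ind, integral_iid hp]

theorem real_iid_prod₂ {a b : ℕ} (hp : p ∈ PD k) (hq : q ∈ PD k)
    (P : (Fin a → Fin k) × (Fin b → Fin k) → Prop) :
    ((iid p a).prod (iid q b)).real {x | P x} =
      piE (pv p) (fun x => piE (pv q) (fun y => ind (P (x, y)))) := by
  have := isProbabilityMeasure_iid hp a
  have := isProbabilityMeasure_iid hq b
  rw [real_eq_integral_ind, integral_prod_of_finite, integral_iid hp]
  simp_rw [integral_iid hq]

theorem real_iid_prod₃ {a b c : ℕ} (hp : p ∈ PD k) (hq : q ∈ PD k) (hr : r ∈ PD k)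
    (P : (Fin a → Fin k) × (Fin b → Fin k) × (Fin c → Fin k) → Prop) :
    ((iid p a).prod ((iid q b).prod (iid r c))).real {x | P x} =
      piE (pv p) (fun x => piE (pv q) (fun y => piE (pv r) (fun z => ind (P (x, y, z))))) := by
  have := isProbabilityMeasure_iid hp a
  have := isProbabilityMeasure_iid hq b
  have := isProbabilityMeasure_iid hr c
  rw [real_eq_integral_ind, integral_prod_of_finite, integral_iid hp]
  simp_rw [integral_prod_of_finite, integral_iid hq, integral_iid hr]

/-- A bound on the conditional probability given the first component bounds the probability. -/
theorem real_prod_le {Ω Ω' : Type*} [MeasurableSpace Ω] [Finite Ω]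
    [MeasurableSingletonClass Ω] [MeasurableSpace Ω'] [Finite Ω'] [MeasurableSingletonClass Ω']
    (μ : Measure Ω) (ν : Measure Ω') [IsProbabilityMeasure μ] [IsProbabilityMeasure ν]
    (P : Ω × Ω' → Prop) (Q : Ω → Prop) (M : ℝ) (hM : 0 ≤ M)
    (h : ∀ x, ¬ Q x → ν.real {y | P (x, y)} ≤ M) :
    (μ.prod ν).real {ω | P ω} ≤ μ.real {x | Q x} + M := by
  rw [real_eq_integral_ind, real_eq_integral_ind, integral_prod_of_finite]
  have h2 : ∫ x, ind (Q x) ∂μ + M = ∫ x, (ind (Q x) + M) ∂μ := by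
    rw [integral_add Integrable.of_finite Integrable.of_finite]; simp
  rw [h2]
  refine integral_mono Integrable.of_finite Integrable.of_finite fun x => ?_
  show ∫ y, ind (P (x, y)) ∂ν ≤ ind (Q x) + M
  rw [← real_eq_integral_ind]
  by_cases hQ : Q x
  · rw [ind_true hQ]; linarith [measureReal_le_one (μ := ν) (s := {y | P (x, y)})]
  · rw [ind_false hQ]; linarith [h x hQ]

end conv

/-! ### Negative association of multinomial counts -/

/-- `F` takes its smallest value, in each coordinate, at every symbol outside `A`. This expresses
that `F` increases with the occurrences of the symbols in `A` and ignores all others. -/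
def MinOff {ι α : Type*} [DecidableEq ι] (A : Set α) (F : (ι → α) → ℝ) : Prop :=
  ∀ ω a i j, i ∉ A → F (Function.update ω a i) ≤ F (Function.update ω a j)

/-- The one-draw case: functions that are minimal off disjoint sets are negatively correlated,
because `(F i - F j) * (G i - G j) ≤ 0` for all `i`, `j`. -/
theorem sum_mul_le_of_min_off {α : Type*} [Fintype α] {w : α → ℝ} (hw : IsProbVec w) {A B : Set α}
    (hAB : Disjoint A B) {F G : α → ℝ} (hF : ∀ i j, i ∉ A → F i ≤ F j)
    (hG : ∀ i j, i ∉ B → G i ≤ G j) :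
    ∑ i, w i * (F i * G i) ≤ (∑ i, w i * F i) * ∑ i, w i * G i := by
  have key : ∀ i j, (F i - F j) * (G i - G j) ≤ 0 := by
    intro i j
    rw [Set.disjoint_left] at hAB
    by_cases hi : i ∈ A
    · have hiB := hAB hi
      by_cases hj : j ∈ B
      · have hjA : j ∉ A := fun h => hAB h hj
        nlinarith [hF j i hjA, hG i j hiB]
      · have : G i = G j := le_antisymm (hG i j hiB) (hG j i hj)
        simp [this]
    · by_cases hj : j ∈ A
      · nlinarith [hF i j hi, hG j i (hAB hj)]
      · have : F i = F j := le_antisymm (hF i j hi) (hF j i hj)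
        simp [this]
  have h0 : ∑ i, ∑ j, w i * w j * ((F i - F j) * (G i - G j)) ≤ 0 :=
    Finset.sum_nonpos fun i _ => Finset.sum_nonpos fun j _ =>
      mul_nonpos_of_nonneg_of_nonpos (mul_nonneg (hw.nonneg i) (hw.nonneg j)) (key i j)
  have h1 : ∑ i, ∑ j, w i * w j * ((F i - F j) * (G i - G j)) =
      (∑ i, w i * (F i * G i)) * (∑ j, w j) + (∑ i, w i) * (∑ j, w j * (F j * G j))
        - (∑ i, w i * F i) * (∑ j, w j * G j) - (∑ i, w i * G i) * (∑ j, w j * F j) := by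
    simp only [Finset.sum_mul_sum, ← Finset.sum_add_distrib, ← Finset.sum_sub_distrib]
    exact Finset.sum_congr rfl fun i _ => Finset.sum_congr rfl fun j _ => by ring
  rw [h1, hw.sum_eq_one] at h0
  nlinarith

theorem piE_cons {α : Type*} [Fintype α] {w : α → ℝ} {n : ℕ} (F : (Fin (n + 1) → α) → ℝ) :
    piE w F = ∑ i, w i * piE w (fun ω : Fin n → α => F (Fin.cons i ω)) := by
  simp only [piE, Finset.mul_sum]
  rw [← Fintype.sum_prod_type']
  refine (Fintype.sum_equiv (Fin.consEquiv fun _ => α) _ _ fun x => ?_).symm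
  simp [Fin.consEquiv, Fin.prod_univ_succ, mul_assoc]

/-- Functions of a sample that depend, monotonically, on the occurrences of disjoint sets of symbols
are negatively correlated; the proof conditions on the first draw. -/
theorem piE_mul_le {α : Type*} [Fintype α] {w : α → ℝ} (hw : IsProbVec w) {A B : Set α}
    (hAB : Disjoint A B) {n : ℕ} {F G : (Fin n → α) → ℝ} (hF : MinOff A F) (hG : MinOff B G) :
    piE w (fun ω => F ω * G ω) ≤ piE w F * piE w G := by
  induction n with
  | zero => simp [piE]
  | succ n ih =>
    rw [piE_cons, piE_cons F, piE_cons G]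
    have hc : ∀ {A : Set α} {F : (Fin (n + 1) → α) → ℝ}, MinOff A F → ∀ i,
        MinOff A (fun ω : Fin n → α => F (Fin.cons i ω)) := by
      intro A F hF i ω a j l hj
      simp only [Fin.cons_update]
      exact hF _ _ _ _ hj
    have hm : ∀ {A : Set α} {F : (Fin (n + 1) → α) → ℝ}, MinOff A F → ∀ i j, i ∉ A →
        piE w (fun ω : Fin n → α => F (Fin.cons i ω)) ≤
          piE w (fun ω : Fin n → α => F (Fin.cons j ω)) := by
      intro A F hF i j hi
      refine piE_mono hw fun ω => ?_
      have := hF (Fin.cons i ω) 0 i j hi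
      simpa using this
    refine le_trans ?_ (sum_mul_le_of_min_off hw hAB (hm hF) (hm hG))
    exact Finset.sum_le_sum fun i _ =>
      mul_le_mul_of_nonneg_left (ih (hc hF i) (hc hG i)) (hw.nonneg i)

/-- Two independent multinomial samples: nonnegative functions `h i` that are increasing in the
occurrences of `i` in the first sample and decreasing in those in the second one satisfy
`E ∏ h i ≤ ∏ E h i`. -/
theorem piE_piE_prod_le {α : Type*} [Fintype α] {w v : α → ℝ} (hw : IsProbVec w)
    (hv : IsProbVec v) {n m : ℕ} (h : α → (Fin n → α) → (Fin m → α) → ℝ) (s : Finset α)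
    (h0 : ∀ i x y, 0 ≤ h i x y)
    (hx : ∀ i y, MinOff {i} (fun x => h i x y)) (hy : ∀ i x, MinOff {i} (fun y => -h i x y)) :
    piE w (fun x => piE v (fun y => ∏ i ∈ s, h i x y)) ≤
      ∏ i ∈ s, piE w (fun x => piE v (fun y => h i x y)) := by
  classical
  induction s using Finset.induction_on with
  | empty => simp [piE_const hw, piE_const hv]
  | insert i s hi ih =>
    rw [Finset.prod_insert hi]
    simp only [Finset.prod_insert hi]
    have hP0 : ∀ x y, 0 ≤ ∏ i ∈ s, h i x y := fun x y => Finset.prod_nonneg fun _ _ => h0 _ _ _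
    have hdis : Disjoint ({i} : Set α) (s : Set α) := by simpa using hi
    have hPx : ∀ y, MinOff (s : Set α) (fun x => ∏ i ∈ s, h i x y) := by
      intro y x a j l hj
      refine Finset.prod_le_prod (fun _ _ => h0 _ _ _) fun i hi => hx i y x a j l ?_
      rintro rfl
      exact hj hi
    have hPy : ∀ x, MinOff (s : Set α) (fun y => -∏ i ∈ s, h i x y) := by
      intro x y a j l hj
      refine neg_le_neg (Finset.prod_le_prod (fun _ _ => h0 _ _ _) fun i hi => ?_)
      refine neg_le_neg_iff.1 (hy i x y a j l ?_)
      rintro rfl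
      exact hj hi
    have hneg : ∀ {F : (Fin m → α) → ℝ}, piE v (fun y => - F y) = - piE v F := by
      intro F
      have := piE_const_mul (w := v) (-1) F
      simpa using this
    have havg : ∀ {A : Set α} {F : (Fin n → α) → (Fin m → α) → ℝ},
        (∀ y, MinOff A (fun x => F x y)) → MinOff A (fun x => piE v (fun y => F x y)) :=
      fun hF x a j l hj => piE_mono hv fun y => hF y x a j l hj
    calc piE w (fun x => piE v (fun y => h i x y * ∏ i ∈ s, h i x y))
        ≤ piE w (fun x => piE v (fun y => h i x y) * piE v (fun y => ∏ i ∈ s, h i x y)) := by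
          refine piE_mono hw fun x => ?_
          have := piE_mul_le hv hdis (hy i x) (hPy x)
          simpa [hneg] using this
      _ ≤ piE w (fun x => piE v (fun y => h i x y)) *
            piE w (fun x => piE v (fun y => ∏ i ∈ s, h i x y)) :=
          piE_mul_le hw hdis (havg (hx i)) (havg hPx)
      _ ≤ _ := mul_le_mul_of_nonneg_left ih
          (piE_nonneg hw fun x => piE_nonneg hv fun y => h0 i x y)

/-! ### Exponential moments and Bernstein bounds for counts -/

/-- The number of draws with index in `T` that fall into `S`. -/
noncomputable def cnt {ι α : Type*} [DecidableEq α] (T : Finset ι) (S : Finset α) (ω : ι → α) : ℝ :=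
  ((T.filter fun a => ω a ∈ S).card : ℝ)

section cnt

variable {ι α : Type*} [Fintype ι] [DecidableEq ι] [Fintype α] [DecidableEq α] {w : α → ℝ}

theorem cnt_eq_sum {ι α : Type*} [DecidableEq α] (T : Finset ι) (S : Finset α) (ω : ι → α) :
    cnt T S ω = ∑ a ∈ T, if ω a ∈ S then (1 : ℝ) else 0 := by
  simp [cnt]

theorem sum_mul_ite_mem (hw : IsProbVec w) (S : Finset α) (x y : ℝ) :
    ∑ i, w i * (if i ∈ S then x else y) = y + (∑ i ∈ S, w i) * (x - y) := by
  have : ∀ i, w i * (if i ∈ S then x else y) = w i * y + (if i ∈ S then w i else 0) * (x - y) := by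
    intro i; split_ifs <;> ring
  simp_rw [this, Finset.sum_add_distrib, ← Finset.sum_mul, hw.sum_eq_one]
  simp

theorem piE_exp_cnt (hw : IsProbVec w) (T : Finset ι) (S : Finset α) (θ : ℝ) :
    piE w (fun ω => Real.exp (θ * cnt T S ω)) =
      (1 + (∑ i ∈ S, w i) * (Real.exp θ - 1)) ^ T.card := by
  have h1 : ∀ ω : ι → α, Real.exp (θ * cnt T S ω) =
      ∏ a, (fun a i => if a ∈ T then (if i ∈ S then Real.exp θ else 1) else 1) a (ω a) := by
    intro ω
    rw [cnt_eq_sum, Finset.mul_sum, Real.exp_sum, Finset.prod_ite_mem Finset.univ T]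
    simp only [Finset.univ_inter]
    refine Finset.prod_congr rfl fun a _ => ?_
    split_ifs <;> simp
  have h0 := piE_prod (ι := ι) (w := w)
    (fun a i => if a ∈ T then (if i ∈ S then Real.exp θ else 1) else 1)
  rw [show piE w (fun ω => Real.exp (θ * cnt T S ω)) = _ from congrArg (piE w) (funext h1), h0]
  have h2 : ∀ a : ι, ∑ i, w i * (if a ∈ T then (if i ∈ S then Real.exp θ else 1) else 1) =
      if a ∈ T then 1 + (∑ i ∈ S, w i) * (Real.exp θ - 1) else 1 := by
    intro a
    by_cases ha : a ∈ T
    · simp only [ha, if_true]; exact sum_mul_ite_mem hw S _ _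
    · simp [ha, hw.sum_eq_one]
  simp_rw [h2]
  rw [Finset.prod_ite_mem Finset.univ T]
  simp

theorem exp_le_one_add_sq {θ : ℝ} (h : |θ| ≤ 1) : Real.exp θ ≤ 1 + θ + θ ^ 2 := by
  have := abs_le.1 (Real.abs_exp_sub_one_sub_id_le h)
  linarith [this.2]

theorem piE_exp_cnt_sub_le (hw : IsProbVec w) (T : Finset ι) (S : Finset α) {θ : ℝ} (h : |θ| ≤ 1) :
    piE w (fun ω => Real.exp (θ * (cnt T S ω - T.card * ∑ i ∈ S, w i))) ≤
      Real.exp (T.card * (∑ i ∈ S, w i) * θ ^ 2) := by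
  set P := ∑ i ∈ S, w i with hP
  have hP0 : 0 ≤ P := Finset.sum_nonneg fun i _ => hw.nonneg i
  have hP1 : P ≤ 1 := hw.sum_le_one S
  have h1 : ∀ ω : ι → α, Real.exp (θ * (cnt T S ω - T.card * P)) =
      Real.exp (-(θ * (T.card * P))) * Real.exp (θ * cnt T S ω) := by
    intro ω; rw [← Real.exp_add]; ring_nf
  simp_rw [h1]
  rw [piE_const_mul, piE_exp_cnt hw]
  have h2 : (1 + P * (Real.exp θ - 1)) ^ T.card ≤ Real.exp (T.card * (P * (θ + θ ^ 2))) := by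
    rw [Real.exp_nat_mul]
    refine pow_le_pow_left₀ (by nlinarith [Real.exp_pos θ]) ?_ _
    refine le_trans ?_ (Real.add_one_le_exp _)
    nlinarith [exp_le_one_add_sq h]
  refine (mul_le_mul_of_nonneg_left h2 (Real.exp_pos _).le).trans (le_of_eq ?_)
  rw [← Real.exp_add]; ring_nf

/-- Bernstein's inequality for the empirical frequency of a set of probability at most `s`. -/
theorem piE_freq_deviation_le (hw : IsProbVec w) {T : Finset ι} (hT : 0 < T.card) (S : Finset α)
    {s Λ : ℝ} (hs : ∑ i ∈ S, w i ≤ s) (hs0 : 0 < s) (hΛ : 0 ≤ Λ) :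
    piE w (fun ω => ind (Real.sqrt (4 * s * Λ / T.card) + 2 * Λ / T.card <
      |cnt T S ω / T.card - ∑ i ∈ S, w i|)) ≤ 2 * Real.exp (-Λ) := by
  set P := ∑ i ∈ S, w i with hP
  set u := Real.sqrt (4 * s * Λ / T.card) + 2 * Λ / T.card with hu
  have hN : (0 : ℝ) < T.card := by exact_mod_cast hT
  have hu0 : 0 ≤ u := by positivity
  have hP0 : 0 ≤ P := Finset.sum_nonneg fun i _ => hw.nonneg i
  -- the exponent `θ = min 1 (u / (2 s))` is optimal up to a constant factor
  obtain ⟨θ, hθ0, hθ1, hθ⟩ : ∃ θ : ℝ, 0 ≤ θ ∧ θ ≤ 1 ∧ T.card * P * θ ^ 2 - θ * (T.card * u) ≤ -Λ :=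
      by
    by_cases h : u ≤ 2 * s
    · refine ⟨u / (2 * s), by positivity, by rw [div_le_one (by positivity)]; exact h, ?_⟩
      have h1 : 4 * s * Λ / T.card ≤ u ^ 2 := by
        rw [← Real.sqrt_le_left hu0]
        have : 0 ≤ 2 * Λ / T.card := by positivity
        linarith
      have h2 : T.card * P * (u / (2 * s)) ^ 2 ≤ T.card * s * (u / (2 * s)) ^ 2 := by gcongr
      have h3 : T.card * s * (u / (2 * s)) ^ 2 - u / (2 * s) * (T.card * u) =
          -(T.card * u ^ 2 / (4 * s)) := by field_simp; ring
      have h4 : Λ ≤ T.card * u ^ 2 / (4 * s) := by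
        rw [le_div_iff₀ (by positivity)]
        rw [div_le_iff₀ hN] at h1
        linarith
      linarith
    · refine ⟨1, by norm_num, le_rfl, ?_⟩
      have h1 : 2 * Λ / T.card ≤ u := by linarith [Real.sqrt_nonneg (4 * s * Λ / T.card)]
      rw [div_le_iff₀ hN] at h1
      have h2 : (T.card : ℝ) * P ≤ T.card * s := by gcongr
      push Not at h
      have h3 : (T.card : ℝ) * (2 * s) ≤ T.card * u := by gcongr
      nlinarith
  have hpt : ∀ ω : ι → α, ind (u < |cnt T S ω / T.card - P|) ≤
      Real.exp (-(θ * (T.card * u))) * (Real.exp (θ * (cnt T S ω - T.card * P)) +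
        Real.exp (-θ * (cnt T S ω - T.card * P))) := by
    intro ω
    by_cases h : u < |cnt T S ω / T.card - P|
    · rw [ind_true h, mul_add, ← Real.exp_add, ← Real.exp_add]
      have e : cnt T S ω = T.card * (cnt T S ω / T.card) := by field_simp
      rcases lt_abs.1 h with h | h
      · have : T.card * u ≤ cnt T S ω - T.card * P := by
          rw [e]; nlinarith
        have := Real.one_le_exp (x := -(θ * (T.card * u)) + θ * (cnt T S ω - T.card * P))
            (by nlinarith)
        linarith [Real.exp_pos (-(θ * (T.card * u)) + -θ * (cnt T S ω - T.card * P))]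
      · have : T.card * u ≤ -(cnt T S ω - T.card * P) := by
          rw [e]; nlinarith
        have := Real.one_le_exp (x := -(θ * (T.card * u)) + -θ * (cnt T S ω - T.card * P))
            (by nlinarith)
        linarith [Real.exp_pos (-(θ * (T.card * u)) + θ * (cnt T S ω - T.card * P))]
    · rw [ind_false h]; positivity
  refine (piE_mono hw hpt).trans ?_
  rw [piE_const_mul, piE_add]
  have a1 := piE_exp_cnt_sub_le hw T S (θ := θ) (by rw [abs_of_nonneg hθ0]; exact hθ1)
  have a2 := piE_exp_cnt_sub_le hw T S (θ := -θ) (by rw [abs_neg, abs_of_nonneg hθ0]; exact hθ1)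
  rw [neg_sq] at a2
  calc Real.exp (-(θ * (T.card * u))) * _ ≤ Real.exp (-(θ * (T.card * u))) *
        (Real.exp (T.card * P * θ ^ 2) + Real.exp (T.card * P * θ ^ 2)) := by gcongr
    _ = 2 * Real.exp (T.card * P * θ ^ 2 - θ * (T.card * u)) := by
        rw [sub_eq_add_neg, Real.exp_add]; ring
    _ ≤ _ := by gcongr

theorem piE_cnt_le_quarter (hw : IsProbVec w) (T : Finset ι) (S : Finset α) :
    piE w (fun ω => ind (cnt T S ω ≤ T.card * (∑ i ∈ S, w i) / 4)) ≤
      Real.exp (-(T.card * (∑ i ∈ S, w i) / 8)) := by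
  set P := ∑ i ∈ S, w i with hP
  have hP0 : 0 ≤ P := Finset.sum_nonneg fun i _ => hw.nonneg i
  have hpt : ∀ ω : ι → α, ind (cnt T S ω ≤ T.card * P / 4) ≤
      Real.exp (-(3 / 8 * (3 / 4) * (T.card * P))) * Real.exp (-(3 / 8) * (cnt T S ω - T.card *
          P)) := by
    intro ω
    by_cases h : cnt T S ω ≤ T.card * P / 4
    · rw [ind_true h, ← Real.exp_add]
      exact Real.one_le_exp (by linarith)
    · rw [ind_false h]; positivity
  refine (piE_mono hw hpt).trans ?_
  rw [piE_const_mul]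
  refine (mul_le_mul_of_nonneg_left (piE_exp_cnt_sub_le hw T S (θ := -(3 / 8))
    (by rw [abs_le]; constructor <;> norm_num)) (Real.exp_pos _).le).trans ?_
  rw [← Real.exp_add]
  have : 0 ≤ T.card * P := by positivity
  exact Real.exp_le_exp.2 (by nlinarith)

theorem piE_le_cnt (hw : IsProbVec w) (T : Finset ι) (S : Finset α) (x : ℝ) :
    piE w (fun ω => ind (x ≤ cnt T S ω)) ≤ Real.exp (2 * (T.card * ∑ i ∈ S, w i) - x) := by
  set P := ∑ i ∈ S, w i with hP
  have hP0 : 0 ≤ P := Finset.sum_nonneg fun i _ => hw.nonneg i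
  have hpt : ∀ ω : ι → α, ind (x ≤ cnt T S ω) ≤
      Real.exp (T.card * P - x) * Real.exp (1 * (cnt T S ω - T.card * P)) := by
    intro ω
    refine (ind_le_exp _ _).trans (le_of_eq ?_)
    rw [← Real.exp_add]; ring_nf
  refine (piE_mono hw hpt).trans ?_
  rw [piE_const_mul]
  refine (mul_le_mul_of_nonneg_left (piE_exp_cnt_sub_le hw T S (θ := 1)
    (by norm_num)) (Real.exp_pos _).le).trans ?_
  rw [← Real.exp_add]
  exact Real.exp_le_exp.2 (by linarith)

end cnt

/-! ### Comparing two binomial counts -/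

/-- The Bernoulli probability vector. -/
noncomputable def bern (P : ℝ) (b : Bool) : ℝ := if b then P else 1 - P

/-- The number of successes. -/
def succs {ι : Type*} [Fintype ι] (x : ι → Bool) : ℕ :=
    (Finset.univ.filter fun a => x a = true).card

/-- The sign of `m - n`. -/
noncomputable def sg (m n : ℕ) : ℝ := if n < m then 1 else if m < n then -1 else 0

theorem sg_le_one (m n : ℕ) : sg m n ≤ 1 := by unfold sg; split_ifs <;> norm_num
theorem neg_one_le_sg (m n : ℕ) : -1 ≤ sg m n := by unfold sg; split_ifs <;> norm_num
theorem sg_antisymm (m n : ℕ) : sg m n = - sg n m := by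
  unfold sg; split_ifs <;> first | omega | norm_num

/-- Expectation over two independent families of Bernoulli draws. -/
noncomputable def bernE (ι : Type*) [Fintype ι] [DecidableEq ι] (P Q : ℝ)
    (F : (ι → Bool) → (ι → Bool) → ℝ) : ℝ :=
  piE (bern P) fun x => piE (bern Q) fun y => F x y

section bern

variable {ι : Type*} [Fintype ι] [DecidableEq ι] {P Q : ℝ}

theorem isProbVec_bern (h0 : 0 ≤ P) (h1 : P ≤ 1) : IsProbVec (bern P) :=
  ⟨fun b => by unfold bern; split_ifs <;> linarith, by simp [bern]⟩

theorem prod_bern {ι : Type*} [Fintype ι] (P : ℝ) (x : ι → Bool) :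
    ∏ a, bern P (x a) = P ^ succs x * (1 - P) ^ (Fintype.card ι - succs x) := by
  have h : (Finset.univ.filter fun a => ¬ x a = true).card = Fintype.card ι - succs x := by
    have := Finset.card_filter_add_card_filter_not (s := (Finset.univ : Finset ι))
      (fun a => x a = true)
    simp only [Finset.card_univ] at this
    unfold succs
    omega
  simp only [bern]
  rw [Finset.prod_ite, Finset.prod_const, Finset.prod_const, h]
  rfl

theorem succs_le {ι : Type*} [Fintype ι] (x : ι → Bool) : succs x ≤ Fintype.card ι :=
    Finset.card_le_univ _

theorem cnt_univ_singleton_true {ι : Type*} [Fintype ι]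
    (x : ι → Bool) : cnt Finset.univ {true} x = succs x := by
  simp [cnt, succs]

theorem bernE_mono (hP0 : 0 ≤ P) (hP1 : P ≤ 1) (hQ0 : 0 ≤ Q) (hQ1 : Q ≤ 1)
    {F G : (ι → Bool) → (ι → Bool) → ℝ} (h : ∀ x y, F x y ≤ G x y) :
    bernE ι P Q F ≤ bernE ι P Q G :=
  piE_mono (isProbVec_bern hP0 hP1) fun x => piE_mono (isProbVec_bern hQ0 hQ1) fun y => h x y

theorem bernE_add (F G : (ι → Bool) → (ι → Bool) → ℝ) :
    bernE ι P Q (fun x y => F x y + G x y) = bernE ι P Q F + bernE ι P Q G := by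
  simp only [bernE, piE_add]

theorem bernE_const_mul (c : ℝ) (F : (ι → Bool) → (ι → Bool) → ℝ) :
    bernE ι P Q (fun x y => c * F x y) = c * bernE ι P Q F := by
  simp only [bernE, piE_const_mul]

theorem bernE_const (hP0 : 0 ≤ P) (hP1 : P ≤ 1) (hQ0 : 0 ≤ Q) (hQ1 : Q ≤ 1) (c : ℝ) :
    bernE ι P Q (fun _ _ => c) = c := by
  simp only [bernE, piE_const (isProbVec_bern hP0 hP1), piE_const (isProbVec_bern hQ0 hQ1)]

theorem bernE_mul (F G : (ι → Bool) → ℝ) :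
    bernE ι P Q (fun x y => F x * G y) = piE (bern P) F * piE (bern Q) G := by
  simp only [bernE, piE_const_mul]
  simp_rw [mul_comm (F _)]
  rw [piE_const_mul, mul_comm]

theorem bern_tilt {a b P₁ Q₁ : ℝ} (ha : a ≠ 0) (hQ : Q₁ ≠ 0) (y d e : ℕ) :
    a ^ y * P₁ ^ (e + d) * (b ^ (y + d) * Q₁ ^ e) =
      a ^ (y + d) * P₁ ^ e * (b ^ y * Q₁ ^ (e + d)) * ((b * P₁) ^ d / (a * Q₁) ^ d) := by
  rw [mul_div_assoc', eq_div_iff (pow_ne_zero _ (mul_ne_zero ha hQ))]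
  ring

/-- Exchanging the two families tilts the law by `ρ ^ (X - Y)`, with `ρ` the odds ratio. Hence
the expectation of an antisymmetric function is that of its positive part against
`1 - ρ ^ (X - Y)`. -/
theorem bernE_antisymm (hP : 0 < P) (hQ : Q < 1) (φ : ℕ → ℕ → ℝ) (hφ : ∀ m n, φ m n = - φ n m) :
    bernE ι P Q (fun x y => φ (succs x) (succs y)) =
      bernE ι P Q (fun x y => ind (succs y < succs x) * φ (succs x) (succs y) *
        (1 - (Q * (1 - P) / (P * (1 - Q))) ^ (succs x - succs y))) := by
  set ρ := Q * (1 - P) / (P * (1 - Q)) with hρ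
  have hQ' : 0 < 1 - Q := by linarith
  have hs : ∀ m n, φ m n = ind (n < m) * φ m n + ind (m < n) * φ m n := by
    intro m n
    rcases lt_trichotomy m n with h | h | h
    · simp [ind_true h, ind_false (not_lt.2 h.le)]
    · subst h
      have : φ m m = 0 := by linarith [hφ m m]
      simp [this]
    · simp [ind_true h, ind_false (not_lt.2 h.le)]
  have hr : ∀ m n, ind (n < m) * φ m n * (1 - ρ ^ (m - n)) =
      ind (n < m) * φ m n + ind (n < m) * φ n m * ρ ^ (m - n) := by
    intro m n; rw [hφ m n]; ring
  simp_rw [hr]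
  rw [show bernE ι P Q (fun x y => φ (succs x) (succs y)) = bernE ι P Q (fun x y =>
    ind (succs y < succs x) * φ (succs x) (succs y) +
      ind (succs x < succs y) * φ (succs x) (succs y)) from by simp_rw [← hs]]
  rw [bernE_add, bernE_add]
  congr 1
  simp only [bernE, piE, Finset.mul_sum]
  rw [Finset.sum_comm]
  refine Finset.sum_congr rfl fun x _ => Finset.sum_congr rfl fun y _ => ?_
  by_cases h : succs y < succs x
  · rw [prod_bern, prod_bern, prod_bern, prod_bern, hρ, div_pow]
    obtain ⟨d, hd⟩ := Nat.exists_eq_add_of_lt h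
    have hX := succs_le x
    obtain ⟨e, he⟩ := Nat.exists_eq_add_of_le hX
    rw [show Fintype.card ι - succs y = e + (d + 1) by omega,
      show Fintype.card ι - succs x = e by omega, show succs x - succs y = d + 1 by omega,
      show succs x = succs y + (d + 1) by omega]
    have := bern_tilt (P₁ := 1 - P) (b := Q) hP.ne' hQ'.ne' (succs y) (d + 1) e
    linear_combination (ind (succs y < succs y + (d + 1)) * φ (succs y) (succs y + (d + 1))) * this
  · simp [ind_false h]

theorem piE_succs :
    piE (bern P) (fun x : ι → Bool => (succs x : ℝ)) = Fintype.card ι * P := by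
  have h1 : ∀ x : ι → Bool, (succs x : ℝ) = ∑ a, (if x a = true then (1 : ℝ) else 0) := by
    intro x; simp [succs]
  simp_rw [h1]
  rw [piE_sum]
  have h2 : ∀ b : ι, piE (bern P) (fun x : ι → Bool => if x b = true then (1 : ℝ) else 0) = P := by
    intro b
    have h3 : ∀ x : ι → Bool, (if x b = true then (1 : ℝ) else 0) =
        ∏ a, (fun a i => if a = b then (if i = true then (1 : ℝ) else 0) else 1) a (x a) := by
      intro x; simp
    have h4 := piE_prod (ι := ι) (w := bern P)
      (fun a i => if a = b then (if i = true then (1 : ℝ) else 0) else 1)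
    rw [show piE (bern P) (fun x : ι → Bool => if x b = true then (1 : ℝ) else 0) = _ from
      congrArg (piE _) (funext h3), h4]
    have h5 : ∀ a : ι, ∑ i, bern P i * (if a = b then (if i = true then (1 : ℝ) else 0) else 1) =
        if a = b then P else 1 := by
      intro a; by_cases h : a = b <;> simp [h, bern]
    simp_rw [h5]
    simp
  simp_rw [h2]
  simp

theorem bernE_sub_succs (hP0 : 0 ≤ P) (hP1 : P ≤ 1) (hQ0 : 0 ≤ Q) (hQ1 : Q ≤ 1) :
    bernE ι P Q (fun x y => (succs x : ℝ) - succs y) = Fintype.card ι * (P - Q) := by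
  simp only [bernE, piE_sub, piE_const (isProbVec_bern hP0 hP1), piE_const (isProbVec_bern hQ0 hQ1),
    piE_succs]
  ring

theorem bernE_exp_le (hP0 : 0 ≤ P) (hP1 : P ≤ 1) (hQ0 : 0 ≤ Q) (hQ1 : Q ≤ 1) {θ : ℝ}
    (hθ : |θ| ≤ 1) :
    bernE ι P Q (fun x y => Real.exp (θ * ((succs x : ℝ) - succs y))) ≤
      Real.exp (Fintype.card ι * ((P - Q) * θ + (P * (1 - Q) + Q * (1 - P)) * θ ^ 2)) := by
  have h1 : ∀ x y : ι → Bool, Real.exp (θ * ((succs x : ℝ) - succs y)) =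
      Real.exp (θ * cnt Finset.univ {true} x) * Real.exp (-θ * cnt Finset.univ {true} y) := by
    intro x y
    rw [cnt_univ_singleton_true, cnt_univ_singleton_true, ← Real.exp_add]; ring_nf
  simp_rw [h1]
  rw [bernE_mul, piE_exp_cnt (isProbVec_bern hP0 hP1), piE_exp_cnt (isProbVec_bern hQ0 hQ1),
    ← mul_pow, Real.exp_nat_mul]
  have e1 := exp_le_one_add_sq hθ
  have e2 := exp_le_one_add_sq (θ := -θ) (by rwa [abs_neg])
  have p1 := Real.exp_pos θ
  have p2 := Real.exp_pos (-θ)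
  have hpm : Real.exp θ * Real.exp (-θ) = 1 := by rw [← Real.exp_add]; simp
  have hb : ∑ i ∈ ({true} : Finset Bool), bern P i = P := by simp [bern]
  have hb' : ∑ i ∈ ({true} : Finset Bool), bern Q i = Q := by simp [bern]
  rw [hb, hb', Finset.card_univ]
  refine pow_le_pow_left₀ (mul_nonneg (by nlinarith) (by nlinarith)) ?_ _
  refine le_trans ?_ (Real.add_one_le_exp _)
  have ea : (1 + P * (Real.exp θ - 1)) * (1 + Q * (Real.exp (-θ) - 1)) =
      1 + P * (1 - Q) * (Real.exp θ - 1) + Q * (1 - P) * (Real.exp (-θ) - 1) := by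
    linear_combination P * Q * hpm
  rw [ea]
  have ha : 0 ≤ P * (1 - Q) := mul_nonneg hP0 (by linarith)
  have hb : 0 ≤ Q * (1 - P) := mul_nonneg hQ0 (by linarith)
  nlinarith

theorem bernE_le_of_le (hP1 : P ≤ 1) (hQ0 : 0 ≤ Q) (hQP : Q < P) :
    bernE ι P Q (fun x y => ind (succs x ≤ succs y)) ≤
      Real.exp (-(Fintype.card ι * (P - Q) ^ 2 / (4 * (P * (1 - Q) + Q * (1 - P))))) := by
  have hP0 : 0 ≤ P := by linarith
  have hQ1 : Q ≤ 1 := by linarith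
  set v := P * (1 - Q) + Q * (1 - P) with hv
  have hvδ : P - Q ≤ v := by nlinarith
  have hδ : 0 < P - Q := by linarith
  have hv0 : 0 < v := by linarith
  set θ := (P - Q) / (2 * v) with hθ
  have hθ0 : 0 ≤ θ := by positivity
  have hθ1 : θ ≤ 1 := by rw [hθ, div_le_one (by positivity)]; linarith
  have hpt : ∀ x y : ι → Bool, ind (succs x ≤ succs y) ≤ Real.exp (-θ *
      ((succs x : ℝ) - succs y)) := by
    intro x y
    by_cases h : succs x ≤ succs y
    · rw [ind_true h]
      have : (succs x : ℝ) ≤ succs y := by exact_mod_cast h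
      exact Real.one_le_exp (by nlinarith)
    · rw [ind_false h]; positivity
  refine (bernE_mono hP0 hP1 hQ0 hQ1 hpt).trans ?_
  refine (bernE_exp_le hP0 hP1 hQ0 hQ1 (by rw [abs_neg, abs_of_nonneg hθ0]; exact hθ1)).trans
    (le_of_eq ?_)
  congr 1
  rw [hθ]; field_simp; ring

/-- The fourth moment of `X - Y` when its mean is at most of the order of its standard deviation;
`P (1 - Q)` is the probability that a pair of draws moves the difference up. -/
theorem bernE_pow_four_le (hP1 : P ≤ 1) (hQ0 : 0 ≤ Q) (hQP : Q < P)
    (hD : Fintype.card ι * (P - Q) ≤ 4 * Real.sqrt (1 + Fintype.card ι * (P * (1 - Q)))) :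
    bernE ι P Q (fun x y => ((succs x : ℝ) - succs y) ^ 4) ≤
      432 * Real.exp 10 * (1 + Fintype.card ι * (P * (1 - Q))) * (Fintype.card ι * (P * (1 - Q))) :=
          by
  have hP0 : 0 ≤ P := by linarith
  have hQ1 : Q ≤ 1 := by linarith
  obtain ⟨N, hN⟩ : ∃ N : ℝ, N = Fintype.card ι := ⟨_, rfl⟩
  rw [← hN] at hD ⊢
  have hN0 : 0 ≤ N := by rw [hN]; positivity
  obtain ⟨a, ha⟩ : ∃ a, a = P * (1 - Q) := ⟨_, rfl⟩
  rw [← ha] at hD ⊢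
  have ha0 : 0 ≤ a := ha ▸ mul_nonneg hP0 (by linarith)
  have hba : Q * (1 - P) ≤ a := by nlinarith
  have hb0 : 0 ≤ Q * (1 - P) := mul_nonneg hQ0 (by linarith)
  have hδa : P - Q ≤ a := by nlinarith
  have hδ : 0 ≤ P - Q := by linarith
  obtain ⟨A, hA⟩ : ∃ A, A = N * a := ⟨_, rfl⟩
  rw [← hA] at hD ⊢
  have hA0 : 0 ≤ A := by rw [hA]; positivity
  obtain ⟨R, hR⟩ : ∃ R, R = 1 + A := ⟨_, rfl⟩
  rw [← hR] at hD ⊢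
  have hR1 : 1 ≤ R := by linarith
  have hR0 : 0 < R := by linarith
  obtain ⟨D, hDdef⟩ : ∃ D, D = N * (P - Q) := ⟨_, rfl⟩
  rw [← hDdef] at hD
  have hD0 : 0 ≤ D := by rw [hDdef]; positivity
  have hDA : D ≤ A := by rw [hDdef, hA]; gcongr
  have hD2 : D ^ 2 ≤ 16 * R := by
    have := pow_le_pow_left₀ hD0 hD 2
    rwa [mul_pow, Real.sq_sqrt hR0.le, show (4 : ℝ) ^ 2 = 16 by norm_num] at this
  have hDA2 : D ^ 2 ≤ 32 * A := by
    rcases le_total 1 A with h | h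
    · linarith
    · nlinarith
  obtain ⟨θ, hθ⟩ : ∃ θ, θ = 1 / Real.sqrt R := ⟨_, rfl⟩
  have hsR : 0 < Real.sqrt R := Real.sqrt_pos.2 hR0
  have hθ0 : 0 ≤ θ := by rw [hθ]; positivity
  have hθ1 : θ ≤ 1 := by
    rw [hθ, div_le_one hsR]; exact Real.one_le_sqrt.2 hR1
  have hθ2 : θ ^ 2 = 1 / R := by rw [hθ, div_pow, Real.sq_sqrt hR0.le, one_pow]
  -- `d ^ 4 ≤ 24 (cosh (θ d) - 1) / θ ^ 4`, with `1 / θ` of the order of the standard deviation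
  have hpt : ∀ x y : ι → Bool, ((succs x : ℝ) - succs y) ^ 4 ≤
      (12 * R ^ 2) * ((Real.exp (θ * ((succs x : ℝ) - succs y)) +
        Real.exp (-θ * ((succs x : ℝ) - succs y))) + (-2)) := by
    intro x y
    set d := (succs x : ℝ) - succs y
    have hc : (θ * d) ^ 4 / 24 ≤ Real.cosh (θ * d) - 1 := by
      have h1 : 1 + (θ * d) ^ 2 / 2 + (θ * d) ^ 4 / 24 ≤ Real.cosh (θ * d) := by
        have hsum := Real.hasSum_cosh (θ * d)
        have := hsum.summable.sum_le_tsum (Finset.range 3) (fun i _ => by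
          rw [pow_mul]; positivity)
        rw [hsum.tsum_eq] at this
        refine le_trans (le_of_eq ?_) this
        simp [Finset.sum_range_succ, Nat.factorial]
      nlinarith [sq_nonneg (θ * d)]
    rw [Real.cosh_eq] at hc
    have h4 : (θ * d) ^ 4 = d ^ 4 / R ^ 2 := by
      rw [mul_pow, show θ ^ 4 = (θ ^ 2) ^ 2 by ring, hθ2]; field_simp
    rw [h4] at hc
    rw [show -θ * d = -(θ * d) by ring]
    have : d ^ 4 = R ^ 2 * (d ^ 4 / R ^ 2) := by field_simp
    rw [this]
    have hR2 : 0 ≤ R ^ 2 := by positivity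
    nlinarith
  refine (bernE_mono hP0 hP1 hQ0 hQ1 hpt).trans ?_
  rw [bernE_const_mul, bernE_add, bernE_add, bernE_const hP0 hP1 hQ0 hQ1]
  have m1 := bernE_exp_le (ι := ι) hP0 hP1 hQ0 hQ1 (θ := θ) (by rw [abs_of_nonneg hθ0]; exact hθ1)
  have m2 := bernE_exp_le (ι := ι) hP0 hP1 hQ0 hQ1 (θ := -θ)
    (by rw [abs_neg, abs_of_nonneg hθ0]; exact hθ1)
  rw [neg_sq] at m2
  rw [← hN, ← ha] at m1 m2
  obtain ⟨g, hg⟩ : ∃ g, g = N * (a + Q * (1 - P)) * θ ^ 2 := ⟨_, rfl⟩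
  have hg0 : 0 ≤ g := by rw [hg]; positivity
  have hgle : g ≤ 2 * A / R := by
    rw [hg, hθ2, mul_one_div]
    refine div_le_div_of_nonneg_right ?_ hR0.le
    rw [hA]
    nlinarith only [hN0, hba]
  have hsum : Real.exp (N * ((P - Q) * θ + (a + Q * (1 - P)) * θ ^ 2)) +
      Real.exp (N * ((P - Q) * -θ + (a + Q * (1 - P)) * θ ^ 2)) =
      2 * (Real.exp g * Real.cosh (D * θ)) := by
    rw [Real.cosh_eq]
    rw [show N * ((P - Q) * θ + (a + Q * (1 - P)) * θ ^ 2) = g + D * θ by rw [hg, hDdef]; ring,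
      show N * ((P - Q) * -θ + (a + Q * (1 - P)) * θ ^ 2) = g + -(D * θ) by rw [hg, hDdef]; ring]
    rw [Real.exp_add, Real.exp_add]
    ring
  obtain ⟨h, hh⟩ : ∃ h, h = g + (D * θ) ^ 2 / 2 := ⟨_, rfl⟩
  have hcosh : Real.exp g * Real.cosh (D * θ) ≤ Real.exp h := by
    rw [hh, Real.exp_add]
    exact mul_le_mul_of_nonneg_left (Real.cosh_le_exp_half_sq _) (Real.exp_pos _).le
  have hh1 : h ≤ 18 * A / R := by
    have : (D * θ) ^ 2 / 2 ≤ 16 * A / R := by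
      rw [mul_pow, hθ2]
      have : D ^ 2 * (1 / R) / 2 = D ^ 2 / 2 / R := by ring
      rw [this]
      gcongr
      linarith
    calc h ≤ 2 * A / R + 16 * A / R := by linarith
      _ = 18 * A / R := by ring
  have hh10 : h ≤ 10 := by
    have h1 : g ≤ 2 := hgle.trans (by rw [div_le_iff₀ hR0]; linarith)
    have h2 : (D * θ) ^ 2 ≤ 16 := by
      rw [mul_pow, hθ2, mul_one_div, div_le_iff₀ hR0]; linarith
    linarith
  have hh0 : 0 ≤ h := by rw [hh]; positivity
  have hexp : Real.exp h - 1 ≤ h * Real.exp 10 := by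
    have h1 := Real.add_one_le_exp (-h)
    have h2 : Real.exp h * Real.exp (-h) = 1 := by rw [← Real.exp_add]; simp
    have h3 : Real.exp h - 1 ≤ h * Real.exp h := by
      have := mul_le_mul_of_nonneg_left h1 (Real.exp_pos h).le
      rw [h2] at this
      linarith only [this]
    have h4 : Real.exp h ≤ Real.exp 10 := Real.exp_le_exp.2 hh10
    exact h3.trans (mul_le_mul_of_nonneg_left h4 hh0)
  have hS := add_le_add m1 m2
  rw [hsum] at hS
  have hR2 : 0 ≤ 12 * R ^ 2 := by positivity
  calc 12 * R ^ 2 * (_ + _ + -2) ≤ 12 * R ^ 2 * (2 * (h * Real.exp 10)) :=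
        mul_le_mul_of_nonneg_left (by linarith only [hS, hcosh, hexp]) hR2
    _ ≤ 12 * R ^ 2 * (2 * (18 * A / R * Real.exp 10)) := by gcongr
    _ = 432 * Real.exp 10 * R * A := by field_simp; ring

end bern

/-! ### The sign of the difference of two binomial counts -/

/-- The constant in the lower bound for the bias of the sign. -/
noncomputable def signConst : ℝ := 1 / (12 * Real.sqrt (432 * Real.exp 10))

theorem signConst_pos : 0 < signConst := by unfold signConst; positivity

theorem signConst_le : signConst ≤ 1 / 2 := by
  unfold signConst
  have : 1 ≤ Real.sqrt (432 * Real.exp 10) := by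
    rw [Real.one_le_sqrt]
    linarith [Real.add_one_le_exp (10 : ℝ)]
  rw [div_le_div_iff₀ (by positivity) (by norm_num)]
  linarith

/-- The order of the bias of `sign (X - Y)` for `X ∼ Bin(N, P)`, `Y ∼ Bin(N, Q)`, `Q ≤ P`. -/
noncomputable def signBias (N P Q : ℝ) : ℝ := min 1 (N * (P - Q) / Real.sqrt (1 + N * Q))

section bern

variable {ι : Type*} [Fintype ι] [DecidableEq ι] {P Q : ℝ}

theorem signBias_nonneg {N : ℝ} (hN : 0 ≤ N) (hQP : Q ≤ P) : 0 ≤ signBias N P Q :=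
  le_min zero_le_one (div_nonneg (mul_nonneg hN (by linarith)) (Real.sqrt_nonneg _))

theorem signBias_le_one {N : ℝ} : signBias N P Q ≤ 1 := min_le_left _ _

theorem bernE_le_of_le' (hP1 : P ≤ 1) (hQ0 : 0 ≤ Q) (hQP : Q < P) :
    bernE ι P Q (fun x y => ind (succs x ≤ succs y)) ≤
      Real.exp (-(Fintype.card ι * (P - Q) ^ 2 / (8 * P))) := by
  refine (bernE_le_of_le hP1 hQ0 hQP).trans (Real.exp_le_exp.2 (neg_le_neg ?_))
  refine div_le_div_of_nonneg_left (by positivity) ?_ (by nlinarith)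
  nlinarith

/-- The core pointwise inequality `d (1 - ρ ^ d) ≤ M (1 - ρ ^ d) + d ^ 4 / M ^ 2 * (1 - ρ)`. -/
theorem mul_one_sub_pow_le {ρ M : ℝ} (h0 : 0 ≤ ρ) (h1 : ρ ≤ 1) (hM : 0 < M) (d : ℕ) :
    d * (1 - ρ ^ d) ≤ M * (1 - ρ ^ d) + (d : ℝ) ^ 4 * ((1 - ρ) / M ^ 2) := by
  have hp : ρ ^ d ≤ 1 := pow_le_one₀ h0 h1
  rcases le_total (d : ℝ) M with h | h
  · have : 0 ≤ (d : ℝ) ^ 4 * ((1 - ρ) / M ^ 2) :=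
      mul_nonneg (by positivity) (div_nonneg (by linarith) (by positivity))
    nlinarith
  · have hb : 1 - ρ ^ d ≤ d * (1 - ρ) := by
      have := one_add_mul_le_pow (a := ρ - 1) (by linarith) d
      rw [show 1 + (ρ - 1) = ρ by ring] at this
      linarith
    have h2 : (d : ℝ) ^ 2 * (1 - ρ) ≤ (d : ℝ) ^ 4 * ((1 - ρ) / M ^ 2) := by
      have h3 : (1 : ℝ) ≤ d ^ 2 / M ^ 2 := by
        rw [one_le_div (by positivity)]; gcongr
      have h4 : (d : ℝ) ^ 4 * ((1 - ρ) / M ^ 2) = (d ^ 2 * (1 - ρ)) * (d ^ 2 / M ^ 2) := by ring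
      rw [h4]
      exact le_mul_of_one_le_right (mul_nonneg (by positivity) (by linarith)) h3
    have h5 : (d : ℝ) * (1 - ρ ^ d) ≤ d * (d * (1 - ρ)) := by gcongr
    nlinarith

/-- The sign is biased by `1/2` when it is positive with probability `3/4`. -/
theorem half_le_bernE_sg (hP1 : P ≤ 1) (hQ0 : 0 ≤ Q) (hQP : Q < P)
    (hw : bernE ι P Q (fun x y => ind (succs x ≤ succs y)) ≤ 1 / 4) :
    1 / 2 ≤ bernE ι P Q (fun x y => sg (succs x) (succs y)) := by
  have hP0 : 0 ≤ P := by linarith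
  have hQ1 : Q ≤ 1 := by linarith
  have hpt : ∀ x y : ι → Bool, 1 + (-2) * ind (succs x ≤ succs y) ≤ sg (succs x) (succs y) := by
    intro x y
    by_cases h : succs x ≤ succs y
    · rw [ind_true h]; linarith [neg_one_le_sg (succs x) (succs y)]
    · rw [ind_false h, sg, if_pos (not_le.1 h)]; norm_num
  have := bernE_mono hP0 hP1 hQ0 hQ1 hpt
  rw [bernE_add, bernE_const_mul, bernE_const hP0 hP1 hQ0 hQ1] at this
  linarith

/-- The bias of the sign. Up to a constant it is the drift of `X - Y` divided by the standard
deviation, as long as this is at most `1`. -/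
theorem signConst_mul_le_bernE_sg (hP1 : P ≤ 1) (hQ0 : 0 ≤ Q) (hQP : Q < P) :
    signConst * signBias (Fintype.card ι) P Q ≤ bernE ι P Q (fun x y => sg (succs x) (succs y)) :=
        by
  have hP0 : 0 < P := by linarith
  have hQ1 : Q < 1 := by linarith
  obtain ⟨N, hN⟩ : ∃ N : ℝ, N = Fintype.card ι := ⟨_, rfl⟩
  have hN0 : 0 ≤ N := by rw [hN]; positivity
  obtain ⟨a, ha⟩ : ∃ a, a = P * (1 - Q) := ⟨_, rfl⟩
  have ha0 : 0 < a := by rw [ha]; exact mul_pos hP0 (by linarith)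
  have hδ : 0 < P - Q := by linarith
  have hba : Q * (1 - P) = a - (P - Q) := by rw [ha]; ring
  have hδa : P - Q ≤ a := by nlinarith
  have hx1 : signBias N P Q ≤ 1 := min_le_left _ _
  have hx0 : 0 ≤ signBias N P Q := signBias_nonneg hN0 hQP.le
  have hxle : signBias N P Q ≤ N * (P - Q) / Real.sqrt (1 + N * Q) := min_le_right _ _
  rw [← hN]
  have hsR : 0 < Real.sqrt (1 + N * a) := Real.sqrt_pos.2 (by positivity)
  have hsq : Real.sqrt (1 + N * a) ^ 2 = 1 + N * a := Real.sq_sqrt (by positivity)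
  by_cases hD : N * (P - Q) ≤ 4 * Real.sqrt (1 + N * a)
  -- small drift: compare `E (X - Y)` with the bias through the fourth moment
  · have h4 := bernE_pow_four_le (ι := ι) hP1 hQ0 hQP (by rw [← hN, ← ha]; exact hD)
    rw [← hN, ← ha] at h4
    obtain ⟨ρ, hρ⟩ : ∃ ρ, ρ = Q * (1 - P) / (P * (1 - Q)) := ⟨_, rfl⟩
    have hρ1 : 1 - ρ = (P - Q) / a := by
      rw [hρ, hba, ← ha]; field_simp; ring
    have hρ0 : 0 ≤ ρ := by
      rw [hρ, ← ha]; exact div_nonneg (mul_nonneg hQ0 (by linarith)) ha0.le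
    have hρle : ρ ≤ 1 := by
      have : 0 ≤ (P - Q) / a := by positivity
      linarith
    have e1 := bernE_antisymm (ι := ι) hP0 hQ1 sg sg_antisymm
    have e2 := bernE_antisymm (ι := ι) hP0 hQ1 (fun m n => (m : ℝ) - n) (fun m n => by ring)
    rw [bernE_sub_succs hP0.le hP1 hQ0 hQ1.le, ← hN, ← hρ] at e2
    rw [← hρ] at e1
    obtain ⟨K, hK⟩ : ∃ K, K = 432 * Real.exp 10 := ⟨_, rfl⟩
    have hK0 : 0 < K := by rw [hK]; positivity
    -- differences above the truncation level `M` contribute at most half of the drift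
    obtain ⟨M, hM⟩ : ∃ M, M = Real.sqrt (2 * K * (1 + N * a)) := ⟨_, rfl⟩
    have hM0 : 0 < M := by rw [hM]; positivity
    have hM2 : M ^ 2 = 2 * K * (1 + N * a) := by rw [hM, Real.sq_sqrt (by positivity)]
    have hpt : ∀ x y : ι → Bool,
        ind (succs y < succs x) * ((succs x : ℝ) - succs y) * (1 - ρ ^ (succs x - succs y)) ≤
        M * (ind (succs y < succs x) * sg (succs x) (succs y) * (1 - ρ ^ (succs x - succs y))) +
          (1 - ρ) / M ^ 2 * ((succs x : ℝ) - succs y) ^ 4 := by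
      intro x y
      by_cases h : succs y < succs x
      · rw [ind_true h, sg, if_pos h]
        have := mul_one_sub_pow_le hρ0 hρle hM0 (succs x - succs y)
        rw [Nat.cast_sub h.le] at this
        linarith
      · rw [ind_false h]
        have : 0 ≤ (1 - ρ) / M ^ 2 * ((succs x : ℝ) - succs y) ^ 4 :=
          mul_nonneg (div_nonneg (by linarith) (by positivity)) (by positivity)
        linarith
    have hE := bernE_mono hP0.le hP1 hQ0 hQ1.le hpt
    rw [bernE_add, bernE_const_mul, bernE_const_mul, ← e1, ← e2, hρ1, hM2] at hE
    have h5 : (P - Q) / a / (2 * K * (1 + N * a)) *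
        bernE ι P Q (fun x y => ((succs x : ℝ) - succs y) ^ 4) ≤ N * (P - Q) / 2 := by
      calc _ ≤ (P - Q) / a / (2 * K * (1 + N * a)) *
            (432 * Real.exp 10 * (1 + N * a) * (N * a)) := by gcongr
        _ = N * (P - Q) / 2 := by
            rw [← hK]
            have : 1 + N * a ≠ 0 := by positivity
            field_simp
    have hE2 : N * (P - Q) / 2 ≤ M * bernE ι P Q (fun x y => sg (succs x) (succs y)) := by
      linarith only [hE, h5]
    -- pass from `1 + N a` to `1 + N Q`
    have hR : 1 + N * a ≤ 18 * (1 + N * Q) := by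
      have h6 : N * a ≤ N * Q + N * (P - Q) := by
        have : a ≤ P := by rw [ha]; nlinarith
        nlinarith
      have h7 : 4 * Real.sqrt (1 + N * a) ≤ (1 + N * a) / 2 + 8 := by
        nlinarith only [sq_nonneg (Real.sqrt (1 + N * a) - 4), hsq]
      have : 0 ≤ N * Q := by positivity
      linarith only [h6, h7, hD, this]
    have hMle : M ≤ 6 * (Real.sqrt K * Real.sqrt (1 + N * Q)) := by
      rw [hM, ← Real.sqrt_mul hK0.le, show (6 : ℝ) = Real.sqrt 36 by
        rw [show (36 : ℝ) = 6 ^ 2 by norm_num, Real.sqrt_sq (by norm_num)],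
        ← Real.sqrt_mul (by norm_num)]
      refine Real.sqrt_le_sqrt ?_
      nlinarith only [mul_le_mul_of_nonneg_left hR hK0.le]
    have hsQ : 0 < Real.sqrt (1 + N * Q) := Real.sqrt_pos.2 (by positivity)
    have hsK : 0 < Real.sqrt K := Real.sqrt_pos.2 hK0
    have hE3 : N * (P - Q) / 2 / M ≤ bernE ι P Q (fun x y => sg (succs x) (succs y)) := by
      rw [div_le_iff₀ hM0]; linarith only [hE2]
    refine le_trans ?_ hE3
    calc signConst * signBias N P Q ≤ signConst * (N * (P - Q) / Real.sqrt (1 + N * Q)) :=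
          mul_le_mul_of_nonneg_left hxle signConst_pos.le
      _ = N * (P - Q) / 2 / (6 * (Real.sqrt K * Real.sqrt (1 + N * Q))) := by
          rw [signConst, ← hK]; field_simp; ring
      _ ≤ _ := by gcongr
  -- large drift: the sign is positive with probability at least `3/4`
  · push Not at hD
    have hw : bernE ι P Q (fun x y => ind (succs x ≤ succs y)) ≤ 1 / 4 := by
      refine (bernE_le_of_le hP1 hQ0 hQP).trans ?_
      rw [hba, ← ha, ← hN]
      have h1 : 2 ≤ N * (P - Q) ^ 2 / (4 * (a + (a - (P - Q)))) := by
        rw [le_div_iff₀ (by linarith)]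
        have h2 : 16 * (1 + N * a) ≤ (N * (P - Q)) ^ 2 := by
          have := pow_le_pow_left₀ (by positivity) hD.le 2
          rw [mul_pow, hsq] at this
          linarith only [this]
        have hN1 : 0 < N := by
          rcases hN0.lt_or_eq with h | h
          · exact h
          · exfalso; rw [← h] at hD; simp at hD; linarith
        have h3 : N * (16 * a) ≤ N * (N * (P - Q) ^ 2) := by nlinarith only [h2]
        have h4 := le_of_mul_le_mul_left h3 hN1
        linarith only [h4, hδ]
      have h2 : Real.exp (-2 : ℝ) ≤ 1 / 4 := by
        have h3 : (2 : ℝ) ≤ Real.exp 1 := by linarith [Real.add_one_le_exp (1 : ℝ)]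
        have h4 : Real.exp 2 = Real.exp 1 * Real.exp 1 := by rw [← Real.exp_add]; norm_num
        rw [Real.exp_neg, inv_eq_one_div]
        exact div_le_div_of_nonneg_left (by norm_num) (by norm_num) (by nlinarith)
      exact (Real.exp_le_exp.2 (neg_le_neg h1)).trans h2
    have := half_le_bernE_sg hP1 hQ0 hQP hw
    nlinarith [signConst_le, signConst_pos]

/-- Sub-Gaussian bound for the sign, without any restriction on `u`. -/
theorem bernE_exp_sg_le (hP1 : P ≤ 1) (hQ0 : 0 ≤ Q) (hQP : Q < P) {u : ℝ} (hu : 0 ≤ u) :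
    bernE ι P Q (fun x y => Real.exp (-u * sg (succs x) (succs y))) ≤
      Real.exp (-(signConst * u * signBias (Fintype.card ι) P Q) + 2 * u ^ 2) := by
  have hP0 : 0 ≤ P := by linarith
  have hQ1 : Q ≤ 1 := by linarith
  have hs := signConst_mul_le_bernE_sg (ι := ι) hP1 hQ0 hQP
  have hc := signConst_le
  have hc0 := signConst_pos
  set x := signBias (Fintype.card ι) P Q with hx
  have hx1 : x ≤ 1 := signBias_le_one
  have hx0 : 0 ≤ x := signBias_nonneg (by positivity) hQP.le
  rcases le_total u 1 with h | h
  · have hpt : ∀ x y : ι → Bool, Real.exp (-u * sg (succs x) (succs y)) ≤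
        (1 + u ^ 2) + (-u) * sg (succs x) (succs y) := by
      intro x y
      have h1 := sg_le_one (succs x) (succs y)
      have h2 := neg_one_le_sg (succs x) (succs y)
      have h3 : |-u * sg (succs x) (succs y)| ≤ 1 := by rw [abs_le]; constructor <;> nlinarith
      refine (exp_le_one_add_sq h3).trans ?_
      have : sg (succs x) (succs y) ^ 2 ≤ 1 := by nlinarith
      nlinarith [sq_nonneg u]
    refine (bernE_mono hP0 hP1 hQ0 hQ1 hpt).trans ?_
    rw [bernE_add, bernE_const_mul, bernE_const hP0 hP1 hQ0 hQ1]
    refine le_trans ?_ (Real.add_one_le_exp _)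
    nlinarith [mul_le_mul_of_nonneg_left hs hu, sq_nonneg u]
  · have hpt : ∀ x y : ι → Bool, Real.exp (-u * sg (succs x) (succs y)) ≤ Real.exp u := by
      intro x y
      refine Real.exp_le_exp.2 ?_
      nlinarith [neg_one_le_sg (succs x) (succs y)]
    refine (bernE_mono hP0 hP1 hQ0 hQ1 hpt).trans ?_
    rw [bernE_const hP0 hP1 hQ0 hQ1]
    refine Real.exp_le_exp.2 ?_
    have : signConst * u * x ≤ u := by
      have : signConst * x ≤ 1 := by nlinarith
      nlinarith
    nlinarith

theorem exp_neg_two_le : Real.exp (-2 : ℝ) ≤ 1 / 4 := by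
  have h3 : (2 : ℝ) ≤ Real.exp 1 := by linarith [Real.add_one_le_exp (1 : ℝ)]
  have h4 : Real.exp 2 = Real.exp 1 * Real.exp 1 := by rw [← Real.exp_add]; norm_num
  rw [Real.exp_neg, inv_eq_one_div]
  exact div_le_div_of_nonneg_left (by norm_num) (by norm_num) (by nlinarith)

/-- When the sign is wrong with probability at most `exp (-Z)`, it behaves like a constant in
exponential moments of order up to `Z / 4`. -/
theorem bernE_exp_sg_le_of_tail (hP1 : P ≤ 1) (hQ0 : 0 ≤ Q) (hQP : Q < P) {u Z : ℝ} (hu : 0 ≤ u)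
    (hw : bernE ι P Q (fun x y => ind (succs x ≤ succs y)) ≤ Real.exp (-Z)) (hZ : 4 ≤ Z)
    (huZ : 4 * u ≤ Z) :
    bernE ι P Q (fun x y => Real.exp (-u * sg (succs x) (succs y))) ≤ Real.exp (-(u / 2)) := by
  have hP0 : 0 ≤ P := by linarith
  have hQ1 : Q ≤ 1 := by linarith
  have hpt : ∀ x y : ι → Bool, Real.exp (-u * sg (succs x) (succs y)) ≤
      Real.exp (-u) + (Real.exp u) * (1 - Real.exp (-(2 * u))) * ind (succs x ≤ succs y) := by
    intro x y
    have e : Real.exp u * (1 - Real.exp (-(2 * u))) = Real.exp u - Real.exp (-u) := by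
      rw [mul_sub, ← Real.exp_add]; ring_nf
    rw [e]
    by_cases h : succs x ≤ succs y
    · rw [ind_true h]
      have : Real.exp (-u * sg (succs x) (succs y)) ≤ Real.exp u :=
        Real.exp_le_exp.2 (by nlinarith [neg_one_le_sg (succs x) (succs y)])
      linarith
    · rw [ind_false h, sg, if_pos (not_le.1 h)]; simp
  refine (bernE_mono hP0 hP1 hQ0 hQ1 hpt).trans ?_
  rw [bernE_add, bernE_const_mul, bernE_const hP0 hP1 hQ0 hQ1]
  have h1 : 1 - Real.exp (-(2 * u)) ≤ 2 * u := by linarith [Real.add_one_le_exp (-(2 * u))]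
  have h0 : 0 ≤ 1 - Real.exp (-(2 * u)) := by
    have : Real.exp (-(2 * u)) ≤ 1 := Real.exp_le_one_iff.2 (by linarith)
    linarith
  have h2 : Real.exp u * (1 - Real.exp (-(2 * u))) *
      bernE ι P Q (fun x y => ind (succs x ≤ succs y)) ≤
      Real.exp u * (2 * u) * Real.exp (-Z) := by
    have h3 : 0 ≤ bernE ι P Q (fun x y => ind (succs x ≤ succs y)) := by
      have := bernE_mono (ι := ι) hP0 hP1 hQ0 hQ1 (fun x y => ind_nonneg (succs x ≤ succs y))
      rwa [bernE_const hP0 hP1 hQ0 hQ1] at this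
    gcongr
  have h3 : Real.exp u * (2 * u) * Real.exp (-Z) ≤ Real.exp (-u) * (u / 2) := by
    have : Real.exp u * Real.exp (-Z) ≤ Real.exp (-u) * (1 / 4) := by
      calc Real.exp u * Real.exp (-Z) = Real.exp (u - Z) := by rw [← Real.exp_add]; ring_nf
        _ ≤ Real.exp (-u + -2) := Real.exp_le_exp.2 (by linarith)
        _ = Real.exp (-u) * Real.exp (-2) := Real.exp_add _ _
        _ ≤ _ := mul_le_mul_of_nonneg_left exp_neg_two_le (Real.exp_pos _).le
    nlinarith
  calc _ ≤ Real.exp (-u) * (1 + u / 2) := by linarith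
    _ ≤ Real.exp (-u) * Real.exp (u / 2) := by
        gcongr; linarith [Real.add_one_le_exp (u / 2)]
    _ = _ := by rw [← Real.exp_add]; ring_nf

/-- Exponential moment of the sign of a symbol that is expected at most `M` times. -/
theorem bernE_exp_sg_le_of_light (hP1 : P ≤ 1) (hQ0 : 0 ≤ Q) (hQP : Q < P) {M l : ℝ} (hM : 0 ≤ M)
    (hQM : Fintype.card ι * Q ≤ M) (hl0 : 0 ≤ l)
    (hl : l ≤ signConst / (4 * (64 + M) * Real.sqrt (1 + M)) * Fintype.card ι) :
    bernE ι P Q (fun x y => Real.exp (-(l * (P - Q)) * sg (succs x) (succs y))) ≤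
      Real.exp (-(signConst / 2 * (l * (P - Q)) * signBias (Fintype.card ι) P Q)) := by
  obtain ⟨N, hN⟩ : ∃ N : ℝ, N = Fintype.card ι := ⟨_, rfl⟩
  have hN0 : 0 ≤ N := by rw [hN]; positivity
  have hδ : 0 < P - Q := by linarith
  have hu : 0 ≤ l * (P - Q) := mul_nonneg hl0 hδ.le
  have hc := signConst_le
  have hc0 := signConst_pos
  have hx0 : 0 ≤ signBias N P Q := signBias_nonneg hN0 hQP.le
  have hx1 : signBias N P Q ≤ 1 := signBias_le_one
  rw [← hN] at hQM hl ⊢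
  have hs1 : 1 ≤ Real.sqrt (1 + M) := Real.one_le_sqrt.2 (by linarith)
  rcases le_total (N * (P - Q)) (64 + M) with h | h
  -- small drift: the quadratic loss `u ^ 2` is absorbed by the bias, which is of the order of `u`
  · refine (bernE_exp_sg_le hP1 hQ0 hQP hu).trans (Real.exp_le_exp.2 ?_)
    rw [← hN]
    have hx : N * (P - Q) / ((64 + M) * Real.sqrt (1 + M)) ≤ signBias N P Q := by
      refine le_min ?_ ?_
      · rw [div_le_one (by positivity)]
        nlinarith
      · refine div_le_div_of_nonneg_left (by positivity)
          (Real.sqrt_pos.2 (by positivity)) ?_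
        have : Real.sqrt (1 + N * Q) ≤ Real.sqrt (1 + M) := Real.sqrt_le_sqrt (by linarith)
        nlinarith
    have h1 : l * (P - Q) ≤ signConst / 4 * (N * (P - Q) / ((64 + M) * Real.sqrt (1 + M))) := by
      calc l * (P - Q) ≤ signConst / (4 * (64 + M) * Real.sqrt (1 + M)) * N * (P - Q) := by gcongr
        _ = _ := by field_simp
    have h2 : l * (P - Q) ≤ signConst / 4 * signBias N P Q :=
      h1.trans (mul_le_mul_of_nonneg_left hx (by linarith))
    nlinarith [mul_le_mul_of_nonneg_left h2 hu]
  -- large drift: a wrong sign is exponentially unlikely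
  · have hND : N * Q ≤ N * (P - Q) := by linarith
    have hNpos : 0 < N := by
      rcases hN0.lt_or_eq with h' | h'
      · exact h'
      · exfalso; rw [← h'] at h; linarith
    have hZ : N * (P - Q) / 16 ≤ N * (P - Q) ^ 2 / (8 * P) := by
      rw [div_le_div_iff₀ (by norm_num) (by linarith)]
      have : Q ≤ P - Q := le_of_mul_le_mul_left hND hNpos
      have h3 : 0 ≤ N * (P - Q) := by positivity
      nlinarith [mul_le_mul_of_nonneg_left this h3]
    have hlN : l ≤ N / 64 := by
      refine hl.trans ?_
      rw [div_mul_eq_mul_div, div_le_div_iff₀ (by positivity) (by norm_num)]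
      have h4 : signConst * 64 ≤ 4 * (64 + M) * Real.sqrt (1 + M) := by nlinarith
      nlinarith
    refine (bernE_exp_sg_le_of_tail (Z := N * (P - Q) / 16) hP1 hQ0 hQP hu ?_ ?_ ?_).trans ?_
    · refine (bernE_le_of_le' hP1 hQ0 hQP).trans (Real.exp_le_exp.2 (neg_le_neg ?_))
      rw [← hN]; exact hZ
    · linarith
    · nlinarith
    · refine Real.exp_le_exp.2 (neg_le_neg ?_)
      have : signConst * signBias N P Q ≤ 1 := by nlinarith
      nlinarith

/-- Exponential moment of the sign of a symbol that is expected at least `κ` times. The loss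
`l ^ 2 * Q / N` is summable over the symbols. -/
theorem bernE_exp_sg_le_of_heavy (hP1 : P ≤ 1) (hQ0 : 0 ≤ Q) (hQP : Q < P) {κ l : ℝ} (hκ : 0 < κ)
    (hQκ : κ ≤ Fintype.card ι * Q) (hl0 : 0 ≤ l) (hl : l ≤ Fintype.card ι / 64) :
    bernE ι P Q (fun x y => Real.exp (-(l * (P - Q)) * sg (succs x) (succs y))) ≤
      Real.exp (-(signConst / 2 * (l * (P - Q)) * signBias (Fintype.card ι) P Q) +
        8192 * (1 + 1 / κ) * (l ^ 2 / Fintype.card ι) * Q) := by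
  obtain ⟨N, hN⟩ : ∃ N : ℝ, N = Fintype.card ι := ⟨_, rfl⟩
  have hN0 : 0 ≤ N := by rw [hN]; positivity
  have hδ : 0 < P - Q := by linarith
  have hu : 0 ≤ l * (P - Q) := mul_nonneg hl0 hδ.le
  have hc := signConst_le
  have hc0 := signConst_pos
  have hx0 : 0 ≤ signBias N P Q := signBias_nonneg hN0 hQP.le
  have hx1 : signBias N P Q ≤ 1 := signBias_le_one
  rw [← hN] at hQκ hl ⊢
  have hNpos : 0 < N := by
    rcases hN0.lt_or_eq with h' | h'
    · exact h'
    · exfalso; rw [← h'] at hQκ; linarith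
  have hQpos : 0 < Q := by
    rcases hQ0.lt_or_eq with h' | h'
    · exact h'
    · exfalso; rw [← h'] at hQκ; linarith
  have hcx : signConst * signBias N P Q ≤ 1 := by nlinarith
  have hcx0 : 0 ≤ signConst * signBias N P Q := by positivity
  have hκ1 : 0 < 1 / κ := by positivity
  have hloss : 0 ≤ l ^ 2 / N * Q := by positivity
  have hloss' : 0 ≤ (1 / κ) * (l ^ 2 / N * Q) := by positivity
  have hsq : Real.sqrt (1 + N * Q) ^ 2 = 1 + N * Q := Real.sq_sqrt (by positivity)
  have hs1 : 1 ≤ Real.sqrt (1 + N * Q) := Real.one_le_sqrt.2 (by nlinarith)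
  have hgood : Real.exp (-(l * (P - Q) / 2)) ≤
      Real.exp (-(signConst / 2 * (l * (P - Q)) * signBias N P Q) +
        8192 * (1 + 1 / κ) * (l ^ 2 / N) * Q) := by
    refine Real.exp_le_exp.2 ?_
    nlinarith
  rcases le_total (N * (P - Q)) (64 * Real.sqrt (1 + N * Q)) with h | h
  -- drift within the standard deviation: `(l (P - Q)) ^ 2` is of the order of the loss
  · refine (bernE_exp_sg_le hP1 hQ0 hQP hu).trans (Real.exp_le_exp.2 ?_)
    rw [← hN]
    have h1 : (N * (P - Q)) ^ 2 ≤ 4096 * (1 + N * Q) := by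
      have := pow_le_pow_left₀ (by positivity) h 2
      rw [mul_pow 64, hsq] at this
      linarith
    have h2 : 1 + N * Q ≤ (1 + 1 / κ) * (N * Q) := by
      have : 1 ≤ 1 / κ * (N * Q) := by rw [one_div, inv_mul_eq_div, one_le_div hκ]; exact hQκ
      linarith
    have h3 : (l * (P - Q)) ^ 2 ≤ 4096 * ((1 + 1 / κ) * (l ^ 2 / N * Q)) := by
      have : (l * (P - Q)) ^ 2 = l ^ 2 / N ^ 2 * (N * (P - Q)) ^ 2 := by field_simp
      rw [this]
      calc l ^ 2 / N ^ 2 * (N * (P - Q)) ^ 2 ≤ l ^ 2 / N ^ 2 * (4096 * ((1 + 1 / κ) * (N * Q))) :=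
          by
            gcongr; linarith
        _ = _ := by field_simp
    have h4 : 0 ≤ l * (P - Q) * (signConst * signBias N P Q) := by positivity
    nlinarith
  -- larger drift: a wrong sign is exponentially unlikely
  · have hNδ : 64 ≤ N * (P - Q) := by nlinarith
    by_cases hδQ : Q ≤ P - Q
    · refine (bernE_exp_sg_le_of_tail (Z := N * (P - Q) / 16) hP1 hQ0 hQP hu ?_ ?_ ?_).trans hgood
      · refine (bernE_le_of_le' hP1 hQ0 hQP).trans (Real.exp_le_exp.2 (neg_le_neg ?_))
        rw [← hN, div_le_div_iff₀ (by norm_num) (by linarith)]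
        have h3 : 0 ≤ N * (P - Q) := by positivity
        nlinarith [mul_le_mul_of_nonneg_left hδQ h3]
      · linarith
      · nlinarith
    · push Not at hδQ
      have hw : bernE ι P Q (fun x y => ind (succs x ≤ succs y)) ≤
          Real.exp (-(N * (P - Q) ^ 2 / (16 * Q))) := by
        refine (bernE_le_of_le' hP1 hQ0 hQP).trans (Real.exp_le_exp.2 (neg_le_neg ?_))
        rw [← hN]
        exact div_le_div_of_nonneg_left (by positivity) (by linarith) (by linarith)
      have hZ4 : 4 ≤ N * (P - Q) ^ 2 / (16 * Q) := by
        rw [le_div_iff₀ (by positivity)]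
        have h1 : 4096 * (1 + N * Q) ≤ (N * (P - Q)) ^ 2 := by
          have := pow_le_pow_left₀ (by positivity) h 2
          rw [mul_pow 64, hsq] at this
          linarith
        have h2 : N * (4 * (16 * Q)) ≤ N * (N * (P - Q) ^ 2) := by nlinarith
        exact le_of_mul_le_mul_left h2 hNpos
      -- if `l` is too large for the tail bound, the loss exceeds the trivial bound `l (P - Q)`
      by_cases hcase : 4 * (l * (P - Q)) ≤ N * (P - Q) ^ 2 / (16 * Q)
      · exact (bernE_exp_sg_le_of_tail hP1 hQ0 hQP hu hw hZ4 hcase).trans hgood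
      · push Not at hcase
        have h1 : P - Q ≤ 64 * l * Q / N := by
          rw [div_lt_iff₀ (by positivity)] at hcase
          rw [le_div_iff₀ hNpos]
          have : (P - Q) * ((P - Q) * N) ≤ (P - Q) * (64 * l * Q) := by nlinarith
          exact le_of_mul_le_mul_left this hδ
        have h2 : l * (P - Q) ≤ 64 * (l ^ 2 / N * Q) := by
          calc l * (P - Q) ≤ l * (64 * l * Q / N) := by gcongr
            _ = _ := by ring
        have hpt : ∀ x y : ι → Bool, Real.exp (-(l * (P - Q)) * sg (succs x) (succs y)) ≤
            Real.exp (l * (P - Q)) := by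
          intro x y
          refine Real.exp_le_exp.2 ?_
          have := mul_nonneg hu (by linarith [neg_one_le_sg (succs x) (succs y)] :
            0 ≤ sg (succs x) (succs y) + 1)
          linarith only [this]
        refine (bernE_mono (by linarith) hP1 hQ0 (by linarith) hpt).trans ?_
        rw [bernE_const (by linarith) hP1 hQ0 (by linarith)]
        refine Real.exp_le_exp.2 ?_
        have h5 : l * (P - Q) * (signConst * signBias N P Q) ≤ l * (P - Q) :=
          mul_le_of_le_one_right hu hcx
        have h6 : 8192 * (1 + 1 / κ) * (l ^ 2 / N) * Q =
            8192 * (l ^ 2 / N * Q) + 8192 * (1 / κ * (l ^ 2 / N * Q)) := by ring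
        rw [h6]
        linarith only [h2, h5, hloss, hloss', hu]

end bern

/-! ### Concentration of the signed differences over a set of symbols -/

theorem piE_map {ι α β : Type*} [Fintype ι] [DecidableEq ι] [Fintype α] [Fintype β] [DecidableEq β]
    {w : α → ℝ} (g : α → β) (F : (ι → β) → ℝ) :
    piE w (fun ω : ι → α => F (fun a => g (ω a))) =
      piE (fun b => ∑ i, if g i = b then w i else 0) F := by
  have h1 : ∀ η : ι → β, ∏ a, (∑ i, if g i = η a then w i else 0) =
      ∑ ω : ι → α, if (fun a => g (ω a)) = η then ∏ a, w (ω a) else 0 := by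
    intro η
    rw [Finset.prod_univ_sum, Fintype.piFinset_univ]
    refine Finset.sum_congr rfl fun ω _ => ?_
    by_cases h : (fun a => g (ω a)) = η
    · rw [if_pos h]
      exact Finset.prod_congr rfl fun a _ => if_pos (congrFun h a)
    · rw [if_neg h]
      obtain ⟨a, ha⟩ := Function.ne_iff.1 h
      exact Finset.prod_eq_zero (Finset.mem_univ a) (if_neg ha)
  simp only [piE, h1, Finset.sum_mul]
  rw [Finset.sum_comm]
  refine Finset.sum_congr rfl fun ω _ => ?_
  simp [ite_mul]

/-- The indices of the first half of the samples. -/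
abbrev FirstHalf (n : ℕ) : Type := {a : Fin n // (a : ℕ) < n / 2}

theorem card_firstHalf (n : ℕ) : Fintype.card (FirstHalf n) = n / 2 := by
  rw [Fintype.card_subtype]
  rw [Fin.card_filter_val_lt]
  omega

section halves

variable {k n : ℕ} {w v : Fin k → ℝ}

theorem firstHalfCount_eq_succs (x : Fin n → Fin k) (i : Fin k) :
    firstHalfCount x i = succs (fun a : FirstHalf n => decide (x a = i)) := by
  unfold firstHalfCount succs
  rw [← Finset.card_map (Function.Embedding.subtype _)]
  congr 1
  ext a
  simp [and_comm]

/-- The number of occurrences of a symbol in the first half is binomial. -/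
theorem piE_firstHalfCount (hw : IsProbVec w) (i : Fin k) (H : ℕ → ℝ) :
    piE w (fun x : Fin n → Fin k => H (firstHalfCount x i)) =
      piE (bern (w i)) (fun b : FirstHalf n → Bool => H (succs b)) := by
  have h1 := piE_split (w := w) (fun a : Fin n => (a : ℕ) < n / 2)
    (fun x _ => H (succs (fun a => decide (x a = i))))
  simp only [piE_const hw] at h1
  simp_rw [firstHalfCount_eq_succs]
  rw [h1, piE_map (fun j => decide (j = i)) (fun b => H (succs b))]
  congr 1
  ext b
  cases b
  · have h2 : ∀ j, (if decide (j = i) = false then w j else 0) = w j - if j = i then w j else 0 :=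
      by
      intro j; by_cases h : j = i <;> simp [h]
    simp_rw [h2, Finset.sum_sub_distrib, hw.sum_eq_one]
    simp [bern]
  · simp [bern]

theorem piE_piE_firstHalfCount (hw : IsProbVec w) (hv : IsProbVec v) (i : Fin k) (H : ℕ → ℕ → ℝ) :
    piE w (fun x : Fin n → Fin k => piE v (fun y : Fin n → Fin k =>
      H (firstHalfCount x i) (firstHalfCount y i))) =
      bernE (FirstHalf n) (w i) (v i) (fun x y => H (succs x) (succs y)) := by
  have h1 : ∀ m, piE v (fun y : Fin n → Fin k => H m (firstHalfCount y i)) =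
      piE (bern (v i)) (fun b : FirstHalf n → Bool => H m (succs b)) :=
    fun m => piE_firstHalfCount hv i (H m)
  simp_rw [h1]
  exact piE_firstHalfCount hw i
    (fun m => piE (bern (v i)) (fun b : FirstHalf n → Bool => H m (succs b)))

theorem firstHalfCount_update_le (x : Fin n → Fin k) (a : Fin n) {i j : Fin k} (l : Fin k)
    (hj : j ≠ i) :
    firstHalfCount (Function.update x a j) i ≤ firstHalfCount (Function.update x a l) i := by
  refine Finset.card_le_card fun b hb => ?_
  simp only [Finset.mem_filter, Finset.mem_univ, true_and] at hb ⊢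
  refine ⟨hb.1, ?_⟩
  by_cases h : b = a
  · subst h
    simp only [Function.update_self] at hb
    exact absurd hb.2 hj
  · simpa [h] using hb.2

theorem sg_mono_left {m m' : ℕ} (n : ℕ) (h : m ≤ m') : sg m n ≤ sg m' n := by
  unfold sg; split_ifs <;> first | omega | norm_num

theorem sg_anti_right (m : ℕ) {n n' : ℕ} (h : n ≤ n') : sg m n' ≤ sg m n := by
  unfold sg; split_ifs <;> first | omega | norm_num

/-- Chernoff's method for symbols more likely under `w` than under `v`: by negative association,
exponential moments multiply. -/
theorem piE_piE_tail_le (hw : IsProbVec w) (hv : IsProbVec v) (D : Finset (Fin k))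
    (hD : ∀ i ∈ D, v i < w i) {l : ℝ} (hl : 0 ≤ l) (g : Fin k → ℝ)
    (hg : ∀ i ∈ D, bernE (FirstHalf n) (w i) (v i)
      (fun x y => Real.exp (-(l * (w i - v i)) * sg (succs x) (succs y))) ≤ Real.exp (g i))
          (b : ℝ) :
    piE w (fun x : Fin n → Fin k => piE v (fun y : Fin n → Fin k =>
      ind (∑ i ∈ D, (w i - v i) * sg (firstHalfCount x i) (firstHalfCount y i) ≤ b))) ≤
      Real.exp (l * b + ∑ i ∈ D, g i) := by
  set h : Fin k → (Fin n → Fin k) → (Fin n → Fin k) → ℝ := fun i x y =>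
    if i ∈ D then Real.exp (-(l * (w i - v i)) * sg (firstHalfCount x i)
        (firstHalfCount y i)) else 1
    with hh
  have hpt : ∀ x y : Fin n → Fin k,
      ind (∑ i ∈ D, (w i - v i) * sg (firstHalfCount x i) (firstHalfCount y i) ≤ b) ≤
        Real.exp (l * b) * ∏ i ∈ D, h i x y := by
    intro x y
    have e : ∏ i ∈ D, h i x y =
        Real.exp (-(l * ∑ i ∈ D, (w i - v i) * sg (firstHalfCount x i) (firstHalfCount y i))) := by
      rw [Finset.mul_sum, ← Finset.sum_neg_distrib, Real.exp_sum]
      refine Finset.prod_congr rfl fun i hi => ?_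
      simp only [hh, if_pos hi]
      congr 1; ring
    rw [e, ← Real.exp_add]
    by_cases hle : ∑ i ∈ D, (w i - v i) * sg (firstHalfCount x i) (firstHalfCount y i) ≤ b
    · rw [ind_true hle]
      exact Real.one_le_exp (by nlinarith)
    · rw [ind_false hle]; positivity
  refine (piE_mono hw fun x => piE_mono hv fun y => hpt x y).trans ?_
  simp only [piE_const_mul]
  rw [piE_comm, Real.exp_add, Real.exp_sum]
  refine mul_le_mul_of_nonneg_left ?_ (Real.exp_pos _).le
  refine (piE_piE_prod_le hv hw (fun i y x => h i x y) D ?_ ?_ ?_).trans ?_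
  · intro i y x
    simp only [hh]; split_ifs <;> positivity
  · intro i x y a j m hj
    simp only [hh]
    split_ifs with hi
    · refine Real.exp_le_exp.2 ?_
      have h1 := firstHalfCount_update_le y a m (i := i) (j := j) (by simpa using hj)
      have h2 := sg_anti_right (firstHalfCount x i) h1
      have h3 : 0 ≤ l * (w i - v i) := mul_nonneg hl (by linarith [hD i hi])
      nlinarith
    · exact le_rfl
  · intro i y x a j m hj
    simp only [hh]
    split_ifs with hi
    · refine neg_le_neg (Real.exp_le_exp.2 ?_)
      have h1 := firstHalfCount_update_le x a m (i := i) (j := j) (by simpa using hj)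
      have h2 := sg_mono_left (firstHalfCount y i) h1
      have h3 : 0 ≤ l * (w i - v i) := mul_nonneg hl (by linarith [hD i hi])
      nlinarith
    · exact le_rfl
  · refine Finset.prod_le_prod (fun i _ => ?_) fun i hi => ?_
    · refine piE_nonneg hv fun y => piE_nonneg hw fun x => ?_
      simp only [hh]
      split_ifs
      positivity
    · refine le_trans (le_of_eq ?_) (hg i hi)
      simp only [hh, if_pos hi]
      rw [piE_comm]
      exact piE_piE_firstHalfCount hw hv i (fun m m' => Real.exp (-(l * (w i - v i)) * sg m m'))

/-- The order of the expected contribution of symbol `i` to the separation. -/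
noncomputable def gain (N : ℝ) (w v : Fin k → ℝ) (i : Fin k) : ℝ :=
  |w i - v i| * min 1 (N * |w i - v i| / Real.sqrt (1 + N * v i))

theorem gain_nonneg {N : ℝ} (hN : 0 ≤ N) (w v : Fin k → ℝ) (i : Fin k) : 0 ≤ gain N w v i :=
  mul_nonneg (abs_nonneg _) (le_min zero_le_one (by positivity))

theorem gain_le {N : ℝ} (w v : Fin k → ℝ) (i : Fin k) : gain N w v i ≤ |w i - v i| :=
  mul_le_of_le_one_right (abs_nonneg _) (min_le_left _ _)

theorem gain_eq_of_lt {N : ℝ} {i : Fin k} (h : v i < w i) :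
    gain N w v i = (w i - v i) * signBias N (w i) (v i) := by
  rw [gain, signBias, abs_of_pos (by linarith)]

theorem gain_le_of_gt {N : ℝ} (hN : 0 ≤ N) (hw : IsProbVec w) {i : Fin k}
    (h : w i < v i) : gain N w v i ≤ (v i - w i) * signBias N (v i) (w i) := by
  rw [gain, signBias, abs_of_neg (by linarith), neg_sub]
  have hw0 := hw.nonneg i
  have h1 : 0 < Real.sqrt (1 + N * w i) := Real.sqrt_pos.2 (by positivity)
  have h2 : Real.sqrt (1 + N * w i) ≤ Real.sqrt (1 + N * v i) :=
    Real.sqrt_le_sqrt (by nlinarith)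
  have h3 : 0 ≤ v i - w i := by linarith
  gcongr

theorem sum_signed_eq (D : Finset (Fin k)) (x y : Fin n → Fin k) :
    ∑ i ∈ D, (w i - v i) * sg (firstHalfCount x i) (firstHalfCount y i) =
      ∑ i ∈ D.filter (fun i => v i < w i),
        (w i - v i) * sg (firstHalfCount x i) (firstHalfCount y i) +
      ∑ i ∈ D.filter (fun i => w i < v i),
        (v i - w i) * sg (firstHalfCount y i) (firstHalfCount x i) := by
  rw [Finset.sum_filter, Finset.sum_filter, ← Finset.sum_add_distrib]
  refine Finset.sum_congr rfl fun i _ => ?_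
  rw [sg_antisymm (firstHalfCount y i)]
  rcases lt_trichotomy (v i) (w i) with h | h | h
  · simp [h, not_lt.2 h.le]
  · simp [h]
  · simp [h, not_lt.2 h.le]; ring

theorem sum_gain_eq {N : ℝ} (D : Finset (Fin k)) :
    ∑ i ∈ D, gain N w v i = ∑ i ∈ D.filter (fun i => v i < w i), gain N w v i +
      ∑ i ∈ D.filter (fun i => w i < v i), gain N w v i := by
  rw [Finset.sum_filter, Finset.sum_filter, ← Finset.sum_add_distrib]
  refine Finset.sum_congr rfl fun i _ => ?_
  rcases lt_trichotomy (v i) (w i) with h | h | h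
  · simp [h, not_lt.2 h.le]
  · simp [h, gain]
  · simp [h, not_lt.2 h.le]

/-- The signed sum is of the order of the total gain, given a per-symbol exponential moment bound
with summable losses `e`. -/
theorem piE_piE_signed_le (hw : IsProbVec w) (hv : IsProbVec v) (D : Finset (Fin k)) {l E : ℝ}
    (hl : 0 ≤ l) (e : Fin k → ℝ) (he0 : ∀ i, 0 ≤ e i) (he : ∑ i, e i ≤ E)
    (h1 : ∀ i ∈ D, v i < w i → bernE (FirstHalf n) (w i) (v i)
      (fun x y => Real.exp (-(l * (w i - v i)) * sg (succs x) (succs y))) ≤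
      Real.exp (-(signConst / 2 * (l * (w i - v i)) * signBias (n / 2 : ℕ) (w i) (v i)) + e i))
    (h2 : ∀ i ∈ D, w i < v i → bernE (FirstHalf n) (v i) (w i)
      (fun x y => Real.exp (-(l * (v i - w i)) * sg (succs x) (succs y))) ≤
      Real.exp (-(signConst / 2 * (l * (v i - w i)) * signBias (n / 2 : ℕ) (v i) (w i)) + e i)) :
    piE w (fun x : Fin n → Fin k => piE v (fun y : Fin n → Fin k =>
      ind (∑ i ∈ D, (w i - v i) * sg (firstHalfCount x i) (firstHalfCount y i) <
        signConst / 4 * ∑ i ∈ D, gain (n / 2 : ℕ) w v i))) ≤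
      2 * Real.exp (-(l * (signConst / 8 * ∑ i ∈ D, gain (n / 2 : ℕ) w v i)) + E) := by
  have hN0 : (0 : ℝ) ≤ (n / 2 : ℕ) := by positivity
  set N : ℝ := ((n / 2 : ℕ) : ℝ) with hN
  set D₁ := D.filter (fun i => v i < w i) with hD₁
  set D₂ := D.filter (fun i => w i < v i) with hD₂
  set G := ∑ i ∈ D, gain N w v i with hG
  have hsum : ∀ s : Finset (Fin k), ∑ i ∈ s, e i ≤ E := fun s =>
    (Finset.sum_le_sum_of_subset_of_nonneg (Finset.subset_univ s) fun i _ _ => he0 i).trans he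
  have t1 := piE_piE_tail_le (n := n) hw hv D₁ (fun i hi => (Finset.mem_filter.1 hi).2) hl
    (fun i => -(signConst / 2 * (l * (w i - v i)) * signBias N (w i) (v i)) + e i)
    (fun i hi => h1 i (Finset.mem_filter.1 hi).1 (Finset.mem_filter.1 hi).2)
    (signConst / 2 * ∑ i ∈ D₁, gain N w v i - signConst / 8 * G)
  have t2 := piE_piE_tail_le (n := n) hv hw D₂ (fun i hi => (Finset.mem_filter.1 hi).2) hl
    (fun i => -(signConst / 2 * (l * (v i - w i)) * signBias N (v i) (w i)) + e i)
    (fun i hi => h2 i (Finset.mem_filter.1 hi).1 (Finset.mem_filter.1 hi).2)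
    (signConst / 2 * ∑ i ∈ D₂, gain N w v i - signConst / 8 * G)
  rw [piE_comm] at t2
  have hpt : ∀ x y : Fin n → Fin k,
      ind (∑ i ∈ D, (w i - v i) * sg (firstHalfCount x i) (firstHalfCount y i) <
        signConst / 4 * G) ≤
      ind (∑ i ∈ D₁, (w i - v i) * sg (firstHalfCount x i) (firstHalfCount y i) ≤
        signConst / 2 * ∑ i ∈ D₁, gain N w v i - signConst / 8 * G) +
      ind (∑ i ∈ D₂, (v i - w i) * sg (firstHalfCount y i) (firstHalfCount x i) ≤
        signConst / 2 * ∑ i ∈ D₂, gain N w v i - signConst / 8 * G) := by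
    intro x y
    refine le_trans (ind_mono fun h => ?_) (ind_or_le _ _)
    rw [sum_signed_eq, ← hD₁, ← hD₂] at h
    have hs : G = ∑ i ∈ D₁, gain N w v i + ∑ i ∈ D₂, gain N w v i := sum_gain_eq D
    by_contra hcon
    push Not at hcon
    have : signConst / 2 * G = signConst / 2 * ∑ i ∈ D₁, gain N w v i +
      signConst / 2 * ∑ i ∈ D₂, gain N w v i := by rw [hs]; ring
    linarith [hcon.1, hcon.2]
  refine (piE_mono hw fun x => piE_mono hv fun y => hpt x y).trans ?_
  simp only [piE_add]
  have b1 : l * (signConst / 2 * ∑ i ∈ D₁, gain N w v i - signConst / 8 * G) +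
      ∑ i ∈ D₁, (-(signConst / 2 * (l * (w i - v i)) * signBias N (w i) (v i)) + e i) ≤
      -(l * (signConst / 8 * G)) + E := by
    rw [Finset.sum_add_distrib]
    have : ∑ i ∈ D₁, -(signConst / 2 * (l * (w i - v i)) * signBias N (w i) (v i)) =
        -(l * (signConst / 2 * ∑ i ∈ D₁, gain N w v i)) := by
      rw [Finset.mul_sum, Finset.mul_sum, Finset.sum_neg_distrib]
      congr 1
      refine Finset.sum_congr rfl fun i hi => ?_
      rw [gain_eq_of_lt (Finset.mem_filter.1 hi).2]; ring
    rw [this]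
    linarith [hsum D₁]
  have b2 : l * (signConst / 2 * ∑ i ∈ D₂, gain N w v i - signConst / 8 * G) +
      ∑ i ∈ D₂, (-(signConst / 2 * (l * (v i - w i)) * signBias N (v i) (w i)) + e i) ≤
      -(l * (signConst / 8 * G)) + E := by
    rw [Finset.sum_add_distrib]
    have : ∑ i ∈ D₂, -(signConst / 2 * (l * (v i - w i)) * signBias N (v i) (w i)) ≤
        -(l * (signConst / 2 * ∑ i ∈ D₂, gain N w v i)) := by
      rw [Finset.mul_sum, Finset.mul_sum, Finset.sum_neg_distrib]
      refine neg_le_neg (Finset.sum_le_sum fun i hi => ?_)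
      have h3 := gain_le_of_gt hN0 hw (Finset.mem_filter.1 hi).2
      have h4 : 0 ≤ l * (signConst / 2) := mul_nonneg hl (by linarith [signConst_pos])
      nlinarith [mul_le_mul_of_nonneg_left h3 h4]
    linarith [hsum D₂]
  have := Real.exp_le_exp.2 b1
  have := Real.exp_le_exp.2 b2
  linarith

/-- Sets of symbols each expected at most `M` times. Without quadratic losses, the rate `l` may be
of the order `n`. -/
theorem piE_piE_signed_le_of_light (hw : IsProbVec w) (hv : IsProbVec v) (D : Finset (Fin k))
    {M : ℝ} (hM : 0 ≤ M) (hD : ∀ i ∈ D, (n / 2 : ℕ) * v i ≤ M) :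
    piE w (fun x : Fin n → Fin k => piE v (fun y : Fin n → Fin k =>
      ind (∑ i ∈ D, (w i - v i) * sg (firstHalfCount x i) (firstHalfCount y i) <
        signConst / 4 * ∑ i ∈ D, gain (n / 2 : ℕ) w v i))) ≤
      2 * Real.exp (-(signConst / (4 * (64 + M) * Real.sqrt (1 + M)) * (signConst / 8) *
        ((n / 2 : ℕ) * ∑ i ∈ D, gain (n / 2 : ℕ) w v i))) := by
  have hl0 : 0 ≤ signConst / (4 * (64 + M) * Real.sqrt (1 + M)) * (n / 2 : ℕ) :=
    mul_nonneg (div_nonneg signConst_pos.le (by positivity)) (by positivity)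
  refine (piE_piE_signed_le (n := n) hw hv D hl0 (fun _ => 0) (fun _ => le_rfl) (E := 0)
    (by simp) ?_ ?_).trans (le_of_eq ?_)
  · intro i hi h
    have := bernE_exp_sg_le_of_light (ι := FirstHalf n) (hw.le_one i) (hv.nonneg i) h hM
      (by rw [card_firstHalf]; exact hD i hi) hl0 (by rw [card_firstHalf])
    rw [card_firstHalf] at this
    rwa [add_zero]
  · intro i hi h
    have h3 : (n / 2 : ℕ) * w i ≤ M :=
      (mul_le_mul_of_nonneg_left h.le (by positivity)).trans (hD i hi)
    have := bernE_exp_sg_le_of_light (ι := FirstHalf n) (hv.le_one i) (hw.nonneg i) h hM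
      (by rw [card_firstHalf]; exact h3) hl0 (by rw [card_firstHalf])
    rw [card_firstHalf] at this
    rwa [add_zero]
  · ring_nf

/-- Arbitrary sets of symbols. The rate `l` is proportional to the total gain `G`, which balances
the linear gain `l G` against the quadratic loss `l ^ 2 / N`. -/
theorem exists_piE_piE_signed_le : ∃ c : ℝ, 0 < c ∧ ∀ {k n : ℕ} {w v : Fin k → ℝ},
    IsProbVec w → IsProbVec v → ∀ D : Finset (Fin k),
    piE w (fun x : Fin n → Fin k => piE v (fun y : Fin n → Fin k =>
      ind (∑ i ∈ D, (w i - v i) * sg (firstHalfCount x i) (firstHalfCount y i) <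
        signConst / 4 * ∑ i ∈ D, gain (n / 2 : ℕ) w v i))) ≤
      2 * Real.exp (-(c * ((n / 2 : ℕ) * (∑ i ∈ D, gain (n / 2 : ℕ) w v i) ^ 2))) := by
  have hc0 := signConst_pos
  have hc1 := signConst_le
  obtain ⟨c₃, hc₃⟩ : ∃ c₃, c₃ = signConst / (4 * (64 + 1) * Real.sqrt (1 + 1)) := ⟨_, rfl⟩
  have hc₃0 : 0 < c₃ := by rw [hc₃]; positivity
  have hc₃64 : c₃ ≤ 1 / 64 := by
    rw [hc₃, div_le_div_iff₀ (by positivity) (by norm_num)]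
    have : 1 ≤ Real.sqrt (1 + 1) := Real.one_le_sqrt.2 (by norm_num)
    nlinarith
  obtain ⟨c', hc'⟩ : ∃ c', c' = min (c₃ / 2) (signConst / 2 ^ 19) := ⟨_, rfl⟩
  have hc'0 : 0 < c' := by rw [hc']; positivity
  have hc'1 : c' ≤ c₃ / 2 := hc' ▸ min_le_left _ _
  have hc'2 : c' ≤ signConst / 2 ^ 19 := hc' ▸ min_le_right _ _
  refine ⟨c' * signConst / 16, by positivity, ?_⟩
  intro k n w v hw hv D
  obtain ⟨N, hN⟩ : ∃ N : ℝ, N = ((n / 2 : ℕ) : ℝ) := ⟨_, rfl⟩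
  have hN0 : 0 ≤ N := by rw [hN]; positivity
  obtain ⟨G, hG⟩ : ∃ G, G = ∑ i ∈ D, gain N w v i := ⟨_, rfl⟩
  have hG0 : 0 ≤ G := by rw [hG]; exact Finset.sum_nonneg fun i _ => gain_nonneg hN0 w v i
  have hG2 : G ≤ 2 := by
    rw [hG]
    calc ∑ i ∈ D, gain N w v i ≤ ∑ i ∈ D, (w i + v i) := Finset.sum_le_sum fun i _ =>
          (gain_le w v i).trans (abs_sub_le_iff.2
            ⟨by linarith [hv.nonneg i], by linarith [hw.nonneg i]⟩)
      _ ≤ 2 := by rw [Finset.sum_add_distrib]; linarith [hw.sum_le_one D, hv.sum_le_one D]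
  have hl0 : 0 ≤ c' * N * G := by positivity
  have hl3 : c' * N * G ≤ c₃ * N := by
    calc c' * N * G ≤ c₃ / 2 * N * 2 := by gcongr
      _ = c₃ * N := by ring
  have key : ∀ {w v : Fin k → ℝ}, IsProbVec w → IsProbVec v → ∀ i, v i < w i →
      bernE (FirstHalf n) (w i) (v i)
      (fun x y => Real.exp (-(c' * N * G * (w i - v i)) * sg (succs x) (succs y))) ≤
      Real.exp (-(signConst / 2 * (c' * N * G * (w i - v i)) * signBias N (w i) (v i)) +
        16384 * ((c' * N * G) ^ 2 / N) * v i) := by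
    intro w v hw hv i h
    rcases le_total (N * v i) 1 with h1 | h1
    · have := bernE_exp_sg_le_of_light (ι := FirstHalf n) (hw.le_one i) (hv.nonneg i) h zero_le_one
        (by rw [card_firstHalf, ← hN]; exact h1) hl0
            (by rw [card_firstHalf, ← hN, ← hc₃]; exact hl3)
      rw [card_firstHalf, ← hN] at this
      refine this.trans (Real.exp_le_exp.2 ?_)
      have : 0 ≤ 16384 * ((c' * N * G) ^ 2 / N) * v i := mul_nonneg (by positivity) (hv.nonneg i)
      linarith
    · have := bernE_exp_sg_le_of_heavy (ι := FirstHalf n) (hw.le_one i) (hv.nonneg i) h zero_lt_one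
        (by rw [card_firstHalf, ← hN]; exact h1) hl0
        (by rw [card_firstHalf, ← hN]; exact hl3.trans (by nlinarith))
      rw [card_firstHalf, ← hN] at this
      refine this.trans (le_of_eq ?_)
      norm_num
  have main := piE_piE_signed_le (n := n) hw hv D hl0
    (fun i => 16384 * ((c' * N * G) ^ 2 / N) * (w i + v i)) (E := 32768 * ((c' * N * G) ^ 2 / N))
    (fun i => mul_nonneg (by positivity) (add_nonneg (hw.nonneg i) (hv.nonneg i)))
    (by rw [← Finset.mul_sum, Finset.sum_add_distrib, hw.sum_eq_one, hv.sum_eq_one]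
        exact le_of_eq (by ring))
    (fun i _ h => by
      rw [← hN]
      refine (key hw hv i h).trans (Real.exp_le_exp.2 ?_)
      have : 0 ≤ 16384 * ((c' * N * G) ^ 2 / N) * w i := mul_nonneg (by positivity) (hw.nonneg i)
      linarith)
    (fun i _ h => by
      rw [← hN]
      refine (key hv hw i h).trans (Real.exp_le_exp.2 ?_)
      have : 0 ≤ 16384 * ((c' * N * G) ^ 2 / N) * v i := mul_nonneg (by positivity) (hv.nonneg i)
      linarith)
  rw [← hN, ← hG] at main ⊢
  refine main.trans ?_
  gcongr
  have e : (c' * N * G) ^ 2 / N = c' * (c' * (N * G ^ 2)) := by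
    rcases hN0.eq_or_lt with h | h
    · rw [← h]; simp
    · field_simp
  rw [e]
  have h5 : 0 ≤ c' * (N * G ^ 2) := by positivity
  nlinarith [mul_le_mul_of_nonneg_right hc'2 h5]

end halves

/-! ### Level sets -/

/-- `r` determines `q` up to the factor `A` wherever one of them exceeds the resolution `1 / t`. -/
def Approximates {k : ℕ} (A t : ℝ) (r q : Fin k → ℝ) : Prop :=
  ∀ i, q i ≤ A * max (r i) (1 / t) ∧ (1 / t < r i → r i ≤ A * q i)

/-- The rate of separation at level `j`, without the factor depending on `ε`. -/
noncomputable def levelRate (k n : ℕ) (t : ℝ) (j : ℕ) : ℝ :=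
  if j = 0 then (n : ℝ) / k else (n : ℝ) / Real.sqrt (k * t / 2 ^ j)

section levels

variable {k n : ℕ} {t : ℝ}

theorem approximates_self {t : ℝ} (q : Fin k → ℝ) (hq : ∀ i, 0 ≤ q i) {A : ℝ} (hA : 1 ≤ A) :
    Approximates A t q q := by
  intro i
  have h1 := le_max_left (q i) (1 / t)
  have h2 := hq i
  exact ⟨by nlinarith, fun _ => by nlinarith⟩

theorem le_two_pow_numLevels (hn : 1 ≤ n) (ht : (n : ℝ) < t) : t / n ≤ 2 ^ numLevels t n := by
  have hn0 : (0 : ℝ) < n := by exact_mod_cast hn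
  have h := Nat.le_ceil (Real.logb 2 (t / n))
  rw [Real.logb_le_iff_le_rpow (by norm_num) (div_pos (hn0.trans ht) hn0),
    Real.rpow_natCast] at h
  exact h

theorem two_pow_numLevels_le (hn : 1 ≤ n) (ht : (n : ℝ) < t) :
    (2 : ℝ) ^ numLevels t n ≤ 2 * (t / n) := by
  have hn0 : (0 : ℝ) < n := by exact_mod_cast hn
  have h1 : 1 < t / n := by rw [one_lt_div hn0]; exact ht
  have h := Nat.ceil_lt_add_one (Real.logb_nonneg (b := 2) (by norm_num) h1.le)
  have h2 : (2 : ℝ) ^ ((numLevels t n : ℕ) : ℝ) ≤ 2 ^ (Real.logb 2 (t / n) + 1) :=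
    Real.rpow_le_rpow_of_exponent_le (by norm_num) h.le
  rw [Real.rpow_natCast, Real.rpow_add (by norm_num), Real.rpow_one,
    Real.rpow_logb (by norm_num) (by norm_num) (by positivity)] at h2
  linarith

theorem one_le_numLevels (hn : 1 ≤ n) (ht : (n : ℝ) < t) : 1 ≤ numLevels t n := by
  have hn0 : (0 : ℝ) < n := by exact_mod_cast hn
  have h1 : 1 < t / n := by rw [one_lt_div hn0]; exact ht
  exact Nat.one_le_ceil_iff.2 (Real.logb_pos (by norm_num) h1)

theorem mem_levelSet {ℓ j : ℕ} {r : Fin k → ℝ} {i : Fin k} :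
    i ∈ levelSet t ℓ r j ↔ (if j = 0 then r i ≤ 1 / t
    else if j ≤ ℓ then 2 ^ (j - 1) / t < r i ∧ r i ≤ 2 ^ j / t
    else 2 ^ ℓ / t < r i) := by
  simp [levelSet]

theorem exists_mem_levelSet (ℓ : ℕ) (r : Fin k → ℝ) (i : Fin k) :
    ∃ j : Fin (ℓ + 2), i ∈ levelSet t ℓ r j := by
  by_cases h0 : r i ≤ 1 / t
  · exact ⟨0, mem_levelSet.2 (by simpa using h0)⟩
  by_cases h1 : r i ≤ 2 ^ ℓ / t
  · classical
    have hex : ∃ j, r i ≤ 2 ^ j / t := ⟨ℓ, h1⟩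
    have hle : Nat.find hex ≤ ℓ := Nat.find_min' hex h1
    have hne : Nat.find hex ≠ 0 := by
      intro h
      have := Nat.find_spec hex
      rw [h] at this
      exact h0 (by simpa using this)
    refine ⟨⟨Nat.find hex, by omega⟩, mem_levelSet.2 ?_⟩
    simp only [hne, if_false, hle, if_true]
    exact ⟨not_le.1 (Nat.find_min hex (by omega)), Nat.find_spec hex⟩
  · refine ⟨⟨ℓ + 1, by omega⟩, mem_levelSet.2 ?_⟩
    simpa using h1

theorem le_of_mem_levelSet {A : ℝ} {r q : Fin k → ℝ} (hA : 0 ≤ A)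
    (h : Approximates A t r q) (ht : 0 < t) {ℓ j : ℕ} (hj : j ≤ ℓ) {i : Fin k}
    (hi : i ∈ levelSet t ℓ r j) : q i ≤ A * (2 ^ j / t) := by
  rw [mem_levelSet] at hi
  refine (h i).1.trans (mul_le_mul_of_nonneg_left ?_ hA)
  by_cases h0 : j = 0
  · subst h0
    simp only [if_true] at hi
    simpa using hi
  · simp only [h0, if_false, hj, if_true] at hi
    exact max_le hi.2 (div_le_div_of_nonneg_right (one_le_pow₀ (by norm_num)) ht.le)

theorem ge_of_mem_levelSet {A : ℝ} {r q : Fin k → ℝ} (h : Approximates A t r q) (ht : 0 < t)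
    {ℓ j : ℕ} (h0 : j ≠ 0) (hj : j ≤ ℓ + 1) {i : Fin k} (hi : i ∈ levelSet t ℓ r j) :
    2 ^ (j - 1) / t ≤ A * q i := by
  rw [mem_levelSet] at hi
  have h1 : 2 ^ (j - 1) / t < r i := by
    simp only [h0, if_false] at hi
    split_ifs at hi with h2
    · exact hi.1
    · rwa [show j - 1 = ℓ by omega]
  refine h1.le.trans ((h i).2 (lt_of_le_of_lt ?_ h1))
  exact div_le_div_of_nonneg_right (one_le_pow₀ (by norm_num)) ht.le

theorem sum_firstHalfCount_le (x : Fin n → Fin k) (S : Finset (Fin k)) :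
    ∑ i ∈ S, firstHalfCount x i ≤ n / 2 := by
  calc ∑ i ∈ S, firstHalfCount x i ≤ ∑ i, firstHalfCount x i :=
        Finset.sum_le_sum_of_subset (Finset.subset_univ S)
    _ = (Finset.univ.filter fun a : Fin n => (a : ℕ) < n / 2).card := by
        rw [Finset.card_eq_sum_card_fiberwise (f := x) (t := Finset.univ) (fun _ _ => by simp)]
        refine Finset.sum_congr rfl fun i _ => ?_
        rw [firstHalfCount, Finset.filter_filter]
    _ ≤ n / 2 := by rw [Fin.card_filter_val_lt]; omega

/-- Candidate sets consist of observed symbols. -/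
theorem card_candSet_le (x y : Fin n → Fin k) (D : Finset (Fin k)) (s : Bool) :
    (candSet x y D s).card ≤ n := by
  have h : ∀ (x : Fin n → Fin k) (S : Finset (Fin k)), (∀ i ∈ S, 0 < firstHalfCount x i) →
      S.card ≤ n := by
    intro x S hS
    calc S.card = ∑ i ∈ S, 1 := by simp
      _ ≤ ∑ i ∈ S, firstHalfCount x i := Finset.sum_le_sum fun i hi => hS i hi
      _ ≤ n := (sum_firstHalfCount_le x S).trans (Nat.div_le_self n 2)
  cases s
  · refine h y _ fun i hi => ?_
    simp only [candSet, Finset.mem_filter, Bool.false_eq_true, if_false] at hi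
    omega
  · refine h x _ fun i hi => ?_
    simp only [candSet, Finset.mem_filter, if_true] at hi
    omega

/-- The mass of a candidate set at level `j` is of order at most `n 2 ^ j / t`. -/
theorem sum_sepSet_le {A : ℝ} (hA : 1 ≤ A) {r q : Fin k → ℝ} (hq : IsProbVec q)
    (h : Approximates A t r q) (hn : 1 ≤ n) (ht : (n : ℝ) < t) (x y : Fin n → Fin k)
    (js : Fin (numLevels t n + 2) × Bool) :
    ∑ i ∈ sepSet t r x y js, q i ≤ A * (n * 2 ^ (js.1 : ℕ) / t) := by
  have hn0 : (0 : ℝ) < n := by exact_mod_cast hn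
  have ht0 : 0 < t := hn0.trans ht
  by_cases hj : (js.1 : ℕ) ≤ numLevels t n
  · calc ∑ i ∈ sepSet t r x y js, q i ≤ ∑ i ∈ sepSet t r x y js, A * (2 ^ (js.1 : ℕ) / t) :=
          Finset.sum_le_sum fun i hi => le_of_mem_levelSet (by linarith) h ht0 hj
            (Finset.mem_filter.1 hi).1
      _ = (sepSet t r x y js).card * (A * (2 ^ (js.1 : ℕ) / t)) := by simp
      _ ≤ n * (A * (2 ^ (js.1 : ℕ) / t)) := by
          gcongr
          exact card_candSet_le _ _ _ _
      _ = _ := by ring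
  · have hj' : (js.1 : ℕ) = numLevels t n + 1 := by have := js.1.isLt; omega
    refine (hq.sum_le_one _).trans ?_
    have h1 := le_two_pow_numLevels hn ht
    rw [hj', pow_succ]
    have h2 : 1 ≤ n * (2 ^ numLevels t n * 2) / t := by
      rw [le_div_iff₀ ht0]
      rw [div_le_iff₀ hn0] at h1
      nlinarith
    nlinarith

theorem two_pow_le (hn : 1 ≤ n) (ht : (n : ℝ) < t) {j : ℕ} (hj : j ≤ numLevels t n + 1) :
    (2 : ℝ) ^ j ≤ 4 * (t / n) := by
  calc (2 : ℝ) ^ j ≤ 2 ^ (numLevels t n + 1) := pow_le_pow_right₀ (by norm_num) hj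
    _ = 2 ^ numLevels t n * 2 := pow_succ _ _
    _ ≤ _ := by linarith [two_pow_numLevels_le hn ht]

theorem levelRate_pos (hn : 1 ≤ n) (ht : (n : ℝ) < t) (hk : t ≤ k) (j : ℕ) :
    0 < levelRate k n t j := by
  have hn0 : (0 : ℝ) < n := by exact_mod_cast hn
  have ht0 : 0 < t := hn0.trans ht
  have hk0 : (0 : ℝ) < k := ht0.trans_le hk
  unfold levelRate
  split_ifs <;> positivity

theorem levelRate_le_two (hn : 1 ≤ n) (ht : (n : ℝ) < t) (hk : t ≤ k) {j : ℕ}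
    (hj : j ≤ numLevels t n + 1) : levelRate k n t j ≤ 2 := by
  have hn0 : (0 : ℝ) < n := by exact_mod_cast hn
  have ht0 : 0 < t := hn0.trans ht
  have hk0 : (0 : ℝ) < k := ht0.trans_le hk
  unfold levelRate
  split_ifs
  · rw [div_le_iff₀ hk0]; linarith
  · rw [div_le_iff₀ (by positivity)]
    have h1 := two_pow_le hn ht hj
    have h2 : ((n : ℝ) / 2) ^ 2 ≤ k * t / 2 ^ j := by
      rw [le_div_iff₀ (by positivity)]
      calc ((n : ℝ) / 2) ^ 2 * 2 ^ j ≤ ((n : ℝ) / 2) ^ 2 * (4 * (t / n)) := by gcongr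
        _ = n * t := by field_simp; ring
        _ ≤ k * t := by exact mul_le_mul_of_nonneg_right (by linarith) ht0.le
    have := Real.le_sqrt_of_sq_le h2
    linarith

theorem le_levelRate (hn : 1 ≤ n) (ht : (n : ℝ) < t) (hk : t ≤ k) (j : ℕ) :
    (n : ℝ) / k ≤ levelRate k n t j := by
  have hn0 : (0 : ℝ) < n := by exact_mod_cast hn
  have ht0 : 0 < t := hn0.trans ht
  have hk0 : (0 : ℝ) < k := ht0.trans_le hk
  unfold levelRate
  split_ifs
  · exact le_rfl
  · refine div_le_div_of_nonneg_left hn0.le (by positivity) ?_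
    rw [Real.sqrt_le_left hk0.le]
    calc k * t / 2 ^ j ≤ k * t := div_le_self (by positivity) (one_le_pow₀ (by norm_num))
      _ ≤ k ^ 2 := by rw [sq]; gcongr

/-- The total of the difference scales in Titu's inequality is at most of order
`1 / levelRate`. -/
theorem sum_scale_le {A : ℝ} (hA : 1 ≤ A) {r q : Fin k → ℝ} (hq : IsProbVec q)
    (h : Approximates A t r q) (hn : 2 ≤ n) (ht : (n : ℝ) < t) (hk : t ≤ k) {j : ℕ}
    (hj : j ≤ numLevels t n + 1) :
    ∑ i ∈ levelSet t (numLevels t n) r j, Real.sqrt (1 + (n / 2 : ℕ) * q i) / (n / 2 : ℕ) ≤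
      18 * A ^ 2 * (1 / levelRate k n t j) := by
  have hn0 : (0 : ℝ) < n := by exact_mod_cast (by omega : 0 < n)
  have hn1 : 1 ≤ n := by omega
  have ht0 : 0 < t := hn0.trans ht
  have hk0 : (0 : ℝ) < k := ht0.trans_le hk
  obtain ⟨N, hN⟩ : ∃ N : ℝ, N = ((n / 2 : ℕ) : ℝ) := ⟨_, rfl⟩
  have hN2 : N ≤ n / 2 := by rw [hN]; exact Nat.cast_div_le
  have hN3 : (n : ℝ) / 3 ≤ N := by
    have : n ≤ 3 * (n / 2) := by omega
    have : (n : ℝ) ≤ 3 * N := by rw [hN]; exact_mod_cast this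
    linarith
  have hN0 : 0 < N := by linarith
  obtain ⟨ℓ, hℓ⟩ : ∃ ℓ, ℓ = numLevels t n := ⟨_, rfl⟩
  rw [← hℓ] at hj
  have hpow1 := le_two_pow_numLevels hn1 ht
  have hpow2 := two_pow_numLevels_le hn1 ht
  rw [← hℓ] at hpow1 hpow2
  rw [← hN, ← hℓ]
  set D := levelSet t ℓ r j with hD
  have hcardk : (D.card : ℝ) ≤ k := by
    have := Finset.card_le_univ D
    rw [Fintype.card_fin] at this
    exact_mod_cast this
  by_cases hjℓ : j ≤ ℓ
  -- every summand is of the order `1 / n`, and the level has few members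
  · have hlight : ∀ i ∈ D, Real.sqrt (1 + N * q i) / N ≤ (3 * A / N) / 2 := by
      intro i hi
      have h1 : q i ≤ A * (2 ^ ℓ / t) := (le_of_mem_levelSet (by linarith) h ht0 hjℓ hi).trans
        (by gcongr; norm_num)
      have h2 : N * q i ≤ A := by
        calc N * q i ≤ n / 2 * (A * (2 ^ ℓ / t)) := by
              have := hq.nonneg i
              gcongr
          _ ≤ n / 2 * (A * (2 * (t / n) / t)) := by gcongr
          _ = A := by field_simp
      have h3 : Real.sqrt (1 + N * q i) ≤ 3 * A / 2 := by
        rw [Real.sqrt_le_left (by positivity)]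
        nlinarith
      rw [div_right_comm]
      exact div_le_div_of_nonneg_right h3 hN0.le
    have hsum : ∑ i ∈ D, Real.sqrt (1 + N * q i) / N ≤ D.card * (9 * A / n / 2) := by
      calc _ ≤ ∑ i ∈ D, (3 * A / N) / 2 := Finset.sum_le_sum hlight
        _ = D.card * (3 * A / N / 2) := by simp
        _ ≤ D.card * (3 * A / (n / 3) / 2) := by gcongr
        _ = _ := by field_simp; norm_num
    refine hsum.trans ?_
    by_cases hj0 : j = 0
    · rw [levelRate, if_pos hj0]
      calc (D.card : ℝ) * (9 * A / n / 2) ≤ k * (9 * A / n / 2) := by gcongr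
        _ = 9 / 2 * A * (1 / (n / k)) := by rw [one_div_div]; ring
        _ ≤ 18 * A ^ 2 * (1 / (n / k)) := by
            exact mul_le_mul_of_nonneg_right (by nlinarith) (by positivity)
    · rw [levelRate, if_neg hj0, one_div_div]
      have hcard : (D.card : ℝ) ≤ 2 * A * (t / 2 ^ j) := by
        have h1 : ∀ i ∈ D, 2 ^ (j - 1) / t / A ≤ q i := fun i hi => by
          rw [div_le_iff₀ (by linarith), mul_comm]
          exact ge_of_mem_levelSet h ht0 hj0 hj hi
        have h2 : D.card * (2 ^ (j - 1) / t / A) ≤ 1 := by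
          calc D.card * (2 ^ (j - 1) / t / A) = ∑ i ∈ D, 2 ^ (j - 1) / t / A := by simp
            _ ≤ ∑ i ∈ D, q i := Finset.sum_le_sum h1
            _ ≤ 1 := hq.sum_le_one D
        have h3 : (2 : ℝ) ^ j = 2 ^ (j - 1) * 2 := by
          rw [← pow_succ]; congr 1; omega
        rw [h3]
        have hp : (0 : ℝ) < 2 ^ (j - 1) := by positivity
        have h4 : (D.card : ℝ) = D.card * (2 ^ (j - 1) / t / A) * (A * (t / 2 ^ (j - 1))) := by
          field_simp
        rw [h4]
        calc _ ≤ 1 * (A * (t / 2 ^ (j - 1))) := by gcongr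
          _ = _ := by field_simp
      have hs : (D.card : ℝ) ≤ 2 * A * Real.sqrt (k * t / 2 ^ j) := by
        have h5 : (D.card : ℝ) ^ 2 ≤ (2 * A) ^ 2 * (k * t / 2 ^ j) := by
          calc (D.card : ℝ) ^ 2 = D.card * D.card := sq _
            _ ≤ k * (2 * A * (t / 2 ^ j)) := by gcongr
            _ = 2 * A * (k * t / 2 ^ j) := by ring
            _ ≤ (2 * A) ^ 2 * (k * t / 2 ^ j) := by
                gcongr
                nlinarith
        have h6 := Real.le_sqrt_of_sq_le h5
        rwa [Real.sqrt_mul (by positivity), Real.sqrt_sq (by positivity)] at h6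
      calc (D.card : ℝ) * (9 * A / n / 2) ≤
            2 * A * Real.sqrt (k * t / 2 ^ j) * (9 * A / n / 2) := by gcongr
        _ = 9 * A ^ 2 * (Real.sqrt (k * t / 2 ^ j) / n) := by ring
        _ ≤ 18 * A ^ 2 * (Real.sqrt (k * t / 2 ^ j) / n) := by gcongr; norm_num
  -- on the top level `n q_i` is bounded below, and the Cauchy–Schwarz inequality applies
  · have hj' : j = ℓ + 1 := by omega
    have hj0 : j ≠ 0 := by omega
    rw [levelRate, if_neg hj0, one_div_div]
    have hheavy : ∀ i ∈ D, Real.sqrt (1 + N * q i) / N ≤ 2 * A / N * (1 * Real.sqrt (N * q i)) := by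
      intro i hi
      have h1 := ge_of_mem_levelSet h ht0 hj0 hj hi
      rw [hj', Nat.add_sub_cancel] at h1
      have h2 : 1 / n ≤ A * q i := by
        refine le_trans ?_ h1
        rw [le_div_iff₀ ht0]
        calc 1 / n * t = t / n := by ring
          _ ≤ _ := hpow1
      have h3 : 1 ≤ 3 * A * (N * q i) := by
        rw [div_le_iff₀ hn0] at h2
        have h4 : 0 ≤ A * q i := mul_nonneg (by linarith) (hq.nonneg i)
        nlinarith
      have h5 : 0 ≤ N * q i := mul_nonneg hN0.le (hq.nonneg i)
      have h6 : Real.sqrt (1 + N * q i) ≤ 2 * A * Real.sqrt (N * q i) := by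
        rw [show 2 * A * Real.sqrt (N * q i) = Real.sqrt ((2 * A) ^ 2 * (N * q i)) by
          rw [Real.sqrt_mul (sq_nonneg (2 * A)), Real.sqrt_sq (by positivity)]]
        refine Real.sqrt_le_sqrt ?_
        have h7 : A * (N * q i) ≤ A ^ 2 * (N * q i) := by gcongr; nlinarith
        nlinarith
      rw [one_mul, div_mul_eq_mul_div]
      gcongr
    have hcs : ∑ i ∈ D, 1 * Real.sqrt (N * q i) ≤ Real.sqrt (k * n) := by
      refine Real.le_sqrt_of_sq_le ?_
      refine (Finset.sum_mul_sq_le_sq_mul_sq D (fun _ => 1) fun i => Real.sqrt (N * q i)).trans ?_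
      have h1 : ∑ i ∈ D, Real.sqrt (N * q i) ^ 2 ≤ n := by
        calc ∑ i ∈ D, Real.sqrt (N * q i) ^ 2 = ∑ i ∈ D, N * q i :=
              Finset.sum_congr rfl fun i _ => Real.sq_sqrt (mul_nonneg hN0.le (hq.nonneg i))
          _ = N * ∑ i ∈ D, q i := by rw [Finset.mul_sum]
          _ ≤ N * 1 := mul_le_mul_of_nonneg_left (hq.sum_le_one D) hN0.le
          _ ≤ n := by linarith
      have h2 : ∑ i ∈ D, (1 : ℝ) ^ 2 ≤ k := by simpa using hcardk
      exact mul_le_mul h2 h1 (Finset.sum_nonneg fun i _ => sq_nonneg _) hk0.le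
    have hroot : Real.sqrt (k * n) ≤ 2 * Real.sqrt (k * t / 2 ^ j) := by
      rw [show 2 * Real.sqrt (k * t / 2 ^ j) = Real.sqrt (2 ^ 2 * (k * t / 2 ^ j)) by
        rw [Real.sqrt_mul (by positivity), Real.sqrt_sq (by positivity)]]
      refine Real.sqrt_le_sqrt ?_
      rw [mul_div_assoc', le_div_iff₀ (by positivity)]
      calc (k : ℝ) * n * 2 ^ j ≤ k * n * (4 * (t / n)) := by
            gcongr
            exact two_pow_le hn1 ht (by omega)
        _ = 2 ^ 2 * (k * t) := by field_simp; norm_num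
    calc _ ≤ ∑ i ∈ D, 2 * A / N * (1 * Real.sqrt (N * q i)) := Finset.sum_le_sum hheavy
      _ = 2 * A / N * ∑ i ∈ D, 1 * Real.sqrt (N * q i) := by rw [Finset.mul_sum]
      _ ≤ 2 * A / (n / 3) * (2 * Real.sqrt (k * t / 2 ^ j)) := by
          have := hcs.trans hroot
          gcongr
      _ = 12 * A * (Real.sqrt (k * t / 2 ^ j) / n) := by field_simp; norm_num
      _ ≤ 18 * A ^ 2 * (Real.sqrt (k * t / 2 ^ j) / n) :=
          mul_le_mul_of_nonneg_right (by nlinarith) (by positivity)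

/-- Titu's inequality bounds the total gain over a level with total difference of order `e`. -/
theorem le_sum_gain {A : ℝ} (hA : 1 ≤ A) {p r q : Fin k → ℝ} (hq : IsProbVec q)
    (h : Approximates A t r q) (hn : 2 ≤ n) (ht : (n : ℝ) < t) (hk : t ≤ k) {j : ℕ}
    (hj : j ≤ numLevels t n + 1) {e : ℝ} (he0 : 0 ≤ e) (he : e ≤ 1 / 2)
    (hΔ : 2 / 3 * e ≤ ∑ i ∈ levelSet t (numLevels t n) r j, |p i - q i|) :
    1 / (45 * A ^ 2) * (e ^ 2 * levelRate k n t j) ≤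
      ∑ i ∈ levelSet t (numLevels t n) r j, gain (n / 2 : ℕ) p q i := by
  have hn1 : 1 ≤ n := by omega
  have hY := sum_scale_le hA hq h hn ht hk hj
  have hρ := levelRate_pos hn1 ht hk j
  have hρ2 := levelRate_le_two hn1 ht hk hj
  obtain ⟨N, hN⟩ : ∃ N : ℝ, N = ((n / 2 : ℕ) : ℝ) := ⟨_, rfl⟩
  have hN0 : 0 < N := by
    rw [hN]
    have : 0 < n / 2 := by omega
    exact_mod_cast this
  rw [← hN] at hY ⊢
  obtain ⟨ρ, hρe⟩ : ∃ ρ, ρ = levelRate k n t j := ⟨_, rfl⟩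
  rw [← hρe] at hY hρ hρ2 ⊢
  set D := levelSet t (numLevels t n) r j
  have hy0 : ∀ i, 0 < Real.sqrt (1 + N * q i) / N := fun i =>
    div_pos (Real.sqrt_pos.2 (by have := hq.nonneg i; positivity)) hN0
  have hg : ∀ i ∈ D, |p i - q i| ^ 2 / (|p i - q i| + Real.sqrt (1 + N * q i) / N) ≤
      gain N p q i := by
    intro i _
    have hy := hy0 i
    set y := Real.sqrt (1 + N * q i) / N with hyd
    set d := |p i - q i| with hd
    have hd0 : 0 ≤ d := abs_nonneg _
    have e1 : N * d / Real.sqrt (1 + N * q i) = d / y := by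
      rw [hyd, div_div_eq_mul_div, mul_comm]
    rw [gain, ← hd, e1, sq, mul_div_assoc]
    refine mul_le_mul_of_nonneg_left (le_min ?_ ?_) hd0
    · rw [div_le_one (by positivity)]; linarith
    · exact div_le_div_of_nonneg_left hd0 hy (by linarith)
  have hT := Finset.sq_sum_div_le_sum_sq_div D (fun i => |p i - q i|)
    (g := fun i => |p i - q i| + Real.sqrt (1 + N * q i) / N)
    (fun i _ => add_pos_of_nonneg_of_pos (abs_nonneg _) (hy0 i))
  refine le_trans ?_ (hT.trans (Finset.sum_le_sum hg))
  rw [Finset.sum_add_distrib]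
  set Δ := ∑ i ∈ D, |p i - q i| with hΔd
  set Y := ∑ i ∈ D, Real.sqrt (1 + N * q i) / N with hYd
  have hY0 : 0 ≤ Y := Finset.sum_nonneg fun i _ => (hy0 i).le
  rcases he0.eq_or_lt with h0 | h0
  · rw [← h0]
    have : 0 ≤ Δ ^ 2 / (Δ + Y) := div_nonneg (sq_nonneg _) (by linarith)
    simpa using this
  have hΔ0 : 0 < Δ := by linarith
  -- `x ^ 2 / (x + Y)` is increasing in `x`
  have hmono : (2 / 3 * e) ^ 2 / (2 / 3 * e + Y) ≤ Δ ^ 2 / (Δ + Y) := by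
    rw [div_le_div_iff₀ (by positivity) (by positivity)]
    have h1 : (2 / 3 * e) ^ 2 * Δ ≤ Δ ^ 2 * (2 / 3 * e) := by
      nlinarith [mul_nonneg (mul_nonneg hΔ0.le h0.le) (sub_nonneg.2 hΔ)]
    have h2 : (2 / 3 * e) ^ 2 * Y ≤ Δ ^ 2 * Y := by gcongr
    linarith
  refine le_trans ?_ hmono
  rw [le_div_iff₀ (by positivity)]
  have hA2 : 1 ≤ A ^ 2 := one_le_pow₀ hA
  have h3 : ρ * (2 / 3 * e + Y) ≤ 20 * A ^ 2 := by
    have h4 : ρ * Y ≤ 18 * A ^ 2 := by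
      calc ρ * Y ≤ ρ * (18 * A ^ 2 * (1 / ρ)) := by gcongr
        _ = 18 * A ^ 2 := by field_simp
    nlinarith
  calc 1 / (45 * A ^ 2) * (e ^ 2 * ρ) * (2 / 3 * e + Y) =
        e ^ 2 / (45 * A ^ 2) * (ρ * (2 / 3 * e + Y)) := by ring
    _ ≤ e ^ 2 / (45 * A ^ 2) * (20 * A ^ 2) := by gcongr
    _ = (2 / 3 * e) ^ 2 := by field_simp; norm_num

theorem sum_candSet_sub (p q : Fin k → ℝ) (x y : Fin n → Fin k) (D : Finset (Fin k)) :
    ∑ i ∈ D, (p i - q i) * sg (firstHalfCount x i) (firstHalfCount y i) =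
      ∑ i ∈ candSet x y D true, (p i - q i) - ∑ i ∈ candSet x y D false, (p i - q i) := by
  simp only [candSet, Finset.sum_filter, if_true, Bool.false_eq_true, if_false]
  rw [← Finset.sum_sub_distrib]
  refine Finset.sum_congr rfl fun i _ => ?_
  unfold sg
  split_ifs <;> first | omega | simp

/-- Some level carries a proportional share of the total variation. -/
theorem exists_level {p q r : Fin k → ℝ} {ℓ : ℕ} (hℓ : 1 ≤ ℓ) {ε : ℝ} (hε : 0 ≤ ε)
    (h : 2 * ε ≤ ∑ i, |p i - q i|) :
    ∃ j : Fin (ℓ + 2), 2 / 3 * (ε / ℓ) ≤ ∑ i ∈ levelSet t ℓ r j, |p i - q i| := by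
  by_contra hcon
  push Not at hcon
  have h1 : ∑ i, |p i - q i| ≤ ∑ j : Fin (ℓ + 2), ∑ i ∈ levelSet t ℓ r j, |p i - q i| := by
    have h2 : ∀ j : Fin (ℓ + 2), ∑ i ∈ levelSet t ℓ r j, |p i - q i| =
        ∑ i, if i ∈ levelSet t ℓ r j then |p i - q i| else 0 := by
      intro j; rw [Finset.sum_ite_mem, Finset.univ_inter]
    simp_rw [h2]
    rw [Finset.sum_comm]
    refine Finset.sum_le_sum fun i _ => ?_
    obtain ⟨j, hj⟩ := exists_mem_levelSet (t := t) ℓ r i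
    calc |p i - q i| = if i ∈ levelSet t ℓ r j then |p i - q i| else 0 := (if_pos hj).symm
      _ ≤ _ := Finset.single_le_sum
          (f := fun j : Fin (ℓ + 2) => if i ∈ levelSet t ℓ r j then |p i - q i| else 0)
          (fun _ _ => by split_ifs <;> positivity) (Finset.mem_univ j)
  have h3 : ∑ j : Fin (ℓ + 2), ∑ i ∈ levelSet t ℓ r j, |p i - q i| <
      ∑ j : Fin (ℓ + 2), 2 / 3 * (ε / ℓ) :=
    Finset.sum_lt_sum_of_nonempty Finset.univ_nonempty fun j _ => hcon j
  rw [Finset.sum_const, Finset.card_univ, Fintype.card_fin, nsmul_eq_mul] at h3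
  have h4 : (1 : ℝ) ≤ ℓ := by exact_mod_cast hℓ
  have h5 : ((ℓ + 2 : ℕ) : ℝ) * (2 / 3 * (ε / ℓ)) ≤ 2 * ε := by
    push_cast
    rw [show ((ℓ : ℝ) + 2) * (2 / 3 * (ε / ℓ)) = ((ℓ + 2) * (2 / 3) / ℓ) * ε by ring]
    gcongr
    rw [div_le_iff₀ (by positivity)]
    linarith
  linarith

end levels

/-! ### Existence of a separating candidate set -/

section exist

variable {k n : ℕ} {t : ℝ}

theorem mul_le_of_mem_levelSet {A : ℝ} (hA : 0 ≤ A) {r q : Fin k → ℝ} (hq : IsProbVec q)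
    (h : Approximates A t r q) (hn : 1 ≤ n) (ht : (n : ℝ) < t) {j : ℕ}
    (hj : j ≤ numLevels t n) {i : Fin k} (hi : i ∈ levelSet t (numLevels t n) r j) :
    (n / 2 : ℕ) * q i ≤ A := by
  have hn0 : (0 : ℝ) < n := by exact_mod_cast hn
  have ht0 : 0 < t := hn0.trans ht
  have hN2 : ((n / 2 : ℕ) : ℝ) ≤ n / 2 := Nat.cast_div_le
  have h0 := hq.nonneg i
  calc ((n / 2 : ℕ) : ℝ) * q i ≤ n / 2 * (A * (2 ^ j / t)) := by
        gcongr
        exact le_of_mem_levelSet hA h ht0 hj hi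
    _ ≤ n / 2 * (A * (2 * (t / n) / t)) := by
        gcongr
        exact (pow_le_pow_right₀ (by norm_num) hj).trans (two_pow_numLevels_le hn ht)
    _ = A := by field_simp

theorem two_mul_div_le_levelRate_sq (hn : 1 ≤ n) (ht : (n : ℝ) < t) (hk : t ≤ k) :
    2 * (n / k : ℝ) ≤ levelRate k n t (numLevels t n + 1) ^ 2 := by
  have hn0 : (0 : ℝ) < n := by exact_mod_cast hn
  have ht0 : 0 < t := hn0.trans ht
  have hk0 : (0 : ℝ) < k := ht0.trans_le hk
  rw [levelRate, if_neg (by omega), div_pow, Real.sq_sqrt (by positivity)]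
  have h := le_two_pow_numLevels hn ht
  have h2 : (2 : ℝ) ^ (numLevels t n + 1) = 2 ^ numLevels t n * 2 := pow_succ _ _
  rw [h2]
  calc 2 * (n / k : ℝ) = n ^ 2 / (k * t / (t / n * 2)) := by field_simp
    _ ≤ n ^ 2 / (k * t / (2 ^ numLevels t n * 2)) := by gcongr

/-- With overwhelming probability one of the candidate sets has separation of the order of the
rate of its level. -/
theorem exists_separating {A : ℝ} (hA : 1 ≤ A) : ∃ c : ℝ, 0 < c ∧ ∃ B : ℝ, 0 < B ∧
    ∀ {k n : ℕ} {t ε Λ : ℝ} {p q r : Fin k → ℝ}, IsProbVec p → IsProbVec q →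
    Approximates A t r q → 2 ≤ n → (n : ℝ) < t → t ≤ k → 0 ≤ ε → ε / numLevels t n ≤ 1 / 2 →
    0 ≤ Λ → B * (k * Λ) ≤ n ^ 2 * (ε / numLevels t n) ^ 4 → 2 * ε ≤ ∑ i, |p i - q i| →
    piE p (fun x : Fin n → Fin k => piE q (fun y : Fin n → Fin k =>
      ind (¬ ∃ js, c * ((ε / numLevels t n) ^ 2 * levelRate k n t (js.1 : ℕ)) ≤
        |∑ i ∈ sepSet t r x y js, (p i - q i)|))) ≤ 2 * Real.exp (-Λ) := by
  have hs0 := signConst_pos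
  obtain ⟨cH, hcH0, hcH⟩ := exists_piE_piE_signed_le
  obtain ⟨cG, hcG⟩ : ∃ cG, cG = 1 / (45 * A ^ 2) := ⟨_, rfl⟩
  have hcG0 : 0 < cG := by rw [hcG]; positivity
  obtain ⟨cL, hcL⟩ : ∃ cL, cL = signConst / (4 * (64 + A) * Real.sqrt (1 + A)) * (signConst / 8) :=
    ⟨_, rfl⟩
  have hcL0 : 0 < cL := by
    rw [hcL]
    have : 0 < Real.sqrt (1 + A) := Real.sqrt_pos.2 (by linarith)
    positivity
  refine ⟨signConst / 8 * cG, by positivity, 3 / (cL * cG) + 3 / (2 * cH *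
      cG ^ 2), by positivity, ?_⟩
  intro k n t ε Λ p q r hp hq hr hn ht hk hε he hΛ hB hpq
  have hn1 : 1 ≤ n := by omega
  have hn0 : (0 : ℝ) < n := by exact_mod_cast (by omega : 0 < n)
  have ht0 : 0 < t := hn0.trans ht
  have hk0 : (0 : ℝ) < k := ht0.trans_le hk
  obtain ⟨N, hN⟩ : ∃ N : ℝ, N = ((n / 2 : ℕ) : ℝ) := ⟨_, rfl⟩
  have hN3 : (n : ℝ) / 3 ≤ N := by
    have : n ≤ 3 * (n / 2) := by omega
    have : (n : ℝ) ≤ 3 * N := by rw [hN]; exact_mod_cast this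
    linarith
  have hN0 : 0 ≤ N := by rw [hN]; positivity
  obtain ⟨e, hee⟩ : ∃ e, e = ε / numLevels t n := ⟨_, rfl⟩
  have he0 : 0 ≤ e := by rw [hee]; positivity
  obtain ⟨j, hj⟩ := exists_level (t := t) (r := r) (one_le_numLevels hn1 ht) hε hpq
  rw [← hee] at hj he hB ⊢
  have hjle : (j : ℕ) ≤ numLevels t n + 1 := by have := j.isLt; omega
  have hG := le_sum_gain hA hq hr hn ht hk hjle he0 he hj
  rw [← hcG] at hG
  have hρ := le_levelRate hn1 ht hk j
  obtain ⟨G, hGd⟩ : ∃ G, G = ∑ i ∈ levelSet t (numLevels t n) r j, gain N p q i := ⟨_, rfl⟩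
  rw [← hN, ← hGd] at hG
  -- a large signed sum makes one of the two candidate sets of the level separating
  have hpt : ∀ x y : Fin n → Fin k,
      ind (¬ ∃ js, signConst / 8 * cG * (e ^ 2 * levelRate k n t (js.1 : ℕ)) ≤
        |∑ i ∈ sepSet t r x y js, (p i - q i)|) ≤
      ind (∑ i ∈ levelSet t (numLevels t n) r j,
        (p i - q i) * sg (firstHalfCount x i) (firstHalfCount y i) < signConst / 4 * G) := by
    intro x y
    refine ind_mono fun h => ?_
    by_contra hcon
    push Not at h hcon
    rw [sum_candSet_sub] at hcon
    have h1 := h (j, true)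
    have h2 := h (j, false)
    simp only [sepSet] at h1 h2
    have h3 := mul_le_mul_of_nonneg_left hG (by positivity : 0 ≤ signConst / 4)
    have h4 := le_abs_self (∑ i ∈ candSet x y (levelSet t (numLevels t n) r j) true, (p i - q i))
    have h5 := neg_abs_le (∑ i ∈ candSet x y (levelSet t (numLevels t n) r j) false, (p i - q i))
    nlinarith
  refine (piE_mono hp fun x => piE_mono hq fun y => hpt x y).trans ?_
  -- `n ^ 2 * e ^ 4 / k` is a large multiple of `Λ`
  have hkey : (3 / (cL * cG) + 3 / (2 * cH * cG ^ 2)) * Λ ≤ n ^ 2 * e ^ 4 / k := by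
    rw [le_div_iff₀ hk0]; linarith
  by_cases hjℓ : (j : ℕ) ≤ numLevels t n
  -- `Λ` must be at most of the order `n G`
  · have := piE_piE_signed_le_of_light (n := n) hp hq (levelSet t (numLevels t n) r j)
      (M := A) (by linarith) fun i hi => mul_le_of_mem_levelSet (by linarith) hq hr hn1 ht hjℓ hi
    rw [← hN, ← hGd, ← hcL] at this
    refine this.trans ?_
    gcongr
    have h1 : n / 3 * (cG * (e ^ 2 * (n / k))) ≤ N * G := by
      have : cG * (e ^ 2 * (n / k)) ≤ G := le_trans (by gcongr) hG
      gcongr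
    have h2 : (n : ℝ) ^ 2 * e ^ 4 / k ≤ n ^ 2 * e ^ 2 / k :=
      div_le_div_of_nonneg_right (mul_le_mul_of_nonneg_left
        (pow_le_pow_of_le_one he0 (by linarith) (by norm_num)) (by positivity)) hk0.le
    have h3 : 3 / (cL * cG) * Λ ≤ n ^ 2 * e ^ 2 / k := by
      have : 0 ≤ 3 / (2 * cH * cG ^ 2) * Λ := by positivity
      linarith
    calc Λ = cL * (cG / 3 * (3 / (cL * cG) * Λ)) := by field_simp
      _ ≤ cL * (cG / 3 * (n ^ 2 * e ^ 2 / k)) := by gcongr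
      _ = cL * (n / 3 * (cG * (e ^ 2 * (n / k)))) := by ring
      _ ≤ _ := by gcongr
  -- `Λ` must be at most of the order `n G ^ 2`
  · have hj' : (j : ℕ) = numLevels t n + 1 := by omega
    have := hcH hp hq (n := n) (levelSet t (numLevels t n) r j)
    rw [← hN, ← hGd] at this
    refine this.trans ?_
    gcongr
    have hρ2 := two_mul_div_le_levelRate_sq hn1 ht hk
    rw [← hj'] at hρ2
    have hρ0 := levelRate_pos hn1 ht hk j
    have h1 : (cG * (e ^ 2 * levelRate k n t j)) ^ 2 ≤ G ^ 2 := by gcongr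
    have h2 : cG ^ 2 * (e ^ 4 * (2 * (n / k))) ≤ G ^ 2 := by
      refine le_trans ?_ h1
      calc cG ^ 2 * (e ^ 4 * (2 * (n / k))) ≤ cG ^ 2 * (e ^ 4 * levelRate k n t j ^ 2) := by gcongr
        _ = _ := by ring
    have h3 : 3 / (2 * cH * cG ^ 2) * Λ ≤ n ^ 2 * e ^ 4 / k := by
      have : 0 ≤ 3 / (cL * cG) * Λ := by positivity
      linarith
    calc Λ = cH * (2 * cG ^ 2 / 3 * (3 / (2 * cH * cG ^ 2) * Λ)) := by field_simp
      _ ≤ cH * (2 * cG ^ 2 / 3 * (n ^ 2 * e ^ 4 / k)) := by gcongr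
      _ = cH * (n / 3 * (cG ^ 2 * (e ^ 4 * (2 * (n / k))))) := by ring
      _ ≤ cH * (N * G ^ 2) := by gcongr

end exist

/-! ### Estimating the separation and selecting a candidate set -/

/-- The difference of empirical frequencies of `S` in two samples. -/
noncomputable def freqDiff {ι ι' α : Type*} [Fintype ι] [Fintype ι'] [DecidableEq α] (S : Finset α)
    (x : ι → α) (y : ι' → α) : ℝ :=
  cnt Finset.univ S x / Fintype.card ι - cnt Finset.univ S y / Fintype.card ι'

/-- The stochastic error of an empirical separation, for a set of size `s`. -/
noncomputable def noise (s ν Λ : ℝ) : ℝ := Real.sqrt (s * Λ / ν) + Λ / ν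

theorem noise_nonneg {s ν Λ : ℝ} (hν : 0 ≤ ν) (hΛ : 0 ≤ Λ) : 0 ≤ noise s ν Λ := by
  unfold noise; positivity

section select

variable {ι ι' α : Type*} [Fintype ι] [DecidableEq ι] [Fintype ι'] [DecidableEq ι'] [Fintype α]
  [DecidableEq α] {p q : α → ℝ}

theorem sqrt_add_le_noise {s d ν N Λ : ℝ} (hs : 0 ≤ s) (hd : 0 ≤ d) (hν : 0 < ν) (hN : ν ≤ N)
    (hΛ : 0 ≤ Λ) :
    Real.sqrt (4 * (s + d) * Λ / N) + 2 * Λ / N ≤ d / 8 + 10 * noise s ν Λ := by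
  have h1 : Real.sqrt (4 * (s + d) * Λ / N) ≤ 2 * Real.sqrt (s * Λ / ν) + 2 * Real.sqrt (d *
      Λ / ν) := by
    rw [Real.sqrt_le_left (by positivity)]
    have a1 := Real.sq_sqrt (show 0 ≤ s * Λ / ν by positivity)
    have a2 := Real.sq_sqrt (show 0 ≤ d * Λ / ν by positivity)
    have a3 : 4 * (s + d) * Λ / N ≤ 4 * (s + d) * Λ / ν := by gcongr
    have a4 : 4 * (s + d) * Λ / ν = 4 * (s * Λ / ν) + 4 * (d * Λ / ν) := by ring
    have a5 := mul_nonneg (Real.sqrt_nonneg (s * Λ / ν)) (Real.sqrt_nonneg (d * Λ / ν))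
    nlinarith
  have h2 : 2 * Real.sqrt (d * Λ / ν) ≤ d / 8 + 8 * (Λ / ν) := by
    have hΛν : 0 ≤ Λ / ν := by positivity
    have a0 : Real.sqrt (d * Λ / ν) ≤ d / 16 + 4 * (Λ / ν) := by
      rw [Real.sqrt_le_left (by positivity), mul_div_assoc]
      nlinarith [sq_nonneg (d / 16 - 4 * (Λ / ν))]
    linarith
  have h3 : 2 * Λ / N ≤ 2 * (Λ / ν) := by
    rw [mul_div_assoc]; gcongr
  have h4 := Real.sqrt_nonneg (s * Λ / ν)
  unfold noise
  linarith

/-- Deviation of the empirical separation, uniformly over the size of the separation. -/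
theorem piE_piE_freqDiff_le (hp : IsProbVec p) (hq : IsProbVec q) {S : Finset α} {s ν Λ : ℝ}
    (hs0 : 0 < s) (hs : ∑ i ∈ S, q i ≤ s) (hν : 0 < ν) (hι : ν ≤ Fintype.card ι)
    (hι' : ν ≤ Fintype.card ι') (hΛ : 0 ≤ Λ) :
    piE p (fun x : ι → α => piE q (fun y : ι' → α =>
      ind (|∑ i ∈ S, (p i - q i)| / 4 + 20 * noise s ν Λ <
        |freqDiff S x y - ∑ i ∈ S, (p i - q i)|))) ≤ 4 * Real.exp (-Λ) := by
  obtain ⟨d, hd⟩ : ∃ d, d = |∑ i ∈ S, (p i - q i)| := ⟨_, rfl⟩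
  have hd0 : 0 ≤ d := by rw [hd]; positivity
  have hcι : 0 < (Finset.univ : Finset ι).card := by
    rw [Finset.card_univ]; exact_mod_cast hν.trans_le hι
  have hcι' : 0 < (Finset.univ : Finset ι').card := by
    rw [Finset.card_univ]; exact_mod_cast hν.trans_le hι'
  have hP : ∑ i ∈ S, p i ≤ s + d := by
    have := le_abs_self (∑ i ∈ S, (p i - q i))
    rw [← hd, Finset.sum_sub_distrib] at this
    linarith
  have b1 := piE_freq_deviation_le hp hcι S hP (by linarith) hΛ
  have b2 := piE_freq_deviation_le hq hcι' S (hs.trans (by linarith : s ≤ s + d)) (by linarith) hΛ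
  have n1 := sqrt_add_le_noise hs0.le hd0 hν hι hΛ
  have n2 := sqrt_add_le_noise hs0.le hd0 hν hι' hΛ
  rw [← Finset.card_univ] at n1 n2
  rw [← hd]
  have hpt : ∀ (x : ι → α) (y : ι' → α), ind (d / 4 + 20 * noise s ν Λ <
        |freqDiff S x y - ∑ i ∈ S, (p i - q i)|) ≤
      ind (Real.sqrt (4 * (s + d) * Λ / (Finset.univ : Finset ι).card) +
        2 * Λ / (Finset.univ : Finset ι).card <
        |cnt Finset.univ S x / (Finset.univ : Finset ι).card - ∑ i ∈ S, p i|) +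
      ind (Real.sqrt (4 * (s + d) * Λ / (Finset.univ : Finset ι').card) +
        2 * Λ / (Finset.univ : Finset ι').card <
        |cnt Finset.univ S y / (Finset.univ : Finset ι').card - ∑ i ∈ S, q i|) := by
    intro x y
    refine le_trans (ind_mono fun h => ?_) (ind_or_le _ _)
    by_contra hcon
    push Not at hcon
    rw [freqDiff, Finset.sum_sub_distrib, ← Finset.card_univ, ← Finset.card_univ] at h
    have h1 := hcon.1.trans n1
    have h2 := hcon.2.trans n2
    have h3 := abs_sub (cnt Finset.univ S x / (Finset.univ : Finset ι).card - ∑ i ∈ S, p i)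
      (cnt Finset.univ S y / (Finset.univ : Finset ι').card - ∑ i ∈ S, q i)
    rw [show ∀ a b c d : ℝ, a - b - (c - d) = a - c - (b - d) by intros; ring] at h
    linarith
  refine (piE_mono hp fun x => piE_mono hq fun y => hpt x y).trans ?_
  simp only [piE_add, piE_const hq, piE_const hp]
  linarith

end select

/-- The indices of the held-out samples. -/
abbrev SecondHalf (n : ℕ) : Type := {a : Fin n // ¬ (a : ℕ) < n / 2}

theorem card_secondHalf (n : ℕ) : Fintype.card (SecondHalf n) = n - n / 2 := by
  rw [Fintype.card_subtype_compl, Fintype.card_fin, card_firstHalf]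

/-- The held-out estimate of the separation of `S`. -/
noncomputable def heldOut {k n : ℕ} (S : Finset (Fin k)) (x y : Fin n → Fin k) : ℝ :=
  freqDiff S (fun a : SecondHalf n => x a) (fun a : SecondHalf n => y a)

section core

variable {k n : ℕ} {t : ℝ}

theorem noise_le_levelRate {e Λ b : ℝ} (hn : 1 ≤ n) (ht : (n : ℝ) < t) (hk : t ≤ k)
    (he0 : 0 ≤ e) (he1 : e ≤ 1) (hΛ : 0 ≤ Λ) (hb : 1 ≤ b)
    (hB : b ^ 2 * (k * Λ) ≤ n ^ 2 * e ^ 4 * (t / k)) (j : ℕ) :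
    noise (n * 2 ^ j / t) n Λ ≤ 2 / b * (e ^ 2 * levelRate k n t j) := by
  have hn0 : (0 : ℝ) < n := by exact_mod_cast hn
  have ht0 : 0 < t := hn0.trans ht
  have hk0 : (0 : ℝ) < k := ht0.trans_le hk
  have hb0 : 0 < b := by linarith
  have htk : t / k ≤ 1 := by rw [div_le_one hk0]; exact hk
  have hB' : b ^ 2 * (k * Λ) ≤ n ^ 2 * e ^ 4 := hB.trans (mul_le_of_le_one_right
      (by positivity) htk)
  have hρ0 := levelRate_pos hn ht hk j
  have h1 : Real.sqrt (n * 2 ^ j / t * Λ / n) ≤ 1 / b * (e ^ 2 * levelRate k n t j) := by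
    rw [Real.sqrt_le_left (by positivity)]
    have e1 : (n : ℝ) * 2 ^ j / t * Λ / n = 2 ^ j * Λ / t := by field_simp
    rw [e1, mul_pow, mul_pow, one_div, inv_pow, inv_mul_eq_div, le_div_iff₀ (by positivity),
      levelRate]
    split_ifs with hj
    · subst hj
      rw [pow_zero, one_mul, div_pow]
      calc Λ / t * b ^ 2 = b ^ 2 * (k * Λ) / (k * t) := by field_simp
        _ ≤ n ^ 2 * e ^ 4 * (t / k) / (k * t) := by gcongr
        _ = _ := by field_simp
    · rw [div_pow, Real.sq_sqrt (by positivity)]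
      calc 2 ^ j * Λ / t * b ^ 2 = b ^ 2 * (k * Λ) * (2 ^ j / (k * t)) := by field_simp
        _ ≤ n ^ 2 * e ^ 4 * (2 ^ j / (k * t)) := by gcongr
        _ = _ := by field_simp
  have h2 : Λ / n ≤ 1 / b * (e ^ 2 * levelRate k n t j) := by
    have h3 := le_levelRate hn ht hk j
    calc Λ / n = 1 / b * (b * (k * Λ) / (n * k)) := by field_simp
      _ ≤ 1 / b * (n ^ 2 * e ^ 2 / (n * k)) := by
          have h4 : b * (k * Λ) ≤ b ^ 2 * (k * Λ) := by gcongr; nlinarith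
          have h5 : (n : ℝ) ^ 2 * e ^ 4 ≤ n ^ 2 * e ^ 2 :=
            mul_le_mul_of_nonneg_left (pow_le_pow_of_le_one he0 he1 (by norm_num)) (by positivity)
          exact mul_le_mul_of_nonneg_left
            (div_le_div_of_nonneg_right (h4.trans (hB'.trans h5)) (by positivity)) (by positivity)
      _ = 1 / b * (e ^ 2 * (n / k)) := by field_simp
      _ ≤ _ := by gcongr
  unfold noise
  calc _ ≤ 1 / b * (e ^ 2 * levelRate k n t j) + 1 / b * (e ^ 2 * levelRate k n t j) :=
        add_le_add h1 h2
    _ = _ := by ring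

theorem noise_mul_le {A s ν ν' Λ : ℝ} (hA : 1 ≤ A) (hs : 0 ≤ s) (hν : 0 < ν) (hν' : ν / 2 ≤ ν')
    (hΛ : 0 ≤ Λ) : noise (A * s) ν' Λ ≤ 2 * A * noise s ν Λ := by
  have hν'0 : 0 < ν' := by linarith
  unfold noise
  have h1 : Real.sqrt (A * s * Λ / ν') ≤ 2 * A * Real.sqrt (s * Λ / ν) := by
    rw [show 2 * A * Real.sqrt (s * Λ / ν) = Real.sqrt ((2 * A) ^ 2 * (s * Λ / ν)) by
      rw [Real.sqrt_mul (sq_nonneg (2 * A)), Real.sqrt_sq (by positivity)]]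
    refine Real.sqrt_le_sqrt ?_
    calc A * s * Λ / ν' ≤ A * s * Λ / (ν / 2) := by gcongr
      _ = 2 * A * (s * Λ / ν) := by field_simp
      _ ≤ (2 * A) ^ 2 * (s * Λ / ν) := by
          gcongr
          nlinarith
  have h2 : Λ / ν' ≤ 2 * A * (Λ / ν) := by
    calc Λ / ν' ≤ Λ / (ν / 2) := by gcongr
      _ = 2 * (Λ / ν) := by field_simp
      _ ≤ 2 * A * (Λ / ν) := by gcongr; linarith
  linarith

/-- The held-out samples are independent of the candidate sets. -/
theorem piE_piE_heldOut_le {A : ℝ} (hA : 1 ≤ A) {p q r : Fin k → ℝ} (hp : IsProbVec p)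
    (hq : IsProbVec q) (hr : Approximates A t r q) (hn : 1 ≤ n) (ht : (n : ℝ) < t) {Λ : ℝ}
    (hΛ : 0 ≤ Λ) (js : Fin (numLevels t n + 2) × Bool) :
    piE p (fun x : Fin n → Fin k => piE q (fun y : Fin n → Fin k =>
      ind (|∑ i ∈ sepSet t r x y js, (p i - q i)| / 4 +
          20 * noise (A * (n * 2 ^ (js.1 : ℕ) / t)) (n / 2) Λ <
        |heldOut (sepSet t r x y js) x y - ∑ i ∈ sepSet t r x y js, (p i - q i)|))) ≤
      4 * Real.exp (-Λ) := by
  have hn0 : (0 : ℝ) < n := by exact_mod_cast hn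
  have ht0 : 0 < t := hn0.trans ht
  set s := A * (n * 2 ^ (js.1 : ℕ) / t) with hs
  have hs0 : 0 < s := by positivity
  have hcard : (n : ℝ) / 2 ≤ Fintype.card (SecondHalf n) := by
    rw [card_secondHalf]
    have : n ≤ 2 * (n - n / 2) := by omega
    have : (n : ℝ) ≤ 2 * ((n - n / 2 : ℕ) : ℝ) := by exact_mod_cast this
    linarith
  -- the candidate set as a function of the first halves
  set S : (FirstHalf n → Fin k) → (FirstHalf n → Fin k) → Finset (Fin k) := fun x y =>
    (levelSet t (numLevels t n) r js.1).filter fun i =>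
      if js.2 then succs (fun a => decide (y a = i)) < succs (fun a => decide (x a = i))
      else succs (fun a => decide (x a = i)) < succs (fun a => decide (y a = i)) with hS
  have hSe : ∀ x y : Fin n → Fin k, sepSet t r x y js =
      S (fun a : FirstHalf n => x a) (fun a : FirstHalf n => y a) := by
    intro x y
    simp only [hS, sepSet, candSet, firstHalfCount_eq_succs]
  set F : (FirstHalf n → Fin k) → (SecondHalf n → Fin k) → (FirstHalf n → Fin k) →
      (SecondHalf n → Fin k) → ℝ := fun x x' y y' =>
    ind (|∑ i ∈ S x y, (p i - q i)| / 4 + 20 * noise s (n / 2) Λ <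
      |freqDiff (S x y) x' y' - ∑ i ∈ S x y, (p i - q i)|) with hF
  have hcongr : ∀ x y : Fin n → Fin k,
      ind (|∑ i ∈ sepSet t r x y js, (p i - q i)| / 4 + 20 * noise s (n / 2) Λ <
        |heldOut (sepSet t r x y js) x y - ∑ i ∈ sepSet t r x y js, (p i - q i)|) =
      F (fun a : FirstHalf n => x a) (fun a : SecondHalf n => x a) (fun a : FirstHalf n => y a)
        (fun a : SecondHalf n => y a) := by
    intro x y
    simp only [hF, heldOut, hSe]
  simp_rw [hcongr]
  have e1 : ∀ x : Fin n → Fin k, piE q (fun y : Fin n → Fin k =>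
      F (fun a : FirstHalf n => x a) (fun a : SecondHalf n => x a) (fun a : FirstHalf n => y a)
        (fun a : SecondHalf n => y a)) = piE q (fun y => piE q (fun y' =>
      F (fun a : FirstHalf n => x a) (fun a : SecondHalf n => x a) y y')) := fun x =>
    piE_split (w := q) (fun a : Fin n => (a : ℕ) < n / 2)
      (F (fun a : FirstHalf n => x a) (fun a : SecondHalf n => x a))
  simp_rw [e1]
  rw [piE_split (w := p) (fun a : Fin n => (a : ℕ) < n / 2)
    (fun x x' => piE q (fun y => piE q (fun y' => F x x' y y')))]
  have e2 : ∀ x, piE p (fun x' => piE q (fun y => piE q (fun y' => F x x' y y'))) ≤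
      4 * Real.exp (-Λ) := by
    intro x
    rw [piE_comm]
    refine le_trans (piE_mono hq fun y => ?_) (le_of_eq (piE_const hq _))
    by_cases hm : ∑ i ∈ S x y, q i ≤ s
    · exact piE_piE_freqDiff_le hp hq hs0 hm (by positivity) hcard hcard hΛ
    -- this first-half sample is impossible, because every candidate set has mass at most `s`
    · exfalso
      refine hm ?_
      have : ∃ x₀ : Fin n → Fin k, (fun a : FirstHalf n => x₀ a) = x := by
        classical
        have hk : 0 < k := by
          by_contra hk
          have hk : k = 0 := by omega
          subst hk
          have := hq.sum_eq_one
          simp at this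
        exact ⟨fun a => if h : (a : ℕ) < n / 2 then x ⟨a, h⟩ else ⟨0, hk⟩, by
          ext a; simp [a.2]⟩
      obtain ⟨x₀, hx₀⟩ := this
      have : ∃ y₀ : Fin n → Fin k, (fun a : FirstHalf n => y₀ a) = y := by
        classical
        have hk : 0 < k := by
          by_contra hk
          have hk : k = 0 := by omega
          subst hk
          have := hq.sum_eq_one
          simp at this
        exact ⟨fun a => if h : (a : ℕ) < n / 2 then y ⟨a, h⟩ else ⟨0, hk⟩, by
          ext a; simp [a.2]⟩
      obtain ⟨y₀, hy₀⟩ := this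
      have := sum_sepSet_le hA hq hr hn ht x₀ y₀ js
      rwa [hSe, hx₀, hy₀] at this
  exact (piE_mono hp e2).trans (le_of_eq (piE_const hp _))

theorem numLevels_add_two_le (hn : 1 ≤ n) (ht : (n : ℝ) < t) (hk : t ≤ k) :
    ((numLevels t n + 2 : ℕ) : ℝ) ≤ 4 * k := by
  have hn0 : (1 : ℝ) ≤ n := by exact_mod_cast hn
  have h1 := two_pow_numLevels_le hn ht
  have h2 : ((numLevels t n : ℕ) : ℝ) < 2 ^ numLevels t n := by
    exact_mod_cast Nat.lt_two_pow_self
  have h3 : t / n ≤ t := div_le_self (by linarith) hn0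
  push_cast
  linarith

/-- The selection rule: some candidate whose held-out separation exceeds the rate of its level
finds a separating set. -/
theorem exists_selection {A : ℝ} (hA : 1 ≤ A) : ∃ c : ℝ, 0 < c ∧ ∃ b : ℝ, 1 ≤ b ∧
    ∀ {k n : ℕ} {t ε Λ : ℝ}, 2 ≤ n → (n : ℝ) < t → t ≤ k → 0 ≤ ε →
    ε / numLevels t n ≤ 1 / 2 → 0 ≤ Λ →
    b ^ 2 * (k * Λ) ≤ n ^ 2 * (ε / numLevels t n) ^ 4 * (t / k) →
    ∃ sel : (Fin k → ℝ) → (Fin n → Fin k) → (Fin n → Fin k) → Fin (numLevels t n + 2) × Bool,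
    ∀ p q r : Fin k → ℝ, IsProbVec p → IsProbVec q → Approximates A t r q →
    2 * ε ≤ ∑ i, |p i - q i| →
    piE p (fun x : Fin n → Fin k => piE q (fun y : Fin n → Fin k =>
      ind (¬ c * ((ε / numLevels t n) ^ 2 * levelRate k n t ((sel r x y).1 : ℕ)) ≤
        |∑ i ∈ sepSet t r x y (sel r x y), (p i - q i)|))) ≤ 34 * k * Real.exp (-Λ) := by
  classical
  obtain ⟨c, hc0, B, hB0, hex⟩ := exists_separating hA
  obtain ⟨b, hb⟩ : ∃ b, b = 1 + B + 640 * A / c := ⟨_, rfl⟩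
  have hb1 : 1 ≤ b := by rw [hb]; have : 0 ≤ 640 * A / c := by positivity
                         linarith
  have hbB : B ≤ b ^ 2 := by
    have : B ≤ b := by rw [hb]; have : 0 ≤ 640 * A / c := by positivity
                       linarith
    nlinarith
  have hbc : 640 * A / b ≤ c := by
    rw [div_le_iff₀ (by linarith), hb]
    have : c * (640 * A / c) = 640 * A := by field_simp
    nlinarith
  refine ⟨c / 4, by positivity, b, hb1, ?_⟩
  intro k n t ε Λ hn ht hk hε he hΛ hcond
  have hn1 : 1 ≤ n := by omega
  have hn0 : (0 : ℝ) < n := by exact_mod_cast (by omega : 0 < n)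
  have ht0 : 0 < t := hn0.trans ht
  have hk0 : (0 : ℝ) < k := ht0.trans_le hk
  obtain ⟨e, hee⟩ : ∃ e, e = ε / numLevels t n := ⟨_, rfl⟩
  have he0 : 0 ≤ e := by rw [hee]; positivity
  rw [← hee] at he hcond ⊢
  obtain ⟨R, hR⟩ : ∃ R : ℕ → ℝ, ∀ j, R j = e ^ 2 * levelRate k n t j := ⟨_, fun _ => rfl⟩
  have hR0 : ∀ j, 0 ≤ R j := fun j => by
    rw [hR]; have := levelRate_pos hn1 ht hk j; positivity
  refine ⟨fun r x y => if h : ∃ js : Fin (numLevels t n + 2) × Bool,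
    c / 2 * R js.1 ≤ |heldOut (sepSet t r x y js) x y| then h.choose else (0, true), ?_⟩
  intro p q r hp hq hr hpq
  have htk : t / k ≤ 1 := by rw [div_le_one hk0]; exact hk
  have hcond' : B * (k * Λ) ≤ n ^ 2 * e ^ 4 := by
    calc B * (k * Λ) ≤ b ^ 2 * (k * Λ) := by gcongr
      _ ≤ _ := hcond
      _ ≤ n ^ 2 * e ^ 4 := mul_le_of_le_one_right (by positivity) htk
  have h1 := hex hp hq hr hn ht hk hε (hee ▸ he) hΛ (hee ▸ hcond') hpq
  rw [← hee] at h1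
  simp only [← hR] at h1 ⊢
  -- the constant `b` makes the noise of the estimates small compared to the rates
  have hnoise : ∀ j : ℕ, 20 * noise (A * (n * 2 ^ j / t)) (n / 2) Λ ≤ c / 8 * R j := by
    intro j
    have a1 := noise_mul_le (A := A) (s := n * 2 ^ j / t) (ν := n) (ν' := n / 2) hA (by positivity)
      hn0 le_rfl hΛ
    have a2 := noise_le_levelRate hn1 ht hk he0 (by linarith) hΛ hb1 hcond j
    rw [← hR] at a2
    calc 20 * noise (A * (n * 2 ^ j / t)) (n / 2) Λ ≤ 20 * (2 * A * (2 / b * R j)) := by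
          have : 2 * A * noise (n * 2 ^ j / t) n Λ ≤ 2 * A * (2 / b * R j) := by gcongr
          linarith
      _ = 640 * A / b / 8 * R j := by ring
      _ ≤ c / 8 * R j := by have := hR0 j; gcongr
  set bad : (Fin n → Fin k) → (Fin n → Fin k) → Fin (numLevels t n + 2) × Bool → Prop :=
    fun x y js => |∑ i ∈ sepSet t r x y js, (p i - q i)| / 4 +
          20 * noise (A * (n * 2 ^ (js.1 : ℕ) / t)) (n / 2) Λ <
        |heldOut (sepSet t r x y js) x y - ∑ i ∈ sepSet t r x y js, (p i - q i)| with hbad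
  have hpt : ∀ x y : Fin n → Fin k, ind (¬ c / 4 * R ((if h : ∃ js : Fin (numLevels t n + 2) × Bool,
      c / 2 * R js.1 ≤ |heldOut (sepSet t r x y js) x y| then h.choose else (0, true)) :
        Fin (numLevels t n + 2) × Bool).1 ≤
        |∑ i ∈ sepSet t r x y (if h : ∃ js : Fin (numLevels t n + 2) × Bool,
      c / 2 * R js.1 ≤ |heldOut (sepSet t r x y js) x y| then h.choose else (0, true)),
          (p i - q i)|) ≤
      ind (¬ ∃ js : Fin (numLevels t n + 2) × Bool, c * R js.1 ≤
        |∑ i ∈ sepSet t r x y js, (p i - q i)|) + ∑ js, ind (bad x y js) := by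
    intro x y
    refine le_trans (ind_mono fun h => ?_)
      ((ind_or_le _ (∃ js, bad x y js)).trans (by gcongr; exact ind_exists_le _))
    by_contra hcon
    push Not at hcon
    obtain ⟨⟨js, hjs⟩, hgood⟩ := hcon
    have hgood' : ∀ js, |heldOut (sepSet t r x y js) x y - ∑ i ∈ sepSet t r x y js, (p i - q i)| ≤
        |∑ i ∈ sepSet t r x y js, (p i - q i)| / 4 + c / 8 * R js.1 := by
      intro js
      have g1 := hgood js
      simp only [hbad, not_lt] at g1
      linarith [hnoise js.1]
    -- the separating candidate passes the selection criterion, and whatever passes separates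
    have hexists : ∃ js : Fin (numLevels t n + 2) × Bool,
        c / 2 * R js.1 ≤ |heldOut (sepSet t r x y js) x y| := by
      refine ⟨js, ?_⟩
      have g1 := hgood' js
      have g2 := abs_sub_abs_le_abs_sub (∑ i ∈ sepSet t r x y js, (p i - q i))
        (heldOut (sepSet t r x y js) x y)
      rw [abs_sub_comm] at g2
      nlinarith [hR0 js.1]
    rw [dif_pos hexists] at h
    have g0 := hexists.choose_spec
    have g1 := hgood' hexists.choose
    have g2 := abs_sub_abs_le_abs_sub (heldOut (sepSet t r x y hexists.choose) x y)
      (∑ i ∈ sepSet t r x y hexists.choose, (p i - q i))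
    refine h ?_
    have := mul_nonneg hc0.le (hR0 hexists.choose.1)
    linarith
  refine (piE_mono hp fun x => piE_mono hq fun y => hpt x y).trans ?_
  simp only [piE_add, piE_sum]
  -- a union bound over the `2 (ℓ + 2)` candidates
  have h2 : ∑ js : Fin (numLevels t n + 2) × Bool,
      piE p (fun x : Fin n → Fin k => piE q (fun y => ind (bad x y js))) ≤
      ∑ js : Fin (numLevels t n + 2) × Bool, 4 * Real.exp (-Λ) :=
    Finset.sum_le_sum fun js _ => piE_piE_heldOut_le hA hp hq hr hn1 ht hΛ js
  rw [Finset.sum_const, Finset.card_univ, Fintype.card_prod, Fintype.card_fin, Fintype.card_bool,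
    nsmul_eq_mul, Nat.cast_mul] at h2
  have h3 := numLevels_add_two_le hn1 ht hk
  have h4 := Real.exp_pos (-Λ)
  have h5 : (1 : ℝ) ≤ k := by
    have : (0 : ℕ) < k := by exact_mod_cast hk0
    exact_mod_cast this
  have h6 := mul_le_mul_of_nonneg_right h3 h4.le
  have h7 := mul_le_mul_of_nonneg_right h5 h4.le
  push_cast at h2
  push_cast at h6
  linarith

end core

/-! ### Level sets of the empirical mass function -/

section emp

variable {k M : ℕ}

theorem empPMF_eq_cnt (z : Fin M → Fin k) (i : Fin k) :
    empPMF z i = cnt Finset.univ {i} z / M := by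
  simp [empPMF, cnt]

/-- The empirical mass function of sufficiently many samples approximates the mass function. -/
theorem piE_not_approximates_empPMF_le {q : Fin k → ℝ} (hq : IsProbVec q) (hM : 0 < M) {t : ℝ}
    (ht : 0 < t) :
    piE q (fun z : Fin M → Fin k => ind (¬ Approximates 4 t (empPMF z) q)) ≤
      2 * k * Real.exp (-(M / (2 * t))) := by
  have hM0 : (0 : ℝ) < M := by exact_mod_cast hM
  have hsingle : ∀ i, ∑ j ∈ ({i} : Finset (Fin k)), q j = q i := fun i => Finset.sum_singleton _ _
  have hc : (((Finset.univ : Finset (Fin M)).card : ℕ) : ℝ) = M := by simp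
  have hpt : ∀ z : Fin M → Fin k, ind (¬ Approximates 4 t (empPMF z) q) ≤
      ∑ i, (ind (4 / t < q i ∧ cnt Finset.univ {i} z ≤ M * q i / 4) +
        ind (M * max (1 / t) (4 * q i) ≤ cnt Finset.univ {i} z)) := by
    intro z
    refine le_trans (ind_mono fun h => ?_) ((ind_exists_le (fun i =>
      (4 / t < q i ∧ cnt Finset.univ {i} z ≤ M * q i / 4) ∨
        (M * max (1 / t) (4 * q i) ≤ cnt Finset.univ {i} z))).trans
        (Finset.sum_le_sum fun i _ => ind_or_le _ _))
    by_contra hcon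
    push Not at hcon
    refine h fun i => ⟨?_, fun hi => ?_⟩
    · by_contra hi
      push Not at hi
      have h1 := le_max_left (empPMF z i) (1 / t)
      have h2 := le_max_right (empPMF z i) (1 / t)
      have h3 : 4 / t < q i := by
        have : 4 / t = 4 * (1 / t) := by ring
        linarith
      have h4 := (hcon i).1 h3
      have h5 : empPMF z i ≤ q i / 4 := by linarith
      rw [empPMF_eq_cnt, div_le_iff₀ hM0] at h5
      linarith
    · by_contra hi'
      push Not at hi'
      have h1 := (hcon i).2
      rw [mul_comm, ← div_lt_iff₀ hM0, ← empPMF_eq_cnt] at h1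
      exact absurd h1 (not_lt.2 (max_le hi.le hi'.le))
  refine (piE_mono hq hpt).trans ?_
  rw [piE_sum]
  simp only [piE_add]
  have hi : ∀ i, piE q (fun z : Fin M → Fin k =>
        ind (4 / t < q i ∧ cnt Finset.univ {i} z ≤ M * q i / 4)) +
      piE q (fun z : Fin M → Fin k => ind (M * max (1 / t) (4 * q i) ≤ cnt Finset.univ {i} z)) ≤
      2 * Real.exp (-(M / (2 * t))) := by
    intro i
    have b1 : piE q (fun z : Fin M → Fin k =>
        ind (4 / t < q i ∧ cnt Finset.univ {i} z ≤ M * q i / 4)) ≤ Real.exp (-(M / (2 * t))) := by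
      by_cases h : 4 / t < q i
      · refine (piE_mono hq fun z => ind_mono fun hz => hz.2).trans ?_
        have := piE_cnt_le_quarter hq (Finset.univ : Finset (Fin M)) {i}
        rw [hsingle, hc] at this
        refine this.trans (Real.exp_le_exp.2 (neg_le_neg ?_))
        calc (M : ℝ) / (2 * t) = M * (4 / t) / 8 := by field_simp; norm_num
          _ ≤ _ := by gcongr
      · refine le_trans (le_of_eq ?_) (Real.exp_pos _).le
        rw [← piE_const (ι := Fin M) hq 0]
        congr 1
        ext z
        exact ind_false fun hz => h hz.1
    have b2 := piE_le_cnt hq (Finset.univ : Finset (Fin M)) {i} (M * max (1 / t) (4 * q i))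
    rw [hsingle, hc] at b2
    have b3 : Real.exp (2 * (M * q i) - M * max (1 / t) (4 * q i)) ≤ Real.exp (-(M / (2 * t))) := by
      refine Real.exp_le_exp.2 ?_
      have h1 := mul_le_mul_of_nonneg_left (le_max_left (1 / t) (4 * q i)) hM0.le
      have h2 := mul_le_mul_of_nonneg_left (le_max_right (1 / t) (4 * q i)) hM0.le
      have h3 : (M : ℝ) / (2 * t) = M * (1 / t) / 2 := by field_simp
      linarith
    linarith
  refine (Finset.sum_le_sum fun i _ => hi i).trans (le_of_eq ?_)
  simp
  ring

end emp

section scale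

variable {c₀ δ : ℝ} {k n m : ℕ}

theorem scale_le (c₀ δ : ℝ) (k m : ℕ) : scale c₀ k m δ ≤ k := min_le_left _ _

theorem one_le_log_one_div (hδ : 0 < δ) (hδ1 : δ ≤ 1 / 4) : 1 ≤ Real.log (1 / δ) := by
  rw [Real.le_log_iff_exp_le (by positivity), le_div_iff₀ hδ]
  have := Real.exp_one_lt_d9
  have := Real.exp_pos 1
  nlinarith

/-- A nontrivial scale forces many samples in both halves of the third sample. -/
theorem le_half_div_scale (hc₀ : 0 < c₀) (hc₁ : c₀ ≤ 1 / 2) (hδ : 0 < δ) (hδ1 : δ ≤ 1 / 4)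
    (hn : 1 ≤ n) (ht : (n : ℝ) < scale c₀ k m δ) :
    0 < m / 2 ∧ n ≤ m - m / 2 ∧
      Real.log (1 / δ) / (6 * c₀) ≤ (m / 2 : ℕ) / (2 * scale c₀ k m δ) := by
  have hL := one_le_log_one_div hδ hδ1
  have hn0 : (1 : ℝ) ≤ n := by exact_mod_cast hn
  have hm0 : (0 : ℝ) ≤ m := by positivity
  have h1 : scale c₀ k m δ * Real.log (1 / δ) ≤ c₀ * m := by
    rw [← le_div_iff₀ (by linarith)]
    exact min_le_right _ _
  have ht0 : 0 < scale c₀ k m δ := by linarith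
  have h2 : scale c₀ k m δ ≤ c₀ * m := le_trans (le_mul_of_one_le_right ht0.le hL) h1
  have h3 : (2 : ℝ) * n < m := by nlinarith
  have h4 : 2 * n < m := by exact_mod_cast h3
  refine ⟨by omega, by omega, ?_⟩
  have h5 : (m : ℝ) ≤ 3 * (m / 2 : ℕ) := by
    have : m ≤ 3 * (m / 2) := by omega
    exact_mod_cast this
  rw [div_le_div_iff₀ (by positivity) (by positivity)]
  nlinarith

end scale

/-! ### Separating sets from samples -/

section goodAtLevel

variable {k n : ℕ} {t c c' ε : ℝ} {p q : Measure (Fin k)} {r : Fin k → ℝ}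

theorem sep_eq_sum (hp : p ∈ PD k) (hq : q ∈ PD k) (S : Finset (Fin k)) :
    sep p q S = ∑ i ∈ S, (pv p i - pv q i) := by
  rw [sep, real_coe_eq_sum hp, real_coe_eq_sum hq, Finset.sum_sub_distrib]

theorem two_mul_tv (p q : Measure (Fin k)) : 2 * tv p q = ∑ i, |pv p i - pv q i| := by
  unfold tv pv
  ring

theorem goodAtLevel_of_le (hp : p ∈ PD k) (hq : q ∈ PD k) (hc : 0 < c) (hc' : c ≤ c')
    (hc4 : c ≤ 1 / 4) (hr : Approximates 4 t r (pv q)) (hn : 1 ≤ n) (ht : (n : ℝ) < t) (hk : t ≤ k)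
    {x y : Fin n → Fin k} {js : Fin (numLevels t n + 2) × Bool}
    (h : c' * ((ε / numLevels t n) ^ 2 * levelRate k n t (js.1 : ℕ)) ≤
      |∑ i ∈ sepSet t r x y js, (pv p i - pv q i)|) :
    GoodAtLevel c ε t n p q js.1 (sepSet t r x y js) := by
  have hn0 : (0 : ℝ) < n := by exact_mod_cast hn
  have ht0 : 0 < t := hn0.trans ht
  have hq' := isProbVec_pv hq
  refine ⟨?_, ?_⟩
  · rw [sep_eq_sum hp hq]
    refine le_trans ?_ h
    have := (levelRate_pos hn ht hk js.1).le
    change c * (ε / numLevels t n) ^ 2 * levelRate k n t (js.1 : ℕ) ≤ _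
    rw [mul_assoc]
    gcongr
  · have h1 := sum_sepSet_le (by norm_num : (1 : ℝ) ≤ 4) hq' hr hn ht x y js
    have hprob : IsProbabilityMeasure q := hq
    refine (min_le_right _ _).trans ?_
    calc _ ≤ q.real (sepSet t r x y js : Set (Fin k)) * 1 := by
          gcongr
          exact measureReal_le_one
      _ = ∑ i ∈ sepSet t r x y js, pv q i := by rw [mul_one, real_coe_eq_sum hq]
      _ ≤ 4 * (n * 2 ^ (js.1 : ℕ) / t) := h1
      _ ≤ 1 / c * (n * 2 ^ (js.1 : ℕ) / t) := by
          gcongr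
          rw [le_div_iff₀ hc]; linarith
      _ = _ := by field_simp

end goodAtLevel

/-- The selection rule succeeds with high probability, for fixed `r`. -/
theorem exists_selection_fixed : ∃ c : ℝ, 0 < c ∧ c ≤ 1 ∧ ∃ b : ℝ, 1 ≤ b ∧
    ∀ {k n : ℕ} {t ε Λ : ℝ}, 1 ≤ n → (n : ℝ) < t → t ≤ k → 0 < ε →
    2 * ε ≤ numLevels t n → 1 ≤ Λ →
    b ^ 2 * (k * Λ) ≤ n ^ 2 * (ε / numLevels t n) ^ 4 * (t / k) →
    ∃ sel : (Fin k → ℝ) → (Fin n → Fin k) → (Fin n → Fin k) → Fin (numLevels t n + 2) × Bool,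
    ∀ p q : Measure (Fin k), p ∈ PD k → q ∈ PD k → ε ≤ tv p q →
    ∀ r : Fin k → ℝ, Approximates 4 t r (pv q) →
    piE (pv p) (fun x : Fin n → Fin k => piE (pv q) (fun y : Fin n → Fin k =>
      ind (¬ c * ((ε / numLevels t n) ^ 2 * levelRate k n t ((sel r x y).1 : ℕ)) ≤
        |∑ i ∈ sepSet t r x y (sel r x y), (pv p i - pv q i)|))) ≤ 34 * k * Real.exp (-Λ) := by
  obtain ⟨c, hc, b, hb, h⟩ := exists_selection (by norm_num : (1 : ℝ) ≤ 4)
  refine ⟨min c 1, by positivity, min_le_right _ _, b, hb, ?_⟩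
  intro k n t ε Λ hn ht hk hε hℓ hΛ hcond
  have hn0 : (0 : ℝ) < n := by exact_mod_cast hn
  have ht0 : 0 < t := hn0.trans ht
  have hk0 : (0 : ℝ) < k := ht0.trans_le hk
  have htk : t / k ≤ 1 := by rw [div_le_one hk0]; exact hk
  have hℓ1 : (1 : ℝ) ≤ numLevels t n := by exact_mod_cast one_le_numLevels hn ht
  have he : ε / numLevels t n ≤ 1 / 2 := by
    rw [div_le_iff₀ (by linarith)]; linarith
  have he0 : 0 ≤ ε / numLevels t n := by positivity
  have hk1 : (1 : ℝ) ≤ k := by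
    have : 0 < k := by exact_mod_cast hk0
    exact_mod_cast this
  -- a single sample has an empty first half, but then the rate condition fails
  have hn2 : 2 ≤ n := by
    by_contra hlt
    have hn1 : (n : ℝ) = 1 := by
      have : n = 1 := by omega
      rw [this]; norm_num
    have h1 : (1 : ℝ) ≤ b ^ 2 * (k * Λ) := by
      have : 1 ≤ b ^ 2 := one_le_pow₀ hb
      have : 1 ≤ k * Λ := one_le_mul_of_one_le_of_one_le hk1 hΛ
      exact one_le_mul_of_one_le_of_one_le ‹_› ‹_›
    have h2 : (n : ℝ) ^ 2 * (ε / numLevels t n) ^ 4 * (t / k) ≤ 1 ^ 2 * (1 / 2) ^ 4 * 1 := by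
      rw [hn1]; gcongr
    norm_num at h2
    linarith
  obtain ⟨sel, hsel⟩ := h hn2 ht hk hε.le he (by linarith) hcond
  refine ⟨sel, fun p q hp hq hpq r hr => ?_⟩
  refine (piE_mono (isProbVec_pv hp) fun x => piE_mono (isProbVec_pv hq) fun y =>
    ind_mono fun hnot hle => hnot ?_).trans (hsel _ _ r (isProbVec_pv hp) (isProbVec_pv hq) hr ?_)
  · rw [← two_mul_tv]; linarith
  · refine le_trans ?_ hle
    have := (levelRate_pos hn ht hk (sel r x y).1).le
    gcongr
    exact min_le_left _ _

/-- The selection rule succeeds with high probability, for the empirical mass function of samples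
from `q`. -/
theorem piE_piE_piE_selection_le {k n M : ℕ} {t c' ε Λ Λ' : ℝ} {p q : Measure (Fin k)}
    (hp : p ∈ PD k) (hq : q ∈ PD k) (hM : 0 < M) (ht : 0 < t) (hΛ' : Λ' ≤ M / (2 * t))
    {sel : (Fin k → ℝ) → (Fin n → Fin k) → (Fin n → Fin k) → Fin (numLevels t n + 2) × Bool}
    (hsel : ∀ r : Fin k → ℝ, Approximates 4 t r (pv q) →
      piE (pv p) (fun x : Fin n → Fin k => piE (pv q) (fun y : Fin n → Fin k =>
      ind (¬ c' * ((ε / numLevels t n) ^ 2 * levelRate k n t ((sel r x y).1 : ℕ)) ≤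
        |∑ i ∈ sepSet t r x y (sel r x y), (pv p i - pv q i)|))) ≤ 34 * k * Real.exp (-Λ)) :
    piE (pv p) (fun x : Fin n → Fin k => piE (pv q) (fun y : Fin n → Fin k =>
      piE (pv q) (fun z : Fin M → Fin k =>
      ind (¬ (Approximates 4 t (empPMF z) (pv q) ∧
        c' * ((ε / numLevels t n) ^ 2 * levelRate k n t ((sel (empPMF z) x y).1 : ℕ)) ≤
        |∑ i ∈ sepSet t (empPMF z) x y (sel (empPMF z) x y), (pv p i - pv q i)|))))) ≤
    2 * k * Real.exp (-Λ') + 34 * k * Real.exp (-Λ) := by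
  have hp' := isProbVec_pv hp
  have hq' := isProbVec_pv hq
  refine (le_of_eq (congrArg (piE (pv p)) (funext fun x => piE_comm _))).trans ?_
  rw [piE_comm]
  have hz : ∀ z : Fin M → Fin k,
      piE (pv p) (fun x : Fin n → Fin k => piE (pv q) (fun y : Fin n → Fin k =>
        ind (¬ (Approximates 4 t (empPMF z) (pv q) ∧
        c' * ((ε / numLevels t n) ^ 2 * levelRate k n t ((sel (empPMF z) x y).1 : ℕ)) ≤
        |∑ i ∈ sepSet t (empPMF z) x y (sel (empPMF z) x y), (pv p i - pv q i)|)))) ≤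
      ind (¬ Approximates 4 t (empPMF z) (pv q)) + 34 * k * Real.exp (-Λ) := by
    intro z
    by_cases h : Approximates 4 t (empPMF z) (pv q)
    · rw [ind_false (not_not.2 h), zero_add]
      refine le_trans (piE_mono hp' fun x => piE_mono hq' fun y => ind_mono fun hn hle => ?_)
        (hsel _ h)
      exact hn ⟨h, hle⟩
    · rw [ind_true h]
      refine le_trans (piE_mono hp' fun x => piE_mono hq' fun y => ind_le_one _) ?_
      simp only [piE_const hp', piE_const hq']
      have : 0 ≤ 34 * k * Real.exp (-Λ) := by positivity
      linarith
  refine (piE_mono hq' hz).trans ?_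
  rw [piE_add, piE_const hq']
  gcongr
  refine (piE_not_approximates_empPMF_le hq' hM ht).trans ?_
  gcongr

/-! ### Classifier-accuracy tests with a separating set -/

theorem accStat_eq_freqDiff {k a b : ℕ} (S : Finset (Fin k)) (A : Fin a → Fin k)
    (B : Fin b → Fin k) : accStat S A B = freqDiff S A B := by
  simp [accStat, freqDiff, cnt]

section threshold

variable {δ τ : ℝ} {n : ℕ}

theorem log_one_div_nonneg (hδ : 0 < δ) (hδ1 : δ ≤ 1) : 0 ≤ Real.log (1 / δ) :=
  Real.log_nonneg (by rw [le_div_iff₀ hδ]; linarith)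

/-- The constant `6400` in the threshold is `20 ^ 2 * 4 * 4`, for mass `4 τ` and error exponent
`4 log (1/δ)`. -/
theorem noise_le_accThreshold (hn : 0 < n) (hδ : 0 < δ) (hδ1 : δ ≤ 1) :
    20 * noise (4 * τ) n (4 * Real.log (1 / δ)) ≤ accThreshold 6400 δ n τ := by
  have hL := log_one_div_nonneg hδ hδ1
  have hn0 : (0 : ℝ) < n := by exact_mod_cast hn
  unfold noise accThreshold
  have h1 : 20 * Real.sqrt (4 * τ * (4 * Real.log (1 / δ)) / n) =
      Real.sqrt (6400 * τ * Real.log (1 / δ) / n) := by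
    rw [show 6400 * τ * Real.log (1 / δ) / n = 20 ^ 2 * (4 * τ * (4 * Real.log
        (1 / δ)) / n) by ring,
      Real.sqrt_mul (by norm_num), Real.sqrt_sq (by norm_num)]
  have h2 : 0 ≤ Real.log (1 / δ) / n := by positivity
  have h3 : 20 * (4 * Real.log (1 / δ) / n) = 80 * (Real.log (1 / δ) / n) := by ring
  have h4 : 6400 * Real.log (1 / δ) / n = 6400 * (Real.log (1 / δ) / n) := by ring
  rw [mul_add, h1, h3, h4]
  linarith

theorem accThreshold_le_noise {Λ : ℝ} (hn : 0 < n) (hτ : 0 ≤ τ) (hδ : 0 < δ) (hδ1 : δ ≤ 1)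
    (hΛ : Real.log (1 / δ) ≤ Λ) : accThreshold 6400 δ n τ ≤ 6400 * noise τ n Λ := by
  have hL := log_one_div_nonneg hδ hδ1
  have hn0 : (0 : ℝ) < n := by exact_mod_cast hn
  unfold noise accThreshold
  have h1 : Real.sqrt (6400 * τ * Real.log (1 / δ) / n) ≤ 6400 * Real.sqrt (τ * Λ / n) := by
    calc Real.sqrt (6400 * τ * Real.log (1 / δ) / n) ≤ Real.sqrt (80 ^ 2 * (τ * Λ / n)) := by
          refine Real.sqrt_le_sqrt ?_
          calc 6400 * τ * Real.log (1 / δ) / n ≤ 6400 * τ * Λ / n := by gcongr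
            _ = _ := by ring
      _ = 80 * Real.sqrt (τ * Λ / n) := by
          rw [Real.sqrt_mul (by norm_num), Real.sqrt_sq (by norm_num)]
      _ ≤ _ := by
          have := Real.sqrt_nonneg (τ * Λ / n)
          linarith
  have h2 : 6400 * Real.log (1 / δ) / n ≤ 6400 * (Λ / n) := by
    rw [mul_div_assoc]; gcongr
  linarith

theorem four_mul_exp_le (hδ : 0 < δ) (hδ1 : δ ≤ 1 / 2) :
    4 * Real.exp (-(4 * Real.log (1 / δ))) ≤ δ / 2 := by
  have h : Real.exp (-(4 * Real.log (1 / δ))) = δ ^ 4 := by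
    rw [one_div, Real.log_inv, show -(4 * -Real.log δ) = ((4 : ℕ) : ℝ) *
        Real.log δ by push_cast; ring,
      Real.exp_nat_mul, Real.exp_log hδ]
  rw [h]
  have h3 : δ ^ 3 ≤ (1 / 2) ^ 3 := by gcongr
  have h4 : δ ^ 4 = δ ^ 3 * δ := by ring
  rw [h4]
  nlinarith

variable {k b : ℕ} {p q : Fin k → ℝ} {S : Finset (Fin k)}

theorem piE_piE_accStat_null_le (hq : IsProbVec q) (hn : 0 < n) (hb : n ≤ b) (hτ : 0 < τ)
    (hS : ∑ i ∈ S, q i ≤ 4 * τ) (hδ : 0 < δ) (hδ1 : δ ≤ 1 / 2) :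
    piE q (fun x : Fin n → Fin k => piE q (fun y : Fin b → Fin k =>
      ind (accThreshold 6400 δ n τ < |accStat S x y|))) ≤ δ / 2 := by
  refine le_trans (piE_mono hq fun x => piE_mono hq fun y => ind_mono fun h => ?_)
    ((piE_piE_freqDiff_le (ι := Fin n) (ι' := Fin b) hq hq (by positivity : 0 < 4 * τ) hS
      (ν := n) (by exact_mod_cast hn) (by simp) (by simpa using hb)
      (mul_nonneg (by norm_num) (log_one_div_nonneg hδ (by linarith)))).trans
      (four_mul_exp_le hδ hδ1))
  simp only [sub_self, Finset.sum_const_zero, abs_zero, zero_div, zero_add, sub_zero]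
  rw [← accStat_eq_freqDiff]
  exact (noise_le_accThreshold hn hδ (by linarith)).trans_lt h

theorem piE_piE_accStat_alt_le (hp : IsProbVec p) (hq : IsProbVec q) (hn : 0 < n) (hb : n ≤ b)
    (hτ : 0 < τ) (hS : ∑ i ∈ S, q i ≤ 4 * τ) (hδ : 0 < δ) (hδ1 : δ ≤ 1 / 2)
    (h3 : 3 * accThreshold 6400 δ n τ < |∑ i ∈ S, (p i - q i)|) :
    piE p (fun x : Fin n → Fin k => piE q (fun y : Fin b → Fin k =>
      ind (¬ accThreshold 6400 δ n τ < |accStat S x y|))) ≤ δ / 2 := by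
  refine le_trans (piE_mono hp fun x => piE_mono hq fun y => ind_mono fun h => ?_)
    ((piE_piE_freqDiff_le (ι := Fin n) (ι' := Fin b) hp hq (by positivity : 0 < 4 * τ) hS
      (ν := n) (by exact_mod_cast hn) (by simp) (by simpa using hb)
      (mul_nonneg (by norm_num) (log_one_div_nonneg hδ (by linarith)))).trans
      (four_mul_exp_le hδ hδ1))
  rw [← accStat_eq_freqDiff]
  have h1 := noise_le_accThreshold (τ := τ) hn hδ (by linarith)
  have h2 := abs_sub_abs_le_abs_sub (∑ i ∈ S, (p i - q i)) (accStat S x y)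
  rw [abs_sub_comm] at h2
  have h4 := noise_nonneg (s := 4 * τ) (ν := n) (Λ := 4 * Real.log (1 / δ)) (by positivity)
    (mul_nonneg (by norm_num) (log_one_div_nonneg hδ (by linarith)))
  push Not at h
  linarith

theorem real_accStat_null_le {P : Measure (Fin k)} (hP : P ∈ PD k) (hn : 0 < n) (hb : n ≤ b)
    (hτ : 0 < τ) (hS : ∑ i ∈ S, pv P i ≤ 4 * τ) (hδ : 0 < δ) (hδ1 : δ ≤ 1 / 2) :
    ((iid P n).prod (iid P b)).real
      {ω | accThreshold 6400 δ n τ < |accStat S ω.1 ω.2|} ≤ δ / 2 := by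
  rw [real_iid_prod₂ hP hP (fun ω => accThreshold 6400 δ n τ < |accStat S ω.1 ω.2|)]
  exact piE_piE_accStat_null_le (isProbVec_pv hP) hn hb hτ hS hδ hδ1

theorem real_accStat_alt_le {P Q : Measure (Fin k)} (hP : P ∈ PD k) (hQ : Q ∈ PD k) (hn : 0 < n)
    (hb : n ≤ b) (hτ : 0 < τ) (hS : ∑ i ∈ S, pv Q i ≤ 4 * τ) (hδ : 0 < δ) (hδ1 : δ ≤ 1 / 2)
    (h3 : 3 * accThreshold 6400 δ n τ < |∑ i ∈ S, (pv P i - pv Q i)|) :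
    ((iid P n).prod (iid Q b)).real
      {ω | ¬ accThreshold 6400 δ n τ < |accStat S ω.1 ω.2|} ≤ δ / 2 := by
  rw [real_iid_prod₂ hP hQ (fun ω => ¬ accThreshold 6400 δ n τ < |accStat S ω.1 ω.2|)]
  exact piE_piE_accStat_alt_le (isProbVec_pv hP) (isProbVec_pv hQ) hn hb hτ hS hδ hδ1 h3

theorem exp_neg_six_log_le (hk : 2 ≤ k) (hδ : 0 < δ) (hδ1 : δ ≤ 1 / 2) :
    136 * k * Real.exp (-(6 * Real.log (k / δ))) ≤ δ := by
  have hk0 : (2 : ℝ) ≤ k := by exact_mod_cast hk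
  have h : Real.exp (-(6 * Real.log (k / δ))) = (δ / k) ^ 6 := by
    rw [show -(6 * Real.log (k / δ)) = ((6 : ℕ) : ℝ) * Real.log (δ / k) by
      rw [← inv_div, Real.log_inv]; push_cast; ring,
      Real.exp_nat_mul, Real.exp_log (by positivity)]
  rw [h]
  have h1 : δ / k ≤ 1 / 4 := by
    rw [div_le_iff₀ (by linarith)]; linarith
  have h2 : (δ / k) ^ 5 ≤ (1 / 4) ^ 5 := by gcongr
  calc 136 * k * (δ / k) ^ 6 = 136 * δ * (δ / k) ^ 5 := by field_simp
    _ ≤ 136 * δ * (1 / 4) ^ 5 := by gcongr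
    _ ≤ δ := by norm_num; linarith

theorem one_le_log_div (hk : 2 ≤ k) (hδ : 0 < δ) (hδ1 : δ ≤ 1 / 2) : 1 ≤ Real.log (k / δ) := by
  have hk0 : (2 : ℝ) ≤ k := by exact_mod_cast hk
  have h1 : δ / k ≤ 1 / 4 := by
    rw [div_le_iff₀ (by linarith)]; linarith
  have := one_le_log_one_div (by positivity) h1
  rwa [one_div_div] at this

theorem log_one_div_le_log_div (hk : 2 ≤ k) (hδ : 0 < δ) :
    Real.log (1 / δ) ≤ Real.log (k / δ) := by
  have hk0 : (2 : ℝ) ≤ k := by exact_mod_cast hk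
  refine Real.log_le_log (by positivity) ?_
  gcongr
  linarith

end threshold

section tests

/-- The separation of a successfully selected set is well above the threshold. -/
theorem three_mul_accThreshold_lt {k n : ℕ} {t e δ Λ b c : ℝ} (hn : 1 ≤ n) (ht : (n : ℝ) < t)
    (hk : t ≤ k) (he0 : 0 < e) (he1 : e ≤ 1) (hδ : 0 < δ) (hδ1 : δ ≤ 1)
    (hΛ : Real.log (1 / δ) ≤ Λ) (hb : 1 ≤ b)
    (hB : b ^ 2 * (k * Λ) ≤ n ^ 2 * e ^ 4 * (t / k)) (hc : 38400 < b * c) (j : ℕ) :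
    3 * accThreshold 6400 δ n (n * 2 ^ j / t) < c * (e ^ 2 * levelRate k n t j) := by
  have hn0 : (0 : ℝ) < n := by exact_mod_cast hn
  have ht0 : 0 < t := hn0.trans ht
  have h1 := accThreshold_le_noise (τ := n * 2 ^ j / t) hn (by positivity) hδ hδ1 hΛ
  have h2 := noise_le_levelRate hn ht hk he0.le he1 ((log_one_div_nonneg hδ hδ1).trans hΛ) hb hB j
  have h3 := levelRate_pos hn ht hk j
  have h4 : 0 < e ^ 2 * levelRate k n t j := by positivity
  calc _ ≤ 3 * (6400 * (2 / b * (e ^ 2 * levelRate k n t j))) := by linarith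
    _ = 38400 / b * (e ^ 2 * levelRate k n t j) := by ring
    _ < _ := by
      gcongr
      rw [div_lt_iff₀ (by linarith)]; linarith

/-- Training and testing each fail with probability at most `δ / 2`: the selection rule is run with
error exponent `6 log (k/δ)`, and the threshold exceeds the fluctuations of the test statistic. -/
theorem gofClassifierTest_of_le : ∃ b : ℝ, 1 ≤ b ∧ ∀ {k n : ℕ} {ε δ : ℝ}, 0 < ε → 0 < δ →
    δ ≤ 1 / 2 → 1 ≤ n → n < k → 2 * ε ≤ numLevels k n →
    b ^ 2 * (k * (6 * Real.log (k / δ))) ≤ n ^ 2 * (ε / numLevels k n) ^ 4 →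
    GoFClassifierTest 6400 k n ε δ := by
  obtain ⟨c, hc, -, b, hb, h⟩ := exists_selection_fixed
  refine ⟨b + 38400 / c, by have : 0 < 38400 / c := by positivity
                            linarith, ?_⟩
  intro k n ε δ hε hδ hδ1 hn hnk hℓ hcond P₀ hP₀
  have hk2 : 2 ≤ k := by omega
  have hk0 : (0 : ℝ) < k := by exact_mod_cast (by omega : 0 < k)
  have hnk' : (n : ℝ) < k := by exact_mod_cast hnk
  have hn0 : (0 : ℝ) < n := by exact_mod_cast hn
  have hlog := one_le_log_div hk2 hδ hδ1
  have hlog' := log_one_div_le_log_div hk2 hδ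
  have hℓ1 : (1 : ℝ) ≤ numLevels k n := by exact_mod_cast one_le_numLevels hn hnk'
  have he0 : 0 < ε / numLevels k n := by positivity
  have he : ε / numLevels k n ≤ 1 := by
    rw [div_le_iff₀ (by linarith)]; linarith
  have hc0 : 0 < 38400 / c := by positivity
  rw [← mul_one ((n : ℝ) ^ 2 * (ε / numLevels k n) ^ 4), ← div_self hk0.ne'] at hcond
  obtain ⟨sel, hsel⟩ := h hn hnk' le_rfl hε hℓ (by linarith : 1 ≤ 6 * Real.log (k / δ))
    (le_trans (by gcongr; linarith) hcond)
  have hP₀' := isProbVec_pv hP₀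
  have hprob₀ := isProbabilityMeasure_iid hP₀ n
  have happ := approximates_self (t := k) (pv P₀) hP₀'.nonneg (by norm_num : (1 : ℝ) ≤ 4)
  have hmass := fun x y js => sum_sepSet_le (by norm_num : (1 : ℝ) ≤ 4) hP₀' happ hn hnk' x y js
  refine ⟨fun ω => sel (pv P₀) ω.1 ω.2, ?_, fun P hP hPε => ?_⟩
  · refine (real_prod_le _ _ _ (fun _ => False) (δ / 2) (by linarith) fun x _ => ?_).trans ?_
    · have key := real_accStat_null_le hP₀ hn le_rfl
        (by positivity : 0 < (n : ℝ) * 2 ^ ((sel (pv P₀) x.1 x.2).1 : ℕ) / k)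
        (hmass x.1 x.2 (sel (pv P₀) x.1 x.2)) hδ hδ1
      exact key
    · simp; linarith
  · have hP' := isProbVec_pv hP
    have hprob := isProbabilityMeasure_iid hP n
    refine (real_prod_le _ _ _ (fun ω : (Fin n → Fin k) × (Fin n → Fin k) => ¬ c *
        ((ε / numLevels k n) ^ 2 *
      levelRate k n k ((sel (pv P₀) ω.1 ω.2).1 : ℕ)) ≤
        |∑ i ∈ sepSet k (pv P₀) ω.1 ω.2 (sel (pv P₀) ω.1 ω.2), (pv P i - pv P₀ i)|)
        (δ / 2) (by linarith) fun x hx => ?_).trans ?_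
    · have key := real_accStat_alt_le hP hP₀ hn le_rfl
        (by positivity : 0 < (n : ℝ) * 2 ^ ((sel (pv P₀) x.1 x.2).1 : ℕ) / k)
        (hmass x.1 x.2 (sel (pv P₀) x.1 x.2)) hδ hδ1
      refine key (lt_of_lt_of_le ?_ (not_not.1 hx))
      refine three_mul_accThreshold_lt hn hnk' le_rfl he0 he hδ (by linarith)
        (Λ := 6 * Real.log (k / δ)) (by linarith) (by linarith : 1 ≤ b + 38400 / c) hcond ?_ _
      rw [add_mul, div_mul_cancel₀ _ hc.ne']
      have : 0 < b * c := by positivity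
      linarith
    · rw [real_iid_prod₂ hP hP₀]
      have h1 := hsel P P₀ hP hP₀ hPε (pv P₀) happ
      have h2 := exp_neg_six_log_le hk2 hδ hδ1
      linarith

/-- If `P_Z = P_X`, the mass of the selected set is controlled by the level sets of the empirical
mass function of `P_X`, and its separation plays no role; if `P_Z = P_Y`, the selected set separates
`P_X` from `P_Y`. -/
theorem lfhtClassifierTest_of_le : ∃ b : ℝ, 1 ≤ b ∧ ∀ {c₀ : ℝ} {k n m : ℕ} {ε δ : ℝ},
    0 < c₀ → c₀ ≤ 1 / 36 → 0 < ε → 0 < δ → δ ≤ 1 / 2 → 1 ≤ n → (n : ℝ) < scale c₀ k m (δ / k) →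
    2 * ε ≤ numLevels (scale c₀ k m (δ / k)) n →
    b ^ 2 * (k * (6 * Real.log (k / δ))) ≤
      n ^ 2 * (ε / numLevels (scale c₀ k m (δ / k)) n) ^ 4 * (scale c₀ k m (δ / k) / k) →
    LFHTClassifierTest 6400 c₀ k n m ε δ := by
  obtain ⟨c, hc, -, b, hb, h⟩ := exists_selection_fixed
  refine ⟨b + 38400 / c, by have : 0 < 38400 / c := by positivity
                            linarith, ?_⟩
  intro c₀ k n m ε δ hc₀ hc₁ hε hδ hδ1 hn hnt hℓ hcond
  have hδk : 0 < k → δ / k ≤ δ := fun hk => div_le_self hδ.le (by exact_mod_cast hk)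
  have hk := scale_le c₀ (δ / k) k m
  have hk2 : 2 ≤ k := by
    have h1 : (n : ℝ) < k := hnt.trans_le hk
    have h2 : n < k := by exact_mod_cast h1
    omega
  have hk0 : (0 : ℝ) < k := by exact_mod_cast (by omega : 0 < k)
  have hk2' : (2 : ℝ) ≤ k := by exact_mod_cast hk2
  have hδk4 : δ / k ≤ 1 / 4 := by
    rw [div_le_iff₀ hk0]; linarith
  obtain ⟨hM, hnm, hMt⟩ := le_half_div_scale hc₀ (by linarith) (by positivity) hδk4 hn hnt
  rw [one_div_div] at hMt
  unfold LFHTClassifierTest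
  generalize scale c₀ k m (δ / k) = t at *
  have hn0 : (0 : ℝ) < n := by exact_mod_cast hn
  have ht0 : 0 < t := hn0.trans hnt
  have hlog := one_le_log_div hk2 hδ hδ1
  have hlog' := log_one_div_le_log_div hk2 hδ
  have hM6 : 6 * Real.log (k / δ) ≤ (m / 2 : ℕ) / (2 * t) := by
    refine le_trans ?_ hMt
    rw [le_div_iff₀ (by positivity)]
    nlinarith
  have hℓ1 : (1 : ℝ) ≤ numLevels t n := by exact_mod_cast one_le_numLevels hn hnt
  have he0 : 0 < ε / numLevels t n := by positivity
  have he : ε / numLevels t n ≤ 1 := by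
    rw [div_le_iff₀ (by linarith)]; linarith
  have hc0 : 0 < 38400 / c := by positivity
  have hexp := exp_neg_six_log_le hk2 hδ hδ1
  obtain ⟨sel, hsel⟩ := h hn hnt hk hε hℓ (by linarith : 1 ≤ 6 * Real.log (k / δ))
    (le_trans (by gcongr; linarith) hcond)
  intro _
  refine ⟨fun ω => sel (empPMF ω.2.2) ω.1 ω.2.1, ?_⟩
  intro _ _ PX hPX PY hPY hε'
  have hX := isProbVec_pv hPX
  have hY := isProbVec_pv hPY
  have i1 := isProbabilityMeasure_iid hPX n
  have i2 := isProbabilityMeasure_iid hPY n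
  have i3 := isProbabilityMeasure_iid hPX (m / 2)
  have i4 := isProbabilityMeasure_iid hPY (m / 2)
  have i5 := isProbabilityMeasure_iid hPX (m - m / 2)
  have i6 := isProbabilityMeasure_iid hPY (m - m / 2)
  refine ⟨?_, ?_⟩
  · refine (real_prod_le _ _ _
      (fun ω : (Fin n → Fin k) × (Fin n → Fin k) × (Fin (m / 2) → Fin k) =>
        ¬ Approximates 4 t (empPMF ω.2.2) (pv PX)) (δ / 2) (by linarith) fun x hx => ?_).trans ?_
    · have key := real_accStat_null_le hPX hn hnm
        (by positivity : 0 < (n : ℝ) * 2 ^ ((sel (empPMF x.2.2) x.1 x.2.1).1 : ℕ) / t)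
        (sum_sepSet_le (by norm_num : (1 : ℝ) ≤ 4) hX (not_not.1 hx) hn hnt x.1 x.2.1 _) hδ hδ1
      exact key
    · rw [real_iid_prod₃ hPX hPY hPX]
      simp only [piE_const hX, piE_const hY]
      have h1 := piE_not_approximates_empPMF_le hX hM ht0
      have h2 : Real.exp (-((m / 2 : ℕ) / (2 * t))) ≤ Real.exp (-(6 * Real.log (k / δ))) :=
        Real.exp_le_exp.2 (neg_le_neg hM6)
      have h3 := mul_le_mul_of_nonneg_left h2 hk0.le
      linarith
  · refine (real_prod_le _ _ _
      (fun ω : (Fin n → Fin k) × (Fin n → Fin k) × (Fin (m / 2) → Fin k) =>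
        ¬ (Approximates 4 t (empPMF ω.2.2) (pv PY) ∧ c * ((ε / numLevels t n) ^ 2 *
          levelRate k n t ((sel (empPMF ω.2.2) ω.1 ω.2.1).1 : ℕ)) ≤
          |∑ i ∈ sepSet t (empPMF ω.2.2) ω.1 ω.2.1 (sel (empPMF ω.2.2) ω.1 ω.2.1),
            (pv PX i - pv PY i)|)) (δ / 2) (by linarith) fun x hx => ?_).trans ?_
    · obtain ⟨hx1, hx2⟩ := not_not.1 hx
      have key := real_accStat_alt_le hPX hPY hn hnm
        (by positivity : 0 < (n : ℝ) * 2 ^ ((sel (empPMF x.2.2) x.1 x.2.1).1 : ℕ) / t)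
        (sum_sepSet_le (by norm_num : (1 : ℝ) ≤ 4) hY hx1 hn hnt x.1 x.2.1 _) hδ hδ1
      refine key (lt_of_lt_of_le ?_ hx2)
      refine three_mul_accThreshold_lt hn hnt hk he0 he hδ (by linarith)
        (Λ := 6 * Real.log (k / δ)) (by linarith) (by linarith : 1 ≤ b + 38400 / c) hcond ?_ _
      rw [add_mul, div_mul_cancel₀ _ hc.ne']
      have : 0 < b * c := by positivity
      linarith
    · rw [real_iid_prod₃ hPX hPY hPY]
      have h1 := piE_piE_piE_selection_le hPX hPY hM ht0 hM6 (hsel PX PY hPX hPY hε')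
      have h3 : 0 ≤ k * Real.exp (-(6 * Real.log (k / δ))) := by positivity
      linarith

end tests

/-! ### Distributions supported on an embedded alphabet -/

section embed

variable {k : ℕ} {β : Type*} [Fintype β] [DecidableEq β]

/-- The distribution on `[k]` with probability vector `w`. -/
noncomputable def vecMeasure (w : Fin k → ℝ) : Measure (Fin k) :=
  ∑ i, ENNReal.ofReal (w i) • Measure.dirac i

theorem pv_vecMeasure {w : Fin k → ℝ} (hw : IsProbVec w) : pv (vecMeasure w) = w := by
  ext i
  simp only [pv, vecMeasure, measureReal_def, Measure.coe_finsetSum, Finset.sum_apply,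
    Measure.smul_apply, Measure.dirac_apply, smul_eq_mul, Set.indicator_apply,
    Set.mem_singleton_iff, Pi.one_apply, mul_ite, mul_one, mul_zero, Finset.sum_ite_eq',
    Finset.mem_univ, if_true]
  exact ENNReal.toReal_ofReal (hw.nonneg i)

theorem vecMeasure_mem_PD {w : Fin k → ℝ} (hw : IsProbVec w) : vecMeasure w ∈ PD k := by
  refine ⟨?_⟩
  simp only [vecMeasure, Measure.coe_finsetSum, Finset.sum_apply, Measure.smul_apply,
    measure_univ, smul_eq_mul, mul_one]
  rw [← ENNReal.ofReal_sum_of_nonneg fun i _ => hw.nonneg i, hw.sum_eq_one, ENNReal.ofReal_one]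

/-- Probability vectors on an alphabet with at most `k` letters are realised by distributions on
`[k]`, compatibly with product expectations and total variation. -/
theorem exists_embedding (h : Fintype.card β ≤ k) :
    ∃ (Φ : (β → ℝ) → Measure (Fin k)) (e : β → Fin k),
      (∀ w, IsProbVec w → Φ w ∈ PD k) ∧
      (∀ w, IsProbVec w → ∀ (n : ℕ) (F : (Fin n → Fin k) → ℝ),
        piE (pv (Φ w)) F = piE w (fun ω : Fin n → β => F (fun a => e (ω a)))) ∧
      ∀ w w', IsProbVec w → IsProbVec w' → tv (Φ w) (Φ w') = 1 / 2 * ∑ b, |w b - w' b| := by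
  obtain ⟨e⟩ : Nonempty (β ↪ Fin k) := Function.Embedding.nonempty_of_card_le (by simpa using h)
  have hpush : ∀ w : β → ℝ, IsProbVec w → IsProbVec (fun i => ∑ b, if e b = i then w b else 0) := by
    intro w hw
    refine ⟨fun i => Finset.sum_nonneg fun b _ => ?_, ?_⟩
    · split_ifs
      exacts [hw.nonneg b, le_rfl]
    · rw [Finset.sum_comm]
      simp [hw.sum_eq_one]
  refine ⟨fun w => vecMeasure fun i => ∑ b, if e b = i then w b else 0, e,
    fun w hw => vecMeasure_mem_PD (hpush w hw), fun w hw n F => ?_, fun w w' hw hw' => ?_⟩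
  · rw [pv_vecMeasure (hpush w hw), piE_map (fun b => e b) F]
  · have h1 := two_mul_tv (vecMeasure fun i => ∑ b, if e b = i then w b else 0)
      (vecMeasure fun i => ∑ b, if e b = i then w' b else 0)
    rw [pv_vecMeasure (hpush w hw), pv_vecMeasure (hpush w' hw')] at h1
    have h2 : ∀ i, |(∑ b, if e b = i then w b else 0) - ∑ b, if e b = i then w' b else 0| =
        ∑ b, if e b = i then |w b - w' b| else 0 := by
      intro i
      by_cases hi : ∃ b, e b = i
      · obtain ⟨b, rfl⟩ := hi
        simp [e.injective.eq_iff]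
      · push Not at hi
        simp [hi]
    simp_rw [h2] at h1
    rw [Finset.sum_comm] at h1
    simp only [Finset.sum_ite_eq, Finset.mem_univ, if_true] at h1
    linarith

end embed

/-! ### Paired perturbations of the uniform distribution -/

/-- The sign of a Boolean. -/
def bsign (b : Bool) : ℝ := if b then 1 else -1

section paired

variable {K n : ℕ} {ε : ℝ}

/-- The uniform vector on `K` pairs. -/
noncomputable def unifPairs (K : ℕ) (_ : Fin K × Bool) : ℝ := 1 / (2 * K)

/-- The likelihood ratio of the perturbation of the uniform vector with sign pattern `v`. -/
noncomputable def pairRatio (ε : ℝ) (v : Fin K → Bool) (i : Fin K × Bool) : ℝ :=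
  1 + 2 * ε * (bsign (v i.1) * bsign i.2)

theorem isProbVec_unifPairs (hK : 0 < K) : IsProbVec (unifPairs K) := by
  have : (0 : ℝ) < K := by exact_mod_cast hK
  refine ⟨fun i => by unfold unifPairs; positivity, ?_⟩
  simp [unifPairs]
  field_simp

theorem isProbVec_pairRatio (hK : 0 < K) (hε : 0 ≤ ε) (hε1 : ε ≤ 1 / 2) (v : Fin K → Bool) :
    IsProbVec (fun i => unifPairs K i * pairRatio ε v i) := by
  have : (0 : ℝ) < K := by exact_mod_cast hK
  refine ⟨fun i => mul_nonneg (by unfold unifPairs; positivity) ?_, ?_⟩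
  · unfold pairRatio bsign
    split_ifs <;> linarith
  · simp only [unifPairs, pairRatio, Fintype.sum_prod_type, Fintype.sum_bool, bsign, if_true,
      Bool.false_eq_true, if_false]
    have : ∀ x : Fin K, 1 / (2 * (K : ℝ)) * (1 + 2 * ε * ((if v x = true then 1 else -1) * 1)) +
      1 / (2 * (K : ℝ)) * (1 + 2 * ε * ((if v x = true then 1 else -1) * -1)) = 1 / K := by
      intro x; field_simp; ring
    simp_rw [this]
    simp
    field_simp

theorem sum_abs_pairRatio (hK : 0 < K) (hε : 0 ≤ ε) (v : Fin K → Bool) :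
    ∑ i, |unifPairs K i - unifPairs K i * pairRatio ε v i| = 2 * ε := by
  have hK0 : (0 : ℝ) < K := by exact_mod_cast hK
  have : ∀ i, |unifPairs K i - unifPairs K i * pairRatio ε v i| = ε / K := by
    intro i
    have h1 : unifPairs K i - unifPairs K i * pairRatio ε v i =
        -(ε / K) * (bsign (v i.1) * bsign i.2) := by
      unfold unifPairs pairRatio; field_simp; ring
    have h2 : |bsign (v i.1) * bsign i.2| = 1 := by
      unfold bsign; split_ifs <;> simp
    rw [h1, abs_mul, h2, mul_one, abs_neg, abs_of_nonneg (by positivity)]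
  simp_rw [this]
  simp
  field_simp

/-- The uniform distribution on sign patterns. -/
noncomputable abbrev fairBool (_ : Bool) : ℝ := 1 / 2

theorem isProbVec_fairBool : IsProbVec fairBool :=
    ⟨fun _ => by norm_num [fairBool], by norm_num [fairBool]⟩

/-- The mixture likelihood ratio. -/
noncomputable def pairMix (ε : ℝ) (ω : Fin n → Fin K × Bool) : ℝ :=
  piE fairBool (fun v : Fin K → Bool => ∏ a, pairRatio ε v (ω a))

theorem piE_mul_prod {ι α : Type*} [Fintype ι] [DecidableEq ι] [Fintype α] (u g : α → ℝ)
    (F : (ι → α) → ℝ) :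
    piE (fun i => u i * g i) F = piE u (fun ω => (∏ a, g (ω a)) * F ω) := by
  simp only [piE, Finset.prod_mul_distrib, mul_assoc]

theorem piE_piE_pairRatio (F : (Fin n → Fin K × Bool) → ℝ) :
    piE fairBool (fun v : Fin K → Bool => piE (fun i => unifPairs K i * pairRatio ε v i) F) =
      piE (unifPairs K) (fun ω => pairMix ε ω * F ω) := by
  simp_rw [piE_mul_prod]
  rw [piE_comm]
  refine congrArg _ (funext fun ω => ?_)
  simp only [pairMix, piE, Finset.sum_mul]
  exact Finset.sum_congr rfl fun v _ => by ring

/-- The second moment of the mixture likelihood ratio: it is the expectation, over two independent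
sign patterns, of the `n`-th power of the affinity of the two perturbations. -/
theorem piE_pairMix_sq_le (hK : 0 < K) (hε : 0 ≤ ε) (hε1 : ε ≤ 1 / 2) :
    piE (unifPairs K) (fun ω : Fin n → Fin K × Bool => pairMix ε ω ^ 2) ≤
      Real.exp (8 * ε ^ 4 * n ^ 2 / K) := by
  have hK0 : (0 : ℝ) < K := by exact_mod_cast hK
  have h1 : piE (unifPairs K) (fun ω : Fin n → Fin K × Bool => pairMix ε ω ^ 2) =
      piE fairBool (fun v : Fin K → Bool => piE fairBool (fun v' : Fin K → Bool =>
        (∑ i, unifPairs K i * (pairRatio ε v i * pairRatio ε v' i)) ^ n)) := by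
    have : ∀ ω : Fin n → Fin K × Bool, pairMix ε ω ^ 2 = piE fairBool (fun v : Fin K → Bool =>
        piE fairBool (fun v' : Fin K → Bool => ∏ a, (pairRatio ε v (ω a) * pairRatio ε v'
            (ω a)))) := by
      intro ω
      simp only [Finset.prod_mul_distrib, piE_const_mul]
      rw [sq]
      nth_rw 1 [pairMix]
      rw [mul_comm, ← piE_const_mul]
      refine congrArg _ (funext fun v => ?_)
      rw [mul_comm]; rfl
    simp_rw [this]
    rw [piE_comm]
    refine congrArg _ (funext fun v => ?_)
    rw [piE_comm]
    refine congrArg _ (funext fun v' => ?_)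
    rw [piE_prod (fun _ i => pairRatio ε v i * pairRatio ε v' i)]
    simp
  rw [h1]
  have h2 : ∀ v v' : Fin K → Bool,
      ∑ i, unifPairs K i * (pairRatio ε v i * pairRatio ε v' i) =
        1 + 4 * ε ^ 2 / K * ∑ j, bsign (v j) * bsign (v' j) := by
    intro v v'
    simp only [Fintype.sum_prod_type, Fintype.sum_bool, unifPairs, pairRatio]
    have : ∀ j, 1 / (2 * (K : ℝ)) * ((1 + 2 * ε * (bsign (v j) * bsign true)) *
        (1 + 2 * ε * (bsign (v' j) * bsign true))) +
        1 / (2 * (K : ℝ)) * ((1 + 2 * ε * (bsign (v j) * bsign false)) *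
        (1 + 2 * ε * (bsign (v' j) * bsign false))) =
        1 / K + 4 * ε ^ 2 / K * (bsign (v j) * bsign (v' j)) := by
      intro j
      simp only [bsign, if_true, Bool.false_eq_true, if_false]
      field_simp
      ring
    simp_rw [this, Finset.sum_add_distrib, ← Finset.mul_sum]
    simp
    field_simp
  have h3 : ∀ v v' : Fin K → Bool,
      (∑ i, unifPairs K i * (pairRatio ε v i * pairRatio ε v' i)) ^ n ≤
        ∏ j, Real.exp (4 * ε ^ 2 / K * n * (bsign (v j) * bsign (v' j))) := by
    intro v v'
    have h0 : 0 ≤ ∑ i, unifPairs K i * (pairRatio ε v i * pairRatio ε v' i) := by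
      refine Finset.sum_nonneg fun i _ => mul_nonneg ((isProbVec_unifPairs hK).nonneg i) ?_
      unfold pairRatio bsign
      refine mul_nonneg ?_ ?_ <;> split_ifs <;> linarith
    rw [← Real.exp_sum, ← Finset.mul_sum]
    calc _ ≤ Real.exp (4 * ε ^ 2 / K * ∑ j, bsign (v j) * bsign (v' j)) ^ n := by
          refine pow_le_pow_left₀ h0 ?_ n
          rw [h2, add_comm]
          exact Real.add_one_le_exp _
      _ = _ := by
          rw [← Real.exp_nat_mul]
          congr 1
          ring
  -- the signs are independent and fair, which produces a power of `cosh`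
  have h4 : ∀ v : Fin K → Bool, piE fairBool (fun v' : Fin K → Bool =>
      ∏ j, Real.exp (4 * ε ^ 2 / K * n * (bsign (v j) * bsign (v' j)))) ≤
      Real.exp (8 * ε ^ 4 * n ^ 2 / K) := by
    intro v
    rw [piE_prod (fun j b => Real.exp (4 * ε ^ 2 / K * n * (bsign (v j) * bsign b)))]
    have : ∀ j, ∑ b, fairBool b * Real.exp (4 * ε ^ 2 / K * n * (bsign (v j) * bsign b)) =
        Real.cosh (4 * ε ^ 2 / K * n) := by
      intro j
      rw [Real.cosh_eq]
      cases v j <;> simp [bsign] <;> ring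
    simp_rw [this]
    rw [Finset.prod_const, Finset.card_univ, Fintype.card_fin]
    calc Real.cosh (4 * ε ^ 2 / K * n) ^ K ≤ Real.exp ((4 * ε ^ 2 / K * n) ^ 2 / 2) ^ K := by
          gcongr
          exact Real.cosh_le_exp_half_sq _
      _ = _ := by
          rw [← Real.exp_nat_mul]
          congr 1
          field_simp
          ring
  refine (piE_mono isProbVec_fairBool fun v => (piE_mono isProbVec_fairBool fun v' => h3 v v').trans
    (h4 v)).trans (le_of_eq (piE_const isProbVec_fairBool _))

theorem piE_mul_sq_le {ι α : Type*} [Fintype ι] [DecidableEq ι] [Fintype α] {w : α → ℝ}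
    (hw : IsProbVec w) (A B : (ι → α) → ℝ) :
    piE w (fun ω => A ω * B ω) ^ 2 ≤ piE w (fun ω => A ω ^ 2) * piE w (fun ω => B ω ^ 2) := by
  have h0 : ∀ ω : ι → α, 0 ≤ ∏ a, w (ω a) := fun ω => Finset.prod_nonneg fun a _ => hw.nonneg _
  exact Finset.sum_sq_le_sum_mul_sum_of_sq_le_mul _ (fun ω _ => mul_nonneg (h0 ω) (sq_nonneg _))
    (fun ω _ => mul_nonneg (h0 ω) (sq_nonneg _)) fun ω _ => le_of_eq (by ring)

variable {F : (Fin n → Fin K × Bool) → ℝ}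

theorem sq_piE_piE_pairRatio_le (hK : 0 < K) (hε : 0 ≤ ε) (hε1 : ε ≤ 1 / 2) (h0 : ∀ ω, 0 ≤ F ω)
    (h1 : ∀ ω, F ω ≤ 1) :
    piE fairBool (fun v : Fin K → Bool =>
      piE (fun i => unifPairs K i * pairRatio ε v i) F) ^ 2 ≤
      Real.exp (8 * ε ^ 4 * n ^ 2 / K) * piE (unifPairs K) F := by
  have hu := isProbVec_unifPairs hK
  rw [piE_piE_pairRatio]
  refine (piE_mul_sq_le hu _ _).trans ?_
  refine mul_le_mul (piE_pairMix_sq_le hK hε hε1) (piE_mono hu fun ω => ?_)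
    (piE_nonneg hu fun ω => sq_nonneg _) (Real.exp_pos _).le
  nlinarith [h0 ω, h1 ω]

theorem sq_piE_piE_pairRatio_sub_le (hK : 0 < K) (hε : 0 ≤ ε) (hε1 : ε ≤ 1 / 2)
    (h0 : ∀ ω, 0 ≤ F ω) (h1 : ∀ ω, F ω ≤ 1) :
    (piE fairBool (fun v : Fin K → Bool =>
      piE (fun i => unifPairs K i * pairRatio ε v i) F) - piE (unifPairs K) F) ^ 2 ≤
      Real.exp (8 * ε ^ 4 * n ^ 2 / K) - 1 := by
  have hu := isProbVec_unifPairs hK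
  have hmix : piE (unifPairs K) (fun ω : Fin n → Fin K × Bool => pairMix ε ω) = 1 := by
    have := piE_piE_pairRatio (K := K) (ε := ε) (fun _ : Fin n → Fin K × Bool => 1)
    simp only [mul_one] at this
    rw [← this]
    simp only [piE_const (isProbVec_pairRatio hK hε hε1 _), piE_const isProbVec_fairBool]
  have h2 : piE fairBool (fun v : Fin K → Bool =>
      piE (fun i => unifPairs K i * pairRatio ε v i) F) - piE (unifPairs K) F =
      piE (unifPairs K) (fun ω => (pairMix ε ω - 1) * F ω) := by
    rw [piE_piE_pairRatio, ← piE_sub]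
    exact congrArg _ (funext fun ω => by ring)
  rw [h2]
  refine (piE_mul_sq_le hu _ _).trans ?_
  have h3 : piE (unifPairs K) (fun ω : Fin n → Fin K × Bool => (pairMix ε ω - 1) ^ 2) ≤
      Real.exp (8 * ε ^ 4 * n ^ 2 / K) - 1 := by
    have : ∀ ω : Fin n → Fin K × Bool, (pairMix ε ω - 1) ^ 2 =
        pairMix ε ω ^ 2 - 2 * pairMix ε ω + 1 := fun ω => by ring
    simp_rw [this, piE_add, piE_sub, piE_const_mul, hmix, piE_const hu]
    linarith [piE_pairMix_sq_le (n := n) hK hε hε1]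
  have h4 : piE (unifPairs K) (fun ω => F ω ^ 2) ≤ 1 := by
    rw [← piE_const (ι := Fin n) hu 1]
    exact piE_mono hu fun ω => by nlinarith [h0 ω, h1 ω]
  have h5 : 0 ≤ piE (unifPairs K) (fun ω => F ω ^ 2) := piE_nonneg hu fun ω => sq_nonneg _
  have h6 : 0 ≤ piE (unifPairs K) (fun ω : Fin n → Fin K × Bool => (pairMix ε ω - 1) ^ 2) :=
    piE_nonneg hu fun ω => sq_nonneg _
  nlinarith

end paired

/-! ### The sample complexity of goodness-of-fit testing -/

section gof

variable {k n : ℕ} {ε δ : ℝ}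

/-- Testing uniformity requires of the order of `√(k log (1/δ)) / ε²` samples. -/
theorem mul_log_le_of_isGoFTest (hk : 2 ≤ k) (hε : 0 < ε) (hε1 : ε ≤ 1 / 2) (hδ : 0 < δ)
    (hδ1 : δ ≤ 1 / 4)
    (h : ∀ P₀ ∈ PD k, ∃ ψ : (Fin n → Fin k) → Bool, IsGoFTest (PD k) P₀ ε δ n ψ) :
    k * Real.log (1 / δ) ≤ 48 * (n ^ 2 * ε ^ 4) := by
  obtain ⟨K, hKd⟩ : ∃ K, K = k / 2 := ⟨_, rfl⟩
  have hK : 0 < K := by omega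
  have hK0 : (0 : ℝ) < K := by exact_mod_cast hK
  have hk0 : (0 : ℝ) < k := by exact_mod_cast (by omega : 0 < k)
  have hK3 : (k : ℝ) ≤ 3 * K := by
    have : k ≤ 3 * K := by omega
    exact_mod_cast this
  obtain ⟨Φ, e, hΦ, hΦE, hΦtv⟩ := exists_embedding (k := k) (β := Fin K × Bool) (by simp; omega)
  have hu := isProbVec_unifPairs hK
  have hv := isProbVec_pairRatio hK hε.le hε1
  obtain ⟨ψ, hψ0, hψ1⟩ := h _ (hΦ _ hu)
  have a0 := sq_piE_piE_pairRatio_le (K := K) (n := n) hK hε.le hε1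
    (F := fun ω => ind (ψ (fun a => e (ω a)) = true)) (fun _ => ind_nonneg _)
        (fun _ => ind_le_one _)
  rw [real_iid (hΦ _ hu), hΦE _ hu] at hψ0
  have a1 : 1 - δ ≤ piE fairBool (fun v : Fin K → Bool =>
      piE (fun i => unifPairs K i * pairRatio ε v i)
        (fun ω : Fin n → Fin K × Bool => ind (ψ (fun a => e (ω a)) = true))) := by
    rw [← piE_const (ι := Fin K) isProbVec_fairBool (1 - δ)]
    refine piE_mono isProbVec_fairBool fun v => ?_
    have h1 := hψ1 _ (hΦ _ (hv v)) (by
      have := hΦtv _ _ (hv v) hu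
      simp_rw [abs_sub_comm (_ * _)] at this
      rw [sum_abs_pairRatio hK hε.le v] at this
      linarith)
    rw [real_iid (hΦ _ (hv v)), hΦE _ (hv v)] at h1
    have h2 : ∀ ω : Fin n → Fin K × Bool, ind (ψ (fun a => e (ω a)) = true) =
        1 - ind (ψ (fun a => e (ω a)) = false) := by
      intro ω
      rw [← ind_not, Bool.not_eq_false]
    simp_rw [h2, piE_sub, piE_const (hv v)]
    linarith
  -- the test rejects rarely under the uniform vector, but often under the mixture
  have a2 : (3 / 4) ^ 2 ≤ Real.exp (8 * ε ^ 4 * n ^ 2 / K) * δ := by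
    calc ((3 : ℝ) / 4) ^ 2 ≤ (1 - δ) ^ 2 := by gcongr; linarith
      _ ≤ _ := by
          refine le_trans (pow_le_pow_left₀ (by linarith) a1 2) (a0.trans ?_)
          gcongr
  have a3 : Real.log (9 / 16 * (1 / δ)) ≤ 8 * ε ^ 4 * n ^ 2 / K := by
    rw [Real.log_le_iff_le_exp (by positivity), mul_one_div, div_le_iff₀ hδ]
    linarith
  rw [Real.log_mul (by norm_num) (by positivity)] at a3
  have a4 : -Real.log (9 / 16) ≤ Real.log (1 / δ) / 2 := by
    rw [← Real.log_inv]
    have : Real.log (2 ^ 2) ≤ Real.log (1 / δ) := by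
      refine Real.log_le_log (by norm_num) ?_
      rw [le_div_iff₀ hδ]; linarith
    rw [Real.log_pow] at this
    have h2 : Real.log ((9 / 16)⁻¹) ≤ Real.log 2 := Real.log_le_log (by norm_num) (by norm_num)
    push_cast at this
    linarith
  have a5 : 8 * ε ^ 4 * n ^ 2 / K ≤ 24 * (n ^ 2 * ε ^ 4) / k := by
    rw [div_le_div_iff₀ hK0 hk0]
    have : 0 ≤ ε ^ 4 * (n : ℝ) ^ 2 := by positivity
    nlinarith
  have a6 : Real.log (1 / δ) / 2 ≤ 24 * (n ^ 2 * ε ^ 4) / k := by linarith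
  rw [le_div_iff₀ hk0] at a6
  linarith

/-- Comparing the empirical mass function with the null distribution is a goodness-of-fit test. -/
theorem exists_isGoFTest (k : ℕ) (hε : 0 < ε) (hδ : 0 < δ) :
    ∃ N : ℕ, ∀ n ≥ N, ∀ P₀ ∈ PD k, ∃ ψ : (Fin n → Fin k) → Bool, IsGoFTest (PD k) P₀ ε δ n ψ := by
  classical
  obtain ⟨Λ, hΛ0, hΛ⟩ : ∃ Λ : ℝ, 0 ≤ Λ ∧ k * (2 * Real.exp (-Λ)) ≤ δ := by
    refine ⟨max 0 (Real.log (2 * (k + 1) / δ)), le_max_left _ _, ?_⟩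
    have : Real.exp (-(max 0 (Real.log (2 * (k + 1) / δ)))) ≤ δ / (2 * (k + 1)) := by
      rw [← Real.le_log_iff_exp_le (by positivity), ← inv_div, Real.log_inv]
      linarith [le_max_right 0 (-Real.log (δ / (2 * ((k : ℝ) + 1))))]
    calc k * (2 * Real.exp _) ≤ k * (2 * (δ / (2 * (k + 1)))) := by gcongr
      _ = k / (k + 1) * δ := by field_simp
      _ ≤ 1 * δ := by
          gcongr
          rw [div_le_one (by positivity)]; linarith
      _ = δ := one_mul δ
  obtain ⟨η, hη0, hη⟩ : ∃ η : ℝ, 0 < η ∧ k * η < ε := by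
    refine ⟨ε / (k + 1), by positivity, ?_⟩
    rw [mul_div_assoc', div_lt_iff₀ (by positivity)]
    nlinarith
  refine ⟨⌈16 * Λ / η ^ 2 + 4 * Λ / η⌉₊ + 1, fun n hn P₀ hP₀ => ?_⟩
  have hn1 : 0 < n := by omega
  have hn0 : (0 : ℝ) < n := by exact_mod_cast hn1
  have hnb : 16 * Λ / η ^ 2 + 4 * Λ / η ≤ n := by
    refine (Nat.le_ceil _).trans ?_
    exact_mod_cast (by omega : _ ≤ n)
  have hdev : Real.sqrt (4 * 1 * Λ / n) + 2 * Λ / n ≤ η := by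
    have h1 : 0 ≤ 16 * Λ / η ^ 2 := by positivity
    have h2 : 0 ≤ 4 * Λ / η := by positivity
    have h3 : 16 * Λ / η ^ 2 ≤ n := by linarith
    have h4 : 4 * Λ / η ≤ n := by linarith
    rw [div_le_iff₀ (by positivity)] at h3 h4
    have h5 : Real.sqrt (4 * 1 * Λ / n) ≤ η / 2 := by
      rw [Real.sqrt_le_left (by positivity), div_le_iff₀ hn0]
      nlinarith
    have h6 : 2 * Λ / n ≤ η / 2 := by
      rw [div_le_iff₀ hn0]; linarith
    linarith
  have key : ∀ P ∈ PD k, (iid P n).real {x | ¬ ∀ i, |empPMF x i - pv P i| ≤ η} ≤ δ := by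
    intro P hP
    have hP' := isProbVec_pv hP
    rw [real_iid hP]
    refine le_trans (piE_mono hP' fun x => ?_) ((le_of_eq (piE_sum Finset.univ
      (fun i (x : Fin n → Fin k) => ind (η < |empPMF x i - pv P i|)))).trans ?_)
    · simp only [not_forall, not_le]
      exact ind_exists_le _
    · refine le_trans (Finset.sum_le_sum (g := fun _ => 2 * Real.exp (-Λ)) fun i _ => ?_)
        (le_trans (le_of_eq ?_) hΛ)
      · have := piE_freq_deviation_le hP' (T := (Finset.univ : Finset (Fin n))) (by simpa using hn1)
          {i} (s := 1) (by simpa using hP'.le_one i) one_pos hΛ0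
        refine le_trans (piE_mono hP' fun x => ind_mono fun hx => ?_) this
        rw [empPMF_eq_cnt] at hx
        simpa using hdev.trans_lt hx
      · simp
  have hsum : ∀ (P : Measure (Fin k)) (x : Fin n → Fin k), (∀ i, |empPMF x i - pv P i| ≤ η) →
      ∑ i, |empPMF x i - pv P i| < ε := by
    intro P x hx
    refine lt_of_le_of_lt (Finset.sum_le_sum fun i _ => hx i) ?_
    simpa using hη
  refine ⟨fun x => decide (ε ≤ ∑ i, |empPMF x i - pv P₀ i|), ?_, fun P hP hPε => ?_⟩
  · have := isProbabilityMeasure_iid hP₀ n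
    refine le_trans (measureReal_mono (show _ ⊆ {x : Fin n → Fin k |
      ¬ ∀ i, |empPMF x i - pv P₀ i| ≤ η} from fun x hx hx' => ?_)) (key P₀ hP₀)
    simp only [Set.mem_ofPred_eq, decide_eq_true_eq] at hx
    exact absurd (hsum P₀ x hx') (not_lt.2 hx)
  · have := isProbabilityMeasure_iid hP n
    refine le_trans (measureReal_mono (show _ ⊆ {x : Fin n → Fin k |
      ¬ ∀ i, |empPMF x i - pv P i| ≤ η} from fun x hx hx' => ?_)) (key P hP)
    simp only [Set.mem_ofPred_eq, decide_eq_false_iff_not, not_le] at hx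
    have h1 := hsum P x hx'
    have h2 := two_mul_tv P P₀
    have h3 : ∑ i, |pv P i - pv P₀ i| ≤
        ∑ i, (|empPMF x i - pv P i| + |empPMF x i - pv P₀ i|) := by
      refine Finset.sum_le_sum fun i _ => ?_
      rw [abs_sub_comm (empPMF x i)]
      exact abs_sub_le _ _ _
    rw [Finset.sum_add_distrib] at h3
    linarith

/-- The set defining `nGoF` is nonempty, so the testing lower bound applies to its infimum. -/
theorem mul_log_le_nGoF (hk : 2 ≤ k) (hε : 0 < ε) (hε1 : ε ≤ 1 / 2) (hδ : 0 < δ)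
    (hδ1 : δ ≤ 1 / 4) :
    k * Real.log (1 / δ) ≤ 48 * ((nGoF (PD k) ε δ : ℝ) ^ 2 * ε ^ 4) := by
  have h := Nat.sInf_mem (s := {N : ℕ | ∀ n ≥ N, ∀ P₀ ∈ PD k, ∃ ψ : (Fin n → Fin k) → Bool,
    IsGoFTest (PD k) P₀ ε δ n ψ}) (exists_isGoFTest k hε hδ)
  exact mul_log_le_of_isGoFTest hk hε hε1 hδ hδ1 (h _ le_rfl)

end gof

/-! ### Lower bounds for likelihood-free testing -/

section lfht

variable {k n m : ℕ} {ε δ : ℝ}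

/-- A likelihood-free test on `[k]` restricts to any alphabet with at most `k` letters. -/
theorem LFHTSolvable.exists_test {β : Type*} [Fintype β] [DecidableEq β]
    (h : LFHTSolvable (PD k) ε δ n m) (hβ : Fintype.card β ≤ k) :
    ∃ ψ : (Fin n → β) → (Fin n → β) → (Fin m → β) → Bool,
      ∀ w w' : β → ℝ, IsProbVec w → IsProbVec w' → 2 * ε ≤ ∑ b, |w b - w' b| →
        piE w (fun x => piE w' (fun y => piE w (fun z => ind (ψ x y z = true)))) ≤ δ ∧
        piE w (fun x => piE w' (fun y => piE w' (fun z => ind (ψ x y z = false)))) ≤ δ := by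
  obtain ⟨Φ, e, hΦ, hΦE, hΦtv⟩ := exists_embedding (k := k) hβ
  obtain ⟨ψ, hψ⟩ := h
  refine ⟨fun x y z => ψ (fun a => e (x a), fun a => e (y a), fun a => e (z a)),
    fun w w' hw hw' hww' => ?_⟩
  obtain ⟨h1, h2⟩ := hψ _ (hΦ w hw) _ (hΦ w' hw') (by rw [hΦtv w w' hw hw']; linarith)
  rw [real_iid_prod₃ (hΦ w hw) (hΦ w' hw') (hΦ w hw) (fun ω => ψ ω = true)] at h1
  rw [real_iid_prod₃ (hΦ w hw) (hΦ w' hw') (hΦ w' hw') (fun ω => ψ ω = false)] at h2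
  simp only [hΦE w hw, hΦE w' hw'] at h1 h2
  exact ⟨h1, h2⟩

theorem ind_eq_false (b : Bool) : ind (b = false) = 1 - ind (b = true) := by
  rw [← ind_not, Bool.not_eq_true]

/-- Likelihood-free testing requires of the order of `√k / ε²` samples from the two candidate
distributions, whatever the number of samples from the third. -/
theorem LFHTSolvable.le_mul_sq (h : LFHTSolvable (PD k) ε δ n m) (hk : 2 ≤ k) (hε : 0 < ε)
    (hε1 : ε ≤ 1 / 2) (hδ1 : δ ≤ 1 / 4) : (k : ℝ) ≤ 408 * (n ^ 2 * ε ^ 4) := by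
  obtain ⟨K, hKd⟩ : ∃ K, K = k / 2 := ⟨_, rfl⟩
  have hK : 0 < K := by omega
  have hK0 : (0 : ℝ) < K := by exact_mod_cast hK
  have hK3 : (k : ℝ) ≤ 3 * K := by
    have : k ≤ 3 * K := by omega
    exact_mod_cast this
  obtain ⟨ψ, hψ⟩ := h.exists_test (β := Fin K × Bool) (by simp; omega)
  have hu := isProbVec_unifPairs hK
  have hv := isProbVec_pairRatio hK hε.le hε1
  have hb := isProbVec_fairBool
  have htv := sum_abs_pairRatio hK hε.le
  -- the acceptance probability as a function of one perturbed sample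
  have n0 : ∀ x y, 0 ≤ piE (unifPairs K) (fun z => ind (ψ x y z = true)) :=
    fun x y => piE_nonneg hu fun z => ind_nonneg _
  have n1 : ∀ x y, piE (unifPairs K) (fun z => ind (ψ x y z = true)) ≤ 1 := fun x y =>
    (piE_mono hu fun z => ind_le_one _).trans (le_of_eq (piE_const hu _))
  have c0 := sq_piE_piE_pairRatio_sub_le (K := K) (n := n) hK hε.le hε1
    (F := fun y => piE (unifPairs K) (fun x : Fin n → _ => piE (unifPairs K)
      (fun z => ind (ψ x y z = true)))) (fun y => piE_nonneg hu fun x => n0 x y)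
    (fun y => (piE_mono hu fun x => n1 x y).trans (le_of_eq (piE_const hu _)))
  have c1 := sq_piE_piE_pairRatio_sub_le (K := K) (n := n) hK hε.le hε1
    (F := fun x => piE (unifPairs K) (fun y : Fin n → _ => piE (unifPairs K)
      (fun z => ind (ψ x y z = true)))) (fun x => piE_nonneg hu fun y => n0 x y)
    (fun x => (piE_mono hu fun y => n1 x y).trans (le_of_eq (piE_const hu _)))
  rw [piE_comm (w := unifPairs K) (w' := unifPairs K)
    (fun y x => piE (unifPairs K) (fun z => ind (ψ x y z = true)))] at c0
  set A := piE (unifPairs K) (fun x => piE (unifPairs K) (fun y => piE (unifPairs K)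
      (fun z => ind (ψ x y z = true)))) with hA
  have d0 : piE fairBool (fun v : Fin K → Bool => piE (fun i => unifPairs K i * pairRatio ε v i)
      (fun y => piE (unifPairs K) (fun x : Fin n → _ => piE (unifPairs K)
      (fun z => ind (ψ x y z = true))))) ≤ δ := by
    refine (piE_mono hb fun v => ?_).trans (le_of_eq (piE_const hb δ))
    rw [piE_comm]
    exact (hψ _ _ hu (hv v) (le_of_eq (htv v).symm)).1
  have d1 : 1 - δ ≤ piE fairBool (fun v : Fin K → Bool =>
      piE (fun i => unifPairs K i * pairRatio ε v i)
      (fun x => piE (unifPairs K) (fun y : Fin n → _ => piE (unifPairs K)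
      (fun z => ind (ψ x y z = true))))) := by
    refine le_trans (le_of_eq (piE_const hb (1 - δ)).symm) (piE_mono hb fun v => ?_)
    have := (hψ _ _ (hv v) hu (by simp_rw [abs_sub_comm (_ * _)]; exact le_of_eq (htv v).symm)).2
    simp only [ind_eq_false, piE_sub, piE_const hu, piE_const (hv v)] at this
    linarith
  -- both hypotheses are close to the one in which all samples are uniform
  have hw : 1 / 16 ≤ Real.exp (8 * ε ^ 4 * n ^ 2 / K) - 1 := by
    have h2 : ∀ a b χ : ℝ, (a - A) ^ 2 ≤ χ → (b - A) ^ 2 ≤ χ → 1 / 2 ≤ b - a → 1 / 16 ≤ χ := by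
      intro a b χ ha hb hab
      nlinarith [sq_nonneg (a - A + (b - A))]
    exact h2 _ _ _ c0 c1 (by linarith)
  have hw2 : 1 / 17 ≤ 8 * ε ^ 4 * n ^ 2 / K := by
    have h1 : Real.log (17 / 16) ≤ 8 * ε ^ 4 * n ^ 2 / K := by
      rw [Real.log_le_iff_le_exp (by norm_num)]; linarith
    have h2 := Real.one_sub_inv_le_log_of_pos (show (0 : ℝ) < 17 / 16 by norm_num)
    norm_num at h2
    linarith
  rw [le_div_iff₀ hK0] at hw2
  linarith

end lfht

/-! ### Product expectations: independence and change of alphabet -/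

section indep

variable {ι α : Type*} [Fintype ι] [DecidableEq ι] [Fintype α] {w : α → ℝ}

/-- Functions of disjoint families of draws are independent. -/
theorem piE_mul_of_disjoint (hw : IsProbVec w) (P : ι → Prop) [DecidablePred P]
    {f g : (ι → α) → ℝ} (hf : ∀ ω ω', (∀ a, P a → ω a = ω' a) → f ω = f ω')
    (hg : ∀ ω ω', (∀ a, ¬ P a → ω a = ω' a) → g ω = g ω') :
    piE w (fun ω => f ω * g ω) = piE w f * piE w g := by
  obtain ⟨i₀⟩ : Nonempty α := by
    by_contra h
    rw [not_nonempty_iff] at h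
    have := hw.sum_eq_one
    simp at this
  obtain ⟨f', hf'⟩ : ∃ f' : ({a // P a} → α) → ℝ, ∀ ω : ι → α, f ω = f' (fun a => ω a) :=
    ⟨fun x => f (fun a => if h : P a then x ⟨a, h⟩ else i₀), fun ω =>
      hf _ _ fun a ha => by simp [ha]⟩
  obtain ⟨g', hg'⟩ : ∃ g' : ({a // ¬ P a} → α) → ℝ, ∀ ω : ι → α, g ω = g' (fun a => ω a) :=
    ⟨fun x => g (fun a => if h : ¬ P a then x ⟨a, h⟩ else i₀), fun ω =>
      hg _ _ fun a ha => by simp [ha]⟩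
  have e1 := piE_split (w := w) P (fun x y => f' x * g' y)
  have e2 := piE_split (w := w) P (fun x (_ : {a // ¬ P a} → α) => f' x)
  have e3 := piE_split (w := w) P (fun (_ : {a // P a} → α) y => g' y)
  simp only [piE_const hw, piE_const_mul] at e1 e2 e3
  simp_rw [mul_comm (f' _), piE_const_mul] at e1
  rw [show f = fun ω => f' (fun a => ω a) from funext hf',
    show g = fun ω => g' (fun a => ω a) from funext hg', e2, e3, mul_comm, ← e1]
  exact congrArg _ (funext fun ω => mul_comm _ _)

theorem piE_eval (hw : IsProbVec w) (a₀ : ι) (f : α → ℝ) :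
    piE w (fun ω => f (ω a₀)) = ∑ i, w i * f i := by
  have h := piE_prod (w := w) (fun a i => if a = a₀ then f i else 1)
  have h1 : ∀ ω : ι → α, ∏ a, (if a = a₀ then f (ω a) else 1) = f (ω a₀) := fun ω => by
    rw [Finset.prod_ite_eq' Finset.univ a₀ fun a => f (ω a)]
    simp
  simp_rw [h1] at h
  rw [h, Finset.prod_eq_single a₀]
  · simp
  · intro a _ ha
    simp [ha, hw.sum_eq_one]
  · simp

/-- Functions of the draws in the cells of a partition are independent. -/
theorem piE_prod_of_partition (hw : IsProbVec w) {κ : Type*} [Fintype κ] [DecidableEq κ] (u : ι → κ)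
    {f : κ → (ι → α) → ℝ} (hf : ∀ x ω ω', (∀ a, u a = x → ω a = ω' a) → f x ω = f x ω')
    (S : Finset κ) : piE w (fun ω => ∏ x ∈ S, f x ω) = ∏ x ∈ S, piE w (f x) := by
  induction S using Finset.induction_on with
  | empty => simp [piE_const hw]
  | insert x S hx ih =>
    simp only [Finset.prod_insert hx]
    rw [piE_mul_of_disjoint hw (fun a => u a = x) (hf x), ih]
    intro ω ω' h
    refine Finset.prod_congr rfl fun y hy => hf y _ _ fun a ha => h a ?_
    rw [ha]
    rintro rfl
    exact hx hy

theorem piE_sum_type {ι' : Type*} [Fintype ι'] [DecidableEq ι'] (F : (ι → α) → (ι' → α) → ℝ) :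
    piE w (fun ω : ι ⊕ ι' → α => F (fun a => ω (Sum.inl a)) (fun a => ω (Sum.inr a))) =
      piE w (fun x => piE w (fun y => F x y)) := by
  simp only [piE, Finset.mul_sum]
  rw [← Fintype.sum_prod_type']
  refine Fintype.sum_equiv (Equiv.sumArrowEquivProdArrow ι ι' α) _ _ fun ω => ?_
  rw [Fintype.prod_sum_type, mul_assoc]
  rfl

theorem piE_prod_type {β : Type*} [Fintype β] {w' : β → ℝ} (F : (ι → α) → (ι → β) → ℝ) :
    piE (fun i : α × β => w i.1 * w' i.2)
      (fun ω : ι → α × β => F (fun a => (ω a).1) (fun a => (ω a).2)) =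
      piE w (fun x => piE w' (fun y => F x y)) := by
  simp only [piE, Finset.mul_sum]
  rw [← Fintype.sum_prod_type']
  refine Fintype.sum_equiv (Equiv.arrowProdEquivProdArrow ι (fun _ => α)
      (fun _ => β)) _ _ fun ω => ?_
  simp only [Finset.prod_mul_distrib, mul_assoc]
  rfl

end indep

/-- The uniform probability vector. -/
noncomputable def unif (α : Type*) [Fintype α] (_ : α) : ℝ := 1 / Fintype.card α

theorem isProbVec_unif (α : Type*) [Fintype α] [Nonempty α] : IsProbVec (unif α) := by
  have : (0 : ℝ) < Fintype.card α := by exact_mod_cast Fintype.card_pos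
  refine ⟨fun i => by unfold unif; positivity, ?_⟩
  simp [unif]

/-! ### Samples from one unit with hidden heavy cells -/

/-- The density, relative to the uniform distribution on the cells, of the mixture of the uniform
distribution and the uniform distribution over the list `h` of heavy cells. -/
noncomputable def dens {G J : ℕ} (h : Fin J → Fin G) (g : Fin G) : ℝ :=
  2 / 3 + ∑ j, if h j = g then (G : ℝ) / (3 * J) else 0

/-- The perturbation of the uniform distribution on `Fin 4` that favours the letter `v g`. -/
noncomputable def xi {G : ℕ} (v : Fin G → Fin 4) (c : Fin G × Fin 4) : ℝ :=
  if c.2 = v c.1 then 3 else -1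

/-- The density of a draw from a unit, in which the perturbation is switched on by the flag. Only
the light component is perturbed. -/
noncomputable def kap {G J : ℕ} (η : ℝ) (fl : Bool) (h : Fin J → Fin G) (v : Fin G → Fin 4)
    (c : Fin G × Fin 4) : ℝ :=
  (if fl then 2 / 3 * η * xi v c else 0) + dens h c.1

/-- The density of the draws with indices in `T` from a unit, averaged over the heavy cells and the
perturbations. -/
noncomputable def unitDens {G : ℕ} (J : ℕ) (η : ℝ) {ι : Type*} (fl : ι → Bool) (T : Finset ι)
    (c : ι → Fin G × Fin 4) : ℝ :=
  piE (unif (Fin G)) (fun h : Fin J → Fin G => piE (unif (Fin 4)) (fun v : Fin G → Fin 4 =>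
    ∏ a ∈ T, kap η (fl a) h v (c a)))

section unit

variable {G J : ℕ} {η : ℝ} {ι : Type*} [DecidableEq ι] {T : Finset ι} {fl : ι → Bool}
  {c : ι → Fin G × Fin 4}

theorem two_thirds_le_dens (h : Fin J → Fin G) (g : Fin G) : 2 / 3 ≤ dens h g := by
  unfold dens
  have : 0 ≤ ∑ j, if h j = g then (G : ℝ) / (3 * J) else 0 :=
    Finset.sum_nonneg fun j _ => by split_ifs <;> positivity
  linarith

theorem dens_pos (h : Fin J → Fin G) (g : Fin G) : 0 < dens h g := by
  linarith [two_thirds_le_dens h g]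

/-- As long as fewer than `J` draws have been made, some heavy cell has not been hit, so that any
given cell is heavy with conditional probability at least `1 / G`. -/
theorem piE_prod_dens_le (hG : 0 < G) {O : Finset ι} (hO : O.card < J) (c : ι → Fin G)
    (g : Fin G) :
    1 / G * piE (unif (Fin G)) (fun h : Fin J → Fin G => ∏ a ∈ O, dens h (c a)) ≤
      piE (unif (Fin G)) (fun h : Fin J → Fin G => ind (∃ j, h j = g) * ∏ a ∈ O, dens h (c a)) := by
  have : Nonempty (Fin G) := ⟨⟨0, hG⟩⟩
  have hw := isProbVec_unif (Fin G)
  -- expand every density according to the component from which the draw comes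
  set lab : Option (Fin J) → (Fin J → Fin G) → Fin G → ℝ := fun x h g =>
    x.elim (2 / 3) (fun j => if h j = g then (G : ℝ) / (3 * J) else 0) with hlab
  have hlab0 : ∀ x h g, 0 ≤ lab x h g := by
    intro x h g
    cases x with
    | none => simp only [hlab, Option.elim]; norm_num
    | some j => simp only [hlab, Option.elim]; split_ifs <;> positivity
  have hexp : ∀ h : Fin J → Fin G, ∏ a ∈ O, dens h (c a) =
      ∑ φ : O → Option (Fin J), ∏ a : O, lab (φ a) h (c a) := by
    intro h
    have : ∀ g, dens h g = ∑ x, lab x h g := by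
      intro g
      rw [Fintype.sum_option]
      rfl
    simp_rw [this]
    rw [← Finset.prod_coe_sort, Finset.prod_univ_sum, Fintype.piFinset_univ]
  simp_rw [hexp, Finset.mul_sum]
  rw [piE_sum, piE_sum, Finset.mul_sum]
  refine Finset.sum_le_sum fun φ _ => ?_
  obtain ⟨j₀, hj₀⟩ : ∃ j₀, ∀ a, φ a ≠ some j₀ := by
    by_contra hcon
    push Not at hcon
    choose s hs using hcon
    have hinj : Function.Injective s := by
      intro i j hij
      have := (hs i).symm.trans ((congrArg φ hij).trans (hs j))
      exact Option.some_injective _ this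
    have := Fintype.card_le_of_injective s hinj
    rw [Fintype.card_fin, Fintype.card_coe] at this
    omega
  calc 1 / G * piE (unif (Fin G)) (fun h : Fin J → Fin G => ∏ a : O, lab (φ a) h (c a))
      = piE (unif (Fin G)) (fun h : Fin J → Fin G =>
          ind (h j₀ = g) * ∏ a : O, lab (φ a) h (c a)) := by
        rw [piE_mul_of_disjoint hw (fun j => j = j₀)]
        · congr 1
          rw [piE_eval hw j₀ (fun i => ind (i = g)), Finset.sum_eq_single g]
          · rw [ind_true rfl]; simp [unif]
          · intro i _ hi
            rw [ind_false hi, mul_zero]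
          · simp
        · intro h h' hh
          rw [hh j₀ rfl]
        · intro h h' hh
          refine Finset.prod_congr rfl fun a _ => ?_
          cases hφ : φ a with
          | none => rfl
          | some j =>
            have : j ≠ j₀ := fun e => hj₀ a (by rw [hφ, e])
            simp only [hlab, Option.elim, hh j this]
    _ ≤ _ := by
        refine piE_mono hw fun h => mul_le_mul_of_nonneg_right (ind_mono fun e => ⟨j₀, e⟩)
          (Finset.prod_nonneg fun a _ => hlab0 _ _ _)

theorem le_dens_of_exists {h : Fin J → Fin G} {g : Fin G} (hg : ∃ j, h j = g) :
    (G : ℝ) / (3 * J) ≤ dens h g := by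
  obtain ⟨j, hj⟩ := hg
  have := Finset.single_le_sum (f := fun j => if h j = g then (G : ℝ) / (3 * J) else 0)
    (fun j _ => by split_ifs <;> positivity) (Finset.mem_univ j)
  simp only [hj, if_true] at this
  unfold dens
  linarith

/-- A collision of two draws is at most `O(J ^ 2 / G)` as likely in the light component as it is
overall, given the other draws. -/
theorem piE_prod_dens_erase_le (hG : 0 < G) (hT : T.card ≤ J + 1) {c : ι → Fin G} {a a' : ι}
    (ha : a ∈ T) (ha' : a' ∈ T) (haa' : a ≠ a') (hc : c a = c a') :
    (2 / 3) ^ 2 * piE (unif (Fin G)) (fun h : Fin J → Fin G =>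
        ∏ b ∈ (T.erase a).erase a', dens h (c b)) ≤
      4 * J ^ 2 / G * piE (unif (Fin G)) (fun h : Fin J → Fin G => ∏ b ∈ T, dens h (c b)) := by
  have : Nonempty (Fin G) := ⟨⟨0, hG⟩⟩
  have hw := isProbVec_unif (Fin G)
  have hG0 : (0 : ℝ) < G := by exact_mod_cast hG
  have ha'' : a' ∈ T.erase a := Finset.mem_erase.2 ⟨haa'.symm, ha'⟩
  have hcard : ((T.erase a).erase a').card + 2 = T.card := by
    have h1 := Finset.card_erase_add_one ha
    have h2 := Finset.card_erase_add_one ha''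
    omega
  have hJ : 0 < J := by
    have : 2 ≤ T.card := by omega
    omega
  have hJ0 : (0 : ℝ) < J := by exact_mod_cast hJ
  have h1 := piE_prod_dens_le (J := J) hG (O := (T.erase a).erase a') (by omega) c (c a)
  have h2 : ((G : ℝ) / (3 * J)) ^ 2 * piE (unif (Fin G)) (fun h : Fin J → Fin G =>
      ind (∃ j, h j = c a) * ∏ b ∈ (T.erase a).erase a', dens h (c b)) ≤
      piE (unif (Fin G)) (fun h : Fin J → Fin G => ∏ b ∈ T, dens h (c b)) := by
    rw [← piE_const_mul]
    refine piE_mono hw fun h => ?_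
    have h0 : 0 ≤ ∏ b ∈ (T.erase a).erase a', dens h (c b) :=
      Finset.prod_nonneg fun b _ => (dens_pos _ _).le
    rw [← Finset.mul_prod_erase T _ ha, ← Finset.mul_prod_erase _ _ ha'', ← hc]
    by_cases hex : ∃ j, h j = c a
    · rw [ind_true hex, one_mul, ← mul_assoc, sq]
      have := le_dens_of_exists hex
      have := (dens_pos h (c a)).le
      gcongr
    · rw [ind_false hex, zero_mul, mul_zero]
      have := (dens_pos h (c a)).le
      positivity
  calc _ = 4 * J ^ 2 / G * ((G / (3 * J)) ^ 2 * (1 / G * piE (unif (Fin G))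
        (fun h : Fin J → Fin G => ∏ b ∈ (T.erase a).erase a', dens h (c b)))) := by
        field_simp
        ring
    _ ≤ _ := by
        gcongr
        exact le_trans (by gcongr) h2

theorem abs_xi_le (v : Fin G → Fin 4) (c : Fin G × Fin 4) : |xi v c| ≤ 3 := by
  unfold xi; split_ifs <;> norm_num

/-- One term in the expansion of the averaged density in powers of the perturbation, where `t` is
the set of draws contributing a perturbation. It vanishes unless two of them share a cell, and then
it is small because such a collision is mostly due to heavy cells. -/
theorem abs_piE_term_le (hG : 0 < G) (hη : 0 ≤ η) (hη1 : η ≤ 1) (hT : T.card ≤ J + 1) {t : Finset ι}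
    (ht : t ⊆ T) (ht0 : t.Nonempty) :
    |piE (unif (Fin G)) (fun h : Fin J → Fin G => (∏ a ∈ T \ t, dens h (c a).1) *
      piE (unif (Fin 4)) (fun v : Fin G → Fin 4 =>
        ∏ a ∈ t, if fl a then 2 / 3 * η * xi v (c a) else 0))| ≤
      if t ⊆ T.filter (fun a => fl a) ∧ 2 ≤ (T.filter (fun a => fl a)).card then
        3 ^ t.card * (η ^ 2 * (4 * J ^ 2 / G *
          piE (unif (Fin G)) (fun h : Fin J → Fin G => ∏ b ∈ T, dens h (c b).1))) else 0 := by
  have : Nonempty (Fin G) := ⟨⟨0, hG⟩⟩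
  have hw := isProbVec_unif (Fin G)
  have hw4 := isProbVec_unif (Fin 4)
  have hnn : 0 ≤ (3 : ℝ) ^ t.card * (η ^ 2 * (4 * J ^ 2 / G *
      piE (unif (Fin G)) (fun h : Fin J → Fin G => ∏ b ∈ T, dens h (c b).1))) := by
    have := piE_nonneg (ι := Fin J) hw (F := fun h => ∏ b ∈ T, dens h (c b).1) fun h =>
      Finset.prod_nonneg fun b _ => (dens_pos _ _).le
    positivity
  have hzero : piE (unif (Fin 4)) (fun v : Fin G → Fin 4 =>
      ∏ a ∈ t, if fl a then 2 / 3 * η * xi v (c a) else 0) = 0 →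
      |piE (unif (Fin G)) (fun h : Fin J → Fin G => (∏ a ∈ T \ t, dens h (c a).1) *
      piE (unif (Fin 4)) (fun v : Fin G → Fin 4 =>
        ∏ a ∈ t, if fl a then 2 / 3 * η * xi v (c a) else 0))| = 0 := by
    intro h
    simp only [h, mul_zero, piE_const hw, abs_zero]
  -- draws without flag contribute no perturbation
  by_cases hflag : ∀ a ∈ t, fl a = true
  swap
  · push Not at hflag
    obtain ⟨a, ha, hfa⟩ := hflag
    rw [hzero]
    · split_ifs
      exacts [hnn, le_rfl]
    · have : ∀ v : Fin G → Fin 4,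
          (∏ a ∈ t, if fl a then 2 / 3 * η * xi v (c a) else 0) = 0 := fun v =>
        Finset.prod_eq_zero ha (if_neg hfa)
      simp only [this, piE_const hw4]
  by_cases hcoll : ∃ a ∈ t, ∃ a' ∈ t, a ≠ a' ∧ (c a).1 = (c a').1
  swap
  -- without collisions the perturbations have mean zero
  · push Not at hcoll
    obtain ⟨a, ha⟩ := ht0
    rw [hzero]
    · split_ifs
      exacts [hnn, le_rfl]
    · have : ∀ v : Fin G → Fin 4, (∏ b ∈ t, if fl b then 2 / 3 * η * xi v (c b) else 0) =
          (2 / 3 * η * (if (c a).2 = v (c a).1 then 3 else -1)) *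
            ∏ b ∈ t.erase a, (2 / 3 * η * xi v (c b)) := by
        intro v
        rw [← Finset.mul_prod_erase t _ ha, if_pos (hflag a ha)]
        congr 1
        exact Finset.prod_congr rfl fun b hb => if_pos (hflag b (Finset.mem_of_mem_erase hb))
      simp_rw [this]
      rw [piE_mul_of_disjoint hw4 (fun g => g = (c a).1),
        piE_eval hw4 (c a).1 (fun i => 2 / 3 * η * (if (c a).2 = i then 3 else -1))]
      · have : ∑ i, unif (Fin 4) i * (2 / 3 * η * (if (c a).2 = i then 3 else -1)) = 0 := by
          generalize (c a).2 = b
          fin_cases b <;> simp [Fin.sum_univ_four, unif] <;> ring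
        rw [this, zero_mul]
      · intro v v' hv
        simp only [hv _ rfl]
      · intro v v' hv
        refine Finset.prod_congr rfl fun b hb => ?_
        obtain ⟨hb1, hb2⟩ := Finset.mem_erase.1 hb
        have := hv (c b).1 (fun e => hcoll a ha b hb2 hb1.symm e.symm)
        simp only [xi, this]
  obtain ⟨a, ha, a', ha', haa', hc⟩ := hcoll
  have hsub : t ⊆ T.filter (fun a => fl a) := fun b hb =>
    Finset.mem_filter.2 ⟨ht hb, hflag b hb⟩
  have htc : 2 ≤ t.card := Finset.one_lt_card.2 ⟨a, ha, a', ha', haa'⟩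
  rw [if_pos ⟨hsub, htc.trans (Finset.card_le_card hsub)⟩]
  have ha'' : a' ∈ t.erase a := Finset.mem_erase.2 ⟨haa'.symm, ha'⟩
  have hcard : ((t.erase a).erase a').card + 2 = t.card := by
    have h1 := Finset.card_erase_add_one ha
    have h2 := Finset.card_erase_add_one ha''
    omega
  have hv : |piE (unif (Fin 4)) (fun v : Fin G → Fin 4 =>
      ∏ a ∈ t, if fl a then 2 / 3 * η * xi v (c a) else 0)| ≤ (2 * η) ^ t.card := by
    rw [abs_le]
    have hb : ∀ v : Fin G → Fin 4,
        |∏ a ∈ t, if fl a then 2 / 3 * η * xi v (c a) else 0| ≤ (2 * η) ^ t.card := by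
      intro v
      rw [Finset.abs_prod, ← Finset.prod_const]
      refine Finset.prod_le_prod (fun _ _ => abs_nonneg _) fun b hb => ?_
      rw [if_pos (hflag b hb), abs_mul, abs_of_nonneg (by positivity)]
      have := mul_le_mul_of_nonneg_left (abs_xi_le v (c b)) (by positivity : 0 ≤ 2 / 3 * η)
      linarith
    constructor
    · rw [← piE_const (ι := Fin G) hw4 (-(2 * η) ^ t.card)]
      exact piE_mono hw4 fun v => (abs_le.1 (hb v)).1
    · rw [← piE_const (ι := Fin G) hw4 ((2 * η) ^ t.card)]
      exact piE_mono hw4 fun v => (abs_le.1 (hb v)).2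
  have hR := piE_prod_dens_erase_le (J := J) hG hT (c := fun b => (c b).1) (ht ha) (ht ha') haa' hc
  have hprod : ∀ h : Fin J → Fin G, (2 / 3) ^ ((t.erase a).erase a').card *
      ∏ b ∈ T \ t, dens h (c b).1 ≤ ∏ b ∈ (T.erase a).erase a', dens h (c b).1 := by
    intro h
    have hun : (T.erase a).erase a' = (t.erase a).erase a' ∪ (T \ t) := by
      ext b
      simp only [Finset.mem_erase, Finset.mem_union, Finset.mem_sdiff]
      constructor
      · rintro ⟨h1, h2, h3⟩
        by_cases hb : b ∈ t
        · exact Or.inl ⟨h1, h2, hb⟩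
        · exact Or.inr ⟨h3, hb⟩
      · rintro (⟨h1, h2, h3⟩ | ⟨h1, h2⟩)
        · exact ⟨h1, h2, ht h3⟩
        · exact ⟨fun e => h2 (e ▸ ha'), fun e => h2 (e ▸ ha), h1⟩
    have hdis : Disjoint ((t.erase a).erase a') (T \ t) := by
      rw [Finset.disjoint_left]
      intro b hb hb'
      exact (Finset.mem_sdiff.1 hb').2 (Finset.mem_of_mem_erase (Finset.mem_of_mem_erase hb))
    rw [hun, Finset.prod_union hdis, ← Finset.prod_const]
    refine mul_le_mul_of_nonneg_right (Finset.prod_le_prod (fun _ _ => by norm_num)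
      fun b _ => two_thirds_le_dens _ _) (Finset.prod_nonneg fun b _ => (dens_pos _ _).le)
  set V := piE (unif (Fin 4)) (fun v : Fin G → Fin 4 =>
      ∏ a ∈ t, if fl a then 2 / 3 * η * xi v (c a) else 0) with hV
  have hR0 : 0 ≤ piE (unif (Fin G)) (fun h : Fin J → Fin G => ∏ b ∈ T \ t, dens h (c b).1) :=
    piE_nonneg hw fun h => Finset.prod_nonneg fun b _ => (dens_pos _ _).le
  have e1 : piE (unif (Fin G)) (fun h : Fin J → Fin G => (∏ a ∈ T \ t, dens h (c a).1) * V) =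
      V * piE (unif (Fin G)) (fun h : Fin J → Fin G => ∏ a ∈ T \ t, dens h (c a).1) := by
    rw [← piE_const_mul]
    exact congrArg _ (funext fun h => mul_comm _ _)
  rw [e1, abs_mul, abs_of_nonneg hR0]
  calc _ ≤ (2 * η) ^ t.card * piE (unif (Fin G)) (fun h : Fin J → Fin G =>
        ∏ b ∈ T \ t, dens h (c b).1) := by gcongr
    _ = 3 ^ t.card * (η ^ t.card * ((2 / 3) ^ 2 * piE (unif (Fin G)) (fun h : Fin J → Fin G =>
        (2 / 3) ^ ((t.erase a).erase a').card * ∏ b ∈ T \ t, dens h (c b).1))) := by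
        rw [piE_const_mul, ← mul_assoc (((2 : ℝ) / 3) ^ 2), ← pow_add, add_comm 2, hcard,
          ← mul_assoc (η ^ _), ← mul_assoc ((3 : ℝ) ^ _), ← mul_pow, ← mul_pow]
        congr 2
        ring
    _ ≤ 3 ^ t.card * (η ^ 2 * ((2 / 3) ^ 2 * piE (unif (Fin G)) (fun h : Fin J → Fin G =>
        ∏ b ∈ (T.erase a).erase a', dens h (c b).1))) := by
        have h1 : η ^ t.card ≤ η ^ 2 := pow_le_pow_of_le_one hη hη1 htc
        have h2 := piE_mono (ι := Fin J) hw hprod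
        have h3 : 0 ≤ piE (unif (Fin G)) (fun h : Fin J → Fin G =>
          (2 / 3) ^ ((t.erase a).erase a').card * ∏ b ∈ T \ t, dens h (c b).1) := by
          rw [piE_const_mul]; positivity
        gcongr
    _ ≤ _ := by gcongr

/-- The relative effect of the perturbation on the density of the draws from one unit. -/
theorem abs_unitDens_sub_le (hG : 0 < G) (hη : 0 ≤ η) (hη1 : η ≤ 1) (hT : T.card ≤ J + 1) :
    |unitDens J η fl T c - unitDens J η (fun _ => false) T c| ≤
      (if 2 ≤ (T.filter (fun a => fl a)).card then
        4 * η ^ 2 * J ^ 2 / G * 4 ^ (T.filter (fun a => fl a)).card else 0) *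
        unitDens J η (fun _ => false) T c := by
  have : Nonempty (Fin G) := ⟨⟨0, hG⟩⟩
  have hw := isProbVec_unif (Fin G)
  have hw4 := isProbVec_unif (Fin 4)
  have h0 : unitDens J η (fun _ => false) T c =
      piE (unif (Fin G)) (fun h : Fin J → Fin G => ∏ b ∈ T, dens h (c b).1) := by
    simp only [unitDens, kap, Bool.false_eq_true, if_false, zero_add, piE_const hw4]
  have h1 : unitDens J η fl T c = ∑ t ∈ T.powerset,
      piE (unif (Fin G)) (fun h : Fin J → Fin G => (∏ a ∈ T \ t, dens h (c a).1) *
      piE (unif (Fin 4)) (fun v : Fin G → Fin 4 =>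
        ∏ a ∈ t, if fl a then 2 / 3 * η * xi v (c a) else 0)) := by
    simp only [unitDens, kap, Finset.prod_add]
    rw [← piE_sum]
    refine congrArg _ (funext fun h => ?_)
    rw [piE_sum]
    refine Finset.sum_congr rfl fun t _ => ?_
    rw [← piE_const_mul]
    exact congrArg _ (funext fun v => mul_comm _ _)
  rw [h1, ← Finset.add_sum_erase _ _ (Finset.empty_mem_powerset T)]
  simp only [Finset.sdiff_empty, Finset.prod_empty, piE_const hw4, mul_one, h0, add_sub_cancel_left]
  refine (Finset.abs_sum_le_sum_abs _ _).trans ?_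
  have hterm : ∀ t ∈ T.powerset.erase ∅, _ := fun t ht =>
    abs_piE_term_le (c := c) (fl := fl) (J := J) hG hη hη1 hT
      (Finset.mem_powerset.1 (Finset.mem_of_mem_erase ht))
      (Finset.nonempty_iff_ne_empty.2 (Finset.ne_of_mem_erase ht))
  refine (Finset.sum_le_sum hterm).trans ?_
  by_cases h2 : 2 ≤ (T.filter (fun a => fl a)).card
  swap
  · simp [h2]
  simp only [h2, and_true, if_true]
  set D := piE (unif (Fin G)) (fun h : Fin J → Fin G => ∏ b ∈ T, dens h (c b).1) with hD
  have hD0 : 0 ≤ D := piE_nonneg hw fun h => Finset.prod_nonneg fun b _ => (dens_pos _ _).le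
  rw [← Finset.sum_filter]
  have hpow := Finset.sum_pow_mul_eq_add_pow (3 : ℝ) 1 (T.filter (fun a => fl a))
  simp only [one_pow, mul_one] at hpow
  calc _ ≤ ∑ t ∈ (T.filter (fun a => fl a)).powerset, 3 ^ t.card * (η ^ 2 * (4 * J ^ 2 / G * D)) :=
      by
        refine Finset.sum_le_sum_of_subset_of_nonneg (fun t ht => ?_) fun t _ _ => by positivity
        exact Finset.mem_powerset.2 (Finset.mem_filter.1 ht).2
    _ = _ := by
        rw [← Finset.sum_mul, hpow]
        norm_num
        ring

end unit

section unit_base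

variable {G J : ℕ} {η : ℝ} {ι : Type*} {T : Finset ι} {c : ι → Fin G × Fin 4}

theorem unitDens_congr {fl : ι → Bool} {c' : ι → Fin G × Fin 4} (h : ∀ a ∈ T, c a = c' a) :
    unitDens J η fl T c = unitDens J η fl T c' := by
  unfold unitDens
  refine congrArg _ (funext fun _ => congrArg _ (funext fun _ => ?_))
  exact Finset.prod_congr rfl fun a ha => by rw [h a ha]

theorem unitDens_base_pos (hG : 0 < G) : 0 < unitDens J η (fun _ => false) T c := by
  have : Nonempty (Fin G) := ⟨⟨0, hG⟩⟩
  have hw := isProbVec_unif (Fin G)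
  have hw4 := isProbVec_unif (Fin 4)
  simp only [unitDens, kap, Bool.false_eq_true, if_false, zero_add, piE_const hw4]
  refine lt_of_lt_of_le (by positivity : (0 : ℝ) < (2 / 3) ^ T.card) ?_
  rw [← piE_const (ι := Fin J) hw (((2 : ℝ) / 3) ^ T.card)]
  refine piE_mono hw fun h => ?_
  rw [← Finset.prod_const]
  exact Finset.prod_le_prod (fun _ _ => by norm_num) fun b _ => two_thirds_le_dens _ _

end unit_base

/-! ### Likelihood-free testing with few samples from the third distribution -/

section mean

variable {G J : ℕ} {η : ℝ}

theorem sum_unif_mul_kap (hG : 0 < G) (hJ : 0 < J) (fl : Bool) (h : Fin J → Fin G)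
    (v : Fin G → Fin 4) : ∑ c, unif (Fin G × Fin 4) c * kap η fl h v c = 1 := by
  have hG0 : (0 : ℝ) < G := by exact_mod_cast hG
  have hJ0 : (0 : ℝ) < J := by exact_mod_cast hJ
  have h1 : ∀ g, ∑ b, kap η fl h v (g, b) = 4 * dens h g := by
    intro g
    simp only [kap, xi, Fin.sum_univ_four]
    generalize v g = b
    cases fl <;> fin_cases b <;> simp <;> ring
  have h2 : ∑ g, dens h g = G := by
    simp only [dens, Finset.sum_add_distrib]
    rw [Finset.sum_comm]
    simp
    field_simp
    norm_num
  simp only [unif, ← Finset.mul_sum]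
  rw [Fintype.sum_prod_type]
  simp only [h1, ← Finset.mul_sum, h2]
  simp
  field_simp

theorem kap_nonneg (hη : 0 ≤ η) (hη1 : η ≤ 1) (fl : Bool) (h : Fin J → Fin G)
    (v : Fin G → Fin 4) (c : Fin G × Fin 4) : 0 ≤ kap η fl h v c := by
  have h1 := two_thirds_le_dens h c.1
  unfold kap xi
  split_ifs <;> nlinarith

variable {ι : Type*} [Fintype ι] [DecidableEq ι] {fl : ι → Bool}

theorem piE_unitDens (hG : 0 < G) (hJ : 0 < J) (T : Finset ι) :
    piE (unif (Fin G × Fin 4)) (unitDens J η fl T) = 1 := by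
  have : Nonempty (Fin G) := ⟨⟨0, hG⟩⟩
  have hw := isProbVec_unif (Fin G)
  have hw4 := isProbVec_unif (Fin 4)
  change piE (unif (Fin G × Fin 4)) (fun c => unitDens J η fl T c) = 1
  simp only [unitDens]
  rw [piE_comm, ← piE_const (ι := Fin J) hw 1]
  refine congrArg _ (funext fun h => ?_)
  rw [piE_comm, ← piE_const (ι := Fin G) hw4 1]
  refine congrArg _ (funext fun v => ?_)
  have h1 : ∀ c : ι → Fin G × Fin 4, ∏ a ∈ T, kap η (fl a) h v (c a) =
      ∏ a, (fun a i => if a ∈ T then kap η (fl a) h v i else 1) a (c a) := by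
    intro c
    rw [Finset.prod_ite_mem Finset.univ T]
    simp
  simp_rw [h1]
  rw [piE_prod (fun a i => if a ∈ T then kap η (fl a) h v i else 1)]
  refine Finset.prod_eq_one fun a _ => ?_
  have : Nonempty (Fin G × Fin 4) := inferInstance
  by_cases ha : a ∈ T
  · simp only [ha, if_true]
    exact sum_unif_mul_kap hG hJ _ _ _
  · simp only [ha, if_false, mul_one]
    exact (isProbVec_unif _).sum_eq_one

/-- The indices of the draws that fall into a given unit. -/
def unitIdx {U : ℕ} (u : ι → Fin U) (x : Fin U) : Finset ι := Finset.univ.filter fun a => u a = x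

/-- The bound on the relative effect of the perturbation, for a unit containing `s` flagged
draws. -/
noncomputable def effect (G J : ℕ) (η : ℝ) (s : ℕ) : ℝ :=
  if 2 ≤ s then 4 * η ^ 2 * J ^ 2 / G * 4 ^ s else 0

/-- Given the units of the draws, the chi-square divergence tensorizes over the units. -/
theorem sq_piE_prod_unitDens_sub_le (hG : 0 < G) (hJ : 0 < J) (hη : 0 ≤ η) (hη1 : η ≤ 1) {U : ℕ}
    {u : ι → Fin U} (hT : ∀ x, (unitIdx u x).card ≤ J + 1) {F : (ι → Fin G × Fin 4) → ℝ}
    (h0 : ∀ c, 0 ≤ F c) (h1 : ∀ c, F c ≤ 1) :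
    (piE (unif (Fin G × Fin 4)) (fun c => (∏ x, unitDens J η fl (unitIdx u x) c) * F c) -
      piE (unif (Fin G × Fin 4))
        (fun c => (∏ x, unitDens J η (fun _ => false) (unitIdx u x) c) * F c)) ^ 2 ≤
      Real.exp (∑ x, effect G J η ((unitIdx u x).filter (fun a => fl a)).card ^ 2) - 1 := by
  have : Nonempty (Fin G) := ⟨⟨0, hG⟩⟩
  have hw := isProbVec_unif (Fin G × Fin 4)
  set D0 : Fin U → (ι → Fin G × Fin 4) → ℝ := fun x c =>
    unitDens J η (fun _ => false) (unitIdx u x) c with hD0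
  set D1 : Fin U → (ι → Fin G × Fin 4) → ℝ := fun x c => unitDens J η fl (unitIdx u x) c with hD1
  have hpos : ∀ x c, 0 < D0 x c := fun x c => unitDens_base_pos hG
  have hP0 : ∀ c, 0 < ∏ x, D0 x c := fun c => Finset.prod_pos fun x _ => hpos x c
  have hdep : ∀ (f : ι → Bool) (x : Fin U) (c c' : ι → Fin G × Fin 4),
      (∀ a, u a = x → c a = c' a) → unitDens J η f (unitIdx u x) c =
        unitDens J η f (unitIdx u x) c' := fun f x c c' h =>
    unitDens_congr fun a ha => h a (Finset.mem_filter.1 ha).2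
  have m0 : piE (unif (Fin G × Fin 4)) (fun c => ∏ x, D0 x c) = 1 := by
    rw [piE_prod_of_partition hw u (hdep _)]
    exact Finset.prod_eq_one fun x _ => piE_unitDens hG hJ _
  have m1 : piE (unif (Fin G × Fin 4)) (fun c => ∏ x, D1 x c) = 1 := by
    rw [piE_prod_of_partition hw u (hdep _)]
    exact Finset.prod_eq_one fun x _ => piE_unitDens hG hJ _
  have m2 : piE (unif (Fin G × Fin 4)) (fun c => ∏ x, (D1 x c ^ 2 / D0 x c)) ≤
      Real.exp (∑ x, effect G J η ((unitIdx u x).filter (fun a => fl a)).card ^ 2) := by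
    rw [piE_prod_of_partition hw u, Real.exp_sum]
    · refine Finset.prod_le_prod (fun x _ => piE_nonneg hw fun c =>
        div_nonneg (sq_nonneg _) (hpos x c).le) fun x _ => ?_
      set τ := effect G J η ((unitIdx u x).filter (fun a => fl a)).card with hτ
      have hpt : ∀ c, D1 x c ^ 2 / D0 x c ≤ τ ^ 2 * D0 x c + 2 * D1 x c - D0 x c := by
        intro c
        rw [div_le_iff₀ (hpos x c)]
        have h2 : |D1 x c - D0 x c| ≤ τ * D0 x c :=
          abs_unitDens_sub_le (c := c) (fl := fl) (J := J) hG hη hη1 (hT x)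
        have h3 := sq_le_sq' (by linarith [abs_le.1 h2 |>.1]) (abs_le.1 h2).2
        nlinarith
      have e0 : piE (unif (Fin G × Fin 4)) (D0 x) = 1 := piE_unitDens hG hJ _
      have e1 : piE (unif (Fin G × Fin 4)) (D1 x) = 1 := piE_unitDens hG hJ _
      refine (piE_mono hw hpt).trans ?_
      rw [piE_sub, piE_add, piE_const_mul, piE_const_mul]
      change τ ^ 2 * piE (unif (Fin G × Fin 4)) (D0 x) + 2 * piE (unif (Fin G × Fin 4)) (D1 x) -
        piE (unif (Fin G × Fin 4)) (D0 x) ≤ _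
      rw [e0, e1]
      linarith [Real.add_one_le_exp (τ ^ 2)]
    · intro x c c' h
      simp only [hD0, hD1, hdep _ x c c' h]
  -- Cauchy–Schwarz bounds the difference by the root of the chi-square divergence
  have hcs := piE_mul_sq_le hw
    (fun c : ι → Fin G × Fin 4 => (∏ x, D1 x c - ∏ x, D0 x c) / Real.sqrt (∏ x, D0 x c))
    (fun c => Real.sqrt (∏ x, D0 x c) * F c)
  rw [← piE_sub]
  have e1 : (fun c : ι → Fin G × Fin 4 => (∏ x, D1 x c - ∏ x, D0 x c) / Real.sqrt (∏ x, D0 x c) *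
      (Real.sqrt (∏ x, D0 x c) * F c)) =
      fun c => (∏ x, D1 x c) * F c - (∏ x, D0 x c) * F c := by
    ext c
    have := (Real.sqrt_pos.2 (hP0 c)).ne'
    field_simp
  rw [e1] at hcs
  refine hcs.trans ?_
  have hA : piE (unif (Fin G × Fin 4)) (fun c : ι → Fin G × Fin 4 =>
      ((∏ x, D1 x c - ∏ x, D0 x c) / Real.sqrt (∏ x, D0 x c)) ^ 2) ≤
      Real.exp (∑ x, effect G J η ((unitIdx u x).filter (fun a => fl a)).card ^ 2) - 1 := by
    have : ∀ c : ι → Fin G × Fin 4,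
        ((∏ x, D1 x c - ∏ x, D0 x c) / Real.sqrt (∏ x, D0 x c)) ^ 2 =
        ∏ x, (D1 x c ^ 2 / D0 x c) - 2 * ∏ x, D1 x c + ∏ x, D0 x c := by
      intro c
      rw [div_pow, Real.sq_sqrt (hP0 c).le, Finset.prod_div_distrib, Finset.prod_pow]
      have := (hP0 c).ne'
      field_simp
      ring
    simp_rw [this]
    rw [piE_add, piE_sub, piE_const_mul, m0, m1]
    linarith
  have hB : piE (unif (Fin G × Fin 4)) (fun c : ι → Fin G × Fin 4 =>
      (Real.sqrt (∏ x, D0 x c) * F c) ^ 2) ≤ 1 := by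
    rw [← m0]
    refine piE_mono hw fun c => ?_
    rw [mul_pow, Real.sq_sqrt (hP0 c).le]
    exact mul_le_of_le_one_right (hP0 c).le (by nlinarith [h0 c, h1 c])
  have hB0 : 0 ≤ piE (unif (Fin G × Fin 4)) (fun c : ι → Fin G × Fin 4 =>
      (Real.sqrt (∏ x, D0 x c) * F c) ^ 2) := piE_nonneg hw fun c => sq_nonneg _
  have hA0 : 0 ≤ piE (unif (Fin G × Fin 4)) (fun c : ι → Fin G × Fin 4 =>
      ((∏ x, D1 x c - ∏ x, D0 x c) / Real.sqrt (∏ x, D0 x c)) ^ 2) :=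
    piE_nonneg hw fun c => sq_nonneg _
  nlinarith

/-- The total variation bound of `sq_piE_prod_unitDens_sub_le`, linearized, without the assumption
that no unit is overfull. -/
theorem abs_piE_prod_unitDens_sub_le (hG : 0 < G) (hJ : 0 < J) (hη : 0 ≤ η) (hη1 : η ≤ 1) {U : ℕ}
    (u : ι → Fin U) {F : (ι → Fin G × Fin 4) → ℝ} (h0 : ∀ c, 0 ≤ F c) (h1 : ∀ c, F c ≤ 1) :
    |piE (unif (Fin G × Fin 4)) (fun c => (∏ x, unitDens J η fl (unitIdx u x) c) * F c) -
      piE (unif (Fin G × Fin 4))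
        (fun c => (∏ x, unitDens J η (fun _ => false) (unitIdx u x) c) * F c)| ≤
      ∑ x, ind ((J + 2 : ℝ) ≤ (unitIdx u x).card) + (1 / 32 +
      16 * ∑ x, effect G J η ((unitIdx u x).filter (fun a => fl a)).card ^ 2) := by
  have : Nonempty (Fin G) := ⟨⟨0, hG⟩⟩
  have hw := isProbVec_unif (Fin G × Fin 4)
  have hbd : ∀ f : ι → Bool, 0 ≤ piE (unif (Fin G × Fin 4))
      (fun c => (∏ x, unitDens J η f (unitIdx u x) c) * F c) ∧ piE (unif (Fin G × Fin 4))
      (fun c => (∏ x, unitDens J η f (unitIdx u x) c) * F c) ≤ 1 := by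
    intro f
    have hn : ∀ c : ι → Fin G × Fin 4, 0 ≤ ∏ x, unitDens J η f (unitIdx u x) c := fun c =>
      Finset.prod_nonneg fun x _ => piE_nonneg (isProbVec_unif _) fun h =>
        piE_nonneg (isProbVec_unif _) fun v =>
          Finset.prod_nonneg fun a _ => kap_nonneg hη hη1 _ _ _ _
    refine ⟨piE_nonneg hw fun c => mul_nonneg (hn c) (h0 c), ?_⟩
    refine (piE_mono hw fun c => mul_le_of_le_one_right (hn c) (h1 c)).trans ?_
    rw [piE_prod_of_partition hw u (f := fun x c => unitDens J η f (unitIdx u x) c) fun x c c' h =>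
      unitDens_congr fun a ha => h a (by simpa [unitIdx] using ha)]
    exact (Finset.prod_eq_one fun x _ => piE_unitDens hG hJ _).le
  have hW : 0 ≤ ∑ x, effect G J η ((unitIdx u x).filter (fun a => fl a)).card ^ 2 :=
    Finset.sum_nonneg fun x _ => sq_nonneg _
  have hI : 0 ≤ ∑ x, ind ((J + 2 : ℝ) ≤ (unitIdx u x).card) :=
    Finset.sum_nonneg fun x _ => ind_nonneg _
  have hle1 : |piE (unif (Fin G × Fin 4)) (fun c => (∏ x, unitDens J η fl (unitIdx u x) c) * F c) -
      piE (unif (Fin G × Fin 4))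
        (fun c => (∏ x, unitDens J η (fun _ => false) (unitIdx u x) c) * F c)| ≤ 1 := by
    have b1 := hbd fl
    have b2 := hbd fun _ => false
    rw [abs_le]
    constructor <;> linarith
  -- the sum of indicators makes the bound trivial when some unit is overfull
  by_cases hT : ∀ x, (unitIdx u x).card ≤ J + 1
  · have hsq := sq_piE_prod_unitDens_sub_le (fl := fl) hG hJ hη hη1 hT h0 h1
    set W := ∑ x, effect G J η ((unitIdx u x).filter (fun a => fl a)).card ^ 2 with hWd
    rw [← sq_abs] at hsq
    set d := |piE (unif (Fin G × Fin 4)) (fun c => (∏ x, unitDens J η fl (unitIdx u x) c) * F c) -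
      piE (unif (Fin G × Fin 4))
        (fun c => (∏ x, unitDens J η (fun _ => false) (unitIdx u x) c) * F c)| with hd
    by_cases hW1 : W ≤ 1
    · have h2 := exp_le_one_add_sq (θ := W) (abs_le.2 ⟨by linarith, hW1⟩)
      have h3 : d ^ 2 ≤ 2 * W := by nlinarith
      nlinarith [sq_nonneg (d - 1 / 16)]
    · linarith
  · push Not at hT
    obtain ⟨x, hx⟩ := hT
    have h2 : 1 ≤ ∑ x, ind ((J + 2 : ℝ) ≤ (unitIdx u x).card) := by
      refine le_trans (le_of_eq (ind_true ?_).symm) (Finset.single_le_sum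
        (f := fun x => ind ((J + 2 : ℝ) ≤ (unitIdx u x).card)) (fun _ _ => ind_nonneg _)
        (Finset.mem_univ x))
      have : J + 2 ≤ (unitIdx u x).card := by omega
      exact_mod_cast this
    linarith

end mean

section assignment

variable {U : ℕ} {ι : Type*} [Fintype ι] [DecidableEq ι]

theorem one_add_pow_le {x : ℝ} (hx : 0 ≤ x) (n : ℕ) :
    (1 + x) ^ n ≤ 1 + n * x + n ^ 2 * x ^ 2 * (1 + x) ^ n := by
  induction n with
  | zero => simp
  | succ n ih =>
    have h1 : 1 ≤ (1 + x) ^ (n + 1) := one_le_pow₀ (by linarith)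
    have h2 : (1 + x) ^ (n + 1) ≤ (1 + x) * (1 + n * x) + n ^ 2 * x ^ 2 * (1 + x) ^ (n + 1) := by
      rw [pow_succ (1 + x) n]
      nlinarith
    push_cast
    have h3 : (n : ℝ) * x ^ 2 ≤ (2 * n + 1) * x ^ 2 * (1 + x) ^ (n + 1) := by
      have : 0 ≤ (n : ℝ) := by positivity
      have h4 : 0 ≤ (2 * n + 1) * x ^ 2 := by positivity
      nlinarith [sq_nonneg x]
    nlinarith

theorem ite_pow_le (x : ℝ) (hx : 0 ≤ x) (s : ℕ) :
    (if 2 ≤ s then x ^ s else 0) ≤ (1 + x) ^ s - 1 - s * x := by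
  induction s with
  | zero => simp
  | succ s ih =>
    rcases Nat.lt_or_ge s 1 with h | h
    · have : s = 0 := by omega
      subst this
      simp
    · rw [if_pos (by omega)]
      rcases Nat.lt_or_ge s 2 with h2 | h2
      · have : s = 1 := by omega
        subst this
        push_cast
        nlinarith
      · rw [if_pos h2] at ih
        rw [pow_succ, pow_succ]
        push_cast
        have h3 : 0 ≤ (s : ℝ) := by positivity
        nlinarith [mul_nonneg h3 (mul_nonneg hx hx), pow_nonneg hx s, mul_nonneg hx
            (pow_nonneg hx s)]

/-- The expected effect of collisions of flagged draws in the same unit. -/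
theorem piE_ite_pow_le (hU : 0 < U) {x : ℝ} (hx : 0 ≤ x) (Y : Finset ι) (hY : Y.card ≤ U)
    (i : Fin U) :
    piE (unif (Fin U)) (fun u : ι → Fin U =>
      if 2 ≤ ((unitIdx u i).filter (fun a => a ∈ Y)).card then
        x ^ ((unitIdx u i).filter (fun a => a ∈ Y)).card else 0) ≤
      (Y.card / U) ^ 2 * (x ^ 2 * Real.exp x) := by
  have : Nonempty (Fin U) := ⟨⟨0, hU⟩⟩
  have hU0 : (0 : ℝ) < U := by exact_mod_cast hU
  have hw := isProbVec_unif (Fin U)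
  have hcnt : ∀ u : ι → Fin U, (((unitIdx u i).filter (fun a => a ∈ Y)).card : ℝ) = cnt Y {i} u :=
      by
    intro u
    unfold cnt unitIdx
    congr 2
    ext a
    simp [and_comm]
  have hsum : ∑ j ∈ ({i} : Finset (Fin U)), unif (Fin U) j = 1 / U := by simp [unif]
  have hpt : ∀ u : ι → Fin U, (if 2 ≤ ((unitIdx u i).filter (fun a => a ∈ Y)).card then
        x ^ ((unitIdx u i).filter (fun a => a ∈ Y)).card else 0) ≤
      Real.exp (Real.log (1 + x) * cnt Y {i} u) - 1 - x * cnt Y {i} u := by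
    intro u
    refine (ite_pow_le x hx _).trans (le_of_eq ?_)
    rw [← hcnt, mul_comm (Real.log _), Real.exp_nat_mul, Real.exp_log (by linarith)]
    ring
  refine (piE_mono hw hpt).trans ?_
  rw [piE_sub, piE_sub, piE_const hw, piE_exp_cnt hw, hsum, Real.exp_log
      (by linarith), piE_const_mul]
  have hmean : piE (unif (Fin U)) (fun u : ι → Fin U => cnt Y {i} u) = Y.card / U := by
    simp_rw [cnt_eq_sum]
    rw [piE_sum]
    have : ∀ a, piE (unif (Fin U)) (fun u : ι → Fin U => if u a ∈ ({i} : Finset (Fin U)) then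
        (1 : ℝ)
        else 0) = 1 / U := by
      intro a
      rw [piE_eval hw a (fun j => if j ∈ ({i} : Finset (Fin U)) then (1 : ℝ) else 0)]
      simp [unif]
    simp_rw [this]
    simp
    ring
  rw [hmean]
  have h1 := one_add_pow_le (x := x / U) (by positivity) Y.card
  have h2 : (1 + x / U) ^ Y.card ≤ Real.exp x := by
    calc (1 + x / U) ^ Y.card ≤ (1 + x / U) ^ U :=
          pow_le_pow_right₀ (by have : 0 ≤ x / U := by positivity
                                linarith) hY
      _ ≤ Real.exp (x / U) ^ U := by
          gcongr
          rw [add_comm]; exact Real.add_one_le_exp _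
      _ = Real.exp x := by
          rw [← Real.exp_nat_mul]
          congr 1
          field_simp
  have h3 : 1 + 1 / (U : ℝ) * (1 + x - 1) = 1 + x / U := by ring
  rw [h3]
  have h4 : (Y.card : ℝ) ^ 2 * (x / U) ^ 2 * (1 + x / U) ^ Y.card ≤
      (Y.card / U) ^ 2 * (x ^ 2 * Real.exp x) := by
    calc (Y.card : ℝ) ^ 2 * (x / U) ^ 2 * (1 + x / U) ^ Y.card ≤
        (Y.card : ℝ) ^ 2 * (x / U) ^ 2 * Real.exp x := by gcongr
      _ = _ := by ring
  have h5 : (Y.card : ℝ) * (x / U) = x * (Y.card / U) := by ring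
  linarith

end assignment

section mixture

variable {U G J : ℕ} {η : ℝ}

/-- The hidden parameters of one unit: the heavy cells and the perturbations of the cells. -/
abbrev UnitParam (G J : ℕ) : Type := (Fin J → Fin G) × (Fin G → Fin 4)

/-- The uniform prior on the hidden parameters of one unit. -/
noncomputable def prior (G J : ℕ) (θ : UnitParam G J) : ℝ :=
  (∏ j, unif (Fin G) (θ.1 j)) * ∏ g, unif (Fin 4) (θ.2 g)

theorem sum_prior_mul (F : (Fin J → Fin G) → (Fin G → Fin 4) → ℝ) :
    ∑ θ, prior G J θ * F θ.1 θ.2 =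
      piE (unif (Fin G)) (fun h => piE (unif (Fin 4)) (fun v => F h v)) := by
  rw [Fintype.sum_prod_type]
  simp only [piE, prior, Finset.mul_sum]
  exact Finset.sum_congr rfl fun h _ => Finset.sum_congr rfl fun v _ => by ring

theorem isProbVec_prior (hG : 0 < G) : IsProbVec (prior G J) := by
  have : Nonempty (Fin G) := ⟨⟨0, hG⟩⟩
  have hw := isProbVec_unif (Fin G)
  have hw4 := isProbVec_unif (Fin 4)
  refine ⟨fun θ => mul_nonneg (Finset.prod_nonneg fun _ _ => hw.nonneg _)
    (Finset.prod_nonneg fun _ _ => hw4.nonneg _), ?_⟩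
  have := sum_prior_mul (G := G) (J := J) fun _ _ => 1
  simpa only [mul_one, piE_const hw4, piE_const hw] using this

/-- The distribution, given the hidden parameters, of a draw of a unit and of a cell and a letter
from it; the perturbation is switched on by the flag. -/
noncomputable def unitLaw (η : ℝ) (θ : Fin U → UnitParam G J) (fl : Bool)
    (i : Fin U × (Fin G × Fin 4)) : ℝ :=
  unif (Fin U) i.1 * unif (Fin G × Fin 4) i.2 * kap η fl (θ i.1).1 (θ i.1).2 i.2

theorem isProbVec_unitLaw (hU : 0 < U) (hG : 0 < G) (hJ : 0 < J) (hη : 0 ≤ η) (hη1 : η ≤ 1)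
    (θ : Fin U → UnitParam G J) (fl : Bool) : IsProbVec (unitLaw η θ fl) := by
  have : Nonempty (Fin U) := ⟨⟨0, hU⟩⟩
  have : Nonempty (Fin G) := ⟨⟨0, hG⟩⟩
  have hw := isProbVec_unif (Fin U)
  refine ⟨fun i => mul_nonneg (mul_nonneg (hw.nonneg _) ((isProbVec_unif _).nonneg _))
    (kap_nonneg hη hη1 _ _ _ _), ?_⟩
  rw [Fintype.sum_prod_type]
  simp only [unitLaw, mul_assoc, ← Finset.mul_sum, sum_unif_mul_kap hG hJ, mul_one]
  exact hw.sum_eq_one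

theorem sum_abs_unitLaw_sub (hU : 0 < U) (hG : 0 < G) (hη : 0 ≤ η) (θ : Fin U → UnitParam G J) :
    ∑ i, |unitLaw η θ false i - unitLaw η θ true i| = η := by
  have : Nonempty (Fin U) := ⟨⟨0, hU⟩⟩
  have hG0 : (0 : ℝ) < G := by exact_mod_cast hG
  have hw := isProbVec_unif (Fin U)
  have h1 : ∀ i, |unitLaw η θ false i - unitLaw η θ true i| =
      unif (Fin U) i.1 * (1 / (4 * G) * (2 / 3 * η * |xi (θ i.1).2 i.2|)) := by
    intro i
    have : unitLaw η θ false i - unitLaw η θ true i =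
        -(unif (Fin U) i.1 * (1 / (4 * G) * (2 / 3 * η * xi (θ i.1).2 i.2))) := by
      simp [unitLaw, kap, unif]
      ring
    rw [this, abs_neg, abs_mul, abs_mul, abs_mul, abs_of_nonneg (hw.nonneg _),
      abs_of_nonneg (by positivity : 0 ≤ 1 / (4 * (G : ℝ))),
      abs_of_nonneg (by positivity : 0 ≤ 2 / 3 * η)]
  have h2 : ∀ (v : Fin G → Fin 4) (g : Fin G), ∑ b, |xi v (g, b)| = 6 := by
    intro v g
    simp only [xi, Fin.sum_univ_four]
    generalize v g = b
    fin_cases b <;> simp <;> norm_num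
  simp_rw [h1]
  rw [Fintype.sum_prod_type]
  simp only [← Finset.mul_sum, Fintype.sum_prod_type, h2]
  simp only [Finset.sum_const, Finset.card_univ, Fintype.card_fin, nsmul_eq_mul]
  rw [← Finset.sum_mul, hw.sum_eq_one]
  field_simp
  ring

variable {ι : Type*} [Fintype ι]

/-- The density of the draws, averaged over the hidden parameters, is a product over the units. -/
theorem piE_prior_prod_kap (fl : ι → Bool) (u : ι → Fin U) (c : ι → Fin G × Fin 4) :
    piE (prior G J) (fun θ : Fin U → UnitParam G J =>
      ∏ a, kap η (fl a) (θ (u a)).1 (θ (u a)).2 (c a)) =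
      ∏ x, unitDens J η fl (unitIdx u x) c := by
  have h1 : ∀ θ : Fin U → UnitParam G J, ∏ a, kap η (fl a) (θ (u a)).1 (θ (u a)).2 (c a) =
      ∏ x, (fun x (θ : UnitParam G J) => ∏ a ∈ unitIdx u x, kap η (fl a) θ.1 θ.2 (c a)) x (θ x) :=
          by
    intro θ
    rw [← Finset.prod_fiberwise Finset.univ u]
    refine Finset.prod_congr rfl fun x _ => Finset.prod_congr rfl fun a ha => ?_
    rw [(Finset.mem_filter.1 ha).2]
  simp_rw [h1]
  rw [piE_prod fun x (θ : UnitParam G J) => ∏ a ∈ unitIdx u x, kap η (fl a) θ.1 θ.2 (c a)]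
  refine Finset.prod_congr rfl fun x _ => ?_
  exact sum_prior_mul fun h v => ∏ a ∈ unitIdx u x, kap η (fl a) h v (c a)

variable [DecidableEq ι]

/-- Draws with flags, averaged over the hidden parameters. -/
theorem piE_prior_piE_prod_kap (fl : ι → Bool) (F : (ι → Fin U × (Fin G × Fin 4)) → ℝ) :
    piE (prior G J) (fun θ : Fin U → UnitParam G J =>
      piE (fun i : Fin U × (Fin G × Fin 4) => unif (Fin U) i.1 * unif (Fin G × Fin 4) i.2)
        (fun ω : ι → Fin U × (Fin G × Fin 4) =>
          (∏ a, kap η (fl a) (θ (ω a).1).1 (θ (ω a).1).2 (ω a).2) * F ω)) =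
    piE (unif (Fin U)) (fun u : ι → Fin U => piE (unif (Fin G × Fin 4)) (fun c =>
      (∏ x, unitDens J η fl (unitIdx u x) c) * F (fun a => (u a, c a)))) := by
  rw [piE_comm]
  have h1 := piE_prod_type (ι := ι) (w := unif (Fin U)) (w' := unif (Fin G × Fin 4)) (fun u c =>
    piE (prior G J) (fun θ : Fin U → UnitParam G J =>
      (∏ a, kap η (fl a) (θ (u a)).1 (θ (u a)).2 (c a)) * F (fun a => (u a, c a))))
  refine h1.trans (congrArg _ (funext fun u => congrArg _ (funext fun c => ?_)))
  simp_rw [mul_comm _ (F _), piE_const_mul, piE_prior_prod_kap]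

/-- The perturbation of the flagged draws is not noticeable on average over the hidden
parameters. -/
theorem abs_piE_prior_sub_le (hU : 0 < U) (hG : 0 < G) (hJ : 0 < J) (hη : 0 ≤ η) (hη1 : η ≤ 1)
    {Y : Finset ι} (hY : Y.card ≤ U) {F : (ι → Fin U × (Fin G × Fin 4)) → ℝ} (h0 : ∀ ω, 0 ≤ F ω)
    (h1 : ∀ ω, F ω ≤ 1) :
    |piE (unif (Fin U)) (fun u : ι → Fin U => piE (unif (Fin G × Fin 4)) (fun c =>
      (∏ x, unitDens J η (fun a => decide (a ∈ Y)) (unitIdx u x) c) * F (fun a => (u a, c a)))) -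
    piE (unif (Fin U)) (fun u : ι → Fin U => piE (unif (Fin G × Fin 4)) (fun c =>
      (∏ x, unitDens J η (fun _ => false) (unitIdx u x) c) * F (fun a => (u a, c a))))| ≤
    U * Real.exp (2 * (Fintype.card ι / U) - (J + 2)) + 1 / 32 +
      2 ^ 16 * Real.exp 16 * (η ^ 4 * J ^ 4 * Y.card ^ 2 / (U * G ^ 2)) := by
  have : Nonempty (Fin U) := ⟨⟨0, hU⟩⟩
  have hw := isProbVec_unif (Fin U)
  have hU0 : (0 : ℝ) < U := by exact_mod_cast hU
  have hG0 : (0 : ℝ) < G := by exact_mod_cast hG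
  rw [← piE_sub]
  have hpt := fun u : ι → Fin U => abs_piE_prod_unitDens_sub_le (fl := fun a => decide (a ∈ Y))
    (J := J) hG hJ hη hη1 u (F := fun c => F (fun a => (u a, c a))) (fun c => h0 _) (fun c => h1 _)
  have habs : ∀ f g : (ι → Fin U) → ℝ, (∀ u, |f u| ≤ g u) →
      |piE (unif (Fin U)) f| ≤ piE (unif (Fin U)) g := by
    intro f g hfg
    rw [abs_le]
    refine ⟨?_, piE_mono hw fun u => (abs_le.1 (hfg u)).2⟩
    have := piE_mono (ι := ι) hw fun u => (abs_le.1 (hfg u)).1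
    have h2 := piE_const_mul (w := unif (Fin U)) (-1) g
    simp only [neg_one_mul] at h2
    linarith
  refine (habs _ _ hpt).trans ?_
  rw [piE_add, piE_add, piE_const hw, piE_const_mul, piE_sum, piE_sum]
  have b1 : ∀ x : Fin U, piE (unif (Fin U)) (fun u : ι → Fin U =>
      ind ((J + 2 : ℝ) ≤ (unitIdx u x).card)) ≤ Real.exp (2 * (Fintype.card ι / U) - (J + 2)) := by
    intro x
    have := piE_le_cnt hw (Finset.univ : Finset ι) {x} (J + 2)
    have hs : ∑ j ∈ ({x} : Finset (Fin U)), unif (Fin U) j = 1 / U := by simp [unif]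
    rw [hs, Finset.card_univ, mul_one_div] at this
    refine le_trans (le_of_eq (congrArg _ (funext fun u => ?_))) this
    simp [cnt, unitIdx]
  have b2 : ∀ x : Fin U, piE (unif (Fin U)) (fun u : ι → Fin U =>
      effect G J η ((unitIdx u x).filter (fun a => decide (a ∈ Y))).card ^ 2) ≤
      16 * η ^ 4 * J ^ 4 / G ^ 2 * ((Y.card / U) ^ 2 * (16 ^ 2 * Real.exp 16)) := by
    intro x
    refine le_trans (le_of_eq ?_) (mul_le_mul_of_nonneg_left
      (piE_ite_pow_le hU (by norm_num : (0 : ℝ) ≤ 16) Y hY x) (by positivity))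
    rw [← piE_const_mul]
    refine congrArg _ (funext fun u => ?_)
    simp only [decide_eq_true_eq, effect]
    split_ifs
    · rw [mul_pow, ← pow_mul, mul_comm _ 2, pow_mul]
      norm_num
      ring
    · simp
  have b3 := Finset.sum_le_sum fun x (_ : x ∈ (Finset.univ : Finset (Fin U))) => b1 x
  have b4 := Finset.sum_le_sum fun x (_ : x ∈ (Finset.univ : Finset (Fin U))) => b2 x
  simp only [Finset.sum_const, Finset.card_univ, Fintype.card_fin, nsmul_eq_mul] at b3 b4
  have e1 : 16 * ((U : ℝ) * (16 * η ^ 4 * J ^ 4 / G ^ 2 * ((Y.card / U) ^ 2 * (16 ^ 2 *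
      Real.exp 16)))) =
      2 ^ 16 * Real.exp 16 * (η ^ 4 * J ^ 4 * Y.card ^ 2 / (U * G ^ 2)) := by
    field_simp
    ring
  linarith

end mixture

section lfht

variable {k n m : ℕ} {ε δ : ℝ}

theorem piE_mul_three {α : Type*} [Fintype α] (w g₁ g₂ g₃ : α → ℝ)
    (F : (Fin n → α) → (Fin n → α) → (Fin m → α) → ℝ) :
    piE (fun i => w i * g₁ i) (fun x => piE (fun i => w i * g₂ i) (fun y =>
      piE (fun i => w i * g₃ i) (fun z => F x y z))) =
    piE w (fun ω : Fin n ⊕ (Fin n ⊕ Fin m) → α =>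
      ((∏ a, g₁ (ω (Sum.inl a))) * ((∏ a, g₂ (ω (Sum.inr (Sum.inl a)))) *
        ∏ a, g₃ (ω (Sum.inr (Sum.inr a))))) *
        F (fun a => ω (Sum.inl a)) (fun a => ω (Sum.inr (Sum.inl a)))
          (fun a => ω (Sum.inr (Sum.inr a)))) := by
  simp_rw [piE_mul_prod]
  have h2 := piE_sum_type (ι := Fin n) (ι' := Fin n ⊕ Fin m) (w := w)
    (fun x y => ((∏ a, g₁ (x a)) * ((∏ a, g₂ (y (Sum.inl a))) * ∏ a, g₃ (y (Sum.inr a)))) *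
        F x (fun a => y (Sum.inl a)) (fun a => y (Sum.inr a)))
  refine Eq.trans ?_ h2.symm
  refine congrArg _ (funext fun x => ?_)
  have h3 := piE_sum_type (ι := Fin n) (ι' := Fin m) (w := w)
    (fun y z => ((∏ a, g₁ (x a)) * ((∏ a, g₂ (y a)) * ∏ a, g₃ (z a))) * F x y z)
  refine Eq.trans ?_ h3.symm
  rw [← piE_const_mul]
  refine congrArg _ (funext fun y => ?_)
  rw [← piE_const_mul, ← piE_const_mul]
  exact congrArg _ (funext fun z => by ring)

/-- Three samples with flags, as one family of draws. -/
theorem piE_unitLaw_three {U G J : ℕ} {η : ℝ} (θ : Fin U → UnitParam G J) (f₁ f₂ f₃ : Bool)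
    (F : (Fin n → Fin U × (Fin G × Fin 4)) → (Fin n → Fin U × (Fin G × Fin 4)) →
      (Fin m → Fin U × (Fin G × Fin 4)) → ℝ) :
    piE (unitLaw η θ f₁) (fun x => piE (unitLaw η θ f₂) (fun y => piE (unitLaw η θ f₃) (fun z =>
      F x y z))) =
    piE (fun i : Fin U × (Fin G × Fin 4) => unif (Fin U) i.1 * unif (Fin G × Fin 4) i.2)
      (fun ω : Fin n ⊕ (Fin n ⊕ Fin m) → Fin U × (Fin G × Fin 4) =>
        (∏ a, kap η (Sum.elim (fun _ => f₁) (Sum.elim (fun _ => f₂) (fun _ => f₃)) a)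
          (θ (ω a).1).1 (θ (ω a).1).2 (ω a).2) *
        F (fun a => ω (Sum.inl a)) (fun a => ω (Sum.inr (Sum.inl a)))
          (fun a => ω (Sum.inr (Sum.inr a)))) := by
  simp only [Fintype.prod_sum_type, Sum.elim_inl, Sum.elim_inr]
  exact piE_mul_three (fun i : Fin U × (Fin G × Fin 4) => unif (Fin U) i.1 * unif
      (Fin G × Fin 4) i.2)
    (fun i => kap η f₁ (θ i.1).1 (θ i.1).2 i.2) (fun i => kap η f₂ (θ i.1).1 (θ i.1).2 i.2)
    (fun i => kap η f₃ (θ i.1).1 (θ i.1).2 i.2) F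

/-- With few samples from the third distribution, likelihood-free testing requires more samples
from the two candidate distributions, by a factor of the order of `√(k / m)` up to logarithms. -/
theorem LFHTSolvable.sq_le (h : LFHTSolvable (PD k) ε δ n m) (hε : 0 ≤ ε)
    (hε1 : ε ≤ 1 / 2) (hδ1 : δ ≤ 1 / 4) (hm : 1 ≤ m) (hmk : 8 * m ≤ k) (hnm : n ≤ m) {J : ℕ}
    (hJ : Real.log k + 7 ≤ J) :
    (k : ℝ) ^ 2 ≤ 2 ^ 30 * Real.exp 16 * J ^ 4 * (n ^ 2 * m * ε ^ 4) := by
  -- `m` units of `G` cells of four letters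
  obtain ⟨G, hGd⟩ : ∃ G, G = k / (4 * m) := ⟨_, rfl⟩
  have hG2 : 2 ≤ G := by
    rw [hGd, Nat.le_div_iff_mul_le (by omega)]; omega
  have hG : 0 < G := by omega
  have hGk : 4 * m * G ≤ k := by rw [hGd]; exact Nat.mul_div_le _ _
  have hGk' : k ≤ 8 * m * G := by
    have h1 : k < 4 * m * (G + 1) := by
      rw [hGd]; exact Nat.lt_mul_div_succ _ (by omega)
    nlinarith
  have hk0 : (0 : ℝ) < k := by exact_mod_cast (by omega : 0 < k)
  have hk1 : (1 : ℝ) ≤ k := by exact_mod_cast (by omega : 1 ≤ k)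
  have hm0 : (0 : ℝ) < m := by exact_mod_cast hm
  have hG0 : (0 : ℝ) < G := by exact_mod_cast hG
  have hJ7 : (7 : ℝ) ≤ J := by linarith [Real.log_nonneg hk1]
  have hJ0 : 0 < J := by
    have : (0 : ℝ) < J := by linarith
    exact_mod_cast this
  obtain ⟨ψ, hψ⟩ := h.exists_test (β := Fin m × (Fin G × Fin 4))
    (by simp only [Fintype.card_prod, Fintype.card_fin]; nlinarith)
  have hη : 0 ≤ 2 * ε := by linarith
  have hη1 : 2 * ε ≤ 1 := by linarith
  have hpr := isProbVec_prior (J := J) hG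
  have hlaw := isProbVec_unitLaw (U := m) (J := J) hm hG hJ0 hη hη1
  have htv := sum_abs_unitLaw_sub (U := m) (J := J) hm hG hη
  set F : (Fin n ⊕ (Fin n ⊕ Fin m) → Fin m × (Fin G × Fin 4)) → ℝ := fun ω =>
    ind (ψ (fun a => ω (Sum.inl a)) (fun a => ω (Sum.inr (Sum.inl a)))
      (fun a => ω (Sum.inr (Sum.inr a))) = true) with hF
  -- the acceptance probability, averaged over the hidden parameters, as a function of the flags
  set M : (Fin n ⊕ (Fin n ⊕ Fin m) → Bool) → ℝ := fun fl =>
    piE (unif (Fin m)) (fun u : Fin n ⊕ (Fin n ⊕ Fin m) → Fin m =>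
      piE (unif (Fin G × Fin 4)) (fun c =>
      (∏ x, unitDens J (2 * ε) fl (unitIdx u x) c) * F (fun a => (u a, c a)))) with hM
  have hmix : ∀ f₁ f₂ f₃ : Bool, piE (prior G J) (fun θ : Fin m → UnitParam G J =>
      piE (unitLaw (2 * ε) θ f₁) (fun x => piE (unitLaw (2 * ε) θ f₂) (fun y =>
        piE (unitLaw (2 * ε) θ f₃) (fun z => ind (ψ x y z = true))))) =
      M (Sum.elim (fun _ => f₁) (Sum.elim (fun _ => f₂) (fun _ => f₃))) := by
    intro f₁ f₂ f₃
    refine Eq.trans ?_ (piE_prior_piE_prod_kap _ F)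
    exact congrArg _ (funext fun θ => piE_unitLaw_three θ f₁ f₂ f₃ fun x y z => ind
        (ψ x y z = true))
  -- the perturbation affects `Y` under one hypothesis and `X` under the other one
  have h0 : M (Sum.elim (fun _ => false) (Sum.elim (fun _ => true) (fun _ => false))) ≤ δ := by
    rw [← hmix, ← piE_const (ι := Fin m) hpr δ]
    exact piE_mono hpr fun θ => (hψ _ _ (hlaw θ false) (hlaw θ true) (le_of_eq (htv θ).symm)).1
  have h1 : 1 - δ ≤ M (Sum.elim (fun _ => true) (Sum.elim (fun _ => false) (fun _ => false))) := by
    rw [← hmix, ← piE_const (ι := Fin m) hpr (1 - δ)]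
    refine piE_mono hpr fun θ => ?_
    have := (hψ _ _ (hlaw θ true) (hlaw θ false) (by
      simp_rw [abs_sub_comm (unitLaw (2 * ε) θ true _)]
      exact le_of_eq (htv θ).symm)).2
    simp only [ind_eq_false, piE_sub, piE_const (hlaw θ true), piE_const (hlaw θ false)] at this
    linarith
  set Y₁ : Finset (Fin n ⊕ (Fin n ⊕ Fin m)) := Finset.univ.map Function.Embedding.inl with hY₁
  set Y₂ : Finset (Fin n ⊕ (Fin n ⊕ Fin m)) :=
    (Finset.univ.map Function.Embedding.inl : Finset (Fin n ⊕ Fin m)).map Function.Embedding.inr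
    with hY₂
  have c1 : Y₁.card = n := by simp [hY₁]
  have c2 : Y₂.card = n := by simp [hY₂]
  have e1 : (Sum.elim (fun _ => true) (Sum.elim (fun _ => false) (fun _ => false)) :
      Fin n ⊕ (Fin n ⊕ Fin m) → Bool) = fun a => decide (a ∈ Y₁) := by
    ext a
    rcases a with a | a | a <;> simp [hY₁]
  have e2 : (Sum.elim (fun _ => false) (Sum.elim (fun _ => true) (fun _ => false)) :
      Fin n ⊕ (Fin n ⊕ Fin m) → Bool) = fun a => decide (a ∈ Y₂) := by
    ext a
    rcases a with a | a | a <;> simp [hY₂]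
  rw [e2] at h0
  rw [e1] at h1
  have d1 := abs_piE_prior_sub_le (J := J) hm hG hJ0 hη hη1 (Y := Y₁) (c1.trans_le hnm) (F := F)
    (fun _ => ind_nonneg _) (fun _ => ind_le_one _)
  have d2 := abs_piE_prior_sub_le (J := J) hm hG hJ0 hη hη1 (Y := Y₂) (c2.trans_le hnm) (F := F)
    (fun _ => ind_nonneg _) (fun _ => ind_le_one _)
  rw [c1] at d1
  rw [c2] at d2
  have d1' := (abs_le.1 d1).2
  have d2' := (abs_le.1 d2).1
  change M (fun a => decide (a ∈ Y₁)) - M (fun _ => false) ≤ _ at d1'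
  change _ ≤ M (fun a => decide (a ∈ Y₂)) - M (fun _ => false) at d2'
  -- overfull units are unlikely
  have hbad : (m : ℝ) * Real.exp (2 * (Fintype.card (Fin n ⊕ (Fin n ⊕ Fin m)) / m) - (J + 2)) ≤
      1 / 16 := by
    have hc : (Fintype.card (Fin n ⊕ (Fin n ⊕ Fin m)) : ℝ) / m ≤ 3 := by
      rw [div_le_iff₀ hm0]
      have : (n : ℝ) ≤ m := by exact_mod_cast hnm
      simp only [Fintype.card_sum, Fintype.card_fin]
      push_cast
      linarith
    have hmk' : (m : ℝ) ≤ k := by exact_mod_cast (by omega : m ≤ k)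
    calc _ ≤ (k : ℝ) * Real.exp (-Real.log k + -3) := by
          gcongr
          linarith
      _ = Real.exp (-3) := by
          rw [Real.exp_add, Real.exp_neg, Real.exp_log hk0]
          field_simp
      _ ≤ 1 / 16 := by
          rw [Real.exp_neg, inv_eq_one_div]
          refine one_div_le_one_div_of_le (by norm_num) ?_
          have h2 : (2.7 : ℝ) ^ 3 ≤ Real.exp 1 ^ 3 := by
            gcongr
            linarith [Real.exp_one_gt_d9]
          rw [← Real.exp_nat_mul] at h2
          norm_num at h2
          linarith
  obtain ⟨E, hE⟩ : ∃ E, E = 2 ^ 16 * Real.exp 16 * ((2 * ε) ^ 4 * J ^ 4 * n ^ 2 / (m * G ^ 2)) :=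
    ⟨_, rfl⟩
  rw [← hE] at d1' d2'
  have hE1 : 1 / 16 ≤ E := by linarith
  have hGk2 : (k : ℝ) ≤ 8 * m * G := by exact_mod_cast hGk'
  rw [hE, ← mul_div_assoc, le_div_iff₀ (by positivity)] at hE1
  calc (k : ℝ) ^ 2 ≤ (8 * m * G) ^ 2 := by gcongr
    _ = (1024 : ℝ) * m * (1 / 16 * (m * (G : ℝ) ^ 2)) := by ring
    _ ≤ (1024 : ℝ) * m * (2 ^ 16 * Real.exp 16 * ((2 * ε) ^ 4 * J ^ 4 * n ^ 2)) := by gcongr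
    _ = _ := by ring

end lfht

/-! ### From sample complexities to the separation conditions -/

section conditions

variable {k n m : ℕ} {ε δ t c₀ : ℝ}

/-- The minimum in the sample size conditions is the ratio `t / k`, up to the constant `c₀`. -/
theorem mul_min_le_scale_div (hc₀ : 0 ≤ c₀) (hc₁ : c₀ ≤ 1) (hk : 0 < k) :
    c₀ * min 1 (m / (Real.log (1 / δ) * k)) ≤ scale c₀ k m δ / k := by
  have hk0 : (0 : ℝ) < k := by exact_mod_cast hk
  rw [le_div_iff₀ hk0]
  refine le_min ?_ ?_
  · calc c₀ * min 1 (m / (Real.log (1 / δ) * k)) * k ≤ c₀ * 1 * k := by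
          gcongr; exact min_le_left _ _
      _ ≤ 1 * 1 * k := by gcongr
      _ = k := by ring
  · calc c₀ * min 1 (m / (Real.log (1 / δ) * k)) * k
        ≤ c₀ * (m / (Real.log (1 / δ) * k)) * k := by gcongr; exact min_le_right _ _
      _ = _ := by rw [← div_div, mul_assoc, div_mul_cancel₀ _ hk0.ne', mul_div_assoc]

theorem sq_mul_log_le_of_nGoF_le {e u D : ℝ} (hk : 2 ≤ k) (he : 0 < e) (he1 : e ≤ 1 / 2)
    (hδ : 0 < δ) (hδ1 : δ ≤ 1 / 4) (hu : 0 ≤ u) (hD : 0 ≤ D)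
    (h : D * (nGoF (PD k) e δ : ℝ) ≤ n * Real.sqrt u) :
    D ^ 2 * (k * Real.log (1 / δ)) ≤ 48 * (n ^ 2 * u * e ^ 4) := by
  have h1 := mul_log_le_nGoF hk he he1 hδ hδ1
  have h2 : (D * (nGoF (PD k) e δ : ℝ)) ^ 2 ≤ n ^ 2 * u := by
    calc _ ≤ (n * Real.sqrt u) ^ 2 := by gcongr
      _ = _ := by rw [mul_pow, Real.sq_sqrt hu]
  calc _ ≤ D ^ 2 * (48 * ((nGoF (PD k) e δ : ℝ) ^ 2 * e ^ 4)) := by gcongr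
    _ = 48 * ((D * (nGoF (PD k) e δ : ℝ)) ^ 2 * e ^ 4) := by ring
    _ ≤ _ := by gcongr

theorem sq_mul_log_le_scale {e b D : ℝ} (hc₀ : 0 < c₀) (hc₁ : c₀ ≤ 1) (hk : 2 ≤ k) (he : 0 < e)
    (he1 : e ≤ 1 / 2) (hδ : 0 < δ) (hδ1 : δ ≤ 1 / 4) (hb : 0 ≤ b) (hD : 48 * b / c₀ ≤ D)
    (h : D * (nGoF (PD k) e δ : ℝ) ≤
      n * Real.sqrt (min 1 (m / (Real.log (1 / δ) * k)))) :
    b ^ 2 * (k * Real.log (1 / δ)) ≤ n ^ 2 * e ^ 4 * (scale c₀ k m δ / k) := by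
  have hL := one_le_log_one_div hδ hδ1
  have hu : 0 ≤ min (1 : ℝ) (m / (Real.log (1 / δ) * k)) := le_min zero_le_one (by positivity)
  have h0 : 0 ≤ 48 * b / c₀ := by positivity
  have h1 := sq_mul_log_le_of_nGoF_le hk he he1 hδ hδ1 hu (h0.trans hD) h
  have h2 := mul_min_le_scale_div (m := m) (δ := δ) hc₀.le hc₁ (by omega : 0 < k)
  generalize min (1 : ℝ) (m / (Real.log (1 / δ) * k)) = u at *
  have h3 : (48 * b) ^ 2 ≤ c₀ * D ^ 2 := by
    rw [div_le_iff₀ hc₀] at hD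
    calc (48 * b) ^ 2 ≤ (D * c₀) ^ 2 := by gcongr
      _ = c₀ * (c₀ * D ^ 2) := by ring
      _ ≤ 1 * (c₀ * D ^ 2) := by gcongr
      _ = _ := one_mul _
  have hkL : 0 ≤ k * Real.log (1 / δ) := by positivity
  have hne : (0 : ℝ) ≤ n ^ 2 * e ^ 4 := by positivity
  have h4 := mul_le_mul_of_nonneg_left h2 hne
  have h5 := mul_le_mul_of_nonneg_right h3 hkL
  have h6 := mul_le_mul_of_nonneg_left h1 hc₀.le
  have h7 : 0 ≤ b ^ 2 * (k * Real.log (1 / δ)) := by positivity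
  nlinarith

theorem half_le_log (hk : 2 ≤ k) : 1 / 2 ≤ Real.log k := by
  have := Real.log_two_gt_d9
  have h : Real.log 2 ≤ Real.log k := Real.log_le_log (by norm_num) (by exact_mod_cast hk)
  linarith

theorem numLevels_le_log (hn : 1 ≤ n) (ht : (n : ℝ) < t) (htk : t ≤ k) :
    (numLevels t n : ℝ) ≤ 4 * Real.log k := by
  have hn1 : (1 : ℝ) ≤ n := by exact_mod_cast hn
  have hk1 : n < k := by exact_mod_cast ht.trans_le htk
  have hk2 : (2 : ℝ) ≤ k := by exact_mod_cast (by omega : 2 ≤ k)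
  have h1 : (2 : ℝ) ^ numLevels t n ≤ k ^ 2 := by
    calc _ ≤ 2 * (t / n) := two_pow_numLevels_le hn ht
      _ ≤ 2 * t := by
        gcongr
        exact div_le_self (by linarith) hn1
      _ ≤ k ^ 2 := by nlinarith
  have h2 := Real.log_le_log (by positivity) h1
  rw [Real.log_pow, Real.log_pow] at h2
  have h3 := Real.log_two_gt_d9
  have h4 : (0 : ℝ) ≤ numLevels t n := by positivity
  push_cast at h2
  nlinarith

/-- Passing from the rate at separation `ε` to the rate at separation `ε / ℓ` costs a power of
`log k`. -/
theorem div_numLevels_pow_ge {y : ℝ} (hn : 1 ≤ n) (ht : (n : ℝ) < t) (htk : t ≤ k)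
    (h : 256 * Real.log k ^ 4 * y ≤ n ^ 2 * ε ^ 4) : y ≤ n ^ 2 * (ε / numLevels t n) ^ 4 := by
  have h1 := numLevels_le_log hn ht htk
  have h2 : (1 : ℝ) ≤ numLevels t n := by exact_mod_cast one_le_numLevels hn ht
  rcases le_or_gt y 0 with hy | hy
  · exact hy.trans (by positivity)
  rw [div_pow, ← mul_div_assoc, le_div_iff₀ (by positivity)]
  calc y * (numLevels t n : ℝ) ^ 4 ≤ y * (4 * Real.log k) ^ 4 := by gcongr
    _ = 256 * Real.log k ^ 4 * y := by ring
    _ ≤ _ := h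

theorem log_div_le_mul_log (hk : 2 ≤ k) (hδ : 0 < δ) (hδ1 : δ ≤ 1 / 4) :
    Real.log (k / δ) ≤ 3 * (Real.log k * Real.log (1 / δ)) := by
  have h1 := half_le_log hk
  have h2 := one_le_log_one_div hδ hδ1
  have h3 : (k : ℝ) ≠ 0 := by exact_mod_cast (by omega : k ≠ 0)
  rw [show (k : ℝ) / δ = k * (1 / δ) by ring, Real.log_mul h3 (by positivity)]
  nlinarith [mul_nonneg (sub_nonneg.2 h1) (sub_nonneg.2 h2)]

/-- A sample size beyond the optimal one by a power of `log k` suffices for the separation condition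
of goodness of fit. -/
theorem gof_condition {b C : ℝ} (hn : 1 ≤ n) (hnk : n < k) (hε : 0 < ε) (hε1 : ε ≤ 1 / 2)
    (hδ : 0 < δ) (hδ1 : δ ≤ 1 / 4) (hb : 0 ≤ b) (hC : 1000 * b ≤ C)
    (h : C * Real.log k ^ 3 * (nGoF (PD k) ε δ : ℝ) ≤ n) :
    b ^ 2 * (k * (6 * Real.log (k / δ))) ≤ n ^ 2 * (ε / numLevels k n) ^ 4 := by
  have hk : 2 ≤ k := by omega
  refine div_numLevels_pow_ge hn (by exact_mod_cast hnk) le_rfl ?_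
  have h1 := mul_log_le_nGoF hk hε hε1 hδ hδ1
  have h2 := log_div_le_mul_log hk hδ hδ1
  have h3 := half_le_log hk
  generalize Real.log k = x at *
  have hN0 : (0 : ℝ) ≤ nGoF (PD k) ε δ := Nat.cast_nonneg _
  generalize (nGoF (PD k) ε δ : ℝ) = N at *
  have h0 : 0 ≤ C := by linarith
  have hN : 0 ≤ N ^ 2 * ε ^ 4 := by positivity
  have h4 : (C * x ^ 3 * N) ^ 2 ≤ (n : ℝ) ^ 2 := by gcongr
  calc 256 * x ^ 4 * (b ^ 2 * (k * (6 * Real.log (k / δ))))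
      ≤ 256 * x ^ 4 * (b ^ 2 * (k * (6 * (3 * (x * Real.log (1 / δ)))))) := by gcongr
    _ = 4608 * x ^ 5 * b ^ 2 * (k * Real.log (1 / δ)) := by ring
    _ ≤ 4608 * x ^ 5 * b ^ 2 * (48 * (N ^ 2 * ε ^ 4)) := by gcongr
    _ = 221184 * (1 * b ^ 2 * x ^ 5 * (N ^ 2 * ε ^ 4)) := by ring
    _ ≤ 221184 * ((2 * x) * b ^ 2 * x ^ 5 * (N ^ 2 * ε ^ 4)) := by gcongr; linarith
    _ ≤ (1000 * b) ^ 2 * x ^ 6 * (N ^ 2 * ε ^ 4) := by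
        have : 0 ≤ b ^ 2 * x ^ 6 * (N ^ 2 * ε ^ 4) := by positivity
        nlinarith
    _ ≤ C ^ 2 * x ^ 6 * (N ^ 2 * ε ^ 4) := by gcongr
    _ = (C * x ^ 3 * N) ^ 2 * ε ^ 4 := by ring
    _ ≤ _ := by gcongr

/-- The lower bounds for likelihood-free testing, in the regimes `k < 8 m` and `8 m ≤ k`, combined
into one bound in terms of the scale `t`. -/
theorem LFHTSolvable.le_scale {N : ℕ} (h : LFHTSolvable (PD k) ε δ N m) (hc₀ : 0 < c₀)
    (hc₁ : c₀ ≤ 1) (hk : 2 ≤ k) (hε : 0 < ε) (hε1 : ε ≤ 1 / 2) (hδ : 0 < δ) (hδ1 : δ ≤ 1 / 4)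
    (hNm : N ≤ m) (hm : 1 ≤ m) :
    (c₀ * k : ℝ) ≤ 2 ^ 30 * Real.exp 16 * 17 ^ 4 * Real.log k ^ 4 * (N ^ 2 * ε ^ 4) *
      (Real.log (k / δ) * (scale c₀ k m (δ / k) / k)) := by
  have hL := one_le_log_div hk hδ (by linarith)
  have hx := half_le_log hk
  have hk0 : (0 : ℝ) < k := by exact_mod_cast (by omega : 0 < k)
  have hs := mul_min_le_scale_div (m := m) (δ := δ / k) hc₀.le hc₁ (by omega : 0 < k)
  rw [one_div_div] at hs
  have hJ : ((⌈Real.log k⌉₊ + 7 : ℕ) : ℝ) ≤ 17 * Real.log k := by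
    have := Nat.ceil_lt_add_one (by linarith : 0 ≤ Real.log k)
    push_cast
    linarith
  have hJ' : Real.log k + 7 ≤ (⌈Real.log k⌉₊ + 7 : ℕ) := by
    have := Nat.le_ceil (Real.log k)
    push_cast
    linarith
  have key := fun hkm => h.sq_le hε.le hε1 hδ1 hm hkm hNm hJ'
  generalize Real.log k = x at *
  set L := Real.log (k / δ)
  generalize scale c₀ k m (δ / k) / k = s at *
  have hm0 : (0 : ℝ) < m := by exact_mod_cast hm
  by_cases hkm : 8 * m ≤ k
  · have h1 := key hkm
    generalize (⌈x⌉₊ + 7 : ℕ) = J at *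
    have hkm' : (8 : ℝ) * m ≤ k := by exact_mod_cast hkm
    rw [min_eq_right ((div_le_one (by positivity)).2 (by nlinarith))] at hs
    have h2 : c₀ * m ≤ L * s * k := by
      rw [← mul_div_assoc, div_le_iff₀ (by positivity)] at hs
      linarith
    refine le_of_mul_le_mul_right ?_ hk0
    calc c₀ * k * k = c₀ * (k : ℝ) ^ 2 := by ring
      _ ≤ c₀ * (2 ^ 30 * Real.exp 16 * J ^ 4 * (N ^ 2 * m * ε ^ 4)) := by gcongr
      _ = 2 ^ 30 * Real.exp 16 * J ^ 4 * (N ^ 2 * ε ^ 4) * (c₀ * m) := by ring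
      _ ≤ 2 ^ 30 * Real.exp 16 * (17 * x) ^ 4 * (N ^ 2 * ε ^ 4) * (L * s * k) := by gcongr
      _ = _ := by ring
  · have h1 := h.le_mul_sq hk hε hε1 hδ1
    have hkm' : (k : ℝ) ≤ 8 * m := by exact_mod_cast (by omega : k ≤ 8 * m)
    have h2 : c₀ ≤ 8 * (L * s) := by
      have h3 : 1 / (8 * L) ≤ min 1 (m / (L * k)) := by
        refine le_min ?_ ?_
        · rw [div_le_one (by positivity)]; linarith
        · rw [div_le_div_iff₀ (by positivity) (by positivity)]
          nlinarith
      have h4 := (mul_le_mul_of_nonneg_left h3 hc₀.le).trans hs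
      rw [← mul_div_assoc, div_le_iff₀ (by positivity)] at h4
      linarith
    have h3 : 1 ≤ 16 * x ^ 4 := by
      have : (1 / 2 : ℝ) ^ 4 ≤ x ^ 4 := by gcongr
      linarith
    have h4 : 1 ≤ Real.exp 16 := Real.one_le_exp (by norm_num)
    have h5 : 0 ≤ L * s := by linarith
    calc c₀ * k ≤ 8 * (L * s) * (408 * (N ^ 2 * ε ^ 4)) := by gcongr
      _ = 3264 * (1 * 1 * (N ^ 2 * ε ^ 4) * (L * s)) := by ring
      _ ≤ 3264 * (Real.exp 16 * (16 * x ^ 4) * (N ^ 2 * ε ^ 4) * (L * s)) := by gcongr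
      _ ≤ _ := by
        have : 0 ≤ Real.exp 16 * x ^ 4 * (N ^ 2 * ε ^ 4) * (L * s) := by positivity
        nlinarith

/-- A sample size beyond one that solves likelihood-free testing, by a power of `log k` and a factor
`log (k / δ)`, suffices for the separation condition. -/
theorem lfht_condition {N : ℕ} {b C : ℝ} (h : LFHTSolvable (PD k) ε δ N m) (hn : 1 ≤ n)
    (hnt : (n : ℝ) < scale c₀ k m (δ / k)) (hc₀ : 0 < c₀) (hc₁ : c₀ ≤ 1) (hε : 0 < ε)
    (hε1 : ε ≤ 1 / 2) (hδ : 0 < δ) (hδ1 : δ ≤ 1 / 4) (hb : 1 ≤ b)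
    (hC : 1536 * b * (2 ^ 30 * Real.exp 16 * 17 ^ 4) / c₀ ≤ C)
    (hnN : C * Real.log k ^ 4 * Real.log (k / δ) * N ≤ n) :
    b ^ 2 * (k * (6 * Real.log (k / δ))) ≤
      n ^ 2 * (ε / numLevels (scale c₀ k m (δ / k)) n) ^ 4 * (scale c₀ k m (δ / k) / k) := by
  have hkt := scale_le c₀ (δ / k) k m
  have hk : 2 ≤ k := by
    have : n < k := by exact_mod_cast hnt.trans_le hkt
    omega
  have hL := one_le_log_div hk hδ (by linarith)
  have hx := half_le_log hk
  have hk0 : (0 : ℝ) < k := by exact_mod_cast (by omega : 0 < k)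
  have hn0 : (0 : ℝ) < n := by exact_mod_cast hn
  have hs0 : 0 < scale c₀ k m (δ / k) / k := div_pos (hn0.trans hnt) hk0
  have hx4 : (1 / 2 : ℝ) ^ 4 ≤ Real.log k ^ 4 := by gcongr
  have hB : (1 : ℝ) ≤ 2 ^ 30 * Real.exp 16 * 17 ^ 4 := by
    have : 1 ≤ Real.exp 16 := Real.one_le_exp (by norm_num)
    linarith
  -- `n < t` forces the third sample to be at least as large as the other two
  have hnm : n ≤ m := by
    have h1 : (n : ℝ) < c₀ * m / Real.log (k / δ) := by
      have := hnt.trans_le (min_le_right _ _)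
      rwa [one_div_div] at this
    rw [lt_div_iff₀ (by linarith)] at h1
    have h2 : (n : ℝ) ≤ m := by
      have : c₀ * m ≤ m := mul_le_of_le_one_left (by positivity) hc₁
      nlinarith
    exact_mod_cast h2
  have hC0 : 1536 * (2 ^ 30 * Real.exp 16 * 17 ^ 4) * b ≤ c₀ * C := by
    rw [div_le_iff₀ hc₀] at hC; linarith
  have hC1 : 1536 ≤ C := by
    have h1 : 1536 ≤ 1536 * (2 ^ 30 * Real.exp 16 * 17 ^ 4) * b := by nlinarith
    by_contra! hlt
    nlinarith
  have hNn : N ≤ n := by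
    have h1 : 1 ≤ C * Real.log k ^ 4 * Real.log (k / δ) := by
      have h2 : 1536 * (1 / 2) ^ 4 * 1 ≤ C * Real.log k ^ 4 * Real.log (k / δ) := by gcongr
      linarith
    have h2 : (N : ℝ) ≤ n := by
      have := mul_le_mul_of_nonneg_right h1 (Nat.cast_nonneg (α := ℝ) N)
      linarith
    exact_mod_cast h2
  have key := h.le_scale hc₀ hc₁ hk hε hε1 hδ hδ1 (hNn.trans hnm) (hn.trans hnm)
  rw [← div_le_iff₀ hs0]
  refine div_numLevels_pow_ge hn hnt hkt ?_
  rw [← mul_div_assoc, div_le_iff₀ hs0]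
  generalize scale c₀ k m (δ / k) / k = s at *
  generalize Real.log k = x at *
  generalize 2 ^ 30 * Real.exp 16 * 17 ^ 4 = B at *
  set L := Real.log (k / δ)
  have h5 : 1536 * b ^ 2 * B ≤ c₀ * C ^ 2 := by
    have h6 : 0 ≤ c₀ * C := by nlinarith
    have h7 : 1 ≤ 1536 * B := by linarith
    calc 1536 * b ^ 2 * B ≤ 1536 * B * (1536 * B) * b ^ 2 := by
          have : 0 ≤ 1536 * B * b ^ 2 := by positivity
          nlinarith
      _ = (1536 * B * b) ^ 2 := by ring
      _ ≤ (c₀ * C) ^ 2 := by gcongr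
      _ = c₀ * (c₀ * C ^ 2) := by ring
      _ ≤ 1 * (c₀ * C ^ 2) := by gcongr
      _ = _ := one_mul _
  refine le_of_mul_le_mul_left ?_ hc₀
  calc c₀ * (256 * x ^ 4 * (b ^ 2 * (k * (6 * L))))
      = 1536 * x ^ 4 * b ^ 2 * L * (c₀ * k) := by ring
    _ ≤ 1536 * x ^ 4 * b ^ 2 * L * (B * x ^ 4 * (N ^ 2 * ε ^ 4) * (L * s)) := by gcongr
    _ = 1536 * b ^ 2 * B * (x ^ 8 * L ^ 2 * N ^ 2 * ε ^ 4 * s) := by ring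
    _ ≤ c₀ * C ^ 2 * (x ^ 8 * L ^ 2 * N ^ 2 * ε ^ 4 * s) := by gcongr
    _ = c₀ * ((C * x ^ 4 * L * N) ^ 2 * ε ^ 4 * s) := by ring
    _ ≤ c₀ * (n ^ 2 * ε ^ 4 * s) := by gcongr

end conditions

/-! ### The four statements -/

theorem exp_neg_log_one_div {δ : ℝ} (hδ : 0 < δ) : Real.exp (-Real.log (1 / δ)) = δ := by
  rw [one_div, Real.log_inv, neg_neg, Real.exp_log hδ]

theorem one_sub_piE_piE_ind_not {ι κ α : Type*} [Fintype ι] [DecidableEq ι] [Fintype κ]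
    [DecidableEq κ] [Fintype α] {u v : α → ℝ} (hu : IsProbVec u) (hv : IsProbVec v)
    (P : (ι → α) → (κ → α) → Prop) :
    1 - piE u (fun x => piE v fun y => ind (¬ P x y)) = piE u fun x => piE v fun y => ind (P x y) :=
        by
  simp only [ind_not, piE_sub, piE_const hu, piE_const hv, sub_sub_cancel]

theorem one_sub_piE_piE_piE_ind_not {ι κ μ α : Type*} [Fintype ι] [DecidableEq ι] [Fintype κ]
    [DecidableEq κ] [Fintype μ] [DecidableEq μ] [Fintype α] {u v w : α → ℝ} (hu : IsProbVec u)
    (hv : IsProbVec v) (hw : IsProbVec w) (P : (ι → α) → (κ → α) → (μ → α) → Prop) :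
    1 - piE u (fun x => piE v fun y => piE w fun z => ind (¬ P x y z)) =
      piE u fun x => piE v fun y => piE w fun z => ind (P x y z) := by
  simp only [ind_not, piE_sub, piE_const hu, piE_const hv, piE_const hw, sub_sub_cancel]

theorem exists_separating_sets_empirical : ∃ cbar : ℝ, 0 < cbar ∧ ∀ c₀ : ℝ, 0 < c₀ → c₀ ≤ cbar →
    ∃ c : ℝ, 0 < c ∧ ∃ C : ℝ, 0 < C ∧
    ∀ (k n m : ℕ) (ε δ : ℝ), 0 < ε → 0 < δ →
      1 ≤ n → (n : ℝ) < scale c₀ k m δ → 2 * ε ≤ numLevels (scale c₀ k m δ) n →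
      1 / c * (nGoF (PD k) (ε / numLevels (scale c₀ k m δ) n) δ : ℝ) ≤
        n * Real.sqrt (min 1 (m / (Real.log (1 / δ) * k))) →
      ∃ sel : (Fin n → Fin k) × (Fin n → Fin k) × (Fin (m / 2) → Fin k) →
          Fin (numLevels (scale c₀ k m δ) n + 2) × Bool,
        ∀ p ∈ PD k, ∀ q ∈ PD k, ε ≤ tv p q →
          1 - C * k * δ ≤
            ((iid p n).prod ((iid q n).prod (iid q (m / 2)))).real
              {ω | GoodAtLevel c ε (scale c₀ k m δ) n p q (sel ω).1
                (sepSet (scale c₀ k m δ) (empPMF ω.2.2) ω.1 ω.2.1 (sel ω))} := by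
  obtain ⟨c, hc, -, b, hb, h⟩ := exists_selection_fixed
  refine ⟨1 / 36, by norm_num, fun c₀ hc₀ hc₁ => ?_⟩
  refine ⟨min (min c (1 / 4)) (c₀ / (48 * b)), by positivity, 36, by norm_num, ?_⟩
  intro k n m ε δ hε hδ hn hnt hℓ hcond
  have hk := scale_le c₀ δ k m
  have hk2 : 2 ≤ k := by
    have : n < k := by exact_mod_cast hnt.trans_le hk
    omega
  have hk2' : (2 : ℝ) ≤ k := by exact_mod_cast hk2
  rcases lt_or_ge (1 / 4) δ with hδ4 | hδ4
  -- For `δ > 1/4` the claimed bound `1 - 36 k δ` is negative.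
  · exact ⟨fun _ => (0, true), fun p _ q _ _ => le_trans (by nlinarith) measureReal_nonneg⟩
  obtain ⟨hM, -, hMt⟩ := le_half_div_scale hc₀ (by linarith) hδ hδ4 hn hnt
  have hL := one_le_log_one_div hδ hδ4
  have hℓ1 : (1 : ℝ) ≤ numLevels (scale c₀ k m δ) n := by
    exact_mod_cast one_le_numLevels hn hnt
  have hcond' := sq_mul_log_le_scale (b := b) hc₀ (by linarith) hk2 (by positivity)
    (by rw [div_le_iff₀ (by linarith)]; linarith) hδ hδ4 (by linarith)
    (by rw [← one_div_div]
        exact one_div_le_one_div_of_le (by positivity) (min_le_right _ _)) hcond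
  generalize scale c₀ k m δ = t at *
  have ht0 : 0 < t := lt_of_le_of_lt (Nat.cast_nonneg n) hnt
  have hML : Real.log (1 / δ) ≤ (m / 2 : ℕ) / (2 * t) := by
    refine le_trans ?_ hMt
    rw [le_div_iff₀ (by positivity)]
    nlinarith
  obtain ⟨sel, hsel⟩ := h hn hnt hk hε hℓ hL hcond'
  refine ⟨fun ω => sel (empPMF ω.2.2) ω.1 ω.2.1, fun p hp q hq hpq => ?_⟩
  have hp' := isProbVec_pv hp
  have hq' := isProbVec_pv hq
  have h1 := piE_piE_piE_selection_le hp hq hM ht0 hML (hsel p q hp hq hpq)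
  rw [exp_neg_log_one_div hδ] at h1
  rw [real_iid_prod₃ hp hq hq (fun ω => GoodAtLevel _ ε t n p q (sel (empPMF ω.2.2) ω.1 ω.2.1).1
    (sepSet t (empPMF ω.2.2) ω.1 ω.2.1 (sel (empPMF ω.2.2) ω.1 ω.2.1)))]
  rw [← one_sub_piE_piE_piE_ind_not hp' hq' hq']
  rw [show 1 - 36 * k * δ = 1 - (2 * k * δ + 34 * k * δ) by ring]
  refine sub_le_sub_left ((piE_mono hp' fun x => piE_mono hq' fun y => piE_mono hq' fun z =>
    ind_mono fun hnot hgood => hnot ?_).trans h1) 1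
  exact goodAtLevel_of_le hp hq (by positivity) ((min_le_left _ _).trans (min_le_left _ _))
    ((min_le_left _ _).trans (min_le_right _ _)) hgood.1 hn hnt hk hgood.2

theorem exists_separating_sets_known : ∃ c : ℝ, 0 < c ∧ ∃ C : ℝ, 0 < C ∧
    ∀ (k n : ℕ) (ε δ : ℝ), 0 < ε → 0 < δ → 1 ≤ n → n < k → 2 * ε ≤ numLevels k n →
      1 / c * (nGoF (PD k) (ε / numLevels k n) δ : ℝ) ≤ n →
      ∀ q ∈ PD k, ∃ sel : (Fin n → Fin k) × (Fin n → Fin k) → Fin (numLevels k n + 2) × Bool,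
        ∀ p ∈ PD k, ε ≤ tv p q →
          1 - C * k * δ ≤
            ((iid p n).prod (iid q n)).real
              {ω | GoodAtLevel c ε k n p q (sel ω).1
                (sepSet k (fun i => q.real {i}) ω.1 ω.2 (sel ω))} := by
  obtain ⟨c, hc, -, b, hb, h⟩ := exists_selection_fixed
  refine ⟨min (min c (1 / 4)) (1 / (48 * b)), by positivity, 34, by norm_num, ?_⟩
  intro k n ε δ hε hδ hn hnk hℓ hcond q hq
  have hk2 : 2 ≤ k := by omega
  have hk2' : (2 : ℝ) ≤ k := by exact_mod_cast hk2
  have hnk' : (n : ℝ) < k := by exact_mod_cast hnk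
  rcases lt_or_ge (1 / 4) δ with hδ4 | hδ4
  -- For `δ > 1/4` the claimed bound `1 - 34 k δ` is negative.
  · exact ⟨fun _ => (0, true), fun p _ _ => le_trans (by nlinarith) measureReal_nonneg⟩
  have hL := one_le_log_one_div hδ hδ4
  have hℓ1 : (1 : ℝ) ≤ numLevels k n := by exact_mod_cast one_le_numLevels hn hnk'
  have hcond' := sq_mul_log_le_of_nGoF_le (n := n) (e := ε / numLevels k n) (u := 1)
    (D := 1 / min (min c (1 / 4)) (1 / (48 * b))) hk2
    (by positivity) (by rw [div_le_iff₀ (by linarith)]; linarith) hδ hδ4 zero_le_one (by positivity)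
    (by rwa [Real.sqrt_one, mul_one])
  have hD : 48 * b ≤ 1 / min (min c (1 / 4)) (1 / (48 * b)) := by
    rw [le_div_iff₀ (by positivity)]
    calc _ ≤ 48 * b * (1 / (48 * b)) := by gcongr; exact min_le_right _ _
      _ = 1 := by field_simp
  have hcond₂ : b ^ 2 * (k * Real.log (1 / δ)) ≤ n ^ 2 * (ε / numLevels k n) ^ 4 * (k / k) := by
    have h1 : (48 * b) ^ 2 * (k * Real.log (1 / δ)) ≤ 48 * (n ^ 2 * 1 * (ε / numLevels k n) ^ 4) :=
      le_trans (by gcongr) hcond'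
    have h2 : 0 ≤ b ^ 2 * (k * Real.log (1 / δ)) := by positivity
    rw [div_self (by linarith), mul_one]
    nlinarith
  obtain ⟨sel, hsel⟩ := h hn hnk' le_rfl hε hℓ hL hcond₂
  have hq' := isProbVec_pv hq
  have happ := approximates_self (t := k) (pv q) hq'.nonneg (by norm_num : (1 : ℝ) ≤ 4)
  refine ⟨fun ω => sel (pv q) ω.1 ω.2, fun p hp hpq => ?_⟩
  have hp' := isProbVec_pv hp
  have h1 := hsel p q hp hq hpq (pv q) happ
  rw [exp_neg_log_one_div hδ] at h1
  refine le_of_le_of_eq ?_ (real_iid_prod₂ hp hq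
    (fun ω => GoodAtLevel (min (min c (1 / 4)) (1 / (48 * b))) ε k n p q (sel (pv q) ω.1 ω.2).1
      (sepSet k (pv q) ω.1 ω.2 (sel (pv q) ω.1 ω.2)))).symm
  rw [← one_sub_piE_piE_ind_not hp' hq']
  refine sub_le_sub_left ((piE_mono hp' fun x => piE_mono hq' fun y =>
    ind_mono fun hnot hgood => hnot ?_).trans h1) 1
  exact goodAtLevel_of_le hp hq (by positivity) ((min_le_left _ _).trans (min_le_left _ _))
    ((min_le_left _ _).trans (min_le_right _ _)) happ hn hnk' le_rfl hgood

theorem exists_gofClassifierTest : ∃ K : ℝ, 0 < K ∧ ∃ C : ℝ, 0 < C ∧ ∃ a : ℕ,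
    ∀ (k n : ℕ) (ε δ : ℝ), 0 < ε → 0 < δ → δ < 1 / 2 → 1 ≤ n → n < k →
      (2 * ε ≤ numLevels k n →
        C * (nGoF (PD k) (ε / numLevels k n) (δ / k) : ℝ) ≤ n →
        GoFClassifierTest K k n ε δ) ∧
      (ε ≤ 1 / 2 → δ ≤ 1 / 4 →
        C * Real.log k ^ a * (nGoF (PD k) ε δ : ℝ) ≤ n →
        GoFClassifierTest K k n ε δ) := by
  obtain ⟨b, hb, h⟩ := gofClassifierTest_of_le
  refine ⟨6400, by norm_num, 1000 * b, by positivity, 3, ?_⟩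
  intro k n ε δ hε hδ hδ1 hn hnk
  have hk2 : 2 ≤ k := by omega
  have hk2' : (2 : ℝ) ≤ k := by exact_mod_cast hk2
  have hℓ1 : (1 : ℝ) ≤ numLevels k n := by
    exact_mod_cast one_le_numLevels hn (by exact_mod_cast hnk)
  refine ⟨fun hℓ hcond => ?_, fun hε1 hδ4 hcond => ?_⟩
  · refine h hε hδ hδ1.le hn hnk hℓ ?_
    have h1 := sq_mul_log_le_of_nGoF_le (n := n) (e := ε / numLevels k n) (u := 1) (δ := δ / k)
      (D := 1000 * b) hk2
      (by positivity) (by rw [div_le_iff₀ (by linarith)]; linarith) (by positivity)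
      (by rw [div_le_iff₀ (by linarith)]; linarith) zero_le_one (by positivity)
      (by rwa [Real.sqrt_one, mul_one])
    rw [one_div_div] at h1
    have h2 := one_le_log_div hk2 hδ hδ1.le
    have h3 : 0 ≤ b ^ 2 * (k * Real.log (k / δ)) := by positivity
    nlinarith
  · exact h hε hδ hδ1.le hn hnk (by linarith)
      (gof_condition hn hnk hε hε1 hδ hδ4 (by linarith) le_rfl hcond)

theorem exists_lfhtClassifierTest : ∃ cbar : ℝ, 0 < cbar ∧ ∀ c₀ : ℝ, 0 < c₀ → c₀ ≤ cbar →
    ∃ K : ℝ, 0 < K ∧ ∃ C : ℝ, 0 < C ∧ ∃ a : ℕ,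
    ∀ (k n m : ℕ) (ε δ : ℝ), 0 < ε → 0 < δ → δ < 1 / 2 →
      1 ≤ n → (n : ℝ) < scale c₀ k m (δ / k) →
      (2 * ε ≤ numLevels (scale c₀ k m (δ / k)) n →
        C * (nGoF (PD k) (ε / numLevels (scale c₀ k m (δ / k)) n) (δ / k) : ℝ) ≤
          n * Real.sqrt (min 1 (m / (Real.log (k / δ) * k))) →
        LFHTClassifierTest K c₀ k n m ε δ) ∧
      (ε ≤ 1 / 2 → δ ≤ 1 / 4 → ∀ n' : ℕ, LFHTSolvable (PD k) ε δ n' m →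
        C * Real.log k ^ a * Real.log (k / δ) * n' ≤ n →
        LFHTClassifierTest K c₀ k n m ε δ) := by
  obtain ⟨b, hb, h⟩ := lfhtClassifierTest_of_le
  refine ⟨1 / 36, by norm_num, fun c₀ hc₀ hc₁ => ⟨6400, by norm_num,
    1536 * b * (2 ^ 30 * Real.exp 16 * 17 ^ 4) / c₀, by positivity, 4, ?_⟩⟩
  intro k n m ε δ hε hδ hδ1 hn hnt
  have hk2 : 2 ≤ k := by
    have : n < k := by exact_mod_cast hnt.trans_le (scale_le c₀ (δ / k) k m)
    omega
  have hk2' : (2 : ℝ) ≤ k := by exact_mod_cast hk2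
  have hℓ1 : (1 : ℝ) ≤ numLevels (scale c₀ k m (δ / k)) n := by
    exact_mod_cast one_le_numLevels hn hnt
  refine ⟨fun hℓ hcond => ?_, fun hε1 hδ4 n' hsolv hcond => ?_⟩
  · refine h hc₀ hc₁ hε hδ hδ1.le hn hnt hℓ ?_
    have hD : 48 * (6 * b) / c₀ ≤ 1536 * b * (2 ^ 30 * Real.exp 16 * 17 ^ 4) / c₀ := by
      have : 1 ≤ Real.exp 16 := Real.one_le_exp (by norm_num)
      gcongr ?_ / c₀
      nlinarith
    rw [← one_div_div δ (k : ℝ)] at hcond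
    have h1 := sq_mul_log_le_scale (δ := δ / k) (b := 6 * b) hc₀ (by linarith) hk2 (by positivity)
      (by rw [div_le_iff₀ (by linarith)]; linarith) (by positivity)
      (by rw [div_le_iff₀ (by linarith)]; linarith) (by positivity) hD hcond
    rw [one_div_div] at h1
    have h2 := one_le_log_div hk2 hδ hδ1.le
    have h3 : 0 ≤ b ^ 2 * (k * Real.log (k / δ)) := by positivity
    refine le_trans ?_ h1
    nlinarith
  · exact h hc₀ hc₁ hε hδ hδ1.le hn hnt (by linarith)
      (lfht_condition hsolv hn hnt hc₀ (by linarith) hε hε1 hδ hδ4 hb le_rfl hcond)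

theorem mainTheorem2 :
    -- separating sets, with the level sets of the empirical mass function of samples from `q`
    (∃ cbar : ℝ, 0 < cbar ∧ ∀ c₀ : ℝ, 0 < c₀ → c₀ ≤ cbar →
      ∃ c : ℝ, 0 < c ∧ ∃ C : ℝ, 0 < C ∧
      ∀ (k n m : ℕ) (ε δ : ℝ), 0 < ε → ε ≤ 1 → 0 < δ → δ < 1 / 2 →
        let t : ℝ := scale c₀ k m δ
        let ℓ : ℕ := numLevels t n
        1 ≤ n → (n : ℝ) < t → 2 * ε ≤ ℓ →
        1 / c * (nGoF (PD k) (ε / ℓ) δ : ℝ) ≤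
          n * Real.sqrt (min 1 (m / (Real.log (1 / δ) * k))) →
        ∃ sel : (Fin n → Fin k) × (Fin n → Fin k) × (Fin (m / 2) → Fin k) → Fin (ℓ + 2) × Bool,
          ∀ p ∈ PD k, ∀ q ∈ PD k, ε ≤ tv p q →
            1 - C * k * δ ≤
              ((iid p n).prod ((iid q n).prod (iid q (m / 2)))).real
                {ω | GoodAtLevel c ε t n p q (sel ω).1
                  (sepSet t (empPMF ω.2.2) ω.1 ω.2.1 (sel ω))}) ∧
    -- separating sets when `q` is known, with the level sets of `q` itself
    (∃ c : ℝ, 0 < c ∧ ∃ C : ℝ, 0 < C ∧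
      ∀ (k n : ℕ) (ε δ : ℝ), 0 < ε → ε ≤ 1 → 0 < δ → δ < 1 / 2 →
        let ℓ : ℕ := numLevels k n
        1 ≤ n → n < k → 2 * ε ≤ ℓ →
        1 / c * (nGoF (PD k) (ε / ℓ) δ : ℝ) ≤ n →
        ∀ q ∈ PD k, ∃ sel : (Fin n → Fin k) × (Fin n → Fin k) → Fin (ℓ + 2) × Bool,
          ∀ p ∈ PD k, ε ≤ tv p q →
            1 - C * k * δ ≤
              ((iid p n).prod (iid q n)).real
                {ω | GoodAtLevel c ε k n p q (sel ω).1
                  (sepSet k (fun i => q.real {i}) ω.1 ω.2 (sel ω))}) ∧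
    -- classifier-accuracy tests for goodness of fit, and their near-optimality
    (∃ K : ℝ, 0 < K ∧ ∃ C : ℝ, 0 < C ∧ ∃ a : ℕ,
      ∀ (k n : ℕ) (ε δ : ℝ), 0 < ε → ε ≤ 1 → 0 < δ → δ < 1 / 2 →
        1 ≤ n → n < k →
        (2 * ε ≤ numLevels k n →
          C * (nGoF (PD k) (ε / numLevels k n) (δ / k) : ℝ) ≤ n →
          GoFClassifierTest K k n ε δ) ∧
        (ε ≤ 1 / 2 → δ ≤ 1 / 4 →
          C * Real.log k ^ a * (nGoF (PD k) ε δ : ℝ) ≤ n →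
          GoFClassifierTest K k n ε δ)) ∧
    -- classifier-accuracy tests for likelihood-free testing, and their near-optimality
    (∃ cbar : ℝ, 0 < cbar ∧ ∀ c₀ : ℝ, 0 < c₀ → c₀ ≤ cbar →
      ∃ K : ℝ, 0 < K ∧ ∃ C : ℝ, 0 < C ∧ ∃ a : ℕ,
      ∀ (k n m : ℕ) (ε δ : ℝ), 0 < ε → ε ≤ 1 → 0 < δ → δ < 1 / 2 →
        let t : ℝ := scale c₀ k m (δ / k)
        let ℓ : ℕ := numLevels t n
        1 ≤ n → (n : ℝ) < t →
        (2 * ε ≤ ℓ →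
          C * (nGoF (PD k) (ε / ℓ) (δ / k) : ℝ) ≤
            n * Real.sqrt (min 1 (m / (Real.log (k / δ) * k))) →
          LFHTClassifierTest K c₀ k n m ε δ) ∧
        (ε ≤ 1 / 2 → δ ≤ 1 / 4 → ∀ n' : ℕ, LFHTSolvable (PD k) ε δ n' m →
          C * Real.log k ^ a * Real.log (k / δ) * n' ≤ n →
          LFHTClassifierTest K c₀ k n m ε δ)) := by
  refine ⟨?_, ?_, ?_, ?_⟩
  · obtain ⟨cbar, hcbar, h⟩ := exists_separating_sets_empirical
    refine ⟨cbar, hcbar, fun c₀ hc₀ hc₁ => ?_⟩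
    obtain ⟨c, hc, C, hC, h⟩ := h c₀ hc₀ hc₁
    exact ⟨c, hc, C, hC, fun k n m ε δ hε _ hδ _ => h k n m ε δ hε hδ⟩
  · obtain ⟨c, hc, C, hC, h⟩ := exists_separating_sets_known
    exact ⟨c, hc, C, hC, fun k n ε δ hε _ hδ _ => h k n ε δ hε hδ⟩
  · obtain ⟨K, hK, C, hC, a, h⟩ := exists_gofClassifierTest
    exact ⟨K, hK, C, hC, a, fun k n ε δ hε _ => h k n ε δ hε⟩
  · obtain ⟨cbar, hcbar, h⟩ := exists_lfhtClassifierTest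
    refine ⟨cbar, hcbar, fun c₀ hc₀ hc₁ => ?_⟩
    obtain ⟨K, hK, C, hC, a, h⟩ := h c₀ hc₀ hc₁
    exact ⟨K, hK, C, hC, a, fun k n m ε δ hε _ => h k n m ε δ hε⟩
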